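/- **Setting.** The toric code of size $L$ is given by the $L\times L$ square lattice with periodic boundaries. Checks are the vertices $(i,j)\in(\mathbb Z/L)^2$ ($i$ = row, downwards; $j$ = column), qubits are the edges, and the parity-check matrix $\mathbf H$ is the vertex–edge incidence matrix over $\mathbb F_2$. An ($X$-)error is $\mathbf e\in\mathbb F_2^{E}$, its syndrome is $\mathbf s=\mathbf H\mathbf e$, its weight is its number of nonzero entries; a check $c$ is unsatisfied if $\mathbf s(c)=1$. Stabilisers are the elements of the span of the plaquettes (the sums of the four edges around a unit square), and the distance of the code is the least weight of an $\mathbf e\notin$ stabilisers with $\mathbf H\mathbf e=0$. **Min-sum (MS).** For a parity-check matrix and a syndrome $\mathbf s$, MS (flooding schedule, all a priori values $1$) starts from the messages $\alpha^{(0)}_{v\to c}=1$ and iterates $$\beta^{(i+1)}_{c\to v}=(-1)^{\mathbf s(c)}\prod_{v'\in N(c)\setminus v}\operatorname{sgn}\alpha^{(i)}_{v'\to c}\cdot\min_{v'\in N(c)\setminus v}|\alpha^{(i)}_{v'\to c}|,\qquad \alpha^{(i+1)}_{v\to c}=1+\sum_{c'\in N(v)\setminus c}\beta^{(i+1)}_{c'\to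 v}.$$ The a posteriori value of $v$ is $1$ at iteration $0$ and $1+\sum_{c\in N(v)}\beta^{(i)}_{c\to v}$ at iteration $i\ge1$; the estimate of $v$ is $1$ iff this value is negative. MS stops at the first iteration at which the estimate satisfies the syndrome, and outputs it. **Stabiliser-blowup (SB).** Blowing up a plaquette replaces its four edges by four new edges that join its four corners to a new, satisfied check in its middle; the variable of the new edge at a corner is the sum of the variables of the two removed edges at that corner. Number the checks around a plaquette $p$ as $$\begin{matrix}7&8&9&10\\6&1&2&11\\5&4&3&12\\16&15&14&13\end{matrix}$$ where $1,2,3,4$ are the corners of $p$. Write $s_k$ for the syndrome at check $k$. The plaquettes are visited three times in lexicographic order of their coordinates, starting with no plaquette blown up; at each visit, $p$ is blown up if one of the patterns of the current pass holds and no plaquette sharing an edge with $p$ is already blown up. The patterns (always for the original syndrome) are: 1. $s_1=s_2=s_3=s_4=1$; or $s_2=s_4=1$, $s_1=s_3=0$ and $s_5+s_9+s_{11}+s_{15}$ even; or $s_1=s_3=1$, $s_2=s_4=0$ and $s_6+s_8+s_{12}+s_{14}$ even. 2. $s_2=s_4=1$, $s_1=s_3=0$; or $s_1=s_3=1$, $s_2=s_4=0$.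 3. Among the six checks $1,2,3,4,11,12$, exactly $1,12$ or exactly $4,11$ are unsatisfied; or among the six checks $1,2,3,4,14,15$, exactly $1,14$ or exactly $2,15$ are unsatisfied. SB+MS runs MS on the resulting graph, and outputs an error on the original qubits whose image under the change of variables is the output of MS. **Theorem (Stabiliser-Blowup Pre-Processing).** On every toric code of distance at least $7$, SB+MS corrects every error $\mathbf e$ of weight at most $3$, degenerate or not: on the syndrome $\mathbf H\mathbf e$, MS on the blown-up graph stops, its output is the image of some error on the original qubits, and every error with that image equals $\mathbf e$ up to a stabiliser. -/

import Mathlib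

namespace ToricSBMS

/-! ### The toric code on the `L × L` square lattice with periodic boundaries -/

/-- Sites `(row, column)` of the periodic `L × L` lattice. They index the (vertex) checks, and also
the plaquettes: plaquette `(i, j)` is the unit square whose top left corner is vertex `(i, j)`. -/
abbrev Site (L : ℕ) : Type := ZMod L × ZMod L

/-- Qubits are the edges of the lattice: `Sum.inl (i, j)` is the horizontal edge joining `(i, j)` to
`(i, j + 1)`, and `Sum.inr (i, j)` is the vertical edge joining `(i, j)` to `(i + 1, j)`. -/
abbrev Qubit (L : ℕ) : Type := Site L ⊕ Site L

/-- The two end points of an edge. -/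
def endpoints {L : ℕ} : Qubit L → Site L × Site L
  | Sum.inl c => (c, (c.1, c.2 + 1))
  | Sum.inr c => (c, (c.1 + 1, c.2))

/-- The parity-check matrix of the toric code: the vertex–edge incidence matrix modulo 2. -/
def toricH (L : ℕ) : Matrix (Site L) (Qubit L) (ZMod 2) := fun c q =>
  (if (endpoints q).1 = c then 1 else 0) + (if (endpoints q).2 = c then 1 else 0)

/-- The corners of a plaquette, clockwise from the top left one. -/
def corner {L : ℕ} (p : Site L) : Fin 4 → Site L :=
  ![(p.1, p.2), (p.1, p.2 + 1), (p.1 + 1, p.2 + 1), (p.1 + 1, p.2)]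

/-- The sides of a plaquette, clockwise from the top one: side `k` joins the corners `k` and
`k + 1` (indices modulo 4). -/
def side {L : ℕ} (p : Site L) : Fin 4 → Qubit L :=
  ![Sum.inl (p.1, p.2), Sum.inr (p.1, p.2 + 1), Sum.inl (p.1 + 1, p.2), Sum.inr (p.1, p.2)]

/-- The stabiliser errors: the span of the plaquette operators. -/
def stabilizers (L : ℕ) : Submodule (ZMod 2) (Qubit L → ZMod 2) :=
  Submodule.span (ZMod 2) (Set.range fun p : Site L => ∑ k : Fin 4, Pi.single (side p k) 1)

/-- The minimum distance of the toric code: the least weight of an error with zero syndrome which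
is not a stabiliser. -/
noncomputable def toricDistance (L : ℕ) [NeZero L] : ℕ :=
  sInf {w : ℕ | ∃ e : Qubit L → ZMod 2,
    (toricH L).mulVec e = 0 ∧ e ∉ stabilizers L ∧ hammingNorm e = w}

/-! ### Min-sum decoding (flooding schedule) on the Tanner graph of a parity-check matrix -/

section MinSum

variable {C V : Type} [Fintype C] [Fintype V] [DecidableEq C] [DecidableEq V]

/-- The checks in which a variable takes part. -/
def checksOf (H : Matrix C V (ZMod 2)) (v : V) : Finset C := Finset.univ.filter fun c => H c v ≠ 0

/-- The variables that take part in a check. -/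
def varsOf (H : Matrix C V (ZMod 2)) (c : C) : Finset V := Finset.univ.filter fun v => H c v ≠ 0

/-- The message from check `c` to variable `v`, given the variable-to-check messages `α`: the sign
is the product of the signs of the incoming messages, flipped if `c` is unsatisfied, and the
magnitude is the minimum of their magnitudes, where the message of `v` itself is left out.
(The value for a check without any other variable is immaterial here.) -/
def checkMsg (H : Matrix C V (ZMod 2)) (s : C → ZMod 2) (α : V → C → ℤ) (c : C) (v : V) : ℤ :=
  (if s c = 1 then -1 else 1) * (∏ w ∈ (varsOf H c).erase v, (α w c).sign) *
    (if h : ((varsOf H c).erase v).Nonempty then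
      ((varsOf H c).erase v).inf' h fun w => |α w c| else 0)

/-- The messages from variables to checks after `i` iterations; all a priori values are `1`. -/
def varMsg (H : Matrix C V (ZMod 2)) (s : C → ZMod 2) : ℕ → V → C → ℤ
  | 0 => fun _ _ => 1
  | i + 1 => fun v c => 1 + ∑ c' ∈ (checksOf H v).erase c, checkMsg H s (varMsg H s i) c' v

/-- The a posteriori values after `i` iterations. -/
def app (H : Matrix C V (ZMod 2)) (s : C → ZMod 2) : ℕ → V → ℤ
  | 0 => fun _ => 1
  | i + 1 => fun v => 1 + ∑ c ∈ checksOf H v, checkMsg H s (varMsg H s i) c v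

/-- The error estimate (hard decision) after `i` iterations. -/
def msEstimate (H : Matrix C V (ZMod 2)) (s : C → ZMod 2) (i : ℕ) : V → ZMod 2 :=
  fun v => if app H s i v < 0 then 1 else 0

open Classical in
/-- The min-sum decoder stops at the first iteration at which the estimate satisfies the syndrome
and outputs that estimate; it has no output if this never happens. -/
noncomputable def msDecoder (H : Matrix C V (ZMod 2)) (s : C → ZMod 2) : Option (V → ZMod 2) :=
  if h : ∃ i, H.mulVec (msEstimate H s i) = s then some (msEstimate H s (Nat.find h)) else none

end MinSum

/-! ### Where to blow up: the greedy heuristic -/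

/-- The 16 checks around the plaquette `p`, numbered `1` to `16`:
`1, 2, 3, 4` are the corners of `p`, clockwise from the top left one, and `5, …, 16` are the checks
on the boundary of the surrounding `3 × 3` block of plaquettes, clockwise from the left neighbour of
corner `4`:
```
   7  8  9 10
   6  1  2 11
   5  4  3 12
  16 15 14 13
```
-/
def nbr {L : ℕ} (p : Site L) : ℕ → Site L
  | 1 => (p.1, p.2)
  | 2 => (p.1, p.2 + 1)
  | 3 => (p.1 + 1, p.2 + 1)
  | 4 => (p.1 + 1, p.2)
  | 5 => (p.1 + 1, p.2 - 1)
  | 6 => (p.1, p.2 - 1)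
  | 7 => (p.1 - 1, p.2 - 1)
  | 8 => (p.1 - 1, p.2)
  | 9 => (p.1 - 1, p.2 + 1)
  | 10 => (p.1 - 1, p.2 + 2)
  | 11 => (p.1, p.2 + 2)
  | 12 => (p.1 + 1, p.2 + 2)
  | 13 => (p.1 + 2, p.2 + 2)
  | 14 => (p.1 + 2, p.2 + 1)
  | 15 => (p.1 + 2, p.2)
  | 16 => (p.1 + 2, p.2 - 1)
  | _ => p

/-- First set of patterns: all four corners unsatisfied, or exactly two diagonally opposite ones,
provided that an even number of the four outer neighbours of these two are unsatisfied. -/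
abbrev pattern₁ {L : ℕ} (s : Site L → ZMod 2) (p : Site L) : Prop :=
  (s (nbr p 1) = 1 ∧ s (nbr p 2) = 1 ∧ s (nbr p 3) = 1 ∧ s (nbr p 4) = 1) ∨
  (s (nbr p 1) = 0 ∧ s (nbr p 2) = 1 ∧ s (nbr p 3) = 0 ∧ s (nbr p 4) = 1 ∧
    s (nbr p 9) + s (nbr p 11) + s (nbr p 5) + s (nbr p 15) = 0) ∨
  (s (nbr p 1) = 1 ∧ s (nbr p 2) = 0 ∧ s (nbr p 3) = 1 ∧ s (nbr p 4) = 0 ∧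
    s (nbr p 6) + s (nbr p 8) + s (nbr p 12) + s (nbr p 14) = 0)

/-- Second set of patterns: exactly two diagonally opposite corners unsatisfied. -/
abbrev pattern₂ {L : ℕ} (s : Site L → ZMod 2) (p : Site L) : Prop :=
  (s (nbr p 1) = 0 ∧ s (nbr p 2) = 1 ∧ s (nbr p 3) = 0 ∧ s (nbr p 4) = 1) ∨
  (s (nbr p 1) = 1 ∧ s (nbr p 2) = 0 ∧ s (nbr p 3) = 1 ∧ s (nbr p 4) = 0)

/-- Third set of patterns: in the rectangle made of `p` and of the plaquette to its right or
below it, exactly two opposite corners of the rectangle are unsatisfied. -/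
abbrev pattern₃ {L : ℕ} (s : Site L → ZMod 2) (p : Site L) : Prop :=
  (s (nbr p 1) = 1 ∧ s (nbr p 2) = 0 ∧ s (nbr p 11) = 0 ∧ s (nbr p 4) = 0 ∧ s (nbr p 3) = 0 ∧
    s (nbr p 12) = 1) ∨
  (s (nbr p 1) = 0 ∧ s (nbr p 2) = 0 ∧ s (nbr p 11) = 1 ∧ s (nbr p 4) = 1 ∧ s (nbr p 3) = 0 ∧
    s (nbr p 12) = 0) ∨
  (s (nbr p 1) = 1 ∧ s (nbr p 2) = 0 ∧ s (nbr p 4) = 0 ∧ s (nbr p 3) = 0 ∧ s (nbr p 15) = 0 ∧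
    s (nbr p 14) = 1) ∨
  (s (nbr p 1) = 0 ∧ s (nbr p 2) = 1 ∧ s (nbr p 4) = 0 ∧ s (nbr p 3) = 0 ∧ s (nbr p 15) = 1 ∧
    s (nbr p 14) = 0)

/-- Two plaquettes are adjacent if they are distinct and share an edge. -/
abbrev Adjacent {L : ℕ} (p p' : Site L) : Prop := p ≠ p' ∧ ∃ k k' : Fin 4, side p k = side p' k'

/-- All plaquettes in the lexicographic order of their coordinates. -/
def plaquetteList (L : ℕ) : List (Site L) :=
  (List.range L).flatMap fun i => (List.range L).map fun j => ((i : ZMod L), (j : ZMod L))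

/-- One pass through all the plaquettes, starting from the set `B` of plaquettes that are already
blown up: a plaquette at which the pattern is found is blown up, unless an adjacent plaquette has
been blown up before. -/
def greedyPass {L : ℕ} (P : Site L → Prop) [DecidablePred P] (B : Finset (Site L)) :
    Finset (Site L) :=
  (plaquetteList L).foldl
    (fun B p => if P p ∧ ∀ p' ∈ B, ¬ Adjacent p p' then insert p B else B) B

/-- The set of blown-up plaquettes for a syndrome: three passes, one for each set of patterns. -/
def blowupSet {L : ℕ} (s : Site L → ZMod 2) : Finset (Site L) :=
  greedyPass (pattern₃ s) (greedyPass (pattern₂ s) (greedyPass (pattern₁ s) ∅))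

/-! ### The blown-up decoding graph -/

/-- The edges of the blown-up graph: the edges that are not a side of a blown-up plaquette, and for
each blown-up plaquette `p` four new edges `(p, k)`, which join corner `k` of `p` to the new check
in the middle of `p`. -/
abbrev BlowupEdge {L : ℕ} (B : Finset (Site L)) : Type :=
  {q : Qubit L // ∀ p ∈ B, ∀ k, side p k ≠ q} ⊕ ({p : Site L // p ∈ B} × Fin 4)

/-- The checks of the blown-up graph: the old ones, and a new one in each blown-up plaquette. -/
abbrev BlowupCheck {L : ℕ} (B : Finset (Site L)) : Type := Site L ⊕ {p : Site L // p ∈ B}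

/-- The parity-check matrix of the blown-up graph. -/
def blowupH {L : ℕ} (B : Finset (Site L)) : Matrix (BlowupCheck B) (BlowupEdge B) (ZMod 2)
  | Sum.inl c, Sum.inl q => toricH L c q.1
  | Sum.inl c, Sum.inr (p, k) => if corner p.1 k = c then 1 else 0
  | Sum.inr _, Sum.inl _ => 0
  | Sum.inr p, Sum.inr (p', _) => if p = p' then 1 else 0

/-- The syndrome on the blown-up graph: the new checks are satisfied. -/
def blowupSyndrome {L : ℕ} (B : Finset (Site L)) (s : Site L → ZMod 2) : BlowupCheck B → ZMod 2
  | Sum.inl c => s c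
  | Sum.inr _ => 0

/-- The change of variables: the value of the new edge at corner `k` of a blown-up plaquette is the
sum of the values of the two removed edges incident to that corner. -/
def changeVars {L : ℕ} (B : Finset (Site L)) (e : Qubit L → ZMod 2) : BlowupEdge B → ZMod 2
  | Sum.inl q => e q.1
  | Sum.inr (p, k) => e (side p.1 (k - 1)) + e (side p.1 k)

/-! ### The decoder -/

/-- `e'` is a possible output of stabiliser-blowup followed by min-sum on the syndrome `s`: min-sum
on the blown-up graph converges, and its output is the image of `e'` under the change of variables.
(The value of `e'` on the sides of the blown-up plaquettes can be chosen among the solutions.) -/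
def SBMSOutput {L : ℕ} [NeZero L] (s : Site L → ZMod 2) (e' : Qubit L → ZMod 2) : Prop :=
  msDecoder (blowupH (blowupSet s)) (blowupSyndrome (blowupSet s) s) =
    some (changeVars (blowupSet s) e')

/-- The error `e` is corrected: on its syndrome the decoder has an output, and every possible output
equals `e` up to a stabiliser. -/
def SBMSCorrects {L : ℕ} [NeZero L] (e : Qubit L → ZMod 2) : Prop :=
  (∃ e', SBMSOutput ((toricH L).mulVec e) e') ∧
    ∀ e', SBMSOutput ((toricH L).mulVec e) e' → e' - e ∈ stabilizers L

end ToricSBMS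

/-! Two errors of weight at most three with the same syndrome differ by a cycle of weight at most
six, and at distance seven or more such a cycle is a stabiliser. An error whose image under the
change of variables is zero is constant around every blown-up plaquette and zero elsewhere, so it is
a stabiliser as well. Hence it suffices that min-sum on the blown-up graph reaches a solution and
that the first solution is the image of some error of weight at most three
(`corrects_of_estimates`); which error of the class it is does not matter. The distance enters
otherwise only through `7 ≤ L` (`seven_le_of_distance`).

For most errors two iterations are enough, and they can be computed by hand: checks send `±1` in the
first iteration and `0` or `±2` in the second. The local formula `bad` collects everything that
could go wrong near a site: the order of the plaquettes might matter, or the estimate after two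
iterations has a defect. If it fails everywhere, then the set of blown-up plaquettes is given by a
local formula (`eq_blown`), the estimate solves the syndrome, and discharging bounds its weight.
Each unsatisfied check carries charge 2, or 1 if a neighbouring check is unsatisfied too. Every edge
of the true error pays at most 2 to its ends (`sum_share_le`), while twice the weight of the
estimate is at most the total charge (`NoDefect.exists_lift`). This gives `corrects_of_not_bad`.

Whether a site is bad depends only on the syndrome within four rows and columns, and a bad site has
an edge of the error nearby. So there are finitely many configurations to test, on the torus itself
for `L ≤ 9` and in a window of side ten otherwise. All triples of edges are tested at once on truth
tables stored as bits of natural numbers, with the outcome that a bad error is a translate of one in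
the list `clusters` (`exists_special_of_bad`). Formulas are written for an arbitrary grid and an
arbitrary logic; since they preserve relations (`Grid.Rel.bad`), the same formula can be read as a
truth table, as a statement on `ℤ × ℤ` and as a statement on the torus.

For the listed errors min-sum is run for up to ten iterations, for all of them in parallel and with
bounds instead of exact messages. The greedy set depends on where the error lies relative to the
start of the enumeration, so every set of plaquettes is tried that meets necessary conditions
independent of the order (`blowupSet_spec`). For `L ≥ 10` the run takes place in a square of side
ten cut out of the torus; this is sound as long as no negative message leaves the square, because
checks outside are satisfied and then answer with nonnegative messages (`Received.succ`). The
conclusion is `corrects_of_checkLanes`. -/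

namespace ToricSBMS

/-! ### Formulas on a grid, with values in an arbitrary Boolean logic -/

/-- The four unit shifts of a grid: right, down, left, up. -/
structure Grid (X : Type) where
  rt : X → X
  dn : X → X
  lf : X → X
  up : X → X

/-- The connectives of a Boolean logic; `sum` is the exclusive or. -/
structure Logic (α : Type) where
  conj : α → α → α
  disj : α → α → α
  sum : α → α → α
  neg : α → α

section Formulas

variable {X α : Type} (g : Grid X) (o : Logic α)

/-- The neighbour in direction `k` (right, down, left, up). -/
def Grid.step : ℕ → X → X
  | 0 => g.rt
  | 1 => g.dn
  | 2 => g.lf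
  | _ => g.up

/-- The corners of the plaquette with top left corner `p`, clockwise. -/
def Grid.cor : ℕ → X → X
  | 0 => id
  | 1 => g.rt
  | 2 => fun p => g.dn (g.rt p)
  | _ => g.dn

/-- The plaquette with corner `k` at `x`. -/
def Grid.uncor : ℕ → X → X
  | 0 => id
  | 1 => g.lf
  | 2 => fun x => g.up (g.lf x)
  | _ => g.up

def Logic.disj4 (a b c d : α) : α := o.disj (o.disj a b) (o.disj c d)
def Logic.conj4 (a b c d : α) : α := o.conj (o.conj a b) (o.conj c d)
def Logic.sum4 (a b c d : α) : α := o.sum (o.sum a b) (o.sum c d)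
def Logic.nor (a b : α) : α := o.neg (o.disj a b)
def Logic.diff (a b : α) : α := o.conj a (o.neg b)

/-- At least three of four. -/
def Logic.three (a b c d : α) : α :=
  o.disj (o.conj (o.conj a b) (o.disj c d)) (o.conj (o.conj c d) (o.disj a b))

/-- At least two of four. -/
def Logic.two (a b c d : α) : α :=
  o.disj (o.disj (o.conj a b) (o.conj c d)) (o.conj (o.disj a b) (o.disj c d))

/-- The patterns of the decoder in terms of shifts, so that one formula serves the torus, the plane
and truth tables; see `patA_iff`, `patB_iff` and `patC_iff`. -/
def patA (S : X → α) (p : X) : α :=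
  let c₁ := S p; let c₂ := S (g.rt p); let c₃ := S (g.dn (g.rt p)); let c₄ := S (g.dn p)
  o.disj (o.conj4 c₁ c₂ c₃ c₄) <| o.disj
    (o.conj (o.conj4 (o.neg c₁) c₂ (o.neg c₃) c₄) (o.neg (o.sum4 (S (g.up (g.rt p)))
      (S (g.rt (g.rt p))) (S (g.lf (g.dn p))) (S (g.dn (g.dn p))))))
    (o.conj (o.conj4 c₁ (o.neg c₂) c₃ (o.neg c₄)) (o.neg (o.sum4 (S (g.lf p)) (S (g.up p))
      (S (g.rt (g.dn (g.rt p)))) (S (g.dn (g.dn (g.rt p)))))))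

def patB (S : X → α) (p : X) : α :=
  let c₁ := S p; let c₂ := S (g.rt p); let c₃ := S (g.dn (g.rt p)); let c₄ := S (g.dn p)
  o.disj (o.conj4 (o.neg c₁) c₂ (o.neg c₃) c₄) (o.conj4 c₁ (o.neg c₂) c₃ (o.neg c₄))

def patC (S : X → α) (p : X) : α :=
  let c₁ := S p; let c₂ := S (g.rt p); let c₃ := S (g.dn (g.rt p)); let c₄ := S (g.dn p)
  let c₁₁ := S (g.rt (g.rt p)); let c₁₂ := S (g.rt (g.dn (g.rt p)))
  let c₁₄ := S (g.dn (g.dn (g.rt p))); let c₁₅ := S (g.dn (g.dn p))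
  let n := fun a b c d => o.neg (o.disj4 a b c d)
  o.disj4 (o.conj (o.conj c₁ c₁₂) (n c₂ c₁₁ c₄ c₃)) (o.conj (o.conj c₁₁ c₄) (n c₁ c₂ c₃ c₁₂))
    (o.conj (o.conj c₁ c₁₄) (n c₂ c₄ c₃ c₁₅)) (o.conj (o.conj c₂ c₁₅) (n c₁ c₄ c₃ c₁₄))

/-- Some plaquette adjacent to `p` satisfies `P`. -/
def adjSome (P : X → α) (p : X) : α := o.disj4 (P (g.rt p)) (P (g.dn p)) (P (g.lf p)) (P (g.up p))

/-- The plaquettes that are blown up, provided that no two adjacent ones compete. -/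
def blown (P Q R : X → α) (p : X) : α :=
  o.disj (P p) (o.diff (o.disj (Q p) (o.diff (R p) (adjSome g o Q p))) (adjSome g o P p))

/-- A configuration near `p` in which the order of the plaquettes might matter. -/
def conflict (P Q R : X → α) (p : X) : α :=
  let q := fun x => o.diff (Q x) (o.disj (P x) (adjSome g o P x))
  let r := fun x => o.diff (R x) (o.disj4 (P x) (Q x) (adjSome g o P x) (adjSome g o Q x))
  -- The first three terms are adjacent competitors of the same pass; looking right and down covers
  -- all adjacent pairs. The last one is a third-pass plaquette next to a second-pass one that is
  -- itself blocked by the first pass: `blown` would wrongly exclude it.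
  o.disj4 (o.conj (P p) (o.disj (P (g.rt p)) (P (g.dn p))))
    (o.conj (q p) (o.disj (q (g.rt p)) (q (g.dn p))))
    (o.conj (r p) (o.disj (r (g.rt p)) (r (g.dn p))))
    (o.conj (o.diff (R p) (o.disj (o.disj (P p) (Q p)) (adjSome g o P p)))
      (adjSome g o (fun x => o.conj (Q x) (adjSome g o P x)) p))

section Blown

variable (S B : X → α)

/-- The edge at `x` in direction `k` is not removed. -/
def kept (k : ℕ) (x : X) : α :=
  match k with
  | 0 => o.nor (B x) (B (g.up x))
  | 1 => o.nor (B x) (B (g.lf x))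
  | 2 => o.nor (B (g.lf x)) (B (g.up (g.lf x)))
  | _ => o.nor (B (g.up x)) (B (g.lf (g.up x)))

/-- The neighbour of `x` in direction `k` is unsatisfied. -/
def unsat (k : ℕ) (x : X) : α := o.conj (kept g o B k x) (S (g.step k x))

def unsatAny (x : X) : α :=
  o.disj4 (unsat g o S B 0 x) (unsat g o S B 1 x) (unsat g o S B 2 x) (unsat g o S B 3 x)

/-- A neighbour of `x` in a direction different from `k` is unsatisfied. -/
def unsatElse (k : ℕ) (x : X) : α :=
  o.disj (unsat g o S B ((k + 1) % 4) x)
    (o.disj (unsat g o S B ((k + 2) % 4) x) (unsat g o S B ((k + 3) % 4) x))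

/-- The estimate of the edge at `x` in direction `k` after two iterations. -/
def estEdge (k : ℕ) (x : X) : α :=
  let y := g.step k x
  let l := (k + 2) % 4
  -- After two iterations an end sends `0` if another neighbour of it is unsatisfied, and otherwise
  -- `-2` or `2` according to its syndrome. The value `1 + a + b` is negative exactly if one message
  -- is `-2` and the other is not `2`.
  o.conj (kept g o B k x) (o.disj
    (o.conj (o.diff (S x) (unsatElse g o S B k x)) (o.disj (S y) (unsatElse g o S B l y)))
    (o.conj (o.diff (S y) (unsatElse g o S B l y)) (o.disj (S x) (unsatElse g o S B k x))))

/-- The estimate of the new edge at corner `k` of the plaquette `p` after two iterations. -/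
def estNew (k : ℕ) (p : X) : α :=
  -- The middle sends `0` or `2`, never `-2`, so the corner has to send `-2` and the middle `0`, the
  -- latter because of another unsatisfied corner.
  o.conj (o.conj (B p) (o.diff (S (g.cor k p)) (unsatAny g o S B (g.cor k p))))
    (o.disj (S (g.cor ((k + 1) % 4) p))
      (o.disj (S (g.cor ((k + 2) % 4) p)) (S (g.cor ((k + 3) % 4) p))))

/-- A defect, at `x`, of the estimate after two iterations, given by `E` and `N`. -/
def defect (E N : ℕ → X → α) (x : X) : α :=
  let e := fun k => E k x
  let m := fun k => N k (g.uncor k x)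
  let u := fun k => unsat g o S B k x
  let all := fun p => o.conj4 (N 0 p) (N 1 p) (N 2 p) (N 3 p)
  let se := o.disj4 (e 0) (e 1) (e 2) (e 3)
  let sm := o.disj4 (m 0) (m 1) (m 2) (m 3)
  let lone := fun k => o.diff (e k) (S (g.step k x))
  let part := fun k => o.diff (m k) (all (g.uncor k x))
  -- The terms are: the syndrome is not met at `x`; an unsatisfied `x` has two estimated edges, or
  -- at least three unsatisfied neighbours along remaining edges; an unsatisfied `x` beside an
  -- unsatisfied check has an estimated edge to a satisfied check, or only part of the new edges
  -- around a plaquette; the parity at a middle is odd. The second and third terms are what the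
  -- weight count and the comparison with iteration one need.
  o.disj4
    (o.sum (S x) (o.sum (o.sum4 (e 0) (e 1) (e 2) (e 3)) (o.sum4 (m 0) (m 1) (m 2) (m 3))))
    (o.conj (S x) (o.disj4 (o.conj se sm) (o.two (e 0) (e 1) (e 2) (e 3))
      (o.two (m 0) (m 1) (m 2) (m 3)) (o.three (u 0) (u 1) (u 2) (u 3))))
    (o.conj (o.conj (S x) (o.disj4 (S (g.rt x)) (S (g.dn x)) (S (g.lf x)) (S (g.up x))))
      (o.disj (o.disj4 (lone 0) (lone 1) (lone 2) (lone 3))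
        (o.disj4 (part 0) (part 1) (part 2) (part 3))))
    (o.sum4 (N 0 x) (N 1 x) (N 2 x) (N 3 x))

end Blown

/-- There is a conflict or a defect at `x`. -/
def bad (S : X → α) (x : X) : α :=
  let P := patA g o S
  let Q := patB g o S
  let R := patC g o S
  let B := blown g o P Q R
  o.disj (conflict g o P Q R x) (defect g o S B (estEdge g o S B) (estNew g o S B) x)

end Formulas

/-! ### Evaluation of formulas on truth tables -/

def latticeGrid : Grid (ℤ × ℤ) where
  rt u := (u.1, u.2 + 1)
  dn u := (u.1 + 1, u.2)
  lf u := (u.1, u.2 - 1)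
  up u := (u.1 - 1, u.2)

def boolLogic : Logic Bool := ⟨and, or, xor, not⟩

/-- Truth tables as bits of natural numbers; `full` is the table of the true statement. -/
def tableLogic (full : ℕ) : Logic ℕ := ⟨Nat.land, Nat.lor, Nat.xor, fun a => Nat.xor full a⟩

/-- Evaluate `n` before it is passed on. -/
def strict {β : Type} (n : ℕ) (k : ℕ → β) : β :=
  -- Choosing a branch forces `n` to be reduced to a numeral, which is then shared by all later
  -- uses.
  match n + 1 with
  | 0 => k 0
  | m + 1 => k m

def strictRow {β : Type} (f : ℕ → ℕ) : ℕ → List ℕ → (List ℕ → β) → β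
  | 0, acc, k => k acc
  | n + 1, acc, k => strict (f n) fun v => strictRow f n (v :: acc) k

def strictRows {β : Type} (f : ℕ → ℕ → ℕ) (w : ℕ) :
    ℕ → List (List ℕ) → (List (List ℕ) → β) → β
  | 0, acc, k => k acc
  | n + 1, acc, k => strictRow (f n) w [] fun r => strictRows f w n (r :: acc) k

/-- Outside of the table the function itself is called. Hence `memo` changes no value, whatever the
window; see `memo_eq`. -/
def lookup2 (t : List (List ℕ)) (r : ℤ) (f : ℤ × ℤ → ℕ) (u : ℤ × ℤ) : ℕ :=
  match u.1 + r, u.2 + r with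
  | Int.ofNat i, Int.ofNat j => ((t[i]?).bind fun l => l[j]?).getD (f u)
  | _, _ => f u

/-- Tabulate `f` on the square of side `w` with corner `(-r, -r)`. -/
def memo {β : Type} (r : ℤ) (w : ℕ) (f : ℤ × ℤ → ℕ) (k : (ℤ × ℤ → ℕ) → β) : β :=
  strictRows (fun i j => f (i - r, j - r)) w w [] fun t => k (lookup2 t r f)

/-- `bad` at the origin, with intermediate results tabulated. -/
def badTable (o : Logic ℕ) (S : ℤ × ℤ → ℕ) : ℕ :=
  -- The windows only affect the amount of work, not the result.
  memo 4 9 S fun S =>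
  memo 4 8 (patA latticeGrid o S) fun P =>
  memo 4 8 (patB latticeGrid o S) fun Q =>
  memo 4 8 (patC latticeGrid o S) fun R =>
  memo 2 4 (blown latticeGrid o P Q R) fun B =>
  memo 1 3 (estEdge latticeGrid o S B 0) fun E₀ =>
  memo 1 3 (estEdge latticeGrid o S B 1) fun E₁ =>
  memo 1 2 (estNew latticeGrid o S B 0) fun N₀ =>
  memo 1 2 (estNew latticeGrid o S B 1) fun N₁ =>
  memo 1 2 (estNew latticeGrid o S B 2) fun N₂ =>
  memo 1 2 (estNew latticeGrid o S B 3) fun N₃ =>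
  strict (conflict latticeGrid o P Q R (0, 0)) fun c =>
  strict (defect latticeGrid o S B
    (fun k x => match k with
      | 0 => E₀ x | 1 => E₁ x | k => estEdge latticeGrid o S B k x)
    (fun k x => match k with
      | 0 => N₀ x | 1 => N₁ x | 2 => N₂ x | 3 => N₃ x | k => estNew latticeGrid o S B k x) (0, 0))
  fun d => o.disj c d

def ones (w : ℕ) : ℕ := 2 ^ w - 1

/-- `k` copies of the `w` bit number `t`. -/
def rep (w k t : ℕ) : ℕ := t * ((2 ^ (w * k) - 1) / (2 ^ w - 1))

/-- The index, in a table for the `M × M` torus, of the edge `t` (`0` for a horizontal and `1` for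
a vertical edge) at `u`. -/
def edgeIdx (M : ℕ) (t : ℕ) (u : ℤ × ℤ) : ℕ :=
  -- The edges at sites with coordinates from `-4` to `4` start at coordinates from `-5` to `4`.
  -- Adding `5` gives `0` to `9`, so nothing wraps around for `M = 10`.
  t * M ^ 2 + ((u.1 + 5) % M).toNat * M + ((u.2 + 5) % M).toNat

def incident (u : ℤ × ℤ) : List (ℕ × ℤ × ℤ) :=
  [(0, u), (1, u), (0, u.1, u.2 - 1), (1, u.1 - 1, u.2)]

/-- Edges near the origin. -/
def nearEdges : List (ℕ × ℤ × ℤ) :=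
  -- These six sites are the ones in `exists_near`: one of them is unsatisfied if the origin is bad.
  [((0, 0) : ℤ × ℤ), (0, 1), (1, 0), (1, 1), (0, -1), (-1, 0)].flatMap incident

def blockOf (w x : ℕ) : List ℕ → ℕ
  | [] => 0
  | a :: l => Nat.lor (if a = x then ones w else 0) (Nat.shiftLeft (blockOf w x l) w)

/-- Bit `(k * N + b) * N + c` stands for the triple of the edges `near[k]`, `b` and `c`, and tells
whether the edge `x` is one of the three. -/
def tripleTable (N : ℕ) (near : List ℕ) (full bm cm x : ℕ) : ℕ :=
  Nat.lor (blockOf (N ^ 2) x near)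
    (Nat.land full (Nat.lor (Nat.shiftLeft bm (x * N)) (Nat.shiftLeft cm x)))

def syndromeTable (M : ℕ) (t : List ℕ) (u : ℤ × ℤ) : ℕ :=
  (incident u).foldr (fun e r => Nat.xor (t.getD (edgeIdx M e.1 e.2) 0) r) 0

/-- The truth table of `bad` at the origin over all triples with a near edge. The index `2 * M ^ 2`
belongs to no edge; it fills the place of a missing second or third edge, so that errors of weight
one and two are included. -/
def badTriples (M : ℕ) : ℕ :=
  let near := nearEdges.map fun e => edgeIdx M e.1 e.2
  let K := near.length
  let n := 2 * M ^ 2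
  let N := n + 1
  strict (ones (N ^ 2 * K)) fun full =>
  strict (rep (N ^ 2) K (ones N)) fun bm =>
  strict (rep (N ^ 2) K (rep N N 1)) fun cm =>
  strictRow (tripleTable N near full bm cm) n [] fun t =>
  badTable (tableLogic full) (syndromeTable M t)


/-! ### Words: truth tables of functions on tori, one block of bits for each torus -/

/-- Evaluate a list before it is passed on. -/
def strictList {β : Type} : List ℕ → (List ℕ → β) → β
  | [], k => k []
  | a :: l, k => strict a fun a => strictList l fun l => k (a :: l)

/-- Shifts of words that consist of tables on the `m × m` torus. -/
structure Words where
  m : ℕ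
  full : ℕ
  firstCol : ℕ
  lastCol : ℕ
  firstRow : ℕ
  lastRow : ℕ

namespace Words

variable (T : Words)

def not (a : ℕ) : ℕ := Nat.xor T.full a

def select (mask a b : ℕ) : ℕ := Nat.lor (Nat.land (T.not mask) a) (Nat.land mask b)

def rt (w : ℕ) : ℕ := T.select T.lastCol (Nat.shiftRight w 1) (Nat.shiftLeft w (T.m - 1))
def lf (w : ℕ) : ℕ := T.select T.firstCol (Nat.shiftLeft w 1) (Nat.shiftRight w (T.m - 1))
def dn (w : ℕ) : ℕ :=
  T.select T.lastRow (Nat.shiftRight w T.m) (Nat.shiftLeft w (T.m * (T.m - 1)))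
def up (w : ℕ) : ℕ :=
  T.select T.firstRow (Nat.shiftLeft w T.m) (Nat.shiftRight w (T.m * (T.m - 1)))

/-- A point is the shift that brings its bit to the base point. A word `S` becomes the function `fun
x => x S`, with `id` as the base point, and a step is therefore a composition on the inside. -/
def grid : Grid (ℕ → ℕ) where
  rt x w := x (T.rt w)
  dn x w := x (T.dn w)
  lf x w := x (T.lf w)
  up x w := x (T.up w)

def logic : Logic ℕ := tableLogic T.full

end Words

/-- The shifts for `K` tables. -/
def withWords {β : Type} (m K : ℕ) (k : Words → β) : β :=
  strict (ones (m * m * K)) fun full =>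
  strict (rep (m * m) K (rep m m 1)) fun firstCol =>
  strict (rep (m * m) K (rep m m (Nat.shiftLeft 1 (m - 1)))) fun lastCol =>
  strict (rep (m * m) K (ones m)) fun firstRow =>
  strict (rep (m * m) K (Nat.shiftLeft (ones m) (m * (m - 1)))) fun lastRow =>
  k ⟨m, full, firstCol, lastCol, firstRow, lastRow⟩

/-- What rules out that `B` is the set of blown-up plaquettes, for the patterns `P`, `Q` and `R`. -/
def invalid {X α : Type} (g : Grid X) (o : Logic α) (P Q R B : X → α) (p : X) : α :=
  -- Conditions on a greedy set that hold for any order of the plaquettes: it is independent and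
  -- consists of matches; a match of the first pass that is not in it has a neighbour in it from the
  -- same pass, one of the second pass from the first two passes, one of the third from any pass.
  o.disj4
    (o.conj (B p) (o.disj (adjSome g o B p) (o.neg (o.disj (P p) (o.disj (Q p) (R p))))))
    (o.diff (P p) (o.disj (B p) (adjSome g o (fun x => o.conj (B x) (P x)) p)))
    (o.diff (Q p) (o.disj (B p) (adjSome g o (fun x => o.conj (B x) (o.disj (P x) (Q x))) p)))
    (o.diff (R p) (o.disj (B p) (adjSome g o B p)))

/-! ### Interval propagation of min-sum messages -/

/-- Words that bound a family of integers `x`: the bits of `pos` and `neg` imply `0 ≤ x` and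
`x ≤ 0`, those of `ge[t]` and `lt[t]` imply `t + 1 ≤ |x|` and `|x| < t + 1`. -/
structure Msg where
  pos : ℕ
  neg : ℕ
  ge : List ℕ
  lt : List ℕ

namespace Msg

def force {β : Type} (a : Msg) (k : Msg → β) : β :=
  strict a.pos fun x => strict a.neg fun y => strictList a.ge fun z => strictList a.lt fun u =>
    k ⟨x, y, z, u⟩

def mix (a b : ℕ) : List ℕ → List ℕ → List ℕ
  | x :: l, y :: l' => Nat.lor (Nat.land a x) (Nat.land b y) :: mix a b l l'
  | x :: l, [] => Nat.land a x :: mix a b l []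
  | [], _ => []

/-- Bounds for `1 + x`. -/
def incr (full : ℕ) (a : Msg) : Msg where
  pos := Nat.lor a.pos (a.lt.getD 1 0)
  neg := Nat.land a.neg (a.ge.getD 0 0)
  ge := Nat.lor a.pos (Nat.lor (a.lt.getD 0 0) (Nat.land a.neg (a.ge.getD 1 0))) ::
    -- For `x ≤ 0`, a bound `t + 2 ≤ |1 + x|` follows from `t + 3 ≤ |x|`, which is stored two places
    -- further on than `t + 1 ≤ |x|`; likewise for the upper bounds.
    mix a.pos a.neg a.ge (a.ge.drop 2)
  lt := Nat.land a.neg (Nat.land (a.ge.getD 0 0) (a.lt.getD 1 0)) ::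
    mix full a.neg a.lt (a.lt.drop 2)

/-- Bounds for the integer with the sign of `x * y` and magnitude `min |x| |y|`. -/
def merge (a b : Msg) : Msg :=
  let lt := List.zipWith Nat.lor a.lt b.lt
  ⟨Nat.lor (lt.getD 0 0) (Nat.lor (Nat.land a.pos b.pos) (Nat.land a.neg b.neg)),
    Nat.lor (lt.getD 0 0) (Nat.lor (Nat.land a.pos b.neg) (Nat.land a.neg b.pos)),
    List.zipWith Nat.land a.ge b.ge, lt⟩

/-- Bounds for the messages received, where `f` moves the messages sent; `off` are the places
without an edge, and `out` those without an edge in the frame. -/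
def arrive (full : ℕ) (f : ℕ → ℕ) (off out : ℕ) (a : Msg) : Msg :=
  -- At places in `off` the bounds describe a positive number beyond all recorded bounds, which is
  -- neutral for `merge`. At places in `out` but not in `off`, an edge enters from outside and only
  -- `0 ≤ x` is recorded.
  strict (Nat.xor full out) fun inn =>
  ⟨Nat.lor out (Nat.land inn (f a.pos)), Nat.land inn (f a.neg),
    a.ge.map fun w => Nat.lor off (Nat.land inn (f w)), a.lt.map fun w => Nat.land inn (f w)⟩

/-- Bounds for the message with sign `s` and unbounded magnitude. -/
def start (full s n : ℕ) : Msg :=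
  ⟨Nat.xor full s, s, List.replicate n full, List.replicate n 0⟩

/-- Where `1 + x + y < 0` and `x ≤ 0`. -/
def below (a b : Msg) : ℕ := go b.neg a.lt (b.ge.drop 1)
where
  go (n : ℕ) : List ℕ → List ℕ → ℕ
    | x :: l, y :: l' => Nat.lor (Nat.land n (Nat.land x y)) (go n l l')
    | _, _ => 0

/-- Where `1 + x + y < 0`. -/
def sumNeg (a b : Msg) : ℕ :=
  Nat.lor (Nat.land (Nat.land a.neg b.neg) (Nat.lor (Nat.lor (a.ge.getD 1 0) (b.ge.getD 1 0))
    (Nat.land (a.ge.getD 0 0) (b.ge.getD 0 0)))) (Nat.lor (below a b) (below b a))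

/-- Where `0 ≤ 1 + x + y`, as `0 ≤ x`. -/
def above (a b : Msg) : ℕ :=
  Nat.land a.pos (Nat.lor (b.lt.getD 1 0) (go a.ge (b.lt.drop 2)))
where
  go : List ℕ → List ℕ → ℕ
    | x :: l, y :: l' => Nat.lor (Nat.land x y) (go l l')
    -- No upper bound is left in the list. This relies on `|y|` being at most the length of `lt`, a
    -- bound by the number of iterations that `Holds.above` takes as a hypothesis.
    | x :: _, [] => x
    | _, _ => 0

/-- Where `0 ≤ 1 + x + y`. -/
def sumPos (a b : Msg) : ℕ :=
  Nat.lor (Nat.land a.pos b.pos) (Nat.lor (above a b) (above b a))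

end Msg

/-- A place where edges end: the places without an edge, those without an edge in the frame, and
the shift to the other end. -/
structure Slot where
  off : ℕ
  out : ℕ
  move : ℕ → ℕ

def strictMsgs {β : Type} : List Msg → (List Msg → β) → β
  | [], k => k []
  | a :: l, k => a.force fun a => strictMsgs l fun l => k (a :: l)

/-- The message sent in slot `k`. -/
def departure (l : List Msg) (start : Msg) (k : ℕ) : Msg :=
  go l start k
where
  go : List Msg → Msg → ℕ → Msg
    | [], acc, _ => acc
    -- The message of slot `k` is left out; the new index lies past the end, so that no other one
    -- is.
    | _ :: l, acc, 0 => go l acc l.length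
    | a :: l, acc, k + 1 => (acc.merge a).force fun acc => go l acc k

/-- The messages sent, for the messages `l` received. -/
def departures {β : Type} (full s n : ℕ) (l : List Msg) (k : List Msg → β) : β :=
  strictMsgs (l.map (Msg.incr full)) fun l =>
  strictMsgs ((List.range l.length).map (departure l (Msg.start full s n))) k

def arrivals {β : Type} (full : ℕ) (slots : List Slot) (out : List Msg) (k : List Msg → β) : β :=
  strictMsgs (List.zipWith (fun e a => a.arrive full e.move e.off e.out) slots out) k

structure Setup where
  full : ℕ
  syn : ℕ
  /-- The expected estimates of edges to the right and downwards. -/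
  goals : List (List ℕ)
  site : List Slot
  mid : List Slot

/-- What is seen after an iteration: places where a message that leaves the frame might be negative,
places where the syndrome is not satisfied, and places where the estimate may differ from each of
the expected ones. -/
structure Report where
  stray : ℕ
  unsolved : ℕ
  misses : List ℕ

namespace Setup

variable (U : Setup)

/-- Where messages to edges outside of the frame might be negative. -/
def stray : List Slot → List Msg → ℕ
  | e :: l, a :: l' =>
    Nat.lor (Nat.land (Nat.xor e.out e.off) (Nat.xor U.full a.pos)) (stray l l')
  | _, _ => 0

def negs : List Msg → List Msg → List Slot → List ℕ
  | a :: l, b :: l', e :: s => Nat.land (Nat.xor U.full e.off) (a.sumNeg b) :: negs l l' s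
  | _, _, _ => []

def poss : List Msg → List Msg → List Slot → List ℕ
  | a :: l, b :: l', e :: s => Nat.lor e.off (a.sumPos b) :: poss l l' s
  | _, _, _ => []

def known : List ℕ → List ℕ → ℕ
  | a :: l, b :: l' => Nat.land (Nat.lor a b) (known l l')
  | _, _ => U.full

def parity (s : ℕ) (n : List ℕ) : ℕ := n.foldr Nat.xor s

def miss : List ℕ → List ℕ → List ℕ → ℕ
  | e :: l, n :: ns, p :: ps =>
    Nat.lor (Nat.xor U.full (Nat.lor (Nat.land e n) (Nat.land p (Nat.xor U.full e))))
      (miss l ns ps)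
  | _, _, _ => 0

def report {β : Type} (out inn : List Msg) (k : Report → β) : β :=
  strictList (U.negs out inn U.site) fun n =>
  strictList (poss out inn U.site) fun p =>
  strict (U.stray U.site out) fun x =>
  strict (Nat.land (U.known n p) (parity U.syn n)) fun u =>
  strictList (U.goals.map fun e => U.miss e n p) fun m =>
  k ⟨x, u, m⟩

/-- The reports after the iterations from `it + 1` on, for the messages received at the sites and
at the middles of plaquettes after `it` iterations. -/
def run {β : Type} : ℕ → ℕ → List Msg → List Msg → (List Report → β) → β
  | 0, _, _, _, k => k []
  | n + 1, it, a, b, k =>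
    departures U.full U.syn (it + 2) a fun oa =>
    departures U.full 0 (it + 2) b fun ob =>
    -- What arrives from the right was sent to the left, and so on: slot `j` faces slot `(j + 2) %
    -- 4` of the neighbour.
    arrivals U.full U.site ([2, 3, 0, 1].map (fun i => oa.getD i ⟨0, 0, [], []⟩) ++ ob) fun a =>
    arrivals U.full U.mid (oa.drop 4) fun b =>
    U.report oa a fun r =>
    run n (it + 1) a b fun l => k (r :: l)

end Setup

/-- The edge `(t, i, j)`: horizontal for `t = 0` and vertical otherwise. -/
abbrev Place : Type := ℕ × ℕ × ℕ

/-- Numbers whose bits are the horizontal and the vertical edges of an error. -/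
def blocks (m : ℕ) : List Place → ℕ × ℕ
  | [] => (0, 0)
  | (t, i, j) :: l =>
    let b := Nat.shiftLeft 1 (i % m * m + j % m)
    match t with
    | 0 => (Nat.lor b (blocks m l).1, (blocks m l).2)
    | _ => ((blocks m l).1, Nat.lor b (blocks m l).2)

/-- Concatenation of blocks. -/
def concat (A : ℕ) : List ℕ → ℕ
  | [] => 0
  | a :: l => strict (concat A l) fun r => Nat.lor a (Nat.shiftLeft r A)

namespace Words

variable (T : Words)

def synd (h v : ℕ) : ℕ := Nat.xor (Nat.xor h (T.lf h)) (Nat.xor v (T.up v))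

def patterns {β : Type} (S : ℕ) (k : ℕ → ℕ → ℕ → β) : β :=
  strict S fun S =>
  strict (patA T.grid T.logic (fun x => x S) id) fun P =>
  strict (patB T.grid T.logic (fun x => x S) id) fun Q =>
  strict (patC T.grid T.logic (fun x => x S) id) fun R => k P Q R

end Words

/-- Submasks of a number. -/
def submasks : ℕ → ℕ → List ℕ
  | 0, _ => [0]
  | n + 1, a =>
    match a with
    | 0 => [0]
    | a + 1 => strict (Nat.shiftLeft 1 (Nat.log2 (a + 1))) fun b =>
      (submasks n (Nat.xor (a + 1) b)).flatMap fun c => [c, Nat.lor b c]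

/-- Errors with the same syndrome, given by blocks, and a set of plaquettes. -/
structure Lane where
  errs : List (ℕ × ℕ)
  blown : ℕ

/-- The lanes for a list of errors with the same syndrome: one for each set of plaquettes at which
a pattern is found. -/
def lanesOf (m : ℕ) (c : List (List Place)) : List Lane :=
  let errs := c.map (blocks m)
  match errs with
  | [] => []
  | e :: _ => strict e.1 fun h => strict e.2 fun v =>
    withWords m 1 fun T => T.patterns (T.synd h v) fun P Q R =>
      (submasks (m * m) (Nat.lor P (Nat.lor Q R))).map fun b => ⟨errs, b⟩

/-- The block `l` of `A` bits. -/
def blockAt (A l w : ℕ) : ℕ := Nat.shiftRight w (A * l) % 2 ^ A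

/-- The reports show that, before a stray message, an expected estimate is found before any other
one satisfies the syndrome. -/
def accept (A l : ℕ) : List Report → Bool
  | [] => false
  | r :: rs => Nat.beq (blockAt A l r.stray) 0 && (r.misses.any (fun w => Nat.beq (blockAt A l w) 0)
    || (Nat.ble 1 (blockAt A l r.unsolved) && accept A l rs))

/-- Every block is accepted, unless `V` shows that it is not relevant. -/
def acceptAll (A V : ℕ) (rs : List Report) : ℕ → Bool
  | 0 => true
  | l + 1 => (Nat.ble 1 (blockAt A l V) || accept A l rs) && acceptAll A V rs l

def strictLanes {β : Type} : List Lane → (List Lane → β) → β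
  | [], k => k []
  | a :: l, k => strictLanes l fun l => go a.errs [] fun e => strict a.blown fun b => k (⟨e, b⟩ :: l)
where
  go {β : Type} : List (ℕ × ℕ) → List (ℕ × ℕ) → (List (ℕ × ℕ) → β) → β
    | [], acc, k => k acc
    | a :: l, acc, k => strict a.1 fun x => strict a.2 fun y => go l ((x, y) :: acc) k

/-- Whether the errors in each lane have the same syndrome, where the sets of plaquettes are not those
that are blown up, and the reports on `n` iterations. If `cut` holds, then the tables describe a
square in a torus of any larger size. -/
def reports {β : Type} (m : ℕ) (cut : Bool) (n : ℕ) (lanes : List Lane)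
    (k : Bool → ℕ → List Report → β) : β :=
  withWords m lanes.length fun T =>
  let A := m * m
  let err := fun r => (concat A (lanes.map fun a => (a.errs.getD r (a.errs.getD 0 (0, 0))).1),
    concat A (lanes.map fun a => (a.errs.getD r (a.errs.getD 0 (0, 0))).2))
  strict (concat A (lanes.map fun a => a.blown)) fun B =>
  -- Three ranks suffice as no cluster has more than three errors (`clusters_length`); in shorter
  -- lists the first error is repeated.
  strictList [(err 0).1, (err 1).1, (err 2).1] fun hs =>
  strictList [(err 0).2, (err 1).2, (err 2).2] fun vs =>
  strictList (List.zipWith T.synd hs vs) fun ss =>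
  let S := ss.getD 0 0
  T.patterns S fun P Q R =>
  strict (invalid T.grid T.logic (fun x => x P) (fun x => x Q) (fun x => x R) (fun x => x B) id)
    fun V =>
  strictList ([0, 1, 2, 3].map fun i =>
    T.not (kept T.grid T.logic (fun x => x B) i id)) fun off =>
  strictList ([0, 1, 2, 3].map fun i => T.not (T.grid.uncor i id B)) fun noff =>
  -- In a square cut out of the torus, the edges across its boundary do not wrap around and count as
  -- leaving the frame.
  strictList (List.zipWith Nat.lor off
    (bif cut then [T.lastCol, T.lastRow, T.firstCol, T.firstRow] else [0, 0, 0, 0])) fun out =>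
  strict (T.not B) fun nb =>
  let site := ([0, 1, 2, 3].map fun i => (⟨off.getD i 0, out.getD i 0, T.grid.step i id⟩ : Slot)) ++
    [0, 1, 2, 3].map fun i => (⟨noff.getD i 0, noff.getD i 0, T.grid.uncor i id⟩ : Slot)
  let mid := [0, 1, 2, 3].map fun i => (⟨nb, nb, T.grid.cor i id⟩ : Slot)
  let goal := fun h v =>
    let l := [h, v, T.lf h, T.up v]
    l ++ [Nat.xor h v, Nat.xor v (T.lf h), Nat.xor (T.lf h) (T.up v), Nat.xor (T.up v) h]
  let goal' := fun h v k =>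
    strictList (List.zipWith (fun (e : ℕ) (a : Slot) => Nat.land e (T.not a.off)) (goal h v) site) k
  goal' (hs.getD 0 0) (vs.getD 0 0) fun g0 =>
  goal' (hs.getD 1 0) (vs.getD 1 0) fun g1 =>
  goal' (hs.getD 2 0) (vs.getD 2 0) fun g2 =>
  let U : Setup := ⟨T.full, S, [g0, g1, g2], site, mid⟩
  -- On every edge the recorded message is exactly `0`, so that the first variable message `1 + 0`
  -- is the a priori value.
  U.run n 0 (site.map fun e => ⟨T.full, T.not e.off, [e.off], [T.not e.off]⟩)
    (mid.map fun e => ⟨T.full, T.not e.off, [e.off], [T.not e.off]⟩) fun rs =>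
  k (ss.all fun w => Nat.beq w S) V rs

/-- Min-sum finds an error of the lane, in all lanes. -/
def checkLanes (m : ℕ) (cut : Bool) (n : ℕ) (lanes : List Lane) : Bool :=
  strictLanes lanes fun lanes =>
  reports m cut n lanes fun b V rs => b && acceptAll (m * m) V rs lanes.length


/-! ### The special errors of weight three -/

/-- Each entry lists errors with a common syndrome, which `checkLanes` verifies. The coordinates
from `2` to `7` leave a margin in the square of side ten. All that is required of the list is that
its images under the symmetries of the square contain every bad error up to translation. -/
def baseClusters : List (List (List Place)) :=
  [[[(0, 4, 5), (1, 2, 3), (1, 6, 4)]], [[(1, 2, 4), (1, 4, 4), (1, 6, 4)]], [[(1, 2, 4), (1, 5,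
    4), (1, 6, 4)]], [[(0, 2, 2), (0, 3, 5), (1, 5, 4)]], [[(0, 2, 4), (0, 3, 4), (1, 5, 5)],
    [(1, 2, 4), (1, 2, 5), (1, 5, 5)]], [[(0, 2, 4), (1, 3, 5), (1, 5, 5)]], [[(0, 2, 5), (0, 4,
    3), (1, 5, 6)]], [[(0, 2, 4), (1, 4, 5), (1, 5, 5)]], [[(1, 2, 3), (1, 2, 5), (1, 5, 4)]],
    [[(1, 2, 4), (1, 3, 3), (1, 5, 5)]], [[(1, 2, 4), (1, 3, 5), (1, 5, 5)]], [[(0, 3, 5), (1, 2,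
    3), (1, 5, 4)]], [[(1, 2, 3), (1, 3, 6), (1, 5, 4)]], [[(0, 4, 3), (1, 2, 5), (1, 5, 6)]],
    [[(0, 4, 4), (1, 2, 4), (1, 5, 5)]], [[(1, 2, 4), (1, 4, 5), (1, 5, 5)]], [[(0, 5, 4), (1, 2,
    4), (1, 5, 5)], [(0, 6, 4), (1, 2, 4), (1, 5, 4)]], [[(0, 4, 3), (1, 2, 6), (1, 5, 6)]],
    [[(0, 4, 3), (1, 2, 5), (1, 5, 5)]], [[(0, 4, 4), (1, 2, 5), (1, 5, 5)]], [[(1, 2, 4), (1, 4,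
    4), (1, 5, 4)]], [[(0, 3, 3), (1, 3, 5), (1, 5, 5)]], [[(0, 3, 4), (0, 4, 3), (1, 5, 6)]],
    [[(0, 3, 3), (0, 4, 3), (1, 5, 5)], [(1, 3, 3), (1, 3, 4), (1, 5, 5)]], [[(0, 3, 3), (0, 4,
    3), (0, 6, 4)], [(0, 6, 4), (1, 3, 3), (1, 3, 4)]], [[(0, 3, 3), (0, 4, 4), (1, 5, 5)]],
    [[(0, 3, 3), (1, 4, 4), (1, 5, 5)]], [[(0, 3, 3), (0, 6, 4), (1, 4, 4)]], [[(0, 3, 3), (1, 4,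
    5), (1, 5, 5)]], [[(0, 3, 3), (0, 5, 4), (1, 5, 5)], [(0, 3, 3), (0, 6, 4), (1, 5, 4)]],
    [[(0, 3, 3), (0, 3, 4), (1, 5, 5)]], [[(0, 4, 4), (1, 3, 3), (1, 5, 5)]], [[(1, 3, 3), (1, 4,
    4), (1, 5, 5)]], [[(1, 3, 3), (1, 4, 5), (1, 5, 5)]], [[(0, 5, 4), (1, 3, 3), (1, 5, 5)],
    [(0, 6, 4), (1, 3, 3), (1, 5, 4)]], [[(0, 3, 4), (0, 4, 4), (1, 5, 5)], [(1, 3, 4), (1, 3,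
    5), (1, 5, 5)]], [[(0, 3, 4), (0, 4, 4), (0, 6, 4)], [(0, 6, 4), (1, 3, 4), (1, 3, 5)]],
    [[(0, 3, 4), (1, 4, 4), (1, 5, 5)]], [[(0, 3, 4), (0, 6, 4), (1, 4, 4)]], [[(0, 3, 3), (0, 4,
    4), (1, 5, 4)]], [[(0, 3, 4), (1, 4, 5), (1, 5, 5)]], [[(0, 3, 3), (0, 4, 5), (1, 5, 4)]],
    [[(0, 3, 4), (0, 5, 4), (1, 5, 5)], [(0, 3, 4), (0, 6, 4), (1, 5, 4)]], [[(1, 3, 3), (1, 3,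
    5), (1, 5, 4)]], [[(0, 3, 3), (0, 3, 4), (1, 5, 4)]], [[(0, 3, 3), (1, 3, 3), (1, 5, 5)],
    [(0, 4, 3), (1, 3, 4), (1, 5, 5)]], [[(0, 4, 4), (1, 3, 3), (1, 5, 4)]], [[(1, 3, 4), (1, 4,
    5), (1, 5, 5)]], [[(0, 5, 4), (1, 3, 4), (1, 5, 5)], [(0, 6, 4), (1, 3, 4), (1, 5, 4)]],
    [[(0, 4, 3), (1, 3, 5), (1, 5, 5)]], [[(1, 3, 5), (1, 4, 4), (1, 5, 5)]], [[(0, 3, 4), (1, 3,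
    4), (1, 5, 5)], [(0, 4, 4), (1, 3, 5), (1, 5, 5)]], [[(1, 3, 4), (1, 4, 4), (1, 5, 4)]],
    [[(0, 3, 4), (1, 3, 3), (1, 4, 5)]], [[(0, 3, 3), (1, 3, 5), (1, 4, 5)]], [[(0, 3, 3), (0, 4,
    3), (1, 4, 5)], [(1, 3, 3), (1, 3, 4), (1, 4, 5)]], [[(0, 3, 3), (0, 4, 4), (1, 4, 5)], [(0,
    3, 3), (0, 5, 4), (1, 4, 4)]], [[(0, 3, 3), (0, 5, 3), (0, 5, 4)]], [[(0, 3, 4), (1, 3, 3),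
    (1, 4, 4)]], [[(0, 3, 4), (0, 4, 3), (0, 5, 4)]], [[(0, 3, 4), (0, 4, 4), (0, 5, 4)], [(0, 3,
    4), (1, 4, 4), (1, 4, 5)], [(0, 5, 4), (1, 3, 4), (1, 3, 5)]], [[(0, 3, 4), (0, 4, 4), (1, 4,
    5)], [(0, 3, 4), (0, 5, 4), (1, 4, 4)], [(1, 3, 4), (1, 3, 5), (1, 4, 5)]], [[(0, 3, 3), (0,
    4, 4), (1, 4, 4)], [(0, 3, 3), (0, 5, 4), (1, 4, 5)]], [[(0, 3, 3), (0, 3, 4), (1, 4, 4)]],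
    [[(0, 3, 4), (1, 3, 5), (1, 4, 5)], [(0, 4, 4), (1, 3, 4), (1, 4, 5)], [(0, 5, 4), (1, 3, 4),
    (1, 4, 4)]], [[(0, 3, 4), (1, 3, 4), (1, 4, 5)], [(0, 4, 4), (1, 3, 5), (1, 4, 5)], [(0, 5,
    4), (1, 3, 5), (1, 4, 4)]]]

/-- Reflection of the square with corners `(2, 2)` and `(7, 7)`. -/
def flipPlace : Place → Place
  | (t, i, j) => match t with
    | 0 => (0, 9 - i, j)
    -- A vertical edge joins the rows `i` and `i + 1`, which go to `9 - i` and `8 - i`; it is named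
    -- after the upper one.
    | _ => (1, 8 - i, j)

/-- Transposition. -/
def turnPlace (a : Place) : Place := (1 - a.1, a.2.2, a.2.1)

/-- The eight maps are the symmetries of the square, as words in a reflection and the transposition.
The decoder is not symmetric, since plaquettes are visited in lexicographic order, so all images
have to be checked separately. -/
def clusters : List (List (List Place)) :=
  [id, flipPlace, turnPlace, flipPlace ∘ turnPlace, turnPlace ∘ flipPlace,
    flipPlace ∘ turnPlace ∘ flipPlace, turnPlace ∘ flipPlace ∘ turnPlace,
    flipPlace ∘ turnPlace ∘ flipPlace ∘ turnPlace].flatMap fun f =>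
  baseClusters.map fun c => c.map fun e => e.map f


/-- Errors with a distinguished first edge. -/
def rooted : List (List Place) :=
  clusters.flatten.flatMap fun e => match e with
    | [a, b, c] => [[a, b, c], [b, c, a], [c, a, b]]
    | _ => []

def strictPlaces {β : Type} : List Place → (List Place → β) → β
  | [], k => k []
  | a :: l, k => strict a.1 fun t => strict a.2.1 fun i => strict a.2.2 fun j =>
    strictPlaces l fun l => k ((t, i, j) :: l)

def strictErrors {β : Type} : List (List Place) → List (List Place) → (List (List Place) → β) → β
  | [], acc, k => k acc
  | a :: l, acc, k => strictPlaces a fun a => strictErrors l (a :: acc) k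

/-- The place, with `5` added to the coordinates, to which `b` is moved with `a` to `(i, j)`. -/
def movedIdx (M : ℕ) (i j : ℕ) (a b : Place) : ℕ :=
  b.1 * M ^ 2 + (b.2.1 + i + M - a.2.1) % M * M + (b.2.2 + j + M - a.2.2) % M

/-- The edge remains within ten rows and columns. -/
def fits (i j : ℕ) (a b : Place) : Bool :=
  Nat.ble a.2.1 (b.2.1 + i) && Nat.ble (b.2.1 + i + 1) (a.2.1 + 10) &&
  Nat.ble a.2.2 (b.2.2 + j) && Nat.ble (b.2.2 + j + 1) (a.2.2 + 10)

/-- For `M ≥ 10` the table stands for a window of a possibly larger torus, so translates that would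
wrap around are left out. Both orders of the second and third edge are entered. -/
def specialPairs (M : ℕ) (t i j : ℕ) : List (List Place) → ℕ → ℕ
  | [], acc => acc
  | e :: l, acc =>
    match e with
    | [a, b, c] =>
      bif Nat.beq a.1 t && (Nat.ble M 9 || (fits i j a b && fits i j a c)) then
        strict (movedIdx M i j a b) fun x => strict (movedIdx M i j a c) fun y =>
        let N := 2 * M ^ 2 + 1
        strict (Nat.lor acc (Nat.lor (Nat.shiftLeft 1 (x * N + y)) (Nat.shiftLeft 1 (y * N + x))))
          fun acc => specialPairs M t i j l acc
      else specialPairs M t i j l acc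
    | _ => specialPairs M t i j l acc

/-- The triples, with the first edge near the origin, of the special errors. -/
def specialTriples (M : ℕ) : ℕ :=
  strictErrors rooted [] fun l =>
  concat ((2 * M ^ 2 + 1) ^ 2) (nearEdges.map fun n =>
    strict n.1 fun t => strict (n.2.1 + 5).toNat fun i => strict (n.2.2 + 5).toNat fun j =>
    specialPairs M t i j l 0)

/-- The bad triples are a subset of the special ones. In particular triples with a missing edge are
never bad, since the special ones have none. -/
def badSpecial (M : ℕ) : Bool :=
  strict (badTriples M) fun x => strict (specialTriples M) fun y =>
  Nat.beq (Nat.land x y) x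


/-! ### Cycles and stabilisers -/

section Basics

variable {L : ℕ}

/-- The grid of sites of the torus. -/
def torusGrid (L : ℕ) : Grid (Site L) where
  rt u := (u.1, u.2 + 1)
  dn u := (u.1 + 1, u.2)
  lf u := (u.1, u.2 - 1)
  up u := (u.1 - 1, u.2)

theorem natCast_ne_zero_of_lt {k : ℕ} (hk : 0 < k) (h : k < L) : (k : ZMod L) ≠ 0 := by
  rw [Ne, ZMod.natCast_eq_zero_iff]
  exact Nat.not_dvd_of_pos_of_lt hk h

theorem one_ne_zero_of_lt (h : 1 < L) : (1 : ZMod L) ≠ 0 := by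
  simpa using natCast_ne_zero_of_lt (k := 1) one_pos h

theorem toricH_mulVec [NeZero L] (e : Qubit L → ZMod 2) (c : Site L) :
    (toricH L).mulVec e c = e (Sum.inl c) + e (Sum.inr c) + e (Sum.inl (c.1, c.2 - 1)) +
      e (Sum.inr (c.1 - 1, c.2)) := by
  simp only [Matrix.mulVec, dotProduct, Fintype.sum_sum_type, toricH, endpoints]
  have h₁ : ∀ x : Site L, (x.1, x.2 + 1) = c ↔ x = (c.1, c.2 - 1) := by
    intro x; constructor
    · rintro rfl; simp
    · rintro rfl; simp
  have h₂ : ∀ x : Site L, (x.1 + 1, x.2) = c ↔ x = (c.1 - 1, c.2) := by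
    intro x; constructor
    · rintro rfl; simp
    · rintro rfl; simp
  have h₃ : ∀ (f : Site L → ZMod 2) (d : Site L), ∑ x, (if x = d then 1 else 0) * f x = f d := by
    simp
  simp only [h₁, h₂, add_mul, Finset.sum_add_distrib]
  erw [h₃, h₃, h₃, h₃]
  ring

theorem mem_stabilizers_of_norm_le [NeZero L] (hd : 7 ≤ toricDistance L) {e : Qubit L → ZMod 2}
    (h : (toricH L).mulVec e = 0) (he : hammingNorm e ≤ 6) : e ∈ stabilizers L := by
  by_contra hn
  have : toricDistance L ≤ hammingNorm e := Nat.sInf_le ⟨e, h, hn, rfl⟩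
  omega

/-- The parity of the horizontal edges of the first column. -/
def crossing (L : ℕ) [NeZero L] : (Qubit L → ZMod 2) →ₗ[ZMod 2] ZMod 2 :=
  ∑ i : ZMod L, LinearMap.proj (Sum.inl (i, 0))

theorem crossing_apply [NeZero L] (e : Qubit L → ZMod 2) :
    crossing L e = ∑ i : ZMod L, e (Sum.inl (i, 0)) := by
  simp [crossing]

/-- The two horizontal sides of a plaquette are in the same column, so each generator crosses the
first column an even number of times. -/
theorem crossing_stabilizer [NeZero L] {e : Qubit L → ZMod 2} (he : e ∈ stabilizers L) :
    crossing L e = 0 := by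
  have : stabilizers L ≤ LinearMap.ker (crossing L) := by
    rw [stabilizers, Submodule.span_le]
    rintro _ ⟨p, rfl⟩
    simp only [SetLike.mem_coe, LinearMap.mem_ker, crossing_apply, Fin.sum_univ_four, side,
      Pi.add_apply, Finset.sum_add_distrib]
    simp only [Matrix.cons_val_zero, Matrix.cons_val_one, Matrix.cons_val, Pi.single_apply,
      reduceCtorEq, if_false, Sum.inl.injEq, Prod.mk.injEq, Finset.sum_const_zero, add_zero]
    by_cases hp : (0 : ZMod L) = p.2
    · simp [hp]
      decide
    · simp [hp]
  exact this he

/-- The horizontal edges of one row form a cycle of weight at most `L` that crosses the first column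
once, hence is not a stabiliser. -/
theorem seven_le_of_distance [NeZero L] (hd : 7 ≤ toricDistance L) : 7 ≤ L := by
  let e : Qubit L → ZMod 2 := Sum.elim (fun c => if c.1 = 0 then 1 else 0) fun _ => 0
  have h : (toricH L).mulVec e = 0 := by
    funext c
    rw [toricH_mulVec]
    simp only [e, Sum.elim_inl, Sum.elim_inr, add_zero, Pi.zero_apply]
    exact CharTwo.add_self_eq_zero _
  have hn : e ∉ stabilizers L := by
    intro he
    have := crossing_stabilizer he
    rw [crossing_apply] at this
    simp [e] at this
  have hw : hammingNorm e ≤ L := by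
    have : (Finset.univ.filter fun q => e q ≠ 0) ⊆
        Finset.univ.image fun j : ZMod L => (Sum.inl (0, j) : Qubit L) := by
      intro q hq
      rw [Finset.mem_filter] at hq
      rcases q with ⟨i, j⟩ | q
      · simp only [e, Sum.elim_inl, ne_eq, ite_eq_right_iff, one_ne_zero, imp_false, not_not]
          at hq
        simp [hq.2]
      · simp [e] at hq
    calc hammingNorm e ≤ _ := Finset.card_le_card this
      _ ≤ _ := Finset.card_image_le
      _ = L := by simp [ZMod.card]
  exact hd.trans ((Nat.sInf_le ⟨e, h, hn, rfl⟩ : toricDistance L ≤ _).trans hw)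

/-- No two plaquettes of `B` are adjacent. -/
def Independent (B : Finset (Site L)) : Prop := ∀ p ∈ B, ∀ p' ∈ B, ¬ Adjacent p p'

theorem Independent.eq_of_side {B : Finset (Site L)} (hB : Independent B) {p p' : Site L}
    (hp : p ∈ B) (hp' : p' ∈ B) {k k' : Fin 4} (h : side p k = side p' k') : p = p' := by
  by_contra hn
  exact hB p hp p' hp' ⟨hn, k, k', h⟩

theorem side_injective (hL : 1 < L) (p : Site L) : Function.Injective (side p) := by
  have h1 := one_ne_zero_of_lt hL
  intro k l h
  fin_cases k <;> fin_cases l <;> simp_all [side, Prod.ext_iff]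

theorem blowupH_mulVec_site [NeZero L] (B : Finset (Site L)) (x : BlowupEdge B → ZMod 2)
    (c : Site L) : (blowupH B).mulVec x (Sum.inl c) =
      ∑ q, toricH L c q.1 * x (Sum.inl q) +
      ∑ p : {p : Site L // p ∈ B}, ∑ k, (if corner p.1 k = c then 1 else 0) * x (Sum.inr (p, k)) := by
  simp only [Matrix.mulVec, dotProduct, Fintype.sum_sum_type, blowupH, Fintype.sum_prod_type]

theorem blowupH_mulVec_mid [NeZero L] (B : Finset (Site L)) (x : BlowupEdge B → ZMod 2)
    (p : {p : Site L // p ∈ B}) : (blowupH B).mulVec x (Sum.inr p) = ∑ k, x (Sum.inr (p, k)) := by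
  simp [Matrix.mulVec, dotProduct, Fintype.sum_sum_type, blowupH, Fintype.sum_prod_type,
    ite_mul]
  rw [Finset.sum_comm]
  simp

/-- Summation by parts around the plaquette: the value of a side is counted once at each of its two
corners. -/
theorem sum_corner_side [NeZero L] (p c : Site L) (f : Fin 4 → ZMod 2) :
    ∑ k, (if corner p k = c then 1 else 0) * (f (k - 1) + f k) =
      ∑ k, toricH L c (side p k) * f k := by
  have h3 : (0 - 1 : Fin 4) = 3 := rfl
  have h0 : (1 - 1 : Fin 4) = 0 := rfl
  have h1 : (2 - 1 : Fin 4) = 1 := rfl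
  have h2 : (3 - 1 : Fin 4) = 2 := rfl
  let δ : Site L → ZMod 2 := fun a => if a = c then 1 else 0
  change ∑ k, δ (corner p k) * _ =
    ∑ k, (δ (endpoints (side p k)).1 + δ (endpoints (side p k)).2) * f k
  simp only [Fin.sum_univ_four, h0, h1, h2, h3, corner, side, endpoints,
    Matrix.cons_val_zero, Matrix.cons_val_one, Matrix.cons_val]
  ring

/-- The new edge at a corner replaces the two removed edges there by their sum. Independence of `B`
ensures that a removed edge is a side of only one blown-up plaquette and is not counted twice. -/
theorem blowupH_mulVec_changeVars [NeZero L] (hL : 1 < L) {B : Finset (Site L)}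
    (hB : Independent B) (e : Qubit L → ZMod 2) (c : Site L) :
    (blowupH B).mulVec (changeVars B e) (Sum.inl c) = (toricH L).mulVec e c := by
  classical
  rw [blowupH_mulVec_site, Matrix.mulVec, dotProduct]
  have hc : ∀ p : {p : Site L // p ∈ B},
      ∑ k, (if corner p.1 k = c then 1 else 0) * changeVars B e (Sum.inr (p, k)) =
        ∑ k, toricH L c (side p.1 k) * e (side p.1 k) :=
    fun p => sum_corner_side p.1 c fun k => e (side p.1 k)
  simp only [hc]
  rw [← Finset.sum_filter_add_sum_filter_not Finset.univ
    (fun q => ∀ p ∈ B, ∀ k, side p k ≠ q)]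
  congr 1
  · exact (Finset.sum_subtype _ (p := fun q => ∀ p ∈ B, ∀ k, side p k ≠ q) (by simp)
      fun q => toricH L c q * e q).symm
  · refine (Fintype.sum_prod_type' fun (p : {p : Site L // p ∈ B}) (k : Fin 4) =>
      toricH L c (side p.1 k) * e (side p.1 k)).symm.trans ?_
    refine Finset.sum_bij (fun x _ => side x.1.1 x.2) ?_ ?_ ?_ ?_
    · rintro ⟨⟨p, hp⟩, k⟩ -
      simp only [Finset.mem_filter, Finset.mem_univ, true_and]
      push Not
      exact ⟨p, hp, k, rfl⟩
    · rintro ⟨⟨p, hp⟩, k⟩ - ⟨⟨p', hp'⟩, k'⟩ - h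
      obtain rfl := hB.eq_of_side hp hp' h
      exact congrArg _ (side_injective hL _ h)
    · intro q hq
      simp only [Finset.mem_filter, Finset.mem_univ, true_and] at hq
      push Not at hq
      obtain ⟨p, hp, k, h⟩ := hq
      exact ⟨(⟨p, hp⟩, k), Finset.mem_univ _, h⟩
    · intros; rfl

/-- Consecutive sides of a blown-up plaquette have sum zero, hence equal values, and all other edges
have value zero. So `f` is a sum of blown-up plaquettes. -/
theorem mem_stabilizers_of_changeVars [NeZero L] (hL : 1 < L) {B : Finset (Site L)}
    (hB : Independent B) {f : Qubit L → ZMod 2} (h : changeVars B f = 0) : f ∈ stabilizers L := by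
  have hs : ∀ p ∈ B, ∀ k, f (side p k) = f (side p 0) := by
    intro p hp
    have hk : ∀ k, f (side p (k - 1)) = f (side p k) := fun k => by
      have := congrFun h (Sum.inr (⟨p, hp⟩, k))
      exact CharTwo.add_eq_zero.1 this
    have h1 : f (side p 0) = f (side p 1) := hk 1
    have h2 : f (side p 1) = f (side p 2) := hk 2
    have h3 : f (side p 2) = f (side p 3) := hk 3
    intro k
    fin_cases k
    · rfl
    · exact h1.symm
    · exact (h1.trans h2).symm
    · exact (h1.trans (h2.trans h3)).symm
  have hf : f = ∑ p ∈ B, f (side p 0) • ∑ k : Fin 4, Pi.single (side p k) 1 := by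
    funext q
    simp only [Finset.sum_apply, Pi.smul_apply, smul_eq_mul]
    by_cases hq : ∀ p ∈ B, ∀ k, side p k ≠ q
    · rw [Finset.sum_eq_zero]
      · exact congrFun h (Sum.inl ⟨q, hq⟩)
      · intro p hp
        rw [Finset.sum_eq_zero, mul_zero]
        intro k _
        rw [Pi.single_apply, if_neg (hq p hp k).symm]
    · push Not at hq
      obtain ⟨p, hp, k, rfl⟩ := hq
      rw [Finset.sum_eq_single p, Finset.sum_eq_single k]
      · simp [hs p hp k]
      · intro k' _ hk
        rw [Pi.single_apply, if_neg fun h => hk (side_injective hL p h).symm]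
      · simp
      · intro p' hp' hn
        rw [Finset.sum_eq_zero, mul_zero]
        intro k' _
        rw [Pi.single_apply, if_neg fun h => hn (hB.eq_of_side hp hp' h).symm]
      · exact fun h => absurd hp h
  rw [hf]
  refine Submodule.sum_mem _ fun p _ => Submodule.smul_mem _ _ (Submodule.subset_span ⟨p, rfl⟩)

theorem changeVars_sub (B : Finset (Site L)) (e e' : Qubit L → ZMod 2) :
    changeVars B (e - e') = changeVars B e - changeVars B e' := by
  funext v
  rcases v with q | ⟨p, k⟩
  · rfl
  · simp only [changeVars, Pi.sub_apply]; ring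

/-- Decoding succeeds if the estimates that satisfy the syndrome, up to some iteration where this
happens, come from errors of weight at most three. -/
theorem corrects_of_estimates [NeZero L] (hd : 7 ≤ toricDistance L) {e : Qubit L → ZMod 2}
    (he : hammingNorm e ≤ 3) {s : Site L → ZMod 2} (hs : (toricH L).mulVec e = s)
    {B : Finset (Site L)} (hBs : blowupSet s = B) (hB : Independent B)
    (i : ℕ) (hi : (blowupH B).mulVec (msEstimate (blowupH B) (blowupSyndrome B s) i) =
      blowupSyndrome B s)
    (hj : ∀ j ≤ i, (blowupH B).mulVec (msEstimate (blowupH B) (blowupSyndrome B s) j) =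
      blowupSyndrome B s → ∃ e', changeVars B e' = msEstimate (blowupH B) (blowupSyndrome B s) j ∧
        hammingNorm e' ≤ 3) : SBMSCorrects e := by
  classical
  have hL : 1 < L := by have := seven_le_of_distance hd; omega
  subst hs
  have hex : ∃ i, (blowupH B).mulVec (msEstimate (blowupH B)
      (blowupSyndrome B ((toricH L).mulVec e)) i) = blowupSyndrome B ((toricH L).mulVec e) := ⟨i, hi⟩
  obtain ⟨e₁, h₁, hw₁⟩ := hj (Nat.find hex) (Nat.find_min' hex hi) (Nat.find_spec hex)
  have hout : ∀ e', SBMSOutput ((toricH L).mulVec e) e' ↔ changeVars B e₁ = changeVars B e' := by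
    intro e'
    rw [SBMSOutput, hBs, msDecoder, dif_pos hex, Option.some_inj, h₁]
  refine ⟨⟨e₁, (hout _).2 rfl⟩, fun e' h' => ?_⟩
  rw [hout] at h'
  have hsyn : (toricH L).mulVec e₁ = (toricH L).mulVec e := by
    funext c
    have hc := congrFun (Nat.find_spec hex) (Sum.inl c)
    rw [← h₁, blowupH_mulVec_changeVars hL hB] at hc
    exact hc
  have ha : e' - e₁ ∈ stabilizers L :=
    mem_stabilizers_of_changeVars hL hB (by rw [changeVars_sub, h', sub_self])
  -- A cycle of weight at most `3 + 3`, less than the distance.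
  have hb : e₁ - e ∈ stabilizers L := by
    apply mem_stabilizers_of_norm_le hd
    · rw [Matrix.mulVec_sub, hsyn, sub_self]
    · have := hammingDist_triangle e₁ 0 e
      rw [hammingDist_zero_right, hammingDist_zero_left] at this
      have h6 : hammingDist e e₁ ≤ 6 := by rw [hammingDist_comm]; omega
      rwa [hammingDist_eq_hammingNorm, neg_add_eq_sub] at h6
  simpa using add_mem ha hb

end Basics


/-! ### Min-sum messages between the slots of sites and plaquettes -/

/-- The message combined from the values `f i`, `i ∈ J`, with sign `σ`. -/
def combine {ι : Type} (σ : ℤ) (J : Finset ι) (f : ι → ℤ) : ℤ :=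
  σ * (∏ i ∈ J, (f i).sign) * if h : J.Nonempty then J.inf' h fun i => |f i| else 0

theorem combine_congr {ι : Type} {σ : ℤ} {J : Finset ι} {f f' : ι → ℤ} (h : ∀ i ∈ J, f i = f' i) :
    combine σ J f = combine σ J f' := by
  unfold combine
  rw [Finset.prod_congr rfl fun i hi => by rw [h i hi]]
  split_ifs with hJ
  · congr 1
    exact Finset.inf'_congr _ rfl fun i hi => by rw [h i hi]
  · rfl

theorem combine_image {ι κ : Type} [DecidableEq κ] {σ : ℤ} {J : Finset ι} {g : ι → κ}
    (hg : Set.InjOn g J) (f : κ → ℤ) : combine σ (J.image g) f = combine σ J (f ∘ g) := by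
  unfold combine
  rw [Finset.prod_image hg]
  by_cases hJ : J.Nonempty
  · rw [dif_pos hJ, dif_pos (hJ.image g), Finset.inf'_image]
    rfl
  · rw [dif_neg hJ, dif_neg (by simpa using hJ)]
    rfl

section Slots

variable {L : ℕ} (B : Finset (Site L)) (s : Site L → ZMod 2)

/-- Whether `p` is blown up. -/
def inB (p : Site L) : Bool := decide (p ∈ B)

/-- Whether a check is unsatisfied. -/
def uns (x : Site L) : Bool := decide (s x = 1)

variable {B} in
@[simp] theorem inB_eq_true {p : Site L} : inB B p = true ↔ p ∈ B := by simp [inB]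

variable {B} in
@[simp] theorem inB_eq_false {p : Site L} : inB B p = false ↔ p ∉ B := by simp [inB]

variable {s} in
@[simp] theorem uns_eq_true {x : Site L} : uns s x = true ↔ s x = 1 := by simp [uns]

/-- There is an edge in slot `j` of the site `x`: slots `0`, …, `3` are for the old edges to the
right, downwards, to the left, and upwards; slot `4 + k` is for the new edge to the middle of the
plaquette whose corner `k` is `x`. -/
def slotUsed (x : Site L) (j : ℕ) : Bool :=
  if j < 4 then kept (torusGrid L) boolLogic (inB B) j x else inB B ((torusGrid L).uncor (j - 4) x)

def slots (x : Site L) : Finset ℕ := (Finset.range 8).filter fun j => slotUsed B x j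

/-- Messages sent from the slots of sites and from the slots (corners) of plaquettes. -/
structure Messages (L : ℕ) where
  site : Site L → ℕ → ℤ
  mid : Site L → ℕ → ℤ

variable {B s}

/-- Every edge has two ends, so the message from an edge to one end is `1` plus the message that it
gets from the other end. This is why only the messages of checks are stored, and why they start at
`0`. -/
def Messages.siteIn (μ : Messages L) (x : Site L) (j : ℕ) : ℤ :=
  if j < 4 then μ.site ((torusGrid L).step j x) ((j + 2) % 4)
  else μ.mid ((torusGrid L).uncor (j - 4) x) (j - 4)

def Messages.midIn (μ : Messages L) (p : Site L) (k : ℕ) : ℤ :=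
  μ.site ((torusGrid L).cor k p) (4 + k)

variable (B s)

def Messages.next (μ : Messages L) : Messages L where
  site x j := combine (if s x = 1 then -1 else 1) ((slots B x).erase j) fun i => 1 + μ.siteIn x i
  mid p k := combine 1 ((Finset.range 4).erase k) fun i => 1 + μ.midIn p i

/-- The messages after `i` iterations. -/
def messages : ℕ → Messages L
  | 0 => ⟨fun _ _ => 0, fun _ _ => 0⟩
  | i + 1 => (messages i).next B s

/-- The estimate of the edge in slot `j` of `x`. -/
def siteEst (i : ℕ) (x : Site L) (j : ℕ) : ZMod 2 :=
  if 1 + (messages B s i).site x j + (messages B s i).siteIn x j < 0 then 1 else 0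

variable {B}

/-- The slot of an edge at the site `x`. -/
def slotAt (x : Site L) : BlowupEdge B → ℕ
  | Sum.inl q => if q.1 = Sum.inl x then 0 else if q.1 = Sum.inr x then 1 else
      if q.1 = Sum.inl (x.1, x.2 - 1) then 2 else 3
  | Sum.inr (_, k) => 4 + k.1

/-- The slot of a new edge at the middle of its plaquette. -/
def slotMid : BlowupEdge B → ℕ
  | Sum.inl _ => 0
  | Sum.inr (_, k) => k.1

theorem side_ne_inl_iff (x : Site L) :
    (∀ p ∈ B, ∀ k, side p k ≠ Sum.inl x) ↔ x ∉ B ∧ (x.1 - 1, x.2) ∉ B := by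
  constructor
  · exact fun h => ⟨fun hx => h x hx 0 rfl, fun hx => h _ hx 2 (by simp [side])⟩
  · rintro ⟨h₁, h₂⟩ p hp k hk
    fin_cases k
    · simp [side] at hk; exact h₁ (hk ▸ hp)
    · simp [side] at hk
    · simp [side] at hk; subst hk; exact h₂ (by simpa using hp)
    · simp [side] at hk

theorem side_ne_inr_iff (x : Site L) :
    (∀ p ∈ B, ∀ k, side p k ≠ Sum.inr x) ↔ x ∉ B ∧ (x.1, x.2 - 1) ∉ B := by
  constructor
  · exact fun h => ⟨fun hx => h x hx 3 rfl, fun hx => h _ hx 1 (by simp [side])⟩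
  · rintro ⟨h₁, h₂⟩ p hp k hk
    fin_cases k
    · simp [side] at hk
    · simp [side] at hk; subst hk; exact h₂ (by simpa using hp)
    · simp [side] at hk
    · simp [side] at hk; exact h₁ (hk ▸ hp)

/-- The qubit in slot `j` of `x`. -/
def qubitAt (x : Site L) (j : ℕ) : Qubit L :=
  match j with
  | 0 => Sum.inl x
  | 1 => Sum.inr x
  | 2 => Sum.inl (x.1, x.2 - 1)
  | _ => Sum.inr (x.1 - 1, x.2)

theorem side_ne_qubitAt_iff (x : Site L) {j : ℕ} (hj : j < 4) :
    (∀ p ∈ B, ∀ k, side p k ≠ qubitAt x j) ↔ slotUsed B x j := by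
  interval_cases j <;>
    simp only [qubitAt, side_ne_inl_iff, side_ne_inr_iff, slotUsed, kept, boolLogic,
      Logic.nor, torusGrid] <;> simp

theorem toricH_ne_zero_iff (hL : 1 < L) (x : Site L) (q : Qubit L) :
    toricH L x q ≠ 0 ↔ ∃ j < 4, q = qubitAt x j := by
  have h1 := one_ne_zero_of_lt hL
  have : (∃ j < 4, q = qubitAt x j) ↔ (endpoints q).1 = x ∨ (endpoints q).2 = x := by
    constructor
    · rintro ⟨j, hj, rfl⟩
      interval_cases j <;> simp [qubitAt, endpoints]
    · rcases q with q | q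
      · rintro (rfl | rfl)
        · exact ⟨0, by norm_num, rfl⟩
        · exact ⟨2, by norm_num, by simp [qubitAt, endpoints]⟩
      · rintro (rfl | rfl)
        · exact ⟨1, by norm_num, rfl⟩
        · exact ⟨3, by norm_num, by simp [qubitAt, endpoints]⟩
  rw [this, toricH]
  by_cases ha : (endpoints q).1 = x <;> by_cases hb : (endpoints q).2 = x
  · exfalso
    rw [← ha] at hb
    rcases q with q | q <;> simp [endpoints, Prod.ext_iff, h1] at hb
  all_goals simp [ha, hb]

theorem slotAt_qubitAt (hL : 1 < L) (x : Site L) {j : ℕ} (hj : j < 4) (q) (hq : q.1 = qubitAt x j) :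
    slotAt x (Sum.inl q : BlowupEdge B) = j := by
  have h1 := one_ne_zero_of_lt hL
  interval_cases j <;> simp [slotAt, hq, qubitAt, Prod.ext_iff, h1]

theorem corner_eq_cor (p : Site L) (k : Fin 4) : corner p k = (torusGrid L).cor k p := by
  fin_cases k <;> rfl

theorem cor_uncor (x : Site L) {k : ℕ} (hk : k < 4) :
    (torusGrid L).cor k ((torusGrid L).uncor k x) = x := by
  interval_cases k <;> simp [Grid.cor, Grid.uncor, torusGrid]

theorem uncor_cor (x : Site L) {k : ℕ} (hk : k < 4) :
    (torusGrid L).uncor k ((torusGrid L).cor k x) = x := by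
  interval_cases k <;> simp [Grid.cor, Grid.uncor, torusGrid]

theorem cor_eq_iff (p x : Site L) {k : ℕ} (hk : k < 4) :
    (torusGrid L).cor k p = x ↔ p = (torusGrid L).uncor k x :=
  ⟨fun h => by rw [← h, uncor_cor _ hk], fun h => by rw [h, cor_uncor _ hk]⟩

theorem mem_slots {x : Site L} {j : ℕ} : j ∈ slots B x ↔ j < 8 ∧ slotUsed B x j := by
  simp [slots]

variable [NeZero L]

theorem mem_varsOf_site (hL : 1 < L) {x : Site L} {v : BlowupEdge B} :
    v ∈ varsOf (blowupH B) (Sum.inl x) ↔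
      (∃ q, v = Sum.inl q ∧ ∃ j < 4, q.1 = qubitAt x j) ∨
      ∃ p k, v = Sum.inr (p, k) ∧ p.1 = (torusGrid L).uncor k x := by
  rw [varsOf, Finset.mem_filter]
  rcases v with q | ⟨p, k⟩
  · simp only [Finset.mem_univ, true_and, Sum.inl.injEq, exists_eq_left', reduceCtorEq, false_and,
      exists_false, or_false, ← toricH_ne_zero_iff hL]
    rfl
  · simp [blowupH, corner_eq_cor, cor_eq_iff]

theorem mem_varsOf_mid {p : {p : Site L // p ∈ B}} {v : BlowupEdge B} :
    v ∈ varsOf (blowupH B) (Sum.inr p) ↔ ∃ k, v = Sum.inr (p, k) := by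
  rw [varsOf, Finset.mem_filter]
  rcases v with q | ⟨p', k⟩
  · simp [blowupH]
  · simp [blowupH, eq_comm]

/-- Since `1 ≠ 0` modulo `L`, the four old slots hold different qubits, and a new edge at `x` is
determined by its corner. With `image_slotAt`, sums and products over the edges of a check become
sums and products over slots. -/
theorem slotAt_injOn (hL : 1 < L) (x : Site L) :
    Set.InjOn (slotAt x) (varsOf (blowupH B) (Sum.inl x) : Set (BlowupEdge B)) := by
  intro v hv w hw h
  rw [Finset.mem_coe, mem_varsOf_site hL] at hv hw
  rcases hv with ⟨q, rfl, j, hj, hq⟩ | ⟨p, k, rfl, hp⟩ <;>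
  rcases hw with ⟨q', rfl, j', hj', hq'⟩ | ⟨p', k', rfl, hp'⟩
  · rw [slotAt_qubitAt hL x hj _ hq, slotAt_qubitAt hL x hj' _ hq'] at h
    subst h
    rw [Subtype.ext (hq.trans hq'.symm)]
  · rw [slotAt_qubitAt hL x hj _ hq] at h
    simp only [slotAt] at h
    omega
  · rw [slotAt_qubitAt hL x hj' _ hq'] at h
    simp only [slotAt] at h
    omega
  · simp only [slotAt] at h
    have hk : k = k' := Fin.ext (by omega)
    subst hk
    rw [Subtype.ext (hp.trans hp'.symm)]

theorem image_slotAt (hL : 1 < L) (x : Site L) :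
    (varsOf (blowupH B) (Sum.inl x)).image (slotAt x) = slots B x := by
  ext j
  rw [Finset.mem_image, mem_slots]
  constructor
  · rintro ⟨v, hv, rfl⟩
    rcases (mem_varsOf_site hL).1 hv with ⟨q, rfl, j, hj, hq⟩ | ⟨p, k, rfl, hp⟩
    · rw [slotAt_qubitAt hL x hj _ hq, ← side_ne_qubitAt_iff x hj, ← hq]
      exact ⟨by omega, q.2⟩
    · rw [show slotAt x (Sum.inr (p, k) : BlowupEdge B) = 4 + k from rfl]
      refine ⟨by omega, ?_⟩
      rw [slotUsed, if_neg (by omega), Nat.add_sub_cancel_left, ← hp]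
      simp
  · rintro ⟨hj, hu⟩
    by_cases h4 : j < 4
    · have := (side_ne_qubitAt_iff x h4).2 hu
      exact ⟨Sum.inl ⟨_, this⟩, (mem_varsOf_site hL).2 (.inl ⟨_, rfl, j, h4, rfl⟩),
        slotAt_qubitAt hL x h4 _ rfl⟩
    · obtain ⟨k, rfl⟩ : ∃ k : ℕ, j = 4 + k := ⟨j - 4, by omega⟩
      have hk : k < 4 := by omega
      have hp : (torusGrid L).uncor k x ∈ B := by simpa [slotUsed] using hu
      exact ⟨Sum.inr (⟨_, hp⟩, ⟨k, hk⟩), (mem_varsOf_site hL).2 (.inr ⟨_, _, rfl, rfl⟩), rfl⟩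

theorem slotMid_injOn (p : {p : Site L // p ∈ B}) :
    Set.InjOn slotMid (varsOf (blowupH B) (Sum.inr p) : Set (BlowupEdge B)) := by
  intro v hv w hw h
  rw [Finset.mem_coe, mem_varsOf_mid] at hv hw
  obtain ⟨k, rfl⟩ := hv
  obtain ⟨l, rfl⟩ := hw
  rw [show k = l from Fin.ext h]

theorem image_slotMid (p : {p : Site L // p ∈ B}) :
    (varsOf (blowupH B) (Sum.inr p)).image slotMid = Finset.range 4 := by
  ext j
  rw [Finset.mem_image, Finset.mem_range]
  constructor
  · rintro ⟨v, hv, rfl⟩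
    obtain ⟨k, rfl⟩ := mem_varsOf_mid.1 hv
    exact k.2
  · exact fun hj => ⟨Sum.inr (p, ⟨j, hj⟩), mem_varsOf_mid.2 ⟨_, rfl⟩, rfl⟩

end Slots


/-! ### Min-sum on the blown-up graph expressed by messages between slots. -/

section Bridge

variable {L : ℕ} {B : Finset (Site L)} {s : Site L → ZMod 2}

theorem image_erase_of_injOn {ι κ : Type} [DecidableEq ι] [DecidableEq κ] {J : Finset ι}
    {g : ι → κ} (hg : Set.InjOn g J) {v : ι} (hv : v ∈ J) :
    (J.erase v).image g = (J.image g).erase (g v) := by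
  ext k
  simp only [Finset.mem_image, Finset.mem_erase]
  constructor
  · rintro ⟨w, ⟨hne, hw⟩, rfl⟩
    exact ⟨fun h => hne (hg hw hv h), w, hw, rfl⟩
  · rintro ⟨hne, w, hw, rfl⟩
    exact ⟨w, ⟨fun h => hne (h ▸ rfl), hw⟩, rfl⟩

theorem qubitAt_step (x : Site L) {j : ℕ} (hj : j < 4) :
    qubitAt ((torusGrid L).step j x) ((j + 2) % 4) = qubitAt x j := by
  interval_cases j <;> simp [qubitAt, Grid.step, torusGrid]

theorem step_ne (hL : 1 < L) (x : Site L) (j : ℕ) : (torusGrid L).step j x ≠ x := by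
  have h1 := one_ne_zero_of_lt hL
  match j with
  | 0 | 1 | 2 | _ + 3 => simp [Grid.step, torusGrid, Prod.ext_iff, h1]

theorem qubitAt_eq_iff (x y : Site L) {j : ℕ} (hj : j < 4) :
    (∃ i < 4, qubitAt x j = qubitAt y i) ↔ y = x ∨ y = (torusGrid L).step j x := by
  constructor
  · rintro ⟨i, hi, h⟩
    interval_cases j <;> interval_cases i <;>
      simp only [qubitAt, Sum.inl.injEq, Sum.inr.injEq, reduceCtorEq] at h <;>
      simp_all [Grid.step, torusGrid, Prod.ext_iff, eq_sub_iff_add_eq, sub_eq_iff_eq_add]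
  · rintro (rfl | rfl)
    · exact ⟨j, hj, rfl⟩
    · exact ⟨(j + 2) % 4, by omega, (qubitAt_step x hj).symm⟩

variable [NeZero L]

theorem mem_checksOf_iff {v : BlowupEdge B} {c : BlowupCheck B} :
    c ∈ checksOf (blowupH B) v ↔ v ∈ varsOf (blowupH B) c := by
  simp [checksOf, varsOf]

theorem checksOf_old (hL : 1 < L) {x : Site L} {j : ℕ} (hj : j < 4) {q} (hq : q.1 = qubitAt x j) :
    checksOf (blowupH B) (Sum.inl q) = {Sum.inl x, Sum.inl ((torusGrid L).step j x)} := by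
  ext c
  rw [mem_checksOf_iff]
  rcases c with y | p
  · rw [mem_varsOf_site hL]
    simp only [Sum.inl.injEq, exists_eq_left', reduceCtorEq, false_and, exists_false, or_false,
      Finset.mem_insert, Finset.mem_singleton, hq]
    exact qubitAt_eq_iff x y hj
  · rw [mem_varsOf_mid]
    simp

theorem checksOf_new (hL : 1 < L) (p : {p : Site L // p ∈ B}) (k : Fin 4) :
    checksOf (blowupH B) (Sum.inr (p, k)) = {Sum.inl ((torusGrid L).cor k p.1), Sum.inr p} := by
  ext c
  rw [mem_checksOf_iff]
  rcases c with y | p'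
  · rw [mem_varsOf_site hL]
    simp [← cor_eq_iff, eq_comm]
  · rw [mem_varsOf_mid]
    simp [eq_comm]

theorem varsOf_step (hL : 1 < L) {x : Site L} {j : ℕ} (hj : j < 4) {q : {_q // _}}
    (hq : q.1 = qubitAt x j) :
    (Sum.inl q : BlowupEdge B) ∈ varsOf (blowupH B) (Sum.inl ((torusGrid L).step j x)) ∧
      slotAt ((torusGrid L).step j x) (Sum.inl q : BlowupEdge B) = (j + 2) % 4 := by
  have h := hq.trans (qubitAt_step x hj).symm
  have h4 : (j + 2) % 4 < 4 := Nat.mod_lt _ (by norm_num)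
  exact ⟨(mem_varsOf_site hL).2 (.inl ⟨_, rfl, _, h4, h⟩), slotAt_qubitAt hL _ h4 _ h⟩

/-- The product and the minimum over the other edges of a check are carried over along the bijection
of edges with slots. -/
theorem checkMsg_of_varMsg (hL : 1 < L) (α : BlowupEdge B → BlowupCheck B → ℤ) (μ : Messages L)
    (hs : ∀ x, ∀ v ∈ varsOf (blowupH B) (Sum.inl x),
      α v (Sum.inl x) = 1 + μ.siteIn x (slotAt x v))
    (hm : ∀ p, ∀ v ∈ varsOf (blowupH B) (Sum.inr p),
      α v (Sum.inr p) = 1 + μ.midIn p.1 (slotMid v)) :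
    (∀ x, ∀ v ∈ varsOf (blowupH B) (Sum.inl x),
      checkMsg (blowupH B) (blowupSyndrome B s) α (Sum.inl x) v =
        (μ.next B s).site x (slotAt x v)) ∧
    ∀ p, ∀ v ∈ varsOf (blowupH B) (Sum.inr p),
      checkMsg (blowupH B) (blowupSyndrome B s) α (Sum.inr p) v =
        (μ.next B s).mid p.1 (slotMid v) := by
  constructor
  · intro x v hv
    have hJ := image_erase_of_injOn (slotAt_injOn hL x) hv
    rw [image_slotAt hL] at hJ
    change combine _ _ _ = combine _ _ _
    rw [← hJ, combine_image ((slotAt_injOn hL x).mono (by simp))]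
    exact combine_congr fun w hw => hs x w (Finset.mem_of_mem_erase hw)
  · intro p v hv
    have hJ := image_erase_of_injOn (slotMid_injOn p) hv
    rw [image_slotMid] at hJ
    change combine _ _ _ = combine _ _ _
    rw [← hJ, combine_image ((slotMid_injOn p).mono (by simp))]
    exact combine_congr fun w hw => hm p w (Finset.mem_of_mem_erase hw)

theorem siteIn_new (μ : Messages L) (x : Site L) (k : ℕ) :
    μ.siteIn x (4 + k) = μ.mid ((torusGrid L).uncor k x) k := by
  rw [Messages.siteIn, if_neg (by omega), Nat.add_sub_cancel_left]

/-- By induction: as a variable takes part in two checks only, the sum over the other checks has a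
single term. -/
theorem varMsg_eq (hL : 1 < L) (i : ℕ) :
    (∀ x, ∀ v ∈ varsOf (blowupH B) (Sum.inl x),
      varMsg (blowupH B) (blowupSyndrome B s) i v (Sum.inl x) =
        1 + (messages B s i).siteIn x (slotAt x v)) ∧
    ∀ p, ∀ v ∈ varsOf (blowupH B) (Sum.inr p),
      varMsg (blowupH B) (blowupSyndrome B s) i v (Sum.inr p) =
        1 + (messages B s i).midIn p.1 (slotMid v) := by
  induction i with
  | zero => simp [varMsg, messages, Messages.siteIn, Messages.midIn]
  | succ i ih =>
    obtain ⟨hs, hm⟩ := checkMsg_of_varMsg (s := s) hL _ _ ih.1 ih.2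
    constructor
    · intro x v hv
      rw [varMsg]
      beta_reduce
      rcases (mem_varsOf_site hL).1 hv with ⟨q, rfl, j, hj, hq⟩ | ⟨p, k, rfl, hp⟩
      · obtain ⟨hv', hslot⟩ := varsOf_step hL hj hq
        rw [checksOf_old hL hj hq, Finset.erase_insert, Finset.sum_singleton, hs _ _ hv', hslot,
          slotAt_qubitAt hL x hj _ hq, Messages.siteIn, if_pos hj]
        · rfl
        · simpa using (step_ne hL x j).symm
      · have hc : (torusGrid L).cor k p.1 = x := (cor_eq_iff _ _ k.2).2 hp
        rw [checksOf_new hL, hc, Finset.erase_insert (by simp), Finset.sum_singleton,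
          hm p _ (mem_varsOf_mid.2 ⟨k, rfl⟩), hp]
        exact congrArg _ (siteIn_new _ x k).symm
    · intro p v hv
      rw [varMsg]
      beta_reduce
      obtain ⟨k, rfl⟩ := mem_varsOf_mid.1 hv
      rw [checksOf_new hL, Finset.erase_insert_of_ne (by simp), Finset.erase_singleton,
        insert_empty_eq, Finset.sum_singleton, hs _ _ ((mem_varsOf_site hL).2
          (.inr ⟨p, k, rfl, (uncor_cor _ k.2).symm⟩))]
      rfl

theorem app_eq (hL : 1 < L) (i : ℕ) {x : Site L} {v : BlowupEdge B}
    (hv : v ∈ varsOf (blowupH B) (Sum.inl x)) :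
    app (blowupH B) (blowupSyndrome B s) i v =
      1 + (messages B s i).site x (slotAt x v) + (messages B s i).siteIn x (slotAt x v) := by
  cases i with
  | zero => simp [app, messages, Messages.siteIn]
  | succ i =>
    obtain ⟨hs, -⟩ := checkMsg_of_varMsg (s := s) hL _ _ (varMsg_eq (s := s) (B := B) hL i).1
      (varMsg_eq (s := s) (B := B) hL i).2
    have h := (varMsg_eq (s := s) (B := B) hL (i + 1)).1 x v hv
    rw [varMsg] at h
    beta_reduce at h
    have hc : Sum.inl x ∈ checksOf (blowupH B) v := mem_checksOf_iff.2 hv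
    rw [app]
    beta_reduce
    -- The a posteriori value is the message from `v` to `x`, known from `varMsg_eq`, plus the
    -- message from `x` to `v`.
    rw [← Finset.add_sum_erase _ _ hc, hs x v hv]
    simp only [messages] at h ⊢
    linarith

theorem msEstimate_eq (hL : 1 < L) (i : ℕ) {x : Site L} {v : BlowupEdge B}
    (hv : v ∈ varsOf (blowupH B) (Sum.inl x)) :
    msEstimate (blowupH B) (blowupSyndrome B s) i v = siteEst B s i x (slotAt x v) := by
  rw [msEstimate, app_eq hL i hv]
  rfl

theorem msEstimate_old (hL : 1 < L) (i : ℕ) {x : Site L} {j : ℕ} (hj : j < 4) {q : {_q // _}}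
    (hq : q.1 = qubitAt x j) :
    msEstimate (blowupH B) (blowupSyndrome B s) i (Sum.inl q) = siteEst B s i x j := by
  rw [msEstimate_eq hL i ((mem_varsOf_site hL).2 (.inl ⟨_, rfl, j, hj, hq⟩)),
    slotAt_qubitAt hL x hj _ hq]

theorem msEstimate_new (hL : 1 < L) (i : ℕ) {x : Site L} {p : {p : Site L // p ∈ B}} {k : Fin 4}
    (hp : p.1 = (torusGrid L).uncor k x) :
    msEstimate (blowupH B) (blowupSyndrome B s) i (Sum.inr (p, k)) = siteEst B s i x (4 + k) :=
  msEstimate_eq hL i ((mem_varsOf_site hL).2 (.inr ⟨_, _, rfl, hp⟩))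

theorem blowupH_mulVec_eq_sum {c : BlowupCheck B} (x : BlowupEdge B → ZMod 2) :
    (blowupH B).mulVec x c = ∑ v ∈ varsOf (blowupH B) c, x v := by
  rw [Matrix.mulVec, dotProduct, varsOf, Finset.sum_filter]
  refine Finset.sum_congr rfl fun v _ => ?_
  split_ifs with h
  · have h1 : blowupH B c v = (1 : ZMod 2) := Fin.eq_one_of_ne_zero _ h
    rw [h1, one_mul]
  · rw [not_not.1 h, zero_mul]

theorem mulVec_msEstimate_site (hL : 1 < L) (i : ℕ) (x : Site L) :
    (blowupH B).mulVec (msEstimate (blowupH B) (blowupSyndrome B s) i) (Sum.inl x) =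
      ∑ j ∈ slots B x, siteEst B s i x j := by
  rw [blowupH_mulVec_eq_sum, ← image_slotAt hL, Finset.sum_image (slotAt_injOn hL x)]
  exact Finset.sum_congr rfl fun v hv => msEstimate_eq hL i hv

theorem mulVec_msEstimate_mid (hL : 1 < L) (i : ℕ) (p : {p : Site L // p ∈ B}) :
    (blowupH B).mulVec (msEstimate (blowupH B) (blowupSyndrome B s) i) (Sum.inr p) =
      ∑ k ∈ Finset.range 4, siteEst B s i ((torusGrid L).cor k p.1) (4 + k) := by
  rw [blowupH_mulVec_mid, Finset.sum_range]
  exact Finset.sum_congr rfl fun k _ => msEstimate_new hL i (uncor_cor _ k.2).symm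

end Bridge


/-! ### The set of blown-up plaquettes -/

section Greedy

variable {L : ℕ}

theorem uns_eq_false {s : Site L → ZMod 2} {x : Site L} : uns s x = false ↔ s x = 0 := by
  rw [uns]
  generalize s x = a
  revert a
  decide

theorem add_eq_zero_iff_uns {s : Site L → ZMod 2} (a b c d : Site L) :
    s a + s b + s c + s d = 0 ↔ xor (xor (uns s a) (uns s b)) (xor (uns s c) (uns s d)) = false := by
  simp only [uns]
  generalize s a = a
  generalize s b = b
  generalize s c = c
  generalize s d = d
  revert a b c d
  decide

theorem patA_iff (s : Site L → ZMod 2) (p : Site L) :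
    patA (torusGrid L) boolLogic (uns s) p = true ↔ pattern₁ s p := by
  simp only [patA, torusGrid, pattern₁, nbr, add_assoc, one_add_one_eq_two, Prod.mk.eta,
    boolLogic, Logic.conj4, Logic.sum4, ← uns_eq_true, ← uns_eq_false]
  simp only [← add_assoc, add_eq_zero_iff_uns]
  generalize xor (xor (uns s (p.1 - 1, p.2 + 1)) _) _ = t
  generalize uns s p = a₁
  generalize uns s (p.1, p.2 + 1) = a₂
  generalize uns s (p.1 + 1, p.2 + 1) = a₃
  generalize uns s (p.1 + 1, p.2) = a₄
  generalize uns s (p.1, p.2 - 1) = a₆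
  generalize uns s (p.1 - 1, p.2) = a₈
  generalize uns s (p.1 + 1, p.2 + 2) = a₁₂
  generalize uns s (p.1 + 2, p.2 + 1) = a₁₄
  cases a₁ <;> cases a₂ <;> cases a₃ <;> cases a₄ <;> simp

theorem patB_iff (s : Site L → ZMod 2) (p : Site L) :
    patB (torusGrid L) boolLogic (uns s) p = true ↔ pattern₂ s p := by
  simp only [patB, torusGrid, pattern₂, nbr, Prod.mk.eta, boolLogic, Logic.conj4, ← uns_eq_true,
    ← uns_eq_false]
  generalize uns s p = a₁
  generalize uns s (p.1, p.2 + 1) = a₂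
  generalize uns s (p.1 + 1, p.2 + 1) = a₃
  generalize uns s (p.1 + 1, p.2) = a₄
  revert a₁ a₂ a₃ a₄
  decide

theorem patC_iff (s : Site L → ZMod 2) (p : Site L) :
    patC (torusGrid L) boolLogic (uns s) p = true ↔ pattern₃ s p := by
  simp only [patC, torusGrid, pattern₃, nbr, add_assoc, one_add_one_eq_two, Prod.mk.eta,
    boolLogic, Logic.disj4, ← uns_eq_true, ← uns_eq_false]
  generalize uns s p = a₁
  generalize uns s (p.1, p.2 + 1) = a₂
  generalize uns s (p.1 + 1, p.2 + 1) = a₃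
  generalize uns s (p.1 + 1, p.2) = a₄
  generalize uns s (p.1, p.2 + 2) = a₁₁
  generalize uns s (p.1 + 2, p.2) = a₁₅
  generalize uns s (p.1 + 1, p.2 + 2) = a₁₂
  generalize uns s (p.1 + 2, p.2 + 1) = a₁₄
  cases a₁ <;> cases a₂ <;> cases a₃ <;> cases a₄ <;> simp [and_comm]

theorem Adjacent.symm {p p' : Site L} (h : Adjacent p p') : Adjacent p' p :=
  ⟨h.1.symm, h.2.choose_spec.choose, h.2.choose, h.2.choose_spec.choose_spec.symm⟩

theorem adjacent_iff (hL : 1 < L) (p p' : Site L) : Adjacent p p' ↔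
    p' = (torusGrid L).rt p ∨ p' = (torusGrid L).dn p ∨ p' = (torusGrid L).lf p ∨
      p' = (torusGrid L).up p := by
  have h1 := one_ne_zero_of_lt hL
  constructor
  · rintro ⟨hn, k, k', h⟩
    obtain ⟨a, b⟩ := p
    obtain ⟨a', b'⟩ := p'
    fin_cases k <;> fin_cases k' <;> simp [side] at h <;> simp [torusGrid] at hn ⊢ <;> grind
  · have h2 : ∀ a : ZMod L, ¬a = a - 1 := fun a h => h1 (by linear_combination h)
    rintro (rfl | rfl | rfl | rfl)
    · exact ⟨by simp [torusGrid, Prod.ext_iff, h1], 1, 3, by simp [side, torusGrid]⟩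
    · exact ⟨by simp [torusGrid, Prod.ext_iff, h1], 2, 0, by simp [side, torusGrid]⟩
    · exact ⟨by simp [torusGrid, Prod.ext_iff, h2], 3, 1, by simp [side, torusGrid]⟩
    · exact ⟨by simp [torusGrid, Prod.ext_iff, h2], 0, 2, by simp [side, torusGrid]⟩

theorem adjSome_iff (hL : 1 < L) (P : Site L → Bool) (p : Site L) :
    adjSome (torusGrid L) boolLogic P p = true ↔ ∃ p', Adjacent p p' ∧ P p' = true := by
  simp only [adjSome, Logic.disj4, boolLogic, Bool.or_eq_true, adjacent_iff hL]
  constructor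
  · rintro ((h | h) | (h | h))
    exacts [⟨_, .inl rfl, h⟩, ⟨_, .inr (.inl rfl), h⟩, ⟨_, .inr (.inr (.inl rfl)), h⟩,
      ⟨_, .inr (.inr (.inr rfl)), h⟩]
  · rintro ⟨p', rfl | rfl | rfl | rfl, h⟩ <;> simp [h]

theorem mem_plaquetteList [NeZero L] (p : Site L) : p ∈ plaquetteList L := by
  have h : ∀ a : ZMod L, ∃ n < L, a = (n : ZMod L) := fun a => ⟨a.val, a.val_lt, by simp⟩
  simpa [plaquetteList, Prod.ext_iff] using ⟨h p.1, h p.2⟩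

/-- The properties of a pass that do not depend on the order of the plaquettes. The last one holds
because a match is rejected only on account of a neighbour, and nothing is removed later. -/
theorem foldl_greedy (P : Site L → Prop) [DecidablePred P] (l : List (Site L))
    {B : Finset (Site L)} (hB : Independent B) :
    let B' := l.foldl (fun B p => if P p ∧ ∀ p' ∈ B, ¬ Adjacent p p' then insert p B else B) B
    Independent B' ∧ B ⊆ B' ∧ (∀ p ∈ B', p ∈ B ∨ P p) ∧
      ∀ p ∈ l, P p → p ∈ B' ∨ ∃ p' ∈ B', Adjacent p p' := by
  induction l generalizing B with
  | nil => exact ⟨hB, subset_rfl, fun p hp => .inl hp, by simp⟩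
  | cons a l ih =>
    simp only [List.foldl_cons]
    by_cases ha : P a ∧ ∀ p' ∈ B, ¬ Adjacent a p'
    · rw [if_pos ha]
      have hB' : Independent (insert a B) := by
        intro p hp p' hp'
        rw [Finset.mem_insert] at hp hp'
        rcases hp with rfl | hp <;> rcases hp' with rfl | hp'
        · exact fun h => h.1 rfl
        · exact ha.2 _ hp'
        · exact fun h => ha.2 _ hp h.symm
        · exact hB _ hp _ hp'
      obtain ⟨h₁, h₂, h₃, h₄⟩ := ih hB'
      refine ⟨h₁, (Finset.subset_insert _ _).trans h₂, fun p hp => ?_, fun p hp hP => ?_⟩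
      · rcases h₃ p hp with h | h
        · rcases Finset.mem_insert.1 h with rfl | h
          exacts [.inr ha.1, .inl h]
        · exact .inr h
      · rcases List.mem_cons.1 hp with rfl | hp
        · exact .inl (h₂ (Finset.mem_insert_self _ _))
        · exact h₄ p hp hP
    · rw [if_neg ha]
      obtain ⟨h₁, h₂, h₃, h₄⟩ := ih hB
      refine ⟨h₁, h₂, h₃, fun p hp hP => ?_⟩
      rcases List.mem_cons.1 hp with rfl | hp
      · have : ∃ p' ∈ B, Adjacent p p' := by
          by_contra hn
          exact ha ⟨hP, fun p' hp' h => hn ⟨p', hp', h⟩⟩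
        obtain ⟨p', hp', h⟩ := this
        exact .inr ⟨p', h₂ hp', h⟩
      · exact h₄ p hp hP

theorem greedyPass_spec [NeZero L] (P : Site L → Prop) [DecidablePred P] {B : Finset (Site L)}
    (hB : Independent B) : Independent (greedyPass P B) ∧ B ⊆ greedyPass P B ∧
      (∀ p ∈ greedyPass P B, p ∈ B ∨ P p) ∧
      ∀ p, P p → p ∈ greedyPass P B ∨ ∃ p' ∈ greedyPass P B, Adjacent p p' := by
  obtain ⟨h₁, h₂, h₃, h₄⟩ := foldl_greedy P (plaquetteList L) hB
  exact ⟨h₁, h₂, h₃, fun p => h₄ p (mem_plaquetteList p)⟩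

theorem boolLogic_conj (a b : Bool) : boolLogic.conj a b = (a && b) := rfl
theorem boolLogic_disj (a b : Bool) : boolLogic.disj a b = (a || b) := rfl
theorem boolLogic_sum (a b : Bool) : boolLogic.sum a b = xor a b := rfl
theorem boolLogic_neg (a : Bool) : boolLogic.neg a = !a := rfl

theorem invalid_eq_false_iff (hL : 1 < L) (P Q R B : Site L → Bool) (p : Site L) :
    invalid (torusGrid L) boolLogic P Q R B p = false ↔
      (B p = true → (¬∃ p', Adjacent p p' ∧ B p' = true) ∧
        (P p = true ∨ Q p = true ∨ R p = true)) ∧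
      (P p = true → B p = true ∨ ∃ p', Adjacent p p' ∧ (B p' && P p') = true) ∧
      (Q p = true → B p = true ∨ ∃ p', Adjacent p p' ∧ (B p' && (P p' || Q p')) = true) ∧
      (R p = true → B p = true ∨ ∃ p', Adjacent p p' ∧ B p' = true) := by
  simp only [← adjSome_iff hL, invalid, Logic.disj4, Logic.diff, boolLogic_conj, boolLogic_disj,
    boolLogic_neg]
  generalize adjSome _ _ _ p = a₁
  generalize adjSome _ _ _ p = a₂
  generalize adjSome _ _ _ p = a₃
  cases a₁ <;> cases a₂ <;> cases a₃ <;> cases B p <;> cases P p <;> cases Q p <;> cases R p <;>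
    simp

/-- All that is used about the greedy set. A match rejected in some pass is blocked by a plaquette
from that pass or an earlier one, and this plaquette remains in the final set. -/
theorem blowupSet_spec [NeZero L] (hL : 1 < L) (s : Site L → ZMod 2) :
    Independent (blowupSet s) ∧ ∀ p, invalid (torusGrid L) boolLogic
      (patA (torusGrid L) boolLogic (uns s)) (patB (torusGrid L) boolLogic (uns s))
      (patC (torusGrid L) boolLogic (uns s)) (inB (blowupSet s)) p = false := by
  obtain ⟨a₁, -, a₃, a₄⟩ := greedyPass_spec (L := L) (pattern₁ s) (B := ∅) (by simp [Independent])
  obtain ⟨b₁, b₂, b₃, b₄⟩ := greedyPass_spec (pattern₂ s) a₁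
  obtain ⟨c₁, c₂, c₃, c₄⟩ := greedyPass_spec (pattern₃ s) b₁
  change Independent (blowupSet s) at c₁
  change _ ⊆ blowupSet s at c₂
  change ∀ p ∈ blowupSet s, _ at c₃
  change ∀ p, _ → p ∈ blowupSet s ∨ ∃ p' ∈ blowupSet s, _ at c₄
  refine ⟨c₁, fun p => ?_⟩
  rw [invalid_eq_false_iff hL]
  simp only [Bool.and_eq_true, Bool.or_eq_true, inB_eq_true]
  refine ⟨?_, ?_, ?_, ?_⟩
  · intro hp
    refine ⟨?_, ?_⟩
    · rintro ⟨p', h, hp'⟩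
      exact c₁ p hp p' hp' h
    · rw [patA_iff, patB_iff, patC_iff]
      rcases c₃ p hp with h | h
      · rcases b₃ p h with h | h
        · rcases a₃ p h with h | h
          · simp at h
          · exact .inl h
        · exact .inr (.inl h)
      · exact .inr (.inr h)
  · intro hP
    rcases a₄ p ((patA_iff s p).1 hP) with h | ⟨p', hp', h⟩
    · exact .inl (c₂ (b₂ h))
    · refine .inr ⟨p', h, c₂ (b₂ hp'), (patA_iff s p').2 ?_⟩
      simpa using a₃ p' hp'
  · intro hP
    rcases b₄ p ((patB_iff s p).1 hP) with h | ⟨p', hp', h⟩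
    · exact .inl (c₂ h)
    · refine .inr ⟨p', h, c₂ hp', ?_⟩
      rw [patA_iff, patB_iff]
      rcases b₃ p' hp' with h | h
      · exact .inl (by simpa using a₃ p' h)
      · exact .inr h
  · intro hP
    rcases c₄ p ((patC_iff s p).1 hP) with h | ⟨p', hp', h⟩
    · exact .inl h
    · exact .inr ⟨p', h, hp'⟩

end Greedy


/-! ### The greedy set in the absence of conflicts. -/

section Blown

variable {L : ℕ}

theorem not_both_of_adjacent (hL : 1 < L) {P : Site L → Prop}
    (h : ∀ p, P p → ¬P ((torusGrid L).rt p) ∧ ¬P ((torusGrid L).dn p)) {p p' : Site L}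
    (ha : Adjacent p p') (hp : P p) : ¬P p' := by
  intro hp'
  rcases (adjacent_iff hL p p').1 ha with rfl | rfl | rfl | rfl
  · exact (h p hp).1 hp'
  · exact (h p hp).2 hp'
  · exact (h _ hp').1 (by simpa [torusGrid] using hp)
  · exact (h _ hp').2 (by simpa [torusGrid] using hp)

/-- Without conflicts, the blown-up plaquettes are given by a formula. -/
theorem eq_blown (hL : 1 < L) {P Q R B : Site L → Bool}
    (hi : ∀ p, invalid (torusGrid L) boolLogic P Q R B p = false)
    (hc : ∀ p, conflict (torusGrid L) boolLogic P Q R p = false) :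
    B = blown (torusGrid L) boolLogic P Q R := by
  let aP : Site L → Prop := fun p => ∃ p', Adjacent p p' ∧ P p' = true
  let aQ : Site L → Prop := fun p => ∃ p', Adjacent p p' ∧ Q p' = true
  let q : Site L → Prop := fun p => Q p = true ∧ P p = false ∧ ¬aP p
  let r : Site L → Prop := fun p => R p = true ∧ P p = false ∧ Q p = false ∧ ¬aP p ∧ ¬aQ p
  have haP : ∀ p, adjSome (torusGrid L) boolLogic P p = true ↔ aP p := adjSome_iff hL P
  have haQ : ∀ p, adjSome (torusGrid L) boolLogic Q p = true ↔ aQ p := adjSome_iff hL Q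
  have hq : ∀ p, (boolLogic.diff (Q p) (boolLogic.disj (P p)
      (adjSome (torusGrid L) boolLogic P p))) = true ↔ q p := by
    intro p
    simp only [Logic.diff, boolLogic_conj, boolLogic_neg, boolLogic_disj, Bool.and_eq_true,
      Bool.not_eq_true', Bool.or_eq_false_iff, q, ← haP, Bool.not_eq_true]
  have hr : ∀ p, (boolLogic.diff (R p) (boolLogic.disj4 (P p) (Q p)
      (adjSome (torusGrid L) boolLogic P p) (adjSome (torusGrid L) boolLogic Q p))) = true ↔
      r p := by
    intro p
    simp only [Logic.diff, Logic.disj4, boolLogic_conj, boolLogic_neg, boolLogic_disj,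
      Bool.and_eq_true, Bool.not_eq_true', Bool.or_eq_false_iff, r, ← haP, ← haQ,
      Bool.not_eq_true, and_assoc]
  have hc' : ∀ p, (P p = true → ¬P ((torusGrid L).rt p) = true ∧ ¬P ((torusGrid L).dn p) = true) ∧
      (q p → ¬q ((torusGrid L).rt p) ∧ ¬q ((torusGrid L).dn p)) ∧
      (r p → ¬r ((torusGrid L).rt p) ∧ ¬r ((torusGrid L).dn p)) ∧
      (R p = true → P p = false → Q p = false → ¬aP p →
        ¬∃ p', Adjacent p p' ∧ Q p' = true ∧ aP p') := by
    intro p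
    have h4 : adjSome (torusGrid L) boolLogic (fun x => boolLogic.conj (Q x)
        (adjSome (torusGrid L) boolLogic P x)) p = true ↔
        ∃ p', Adjacent p p' ∧ Q p' = true ∧ aP p' := by
      rw [adjSome_iff hL]
      simp only [boolLogic_conj, Bool.and_eq_true, haP]
    let bq : Site L → Bool := fun p => boolLogic.diff (Q p) (boolLogic.disj (P p)
      (adjSome (torusGrid L) boolLogic P p))
    let br : Site L → Bool := fun p => boolLogic.diff (R p) (boolLogic.disj4 (P p) (Q p)
      (adjSome (torusGrid L) boolLogic P p) (adjSome (torusGrid L) boolLogic Q p))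
    have h : (((P p && (P ((torusGrid L).rt p) || P ((torusGrid L).dn p))) ||
        (bq p && (bq ((torusGrid L).rt p) || bq ((torusGrid L).dn p)))) ||
        ((br p && (br ((torusGrid L).rt p) || br ((torusGrid L).dn p))) ||
        (boolLogic.diff (R p) (boolLogic.disj (boolLogic.disj (P p) (Q p))
          (adjSome (torusGrid L) boolLogic P p)) && adjSome (torusGrid L) boolLogic
          (fun x => boolLogic.conj (Q x) (adjSome (torusGrid L) boolLogic P x)) p))) = false := hc p
    rw [← Bool.not_eq_true] at h
    simp only [Bool.or_eq_true, Bool.and_eq_true, not_or, not_and] at h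
    obtain ⟨⟨h₁, h₂⟩, h₃, h₅⟩ := h
    refine ⟨h₁, ?_, ?_, ?_⟩
    · intro hp
      have := h₂ ((hq p).2 hp)
      exact ⟨fun h => this.1 ((hq _).2 h), fun h => this.2 ((hq _).2 h)⟩
    · intro hp
      have := h₃ ((hr p).2 hp)
      exact ⟨fun h => this.1 ((hr _).2 h), fun h => this.2 ((hr _).2 h)⟩
    · intro a b c d h
      refine h₅ ?_ (h4.2 h)
      rw [← haP, Bool.not_eq_true] at d
      simp only [Logic.diff, boolLogic_conj, boolLogic_neg, boolLogic_disj, a, b, c, d]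
      rfl
  have c₁ := fun {p p'} => not_both_of_adjacent hL (P := fun p => P p = true)
    (fun p => (hc' p).1) (p := p) (p' := p')
  have c₂ := fun {p p'} => not_both_of_adjacent hL (fun p => (hc' p).2.1) (p := p) (p' := p')
  have c₃ := fun {p p'} => not_both_of_adjacent hL (fun p => (hc' p).2.2.1) (p := p) (p' := p')
  have hi' := fun p => (invalid_eq_false_iff hL P Q R B p).1 (hi p)
  simp only [Bool.and_eq_true, Bool.or_eq_true] at hi'
  have hind : ∀ {p p'}, Adjacent p p' → B p = true → B p' = false := by
    intro p p' h hp
    by_contra hn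
    exact ((hi' p).1 hp).1 ⟨p', h, by simpa using hn⟩
  have hPB : ∀ {p}, P p = true → B p = true := by
    intro p hp
    rcases (hi' p).2.1 hp with h | ⟨p', h, -, h'⟩
    · exact h
    · exact absurd h' (c₁ h hp)
  have haPB : ∀ {p}, B p = true → ¬aP p := by
    rintro p hp ⟨p', h, h'⟩
    have := hind h hp
    rw [hPB h'] at this
    simp at this
  -- A blocking neighbour of the first pass is ruled out by `¬aP p`. One of the second pass would
  -- satisfy `q` as well, and two adjacent such plaquettes are a conflict.
  have hqB : ∀ {p}, q p → B p = true := by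
    intro p hp
    rcases (hi' p).2.2.1 hp.1 with h | ⟨p', h, hB, hP | hQ⟩
    · exact h
    · exact absurd ⟨p', h, hP⟩ hp.2.2
    · have hP' : P p' = false := by
        by_contra hn
        exact hp.2.2 ⟨p', h, by simpa using hn⟩
      exact absurd ⟨hQ, hP', haPB hB⟩ (c₂ h hp)
  -- A second-pass neighbour is not in `B`. It does not touch a first-pass match, by the last kind
  -- of conflict, so it would satisfy `q` and be in `B` after all.
  have haQB : ∀ {p}, B p = true → R p = true → P p = false → Q p = false → ¬aQ p := by
    rintro p hB hR hP hQ ⟨x, hx, hQx⟩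
    have hnB := hind hx hB
    have hPx : P x = false := by
      by_contra hn
      rw [hPB (by simpa using hn)] at hnB
      simp at hnB
    have hax : ¬aP x := fun h => (hc' p).2.2.2 hR hP hQ (haPB hB) ⟨x, hx, hQx, h⟩
    rw [hqB ⟨hQx, hPx, hax⟩] at hnB
    simp at hnB
  have hrB : ∀ {p}, r p → B p = true := by
    intro p hp
    rcases (hi' p).2.2.2 hp.1 with h | ⟨p', h, hB⟩
    · exact h
    · have hP' : P p' = false := by
        by_contra hn
        exact hp.2.2.2.1 ⟨p', h, by simpa using hn⟩
      have hQ' : Q p' = false := by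
        by_contra hn
        exact hp.2.2.2.2 ⟨p', h, by simpa using hn⟩
      have hR' : R p' = true := by
        rcases ((hi' p').1 hB).2 with h | h | h
        · rw [hP'] at h; simp at h
        · rw [hQ'] at h; simp at h
        · exact h
      exact absurd ⟨hR', hP', hQ', haPB hB, haQB hB hR' hP' hQ'⟩ (c₃ h hp)
  funext p
  rw [Bool.eq_iff_iff, blown]
  simp only [Logic.diff, boolLogic_conj, boolLogic_disj, boolLogic_neg, Bool.or_eq_true,
    Bool.and_eq_true, Bool.not_eq_true', ← Bool.not_eq_true, haP, haQ]
  constructor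
  · intro hB
    by_cases hP : P p = true
    · exact .inl hP
    · refine .inr ⟨?_, haPB hB⟩
      by_cases hQ : Q p = true
      · exact .inl hQ
      · rcases ((hi' p).1 hB).2 with h | h | h
        · exact absurd h hP
        · exact absurd h hQ
        · exact .inr ⟨h, haQB hB h (by simpa using hP) (by simpa using hQ)⟩
  · rintro (h | ⟨h | ⟨h, h'⟩, hp⟩)
    · exact hPB h
    · by_cases hP : P p = true
      · exact hPB hP
      · exact hqB ⟨h, by simpa using hP, hp⟩
    · by_cases hP : P p = true
      · exact hPB hP
      · by_cases hQ : Q p = true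
        · exact hqB ⟨hQ, by simpa using hP, hp⟩
        · exact hrB ⟨h, by simpa using hP, by simpa using hQ, hp, h'⟩

end Blown


/-! ### Two iterations of min-sum -/

section Combine

variable {ι : Type} {J : Finset ι} {σ : ℤ} {f : ι → ℤ}

theorem combine_const {a : ℤ} (ha : 0 < a) (hJ : J.Nonempty) (h : ∀ i ∈ J, f i = a) :
    combine σ J f = σ * a := by
  rw [combine_congr (f' := fun _ => a) h, combine, dif_pos hJ, Finset.inf'_const,
    Finset.prod_const, Int.sign_eq_one_of_pos ha, one_pow, abs_of_pos ha, mul_one]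

theorem combine_eq_zero {i : ι} (hi : i ∈ J) (h : f i = 0) : combine σ J f = 0 := by
  rw [combine, Finset.prod_eq_zero hi (by rw [h]; rfl)]
  simp

end Combine

section Iterations

variable {L : ℕ} {B : Finset (Site L)} {s : Site L → ZMod 2}

theorem Independent.not_mem (hL : 1 < L) (hB : Independent B) {p p' : Site L}
    (h : p' = (torusGrid L).rt p ∨ p' = (torusGrid L).dn p ∨ p' = (torusGrid L).lf p ∨
      p' = (torusGrid L).up p) (hp : p ∈ B) : p' ∉ B :=
  fun hp' => hB p hp p' hp' ((adjacent_iff hL p p').2 h)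

/-- Every site has at least two edges. -/
theorem slots_erase_nonempty (hL : 1 < L) (hB : Independent B) (x : Site L) (j : ℕ) :
    ((slots B x).erase j).Nonempty := by
  have h01 : ¬(inB B x = true ∧ inB B ((torusGrid L).lf x) = true) := by
    simp only [inB_eq_true]
    exact fun h => hB.not_mem hL (by simp) h.1 h.2
  have h03 : ¬(inB B x = true ∧ inB B ((torusGrid L).up x) = true) := by
    simp only [inB_eq_true]
    exact fun h => hB.not_mem hL (by simp) h.1 h.2
  have h12 : ¬(inB B ((torusGrid L).lf x) = true ∧
      inB B ((torusGrid L).up ((torusGrid L).lf x)) = true) := by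
    simp only [inB_eq_true]
    exact fun h => hB.not_mem hL (by simp) h.1 h.2
  have h32 : ¬(inB B ((torusGrid L).up x) = true ∧
      inB B ((torusGrid L).up ((torusGrid L).lf x)) = true) := by
    simp only [inB_eq_true]
    exact fun h => hB.not_mem hL (by simp [torusGrid]) h.1 h.2
  have hcomm : (torusGrid L).lf ((torusGrid L).up x) = (torusGrid L).up ((torusGrid L).lf x) := rfl
  have : ∃ i < 8, i ≠ j ∧ slotUsed B x i = true := by
    have e : ∀ k, slotUsed B x (4 + k) = inB B ((torusGrid L).uncor k x) := by
      intro k; rw [slotUsed, if_neg (by omega), Nat.add_sub_cancel_left]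
    have e4 : slotUsed B x 4 = inB B x := e 0
    have e5 : slotUsed B x 5 = inB B ((torusGrid L).lf x) := e 1
    have e6 : slotUsed B x 6 = inB B ((torusGrid L).up ((torusGrid L).lf x)) := e 2
    have e7 : slotUsed B x 7 = inB B ((torusGrid L).up x) := e 3
    have d0 : slotUsed B x 0 = !(inB B x || inB B ((torusGrid L).up x)) := rfl
    have d1 : slotUsed B x 1 = !(inB B x || inB B ((torusGrid L).lf x)) := rfl
    have d2 : slotUsed B x 2 = !(inB B ((torusGrid L).lf x) ||
        inB B ((torusGrid L).up ((torusGrid L).lf x))) := rfl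
    have d3 : slotUsed B x 3 = !(inB B ((torusGrid L).up x) ||
        inB B ((torusGrid L).up ((torusGrid L).lf x))) := rfl
    have two : ∀ a b, a ≠ b → a < 8 → b < 8 → slotUsed B x a = true → slotUsed B x b = true →
        ∃ i < 8, i ≠ j ∧ slotUsed B x i = true := by
      intro a b hab ha hb h h'
      by_cases haj : a = j
      · exact ⟨b, hb, fun hbj => hab (haj.trans hbj.symm), h'⟩
      · exact ⟨a, ha, haj, h⟩
    -- Of the four plaquettes around `x`, none, one or two opposite ones are blown up. The two edges
    -- are two old ones in the first two cases and two new ones in the third.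
    cases h0 : inB B x <;> cases h1 : inB B ((torusGrid L).lf x) <;>
      cases h3 : inB B ((torusGrid L).up x) <;>
      cases h2 : inB B ((torusGrid L).up ((torusGrid L).lf x)) <;>
      simp only [h0, h1, h2, h3, and_self, not_true_eq_false] at h01 h03 h12 h32 <;>
      simp only [h0, h1, h2, h3, Bool.or_self, Bool.or_true, Bool.true_or, Bool.not_true,
        Bool.not_false] at e4 e5 e6 e7 d0 d1 d2 d3 <;> first
      | exact two 0 1 (by norm_num) (by norm_num) (by norm_num) d0 d1
      | exact two 0 3 (by norm_num) (by norm_num) (by norm_num) d0 d3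
      | exact two 2 3 (by norm_num) (by norm_num) (by norm_num) d2 d3
      | exact two 1 2 (by norm_num) (by norm_num) (by norm_num) d1 d2
      | exact two 4 6 (by norm_num) (by norm_num) (by norm_num) e4 e6
      | exact two 5 7 (by norm_num) (by norm_num) (by norm_num) e5 e7
  obtain ⟨i, hi, hne, hu⟩ := this
  exact ⟨i, Finset.mem_erase.2 ⟨hne, mem_slots.2 ⟨hi, hu⟩⟩⟩

theorem range_erase_nonempty (j : ℕ) : ((Finset.range 4).erase j).Nonempty := by
  by_cases h : j = 0
  · exact ⟨1, by simp [h]⟩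
  · exact ⟨0, by simp [Ne.symm h]⟩

/-- All incoming values are `1`, so only the sign of the syndrome matters. -/
theorem messages_one_site (hL : 1 < L) (hB : Independent B) (x : Site L) (j : ℕ) :
    (messages B s 1).site x j = if uns s x then -1 else 1 := by
  refine (combine_const one_pos (slots_erase_nonempty hL hB x j) fun i _ => ?_).trans ?_
  · simp [messages, Messages.siteIn]
  · simp

theorem messages_one_mid (p : Site L) (j : ℕ) : (messages B s 1).mid p j = 1 := by
  refine (combine_const one_pos (range_erase_nonempty j) fun i _ => ?_).trans ?_
  · simp [messages, Messages.midIn]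
  · simp

/-- A neighbour of `x`, not in slot `j`, is unsatisfied. -/
def elsewhere (B : Finset (Site L)) (s : Site L → ZMod 2) (x : Site L) (j : ℕ) : Bool :=
  if j < 4 then unsatElse (torusGrid L) boolLogic (uns s) (inB B) j x
  else unsatAny (torusGrid L) boolLogic (uns s) (inB B) x

theorem unsat_eq (x : Site L) {i : ℕ} (hi : i < 4) :
    unsat (torusGrid L) boolLogic (uns s) (inB B) i x =
      (slotUsed B x i && uns s ((torusGrid L).step i x)) := by
  rw [slotUsed, if_pos hi]
  rfl

theorem elsewhere_iff (x : Site L) (j : ℕ) : elsewhere B s x j = true ↔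
    ∃ i < 4, i ≠ j ∧ slotUsed B x i = true ∧ uns s ((torusGrid L).step i x) = true := by
  have hu := fun i hi => unsat_eq (B := B) (s := s) x (i := i) hi
  rw [elsewhere]
  split_ifs with hj
  · simp only [unsatElse, boolLogic_disj, Bool.or_eq_true]
    rw [hu _ (Nat.mod_lt _ (by norm_num)), hu _ (Nat.mod_lt _ (by norm_num)),
      hu _ (Nat.mod_lt _ (by norm_num))]
    simp only [Bool.and_eq_true]
    constructor
    · rintro (h | h | h)
      exacts [⟨_, Nat.mod_lt _ (by norm_num), by omega, h⟩,
        ⟨_, Nat.mod_lt _ (by norm_num), by omega, h⟩, ⟨_, Nat.mod_lt _ (by norm_num), by omega, h⟩]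
    · rintro ⟨i, hi, hij, h⟩
      have : i = (j + 1) % 4 ∨ i = (j + 2) % 4 ∨ i = (j + 3) % 4 := by omega
      rcases this with rfl | rfl | rfl
      exacts [.inl h, .inr (.inl h), .inr (.inr h)]
  · simp only [unsatAny, Logic.disj4, boolLogic_disj, Bool.or_eq_true]
    rw [hu 0 (by norm_num), hu 1 (by norm_num), hu 2 (by norm_num), hu 3 (by norm_num)]
    simp only [Bool.and_eq_true]
    constructor
    · rintro ((h | h) | (h | h))
      exacts [⟨0, by norm_num, by omega, h⟩, ⟨1, by norm_num, by omega, h⟩,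
        ⟨2, by norm_num, by omega, h⟩, ⟨3, by norm_num, by omega, h⟩]
    · rintro ⟨i, hi, -, h⟩
      interval_cases i
      exacts [.inl (.inl h), .inl (.inr h), .inr (.inl h), .inr (.inr h)]

theorem siteIn_one (hL : 1 < L) (hB : Independent B) (x : Site L) (i : ℕ) :
    (messages B s 1).siteIn x i =
      if i < 4 ∧ uns s ((torusGrid L).step i x) then -1 else 1 := by
  rw [Messages.siteIn]
  by_cases hi : i < 4
  · rw [if_pos hi, messages_one_site hL hB]
    simp [hi]
  · rw [if_neg hi, messages_one_mid]
    simp [hi]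

/-- The incoming values are `1 - 1 = 0` from unsatisfied neighbours and `1 + 1 = 2` from satisfied
ones and from middles. A single `0` makes the message vanish. -/
theorem messages_two_site (hL : 1 < L) (hB : Independent B) (x : Site L) (j : ℕ) :
    (messages B s 2).site x j =
      if elsewhere B s x j then 0 else if uns s x then -2 else 2 := by
  change combine _ _ _ = _
  by_cases h : elsewhere B s x j = true
  · rw [if_pos h]
    obtain ⟨i, hi, hij, hu, h'⟩ := (elsewhere_iff x j).1 h
    refine combine_eq_zero (i := i) (Finset.mem_erase.2 ⟨hij, mem_slots.2 ⟨by omega, hu⟩⟩) ?_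
    rw [siteIn_one hL hB, if_pos ⟨hi, h'⟩]
    rfl
  · rw [if_neg h]
    refine (combine_const two_pos (slots_erase_nonempty hL hB x j) fun i hi => ?_).trans ?_
    · rw [siteIn_one hL hB, if_neg]
      · rfl
      · rintro ⟨hi4, h'⟩
        obtain ⟨hij, hu⟩ := Finset.mem_erase.1 hi
        exact h ((elsewhere_iff x j).2 ⟨i, hi4, hij, (mem_slots.1 hu).2, h'⟩)
    · simp only [uns_eq_true]
      split_ifs <;> rfl

-- The middle itself is satisfied, so its message is `2` unless the zero from another unsatisfied
-- corner intervenes.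
open Classical in
theorem messages_two_mid (hL : 1 < L) (hB : Independent B) (p : Site L) (j : ℕ) :
    (messages B s 2).mid p j =
      if ∃ i < 4, i ≠ j ∧ uns s ((torusGrid L).cor i p) = true then 0 else 2 := by
  have hin : ∀ i, (messages B s 1).midIn p i = if uns s ((torusGrid L).cor i p) then -1 else 1 :=
    fun i => messages_one_site hL hB _ _
  change combine _ _ _ = _
  split_ifs with h
  · obtain ⟨i, hi, hij, h'⟩ := h
    refine combine_eq_zero (i := i) (Finset.mem_erase.2 ⟨hij, Finset.mem_range.2 hi⟩) ?_
    rw [hin, if_pos h']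
    rfl
  · refine (combine_const two_pos (range_erase_nonempty j) fun i hi => ?_).trans (one_mul 2)
    rw [hin, if_neg]
    · rfl
    · intro h'
      obtain ⟨hij, hi⟩ := Finset.mem_erase.1 hi
      exact h ⟨i, Finset.mem_range.1 hi, hij, h'⟩

/-- The estimate of the edge in slot `j` of `x` after two iterations. -/
def estTwo (B : Finset (Site L)) (s : Site L → ZMod 2) (x : Site L) (j : ℕ) : Bool :=
  if j < 4 then estEdge (torusGrid L) boolLogic (uns s) (inB B) j x
  else estNew (torusGrid L) boolLogic (uns s) (inB B) (j - 4) ((torusGrid L).uncor (j - 4) x)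

theorem siteEst_zero (x : Site L) (j : ℕ) : siteEst B s 0 x j = 0 := by
  simp [siteEst, messages, Messages.siteIn]

theorem siteEst_one (hL : 1 < L) (hB : Independent B) (x : Site L) (j : ℕ) :
    siteEst B s 1 x j =
      if j < 4 ∧ uns s x ∧ uns s ((torusGrid L).step j x) then 1 else 0 := by
  rw [siteEst, siteIn_one hL hB, messages_one_site hL hB]
  by_cases hj : j < 4 <;> cases uns s x <;> cases uns s ((torusGrid L).step j x) <;> simp [hj]

/-- Both messages on an edge lie in `{-2, 0, 2}`, and the formulas for the estimate list the cases
in which `1` plus their sum is negative. -/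
theorem siteEst_two (hL : 1 < L) (hB : Independent B) (x : Site L) {j : ℕ} (hj : j ∈ slots B x) :
    siteEst B s 2 x j = if estTwo B s x j then 1 else 0 := by
  obtain ⟨h8, hu⟩ := mem_slots.1 hj
  rw [siteEst, messages_two_site hL hB, Messages.siteIn, estTwo]
  by_cases h4 : j < 4
  · have hl : (j + 2) % 4 < 4 := Nat.mod_lt _ (by norm_num)
    rw [slotUsed, if_pos h4] at hu
    rw [if_pos h4, if_pos h4, messages_two_site hL hB, estEdge, elsewhere, elsewhere, if_pos h4,
      if_pos hl, hu]
    simp only [Logic.diff, boolLogic_conj, boolLogic_disj, boolLogic_neg]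
    generalize unsatElse _ _ _ _ _ x = a
    generalize unsatElse _ _ _ _ _ ((torusGrid L).step j x) = b
    cases uns s x <;> cases uns s ((torusGrid L).step j x) <;> cases a <;> cases b <;> simp
  · obtain ⟨k, rfl⟩ : ∃ k, j = 4 + k := ⟨j - 4, by omega⟩
    have hk : k < 4 := by omega
    rw [slotUsed, if_neg h4, Nat.add_sub_cancel_left] at hu
    rw [if_neg h4, if_neg h4, messages_two_mid hL hB, Nat.add_sub_cancel_left, estNew, hu,
      elsewhere, if_neg h4, cor_uncor x hk]
    have he : (∃ i < 4, i ≠ k ∧ uns s ((torusGrid L).cor i ((torusGrid L).uncor k x)) = true) ↔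
        (uns s ((torusGrid L).cor ((k + 1) % 4) ((torusGrid L).uncor k x)) ||
        (uns s ((torusGrid L).cor ((k + 2) % 4) ((torusGrid L).uncor k x)) ||
        uns s ((torusGrid L).cor ((k + 3) % 4) ((torusGrid L).uncor k x)))) = true := by
      simp only [Bool.or_eq_true]
      constructor
      · rintro ⟨i, hi, hij, h⟩
        have : i = (k + 1) % 4 ∨ i = (k + 2) % 4 ∨ i = (k + 3) % 4 := by omega
        rcases this with rfl | rfl | rfl
        exacts [.inl h, .inr (.inl h), .inr (.inr h)]
      · rintro (h | h | h)
        exacts [⟨_, Nat.mod_lt _ (by norm_num), by omega, h⟩,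
          ⟨_, Nat.mod_lt _ (by norm_num), by omega, h⟩,
          ⟨_, Nat.mod_lt _ (by norm_num), by omega, h⟩]
    simp only [Logic.diff, boolLogic_conj, boolLogic_disj, boolLogic_neg]
    generalize unsatAny _ _ _ _ x = a
    by_cases hc : ∃ i < 4, i ≠ k ∧ uns s ((torusGrid L).cor i ((torusGrid L).uncor k x)) = true
    · simp only [if_pos hc, he.1 hc]
      cases uns s x <;> cases a <;> simp
    · simp only [if_neg hc, Bool.eq_false_iff.2 fun h => hc (he.2 h)]
      cases uns s x <;> cases a <;> simp

theorem estTwo_eq_false (x : Site L) {j : ℕ} (h8 : j < 8) (hj : j ∉ slots B x) :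
    estTwo B s x j = false := by
  have hu : slotUsed B x j = false := by
    by_contra h
    exact hj (mem_slots.2 ⟨h8, by simpa using h⟩)
  rw [slotUsed] at hu
  rw [estTwo]
  split_ifs at hu ⊢ with h4
  · rw [estEdge, hu]; rfl
  · rw [estNew, hu]; rfl

end Iterations


/-! ### Errors without defects are corrected after two iterations -/

section Boolean

theorem sum_range_eight {M : Type} [AddCommMonoid M] (f : ℕ → M) : ∑ j ∈ Finset.range 8, f j =
    ((f 0 + f 1) + (f 2 + f 3)) + ((f 4 + f 5) + (f 6 + f 7)) := by
  simp only [Finset.sum_range_succ, Finset.sum_range_zero, zero_add, add_assoc]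

theorem sum_range_four {M : Type} [AddCommMonoid M] (f : ℕ → M) : ∑ j ∈ Finset.range 4, f j =
    (f 0 + f 1) + (f 2 + f 3) := by
  simp only [Finset.sum_range_succ, Finset.sum_range_zero, zero_add, add_assoc]

/-- A truth value as a number modulo 2. -/
def bit2 (b : Bool) : ZMod 2 := if b then 1 else 0

theorem bit2_xor (a b : Bool) : bit2 (xor a b) = bit2 a + bit2 b := by
  cases a <;> cases b <;> decide

theorem bit2_uns {L : ℕ} (s : Site L → ZMod 2) (x : Site L) : bit2 (uns s x) = s x := by
  rw [bit2, uns]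
  generalize s x = a
  revert a
  decide

theorem toNat_sum_le_one : ∀ a₀ a₁ a₂ a₃ b₀ b₁ b₂ b₃ : Bool,
    (boolLogic.disj4 (boolLogic.conj (boolLogic.disj4 a₀ a₁ a₂ a₃) (boolLogic.disj4 b₀ b₁ b₂ b₃))
      (boolLogic.two a₀ a₁ a₂ a₃) (boolLogic.two b₀ b₁ b₂ b₃) false) = false →
    ((a₀.toNat + a₁.toNat) + (a₂.toNat + a₃.toNat)) +
      ((b₀.toNat + b₁.toNat) + (b₂.toNat + b₃.toNat)) ≤ 1 := by
  decide +kernel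

/-- Fewer than three, and an odd number, means exactly one. So some other one holds if and only if
the given one does not. -/
theorem else_eq_not : ∀ u₀ u₁ u₂ u₃ : Bool, boolLogic.three u₀ u₁ u₂ u₃ = false →
    (bit2 u₀ + bit2 u₁) + (bit2 u₂ + bit2 u₃) = 1 →
    (u₁ || (u₂ || u₃)) = !u₀ ∧ (u₂ || (u₃ || u₀)) = !u₁ ∧ (u₃ || (u₀ || u₁)) = !u₂ ∧
      (u₀ || (u₁ || u₂)) = !u₃ ∧ ((u₀ || u₁) || (u₂ || u₃)) = true := by
  decide +kernel

/-- A syndrome of even weight on a cycle of length four has a solution of weight at most two. -/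
theorem exists_cover : ∀ n : Fin 4 → ZMod 2, (n 0 + n 1) + (n 2 + n 3) = 0 →
    ∃ f : Fin 4 → ZMod 2, (∀ k, f (k - 1) + f k = n k) ∧
      (Finset.univ.filter fun k => f k ≠ 0).card ≤ 2 ∧ (n = 0 → f = 0) := by
  decide +kernel

theorem two_or_four : ∀ n₀ n₁ n₂ n₃ : Bool, (bit2 n₀ + bit2 n₁) + (bit2 n₂ + bit2 n₃) = 0 →
    (n₀ || (n₁ || (n₂ || n₃))) = true → (n₀ && (n₁ && (n₂ && n₃))) = true ∨
      (n₀.toNat + n₁.toNat) + (n₂.toNat + n₃.toNat) = 2 := by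
  decide +kernel

end Boolean

section Defects

variable {L : ℕ} {B : Finset (Site L)} {s : Site L → ZMod 2}

/-- The estimate after two iterations has no defects. -/
structure NoDefect (B : Finset (Site L)) (s : Site L → ZMod 2) : Prop where
  site : ∀ x, ∑ j ∈ Finset.range 8, bit2 (estTwo B s x j) = s x
  mid : ∀ p, ∑ k ∈ Finset.range 4, bit2 (estTwo B s ((torusGrid L).cor k p) (4 + k)) = 0
  unique : ∀ x, uns s x = true → ∑ j ∈ Finset.range 8, (estTwo B s x j).toNat ≤ 1
  three : ∀ x, uns s x = true → boolLogic.three (unsat (torusGrid L) boolLogic (uns s) (inB B) 0 x)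
    (unsat (torusGrid L) boolLogic (uns s) (inB B) 1 x)
    (unsat (torusGrid L) boolLogic (uns s) (inB B) 2 x)
    (unsat (torusGrid L) boolLogic (uns s) (inB B) 3 x) = false
  old : ∀ x, uns s x = true → (∃ i < 4, uns s ((torusGrid L).step i x) = true) →
    ∀ k < 4, estTwo B s x k = true → uns s ((torusGrid L).step k x) = true
  new : ∀ x, uns s x = true → (∃ i < 4, uns s ((torusGrid L).step i x) = true) →
    ∀ k < 4, estTwo B s x (4 + k) = true → ∀ l < 4,
      estTwo B s ((torusGrid L).cor l ((torusGrid L).uncor k x)) (4 + l) = true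

theorem estTwo_old (x : Site L) {k : ℕ} (hk : k < 4) :
    estTwo B s x k = estEdge (torusGrid L) boolLogic (uns s) (inB B) k x := by
  rw [estTwo, if_pos hk]

theorem estTwo_new (x : Site L) (k : ℕ) : estTwo B s x (4 + k) =
    estNew (torusGrid L) boolLogic (uns s) (inB B) k ((torusGrid L).uncor k x) := by
  rw [estTwo, if_neg (by omega), Nat.add_sub_cancel_left]

theorem estTwo_cor (p : Site L) {k : ℕ} (hk : k < 4) :
    estTwo B s ((torusGrid L).cor k p) (4 + k) =
      estNew (torusGrid L) boolLogic (uns s) (inB B) k p := by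
  rw [estTwo_new, uncor_cor p hk]

theorem noDefect (h : ∀ x, defect (torusGrid L) boolLogic (uns s) (inB B)
    (estEdge (torusGrid L) boolLogic (uns s) (inB B))
    (estNew (torusGrid L) boolLogic (uns s) (inB B)) x = false) : NoDefect B s := by
  have h' : ∀ x, _ := fun x => h x
  simp only [defect, Logic.disj4, boolLogic_disj, Bool.or_eq_false_iff] at h'
  have t0 := fun x => estTwo_old (B := B) (s := s) x (k := 0) (by norm_num)
  have t1 := fun x => estTwo_old (B := B) (s := s) x (k := 1) (by norm_num)
  have t2 := fun x => estTwo_old (B := B) (s := s) x (k := 2) (by norm_num)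
  have t3 := fun x => estTwo_old (B := B) (s := s) x (k := 3) (by norm_num)
  have t4 := fun x => estTwo_new (B := B) (s := s) x 0
  have t5 := fun x => estTwo_new (B := B) (s := s) x 1
  have t6 := fun x => estTwo_new (B := B) (s := s) x 2
  have t7 := fun x => estTwo_new (B := B) (s := s) x 3
  constructor
  · intro x
    have h₁ := (h' x).1.1
    rw [boolLogic_sum, bne_eq_false_iff_eq] at h₁
    rw [← bit2_uns s x, h₁, sum_range_eight]
    simp only [Logic.sum4, boolLogic_sum, bit2_xor, ← t0, ← t1, ← t2, ← t3, ← t4, ← t5, ← t6, ← t7]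
  · intro p
    have h₁ := (h' p).2.2
    rw [sum_range_four, estTwo_cor _ (by norm_num), estTwo_cor _ (by norm_num),
      estTwo_cor _ (by norm_num), estTwo_cor _ (by norm_num), ← bit2_xor, ← bit2_xor, ← bit2_xor]
    exact congrArg bit2 h₁
  · intro x hx
    have h₁ := (h' x).1.2
    rw [hx, boolLogic_conj, Bool.true_and, Bool.or_eq_false_iff, Bool.or_eq_false_iff] at h₁
    rw [sum_range_eight]
    refine toNat_sum_le_one _ _ _ _ _ _ _ _ ?_
    rw [t0, t1, t2, t3, t4, t5, t6, t7]
    simp only [Logic.disj4, boolLogic_disj] at h₁ ⊢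
    rw [h₁.1.1, h₁.1.2, (Bool.or_eq_false_iff.1 h₁.2).1]
    rfl
  · intro x hx
    have h₁ := (h' x).1.2
    rw [hx, boolLogic_conj, Bool.true_and, Bool.or_eq_false_iff, Bool.or_eq_false_iff] at h₁
    exact (Bool.or_eq_false_iff.1 h₁.2).2
  · intro x hx hn k hk hT
    have h₁ := (h' x).2.1
    have hn' : ((uns s ((torusGrid L).rt x) || uns s ((torusGrid L).dn x)) ||
        (uns s ((torusGrid L).lf x) || uns s ((torusGrid L).up x))) = true := by
      obtain ⟨i, hi, h⟩ := hn
      interval_cases i <;> simp only [Grid.step] at h <;> rw [h] <;> simp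
    rw [hn', hx] at h₁
    simp only [boolLogic_conj, Bool.true_and, Bool.or_eq_false_iff, Logic.diff, boolLogic_neg] at h₁
    obtain ⟨⟨⟨a₀, a₁⟩, a₂, a₃⟩, -⟩ := h₁
    rw [estTwo_old x hk] at hT
    interval_cases k
    · rw [hT] at a₀; simpa using a₀
    · rw [hT] at a₁; simpa using a₁
    · rw [hT] at a₂; simpa using a₂
    · rw [hT] at a₃; simpa using a₃
  · intro x hx hn k hk hT l hl
    have h₁ := (h' x).2.1
    have hn' : ((uns s ((torusGrid L).rt x) || uns s ((torusGrid L).dn x)) ||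
        (uns s ((torusGrid L).lf x) || uns s ((torusGrid L).up x))) = true := by
      obtain ⟨i, hi, h⟩ := hn
      interval_cases i <;> simp only [Grid.step] at h <;> rw [h] <;> simp
    rw [hn', hx] at h₁
    simp only [boolLogic_conj, Bool.true_and, Bool.or_eq_false_iff, Logic.diff, boolLogic_neg,
      Logic.conj4] at h₁
    obtain ⟨-, ⟨a₀, a₁⟩, a₂, a₃⟩ := h₁
    rw [estTwo_new] at hT
    rw [estTwo_cor _ hl]
    interval_cases k
    · rw [hT] at a₀; interval_cases l <;> simp_all
    · rw [hT] at a₁; interval_cases l <;> simp_all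
    · rw [hT] at a₂; interval_cases l <;> simp_all
    · rw [hT] at a₃; interval_cases l <;> simp_all

end Defects


/-! ### Discharging: the weight of the estimate against that of the error. -/

section Weights

variable {L : ℕ} {B : Finset (Site L)} {s : Site L → ZMod 2}

theorem sum_step [NeZero L] (f : Site L → ℕ) (k : ℕ) : ∑ x, f ((torusGrid L).step k x) = ∑ x, f x := by
  have h : ∀ g : Site L → Site L, ((torusGrid L).step k ∘ g = id) → (g ∘ (torusGrid L).step k = id) →
      ∑ x, f ((torusGrid L).step k x) = ∑ x, f x := fun g h h' =>
    Function.Bijective.sum_comp (Function.bijective_iff_has_inverse.2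
      ⟨g, congrFun h', congrFun h⟩) f
  match k with
  | 0 => refine h (torusGrid L).lf ?_ ?_ <;> funext x <;> simp [torusGrid, Grid.step]
  | 1 => refine h (torusGrid L).up ?_ ?_ <;> funext x <;> simp [torusGrid, Grid.step]
  | 2 => refine h (torusGrid L).rt ?_ ?_ <;> funext x <;> simp [torusGrid, Grid.step]
  | _ + 3 => refine h (torusGrid L).dn ?_ ?_ <;> funext x <;> simp [torusGrid, Grid.step]

theorem sum_cor [NeZero L] (f : Site L → ℕ) {k : ℕ} (hk : k < 4) :
    ∑ x, f ((torusGrid L).cor k x) = ∑ x, f x :=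
  Function.Bijective.sum_comp (e := (torusGrid L).cor k) (Function.bijective_iff_has_inverse.2
    ⟨(torusGrid L).uncor k, fun x => uncor_cor x hk, fun x => cor_uncor x hk⟩) f

theorem step_step (x : Site L) {k : ℕ} (hk : k < 4) :
    (torusGrid L).step ((k + 2) % 4) ((torusGrid L).step k x) = x := by
  interval_cases k <;> simp [torusGrid, Grid.step]

open Classical in
theorem hammingNorm_eq_sum [NeZero L] (e : Qubit L → ZMod 2) : hammingNorm e =
    ∑ x, ((if e (Sum.inl x) ≠ 0 then 1 else 0) + (if e (Sum.inr x) ≠ 0 then 1 else 0)) := by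
  rw [Finset.sum_add_distrib, hammingNorm, Finset.card_filter, Fintype.sum_sum_type]

open Classical in
/-- The share of a check in the weight of an error, counted twice. -/
noncomputable def share (s : Site L → ZMod 2) (x : Site L) : ℕ :=
  if uns s x then if ∃ i < 4, uns s ((torusGrid L).step i x) = true then 1 else 2 else 0

theorem share_of_sat {x : Site L} (h : uns s x = false) : share s x = 0 := by simp [share, h]

theorem share_le_two (x : Site L) : share s x ≤ 2 := by
  unfold share; split_ifs <;> norm_num

theorem one_le_share {x : Site L} (h : uns s x = true) : 1 ≤ share s x := by
  unfold share; split_ifs <;> norm_num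

theorem share_of_adjacent {x : Site L} {k : ℕ} (hk : k < 4) (h : uns s x = true)
    (h' : uns s ((torusGrid L).step k x) = true) :
    share s x = 1 ∧ share s ((torusGrid L).step k x) = 1 := by
  constructor
  · rw [share, if_pos h, if_pos ⟨k, hk, h'⟩]
  · rw [share, if_pos h', if_pos ⟨(k + 2) % 4, Nat.mod_lt _ (by norm_num), by rwa [step_step x hk]⟩]

/-- If both ends are unsatisfied then each has share 1 because of the other, and otherwise only one
of them has a share. -/
theorem share_add_le (x : Site L) {k : ℕ} (hk : k < 4) :
    share s x + share s ((torusGrid L).step k x) ≤ 2 := by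
  cases h : uns s x
  · rw [share_of_sat h, zero_add]; exact share_le_two _
  · cases h' : uns s ((torusGrid L).step k x)
    · rw [share_of_sat h', add_zero]; exact share_le_two _
    · rw [(share_of_adjacent hk h h').1, (share_of_adjacent hk h h').2]

/-- An unsatisfied check lies on some edge of the error and charges its share to the edges of the
error there. By `share_add_le`, no edge is charged more than 2. -/
theorem sum_share_le [NeZero L] {e : Qubit L → ZMod 2} (hs : (toricH L).mulVec e = s) :
    ∑ x, share s x ≤ 2 * hammingNorm e := by
  classical
  let b : ℕ → Site L → ℕ := fun j x => if e (qubitAt x j) ≠ 0 then share s x else 0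
  have h₁ : ∀ x, share s x ≤ (b 0 x + b 1 x) + (b 2 x + b 3 x) := by
    intro x
    cases hx : uns s x
    · rw [share_of_sat hx]; exact Nat.zero_le _
    · have hc := congrFun hs x
      rw [toricH_mulVec, uns_eq_true.1 hx] at hc
      have : ∃ j < 4, e (qubitAt x j) ≠ 0 := by
        by_contra! hn
        have h0 := hn 0 (by norm_num)
        have h1 := hn 1 (by norm_num)
        have h2 := hn 2 (by norm_num)
        have h3 := hn 3 (by norm_num)
        simp only [qubitAt] at h0 h1 h2 h3
        rw [h0, h1, h2, h3] at hc
        simp at hc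
      obtain ⟨j, hj, h⟩ := this
      have hb : b j x = share s x := if_pos h
      interval_cases j <;> omega
  have h₂ : ∀ x, b 0 x + b 2 ((torusGrid L).step 0 x) ≤
      2 * if e (Sum.inl x) ≠ 0 then 1 else 0 := by
    intro x
    have : qubitAt ((torusGrid L).step 0 x) 2 = Sum.inl x := by
      simp [qubitAt, torusGrid, Grid.step]
    rw [show b 2 ((torusGrid L).step 0 x) = if e (Sum.inl x) ≠ 0 then _ else 0 by
      simp only [b]; rw [this], show b 0 x = if e (Sum.inl x) ≠ 0 then _ else 0 from rfl]
    split_ifs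
    · exact share_add_le x (by norm_num)
    · simp
  have h₃ : ∀ x, b 1 x + b 3 ((torusGrid L).step 1 x) ≤
      2 * if e (Sum.inr x) ≠ 0 then 1 else 0 := by
    intro x
    have : qubitAt ((torusGrid L).step 1 x) 3 = Sum.inr x := by
      simp [qubitAt, torusGrid, Grid.step]
    rw [show b 3 ((torusGrid L).step 1 x) = if e (Sum.inr x) ≠ 0 then _ else 0 by
      simp only [b]; rw [this], show b 1 x = if e (Sum.inr x) ≠ 0 then _ else 0 from rfl]
    split_ifs
    · exact share_add_le x (by norm_num)
    · simp
  have h₄ := Finset.sum_le_sum fun x (_ : x ∈ Finset.univ) => h₁ x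
  have h₅ := Finset.sum_le_sum fun x (_ : x ∈ Finset.univ) => h₂ x
  have h₆ := Finset.sum_le_sum fun x (_ : x ∈ Finset.univ) => h₃ x
  rw [hammingNorm_eq_sum]
  simp only [Finset.sum_add_distrib, ← Finset.mul_sum] at h₄ h₅ h₆ ⊢
  rw [sum_step (b 2) 0] at h₅
  rw [sum_step (b 3) 1] at h₆
  omega

theorem estTwo_step (x : Site L) {k : ℕ} (hk : k < 4) :
    estTwo B s ((torusGrid L).step k x) ((k + 2) % 4) = estTwo B s x k := by
  rw [estTwo_old x hk, estTwo_old _ (Nat.mod_lt _ (by norm_num)), estEdge, estEdge]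
  have h4 : ((k + 2) % 4 + 2) % 4 = k := by omega
  have hk' : kept (torusGrid L) boolLogic (inB B) ((k + 2) % 4) ((torusGrid L).step k x) =
      kept (torusGrid L) boolLogic (inB B) k x := by
    interval_cases k <;>
      simp [kept, torusGrid, Grid.step, boolLogic, Logic.nor]
  simp only [step_step x hk, hk', h4, boolLogic_conj, boolLogic_disj]
  rw [Bool.or_comm]

theorem uns_of_estTwo_old {x : Site L} {k : ℕ} (hk : k < 4) (h : estTwo B s x k = true) :
    uns s x = true ∨ uns s ((torusGrid L).step k x) = true := by
  rw [estTwo_old x hk, estEdge] at h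
  simp only [boolLogic_conj, boolLogic_disj, Logic.diff, Bool.and_eq_true, Bool.or_eq_true] at h
  exact h.2.imp (fun h => h.1.1) (fun h => h.1.1)

theorem uns_of_estTwo_new {x : Site L} {k : ℕ} (hk : k < 4) (h : estTwo B s x (4 + k) = true) :
    uns s x = true := by
  rw [estTwo_new, estNew] at h
  simp only [boolLogic_conj, Logic.diff, Bool.and_eq_true] at h
  have := h.1.2.1
  rwa [cor_uncor x hk] at this

/-- The share of the check `x` in the estimate in slot `j`. -/
noncomputable def slotShare (B : Finset (Site L)) (s : Site L → ZMod 2) (j : ℕ) (x : Site L) : ℕ :=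
  if estTwo B s x j then share s x else 0

/-- An estimated edge has an unsatisfied end. If both ends are unsatisfied they contribute 1 each.
If only one is, then by `NoDefect.old` it has no unsatisfied neighbour and contributes 2. -/
theorem two_le_slotShare (h : NoDefect B s) {x : Site L} {k : ℕ} (hk : k < 4)
    (hT : estTwo B s x k = true) :
    2 ≤ slotShare B s k x + slotShare B s ((k + 2) % 4) ((torusGrid L).step k x) := by
  have hT' := (estTwo_step x hk).trans hT
  rw [slotShare, slotShare, if_pos hT, if_pos hT']
  cases hx : uns s x <;> cases hy : uns s ((torusGrid L).step k x)
  · rcases uns_of_estTwo_old hk hT with h | h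
    · rw [hx] at h; simp at h
    · rw [hy] at h; simp at h
  · rw [share_of_sat hx, zero_add, share, if_pos hy, if_neg]
    intro hn
    have := h.old _ hy hn _ (Nat.mod_lt _ (by norm_num)) hT'
    rw [step_step x hk, hx] at this
    simp at this
  · rw [share_of_sat hy, add_zero, share, if_pos hx, if_neg]
    intro hn
    have := h.old _ hx hn _ hk hT
    rw [hy] at this
    simp at this
  · rw [(share_of_adjacent hk hx hy).1, (share_of_adjacent hk hx hy).2]

/-- By parity either all four new edges are estimated, with share at least 1 at each corner, or
exactly two are, and then `NoDefect.new` makes both shares equal to 2. A total of 4 pays for two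
sides of the plaquette, which is all that `exists_cover` needs. -/
theorem four_le_slotShare (h : NoDefect B s) (p : Site L)
    (hT : ∃ k < 4, estTwo B s ((torusGrid L).cor k p) (4 + k) = true) :
    4 ≤ ∑ k ∈ Finset.range 4, slotShare B s (4 + k) ((torusGrid L).cor k p) := by
  have hm := h.mid p
  rw [sum_range_four] at hm
  by_cases hall : ∀ k < 4, estTwo B s ((torusGrid L).cor k p) (4 + k) = true
  · calc 4 = ∑ k ∈ Finset.range 4, 1 := by simp
      _ ≤ _ := Finset.sum_le_sum fun k hk => by
        have hk := Finset.mem_range.1 hk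
        rw [slotShare, if_pos (hall k hk)]
        exact one_le_share (uns_of_estTwo_new hk (hall k hk))
  · have hs : ∀ k < 4, slotShare B s (4 + k) ((torusGrid L).cor k p) =
        2 * (estTwo B s ((torusGrid L).cor k p) (4 + k)).toNat := by
      intro k hk
      rw [slotShare]
      split_ifs with hT
      · rw [hT, share, if_pos (uns_of_estTwo_new hk hT), if_neg]
        · rfl
        · intro hn
          have := h.new _ (uns_of_estTwo_new hk hT) hn k hk hT
          rw [uncor_cor p hk] at this
          exact hall this
      · rw [Bool.eq_false_iff.2 hT]; rfl
    rcases two_or_four _ _ _ _ hm (by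
      obtain ⟨k, hk, h⟩ := hT
      interval_cases k <;> rw [h] <;> simp) with h | h
    · exfalso
      simp only [Bool.and_eq_true] at h
      refine hall fun k hk => ?_
      interval_cases k
      exacts [h.1, h.2.1, h.2.2.1, h.2.2.2]
    · rw [Finset.sum_congr rfl fun k hk => hs k (Finset.mem_range.1 hk), ← Finset.mul_sum,
        sum_range_four, h]
      exact le_rfl

/-- No share is spent twice, since an unsatisfied check has at most one estimated edge. -/
theorem sum_slotShare_le (h : NoDefect B s) (x : Site L) :
    ∑ j ∈ Finset.range 8, slotShare B s j x ≤ share s x := by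
  have : ∀ j, slotShare B s j x = (estTwo B s x j).toNat * share s x := by
    intro j
    rw [slotShare]
    cases estTwo B s x j <;> simp
  simp only [this]
  rw [← Finset.sum_mul]
  cases hx : uns s x
  · rw [share_of_sat hx, mul_zero]
  · calc _ ≤ 1 * share s x := Nat.mul_le_mul_right _ (h.unique x hx)
      _ = _ := one_mul _

end Weights


/-! ### Lifting the estimate after two iterations to an error on the original qubits. -/

section Lift

variable {L : ℕ} {B : Finset (Site L)} {s : Site L → ZMod 2}

/-- The error with values `f` on the sides of blown-up plaquettes and values `t` elsewhere. -/
def lift (B : Finset (Site L)) (f : Site L → Fin 4 → ZMod 2) (t : Qubit L → ZMod 2) :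
    Qubit L → ZMod 2 :=
  Sum.elim
    (fun x => if x ∈ B then f x 0 else
      if (torusGrid L).up x ∈ B then f ((torusGrid L).up x) 2 else t (Sum.inl x))
    (fun x => if x ∈ B then f x 3 else
      if (torusGrid L).lf x ∈ B then f ((torusGrid L).lf x) 1 else t (Sum.inr x))

theorem lift_side (hL : 1 < L) (hB : Independent B) (f : Site L → Fin 4 → ZMod 2)
    (t : Qubit L → ZMod 2) {p : Site L} (hp : p ∈ B) (k : Fin 4) :
    lift B f t (side p k) = f p k := by
  fin_cases k
  · exact if_pos hp
  · have h₁ : (p.1, p.2 + 1) ∉ B := hB.not_mem hL (by simp [torusGrid]) hp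
    have h₂ : (torusGrid L).lf (p.1, p.2 + 1) = p := by simp [torusGrid]
    change (if (p.1, p.2 + 1) ∈ B then _ else _) = _
    rw [if_neg h₁, h₂, if_pos hp]
    rfl
  · have h₁ : (p.1 + 1, p.2) ∉ B := hB.not_mem hL (by simp [torusGrid]) hp
    have h₂ : (torusGrid L).up (p.1 + 1, p.2) = p := by simp [torusGrid]
    change (if (p.1 + 1, p.2) ∈ B then _ else _) = _
    rw [if_neg h₁, h₂, if_pos hp]
    rfl
  · exact if_pos hp

theorem lift_old (f : Site L → Fin 4 → ZMod 2) (t : Qubit L → ZMod 2) {q : Qubit L}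
    (hq : ∀ p ∈ B, ∀ k, side p k ≠ q) : lift B f t q = t q := by
  rcases q with x | x
  · have h := (side_ne_inl_iff x).1 hq
    exact (if_neg h.1).trans (if_neg h.2)
  · have h := (side_ne_inr_iff x).1 hq
    exact (if_neg h.1).trans (if_neg h.2)

theorem changeVars_lift (hL : 1 < L) (hB : Independent B) (f : Site L → Fin 4 → ZMod 2)
    (t : Qubit L → ZMod 2) {y : BlowupEdge B → ZMod 2}
    (h₁ : ∀ q, y (Sum.inl q) = t q.1)
    (h₂ : ∀ p k, y (Sum.inr (p, k)) = f p.1 (k - 1) + f p.1 k) :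
    changeVars B (lift B f t) = y := by
  funext v
  rcases v with q | ⟨p, k⟩
  · exact (lift_old f t q.2).trans (h₁ q).symm
  · rw [h₂, changeVars, lift_side hL hB f t p.2, lift_side hL hB f t p.2]

theorem qubit_eq (q : Qubit L) : ∃ x, ∃ j < 4, q = qubitAt x j := by
  rcases q with x | x
  · exact ⟨x, 0, by norm_num, rfl⟩
  · exact ⟨x, 1, by norm_num, rfl⟩

theorem mem_slots_of_old {q : {q : Qubit L // ∀ p ∈ B, ∀ k, side p k ≠ q}} {x : Site L} {j : ℕ}
    (hj : j < 4) (hq : q.1 = qubitAt x j) : j ∈ slots B x :=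
  mem_slots.2 ⟨by omega, (side_ne_qubitAt_iff x hj).1 (hq ▸ q.2)⟩

theorem mem_slots_of_new (p : {p : Site L // p ∈ B}) (k : Fin 4) :
    4 + k.1 ∈ slots B ((torusGrid L).cor k p.1) := by
  refine mem_slots.2 ⟨by omega, ?_⟩
  rw [slotUsed, if_neg (by omega), Nat.add_sub_cancel_left, uncor_cor _ k.2]
  simp

theorem sum_slots (x : Site L) : ∑ j ∈ slots B x, (if estTwo B s x j then 1 else 0 : ZMod 2) =
    ∑ j ∈ Finset.range 8, bit2 (estTwo B s x j) := by
  rw [slots, Finset.sum_filter]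
  refine Finset.sum_congr rfl fun j hj => ?_
  split_ifs with h₁ h₂
  · rw [h₂]; rfl
  · rw [Bool.eq_false_iff.2 h₂]; rfl
  · rw [estTwo_eq_false x (Finset.mem_range.1 hj) fun h => h₁ (mem_slots.1 h).2]; rfl

theorem estTwo_eq_false_of_not_mem {p : Site L} (hp : p ∉ B) {k : ℕ} (hk : k < 4) :
    estTwo B s ((torusGrid L).cor k p) (4 + k) = false := by
  refine estTwo_eq_false _ (by omega) fun h => hp ?_
  have := (mem_slots.1 h).2
  rw [slotUsed, if_neg (by omega), Nat.add_sub_cancel_left, uncor_cor p hk] at this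
  simpa using this

variable [NeZero L]

theorem estimate_eq_of_slots (hL : 1 < L) {i i' : ℕ}
    (h : ∀ x, ∀ j ∈ slots B x, siteEst B s i x j = siteEst B s i' x j) :
    msEstimate (blowupH B) (blowupSyndrome B s) i = msEstimate (blowupH B) (blowupSyndrome B s) i' := by
  funext v
  rcases v with q | ⟨p, k⟩
  · obtain ⟨x, j, hj, hq⟩ := qubit_eq q.1
    rw [msEstimate_old hL i hj hq, msEstimate_old hL i' hj hq, h x j (mem_slots_of_old hj hq)]
  · have hp := (uncor_cor p.1 k.2).symm
    rw [msEstimate_new hL i hp, msEstimate_new hL i' hp, h _ _ (mem_slots_of_new p k)]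

theorem NoDefect.solves_two (hL : 1 < L) (hB : Independent B) (h : NoDefect B s) :
    (blowupH B).mulVec (msEstimate (blowupH B) (blowupSyndrome B s) 2) = blowupSyndrome B s := by
  funext c
  rcases c with x | p
  · have h₂ : ∀ j ∈ slots B x, siteEst B s 2 x j = if estTwo B s x j then 1 else 0 :=
      fun j hj => siteEst_two hL hB x hj
    rw [mulVec_msEstimate_site hL, Finset.sum_congr rfl h₂, sum_slots, h.site]
    rfl
  · have h₂ : ∀ k ∈ Finset.range 4, siteEst B s 2 ((torusGrid L).cor k p.1) (4 + k) =
        bit2 (estTwo B s ((torusGrid L).cor k p.1) (4 + k)) :=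
      fun k hk => siteEst_two hL hB _ (mem_slots_of_new p ⟨k, Finset.mem_range.1 hk⟩)
    rw [mulVec_msEstimate_mid hL, Finset.sum_congr rfl h₂]
    exact h.mid p.1

/-- If the estimate already solves the syndrome after one iteration, it does not change. -/
theorem NoDefect.one_eq_two (hL : 1 < L) (hB : Independent B) (h : NoDefect B s)
    (h₁ : (blowupH B).mulVec (msEstimate (blowupH B) (blowupSyndrome B s) 1) = blowupSyndrome B s)
    (x : Site L) {j : ℕ} (hj : j ∈ slots B x) : siteEst B s 1 x j = siteEst B s 2 x j := by
  -- After one iteration the estimate consists of the old edges between unsatisfied checks. If it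
  -- solves the syndrome, then an unsatisfied check has an odd number of unsatisfied neighbours
  -- along its edges, and at most two, hence exactly one.
  have key : ∀ x, uns s x = true → (∀ k < 4, unsatElse (torusGrid L) boolLogic (uns s) (inB B) k x =
      !unsat (torusGrid L) boolLogic (uns s) (inB B) k x) ∧
      unsatAny (torusGrid L) boolLogic (uns s) (inB B) x = true := by
    intro x hx
    have hc := congrFun h₁ (Sum.inl x)
    rw [mulVec_msEstimate_site hL] at hc
    have hu : ∑ j ∈ slots B x, siteEst B s 1 x j =
        ∑ j ∈ Finset.range 4, bit2 (unsat (torusGrid L) boolLogic (uns s) (inB B) j x) := by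
      have : Finset.range 4 = (Finset.range 8).filter fun j => j < 4 := by decide
      rw [slots, Finset.sum_filter, this, Finset.sum_filter]
      refine Finset.sum_congr rfl fun j _ => ?_
      rw [siteEst_one hL hB]
      by_cases h4 : j < 4
      · rw [unsat_eq x h4]
        simp only [hx, h4, true_and, if_true]
        cases slotUsed B x j <;> simp [bit2]
      · simp [h4]
    rw [hu, sum_range_four] at hc
    obtain ⟨e₀, e₁, e₂, e₃, e₄⟩ := else_eq_not _ _ _ _ (h.three x hx) (hc.trans (uns_eq_true.1 hx))
    refine ⟨fun k hk => ?_, e₄⟩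
    interval_cases k
    exacts [e₀, e₁, e₂, e₃]
  obtain ⟨h8, hu⟩ := mem_slots.1 hj
  rw [siteEst_one hL hB, siteEst_two hL hB x hj]
  by_cases h4 : j < 4
  · have hu' := hu
    rw [slotUsed, if_pos h4] at hu'
    have hl : (j + 2) % 4 < 4 := Nat.mod_lt _ (by norm_num)
    have hul : slotUsed B ((torusGrid L).step j x) ((j + 2) % 4) = true := by
      rw [slotUsed, if_pos hl, ← hu']
      clear hj hu hu'
      interval_cases j <;> simp [kept, torusGrid, Grid.step, boolLogic, Logic.nor]
    rw [estTwo_old x h4, estEdge, hu']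
    simp only [boolLogic_conj, boolLogic_disj, Logic.diff, boolLogic_neg, Bool.true_and]
    cases hx : uns s x <;> cases hy : uns s ((torusGrid L).step j x)
    · simp
    · rw [(key _ hy).1 _ hl, unsat_eq _ hl, step_step x h4, hx]
      simp
    · rw [(key _ hx).1 _ h4, unsat_eq _ h4, hy]
      simp
    · rw [(key _ hx).1 _ h4, unsat_eq _ h4, hy, (key _ hy).1 _ hl, unsat_eq _ hl, step_step x h4,
        hx, hu, hul]
      simp [h4]
  · obtain ⟨k, rfl⟩ : ∃ k, j = 4 + k := ⟨j - 4, by omega⟩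
    have hT : estTwo B s x (4 + k) = false := by
      by_contra hn
      have hn' : estTwo B s x (4 + k) = true := by simpa using hn
      have hx := uns_of_estTwo_new (by omega) hn'
      rw [estTwo_new, estNew, cor_uncor x (by omega)] at hn'
      simp only [boolLogic_conj, Logic.diff, (key x hx).2, boolLogic_neg] at hn'
      simp at hn'
    rw [hT, if_neg fun h => h4 h.1]
    rfl

/-- The estimate after two iterations is the image of an error of small weight. -/
theorem NoDefect.exists_lift (hL : 1 < L) (hB : Independent B) (h : NoDefect B s) :
    ∃ e', changeVars B e' = msEstimate (blowupH B) (blowupSyndrome B s) 2 ∧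
      2 * hammingNorm e' ≤ ∑ x, share s x := by
  classical
  let n : Site L → Fin 4 → ZMod 2 := fun p k =>
    bit2 (estTwo B s ((torusGrid L).cor k p) (4 + k))
  have hn : ∀ p, (n p 0 + n p 1) + (n p 2 + n p 3) = 0 := fun p => by
    have := h.mid p
    rwa [sum_range_four] at this
  -- The values on the four sides are determined by the new edges up to adding the plaquette; of the
  -- two choices, one with at most two nonzero sides is taken.
  choose f hf hf2 hf0 using fun p => exists_cover (n p) (hn p)
  let t : Qubit L → ZMod 2 := Sum.elim (fun x => bit2 (estTwo B s x 0)) fun x => bit2 (estTwo B s x 1)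
  refine ⟨lift B f t, changeVars_lift hL hB f t ?_ ?_, ?_⟩
  · rintro ⟨x | x, hq⟩
    · have hx : (⟨Sum.inl x, hq⟩ : {q : Qubit L // ∀ p ∈ B, ∀ k, side p k ≠ q}).1 = qubitAt x 0 := rfl
      rw [msEstimate_old hL 2 (by norm_num) hx, siteEst_two hL hB x (mem_slots_of_old (by norm_num) hx)]
      rfl
    · have hx : (⟨Sum.inr x, hq⟩ : {q : Qubit L // ∀ p ∈ B, ∀ k, side p k ≠ q}).1 = qubitAt x 1 := rfl
      rw [msEstimate_old hL 2 (by norm_num) hx, siteEst_two hL hB x (mem_slots_of_old (by norm_num) hx)]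
      rfl
  · intro p k
    rw [msEstimate_new hL 2 (uncor_cor p.1 k.2).symm, siteEst_two hL hB _ (mem_slots_of_new p k), hf]
    rfl
  -- Edges of the lift come from sides of plaquettes, counted by `c`, and from old edges, counted by
  -- `d`. Twice each count is bounded by slot shares, whose sum at a check is at most its share;
  -- shifting the summation by one site collects the shares at both ends of an edge.
  · let c : Fin 4 → Site L → ℕ := fun k p => if f p k ≠ 0 then 1 else 0
    let d : ℕ → Site L → ℕ := fun j x => if bit2 (estTwo B s x j) ≠ 0 then 1 else 0
    have hd : ∀ x, ∀ j < 4, 2 * d j x ≤ slotShare B s j x +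
        slotShare B s ((j + 2) % 4) ((torusGrid L).step j x) := by
      intro x j hj
      cases hT : estTwo B s x j
      · simp [d, hT, bit2]
      · have := two_le_slotShare h hj hT
        simpa [d, hT, bit2] using this
    have hc : ∀ p, 2 * (c 0 p + c 1 p + c 2 p + c 3 p) ≤
        ∑ k ∈ Finset.range 4, slotShare B s (4 + k) ((torusGrid L).cor k p) := by
      intro p
      have h2 := hf2 p
      rw [Finset.card_filter, Fin.sum_univ_four] at h2
      by_cases hT : ∃ k < 4, estTwo B s ((torusGrid L).cor k p) (4 + k) = true
      · have := four_le_slotShare h p hT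
        simp only [c]
        omega
      · have : n p = 0 := by
          funext k
          have : estTwo B s ((torusGrid L).cor k p) (4 + k) = false := by
            by_contra hn
            exact hT ⟨k, k.2, by simpa using hn⟩
          simp only [n, this]
          rfl
        simp [c, hf0 p this]
    have hc0 : ∀ p ∉ B, ∀ k, f p k = 0 := by
      intro p hp k
      have : n p = 0 := by
        funext k
        simp only [n, estTwo_eq_false_of_not_mem hp k.2]
        rfl
      rw [hf0 p this]; rfl
    have hl : ∀ x, (if lift B f t (Sum.inl x) ≠ 0 then 1 else 0) ≤
        c 0 x + c 2 ((torusGrid L).step 3 x) + d 0 x := by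
      intro x
      by_cases h₁ : x ∈ B
      · rw [show lift B f t (Sum.inl x) = f x 0 from if_pos h₁]
        exact Nat.le_add_right_of_le (Nat.le_add_right _ _)
      · by_cases h₂ : (torusGrid L).up x ∈ B
        · rw [show lift B f t (Sum.inl x) = f ((torusGrid L).up x) 2 from
            (if_neg h₁).trans (if_pos h₂)]
          exact Nat.le_add_right_of_le (Nat.le_add_left _ _)
        · rw [show lift B f t (Sum.inl x) = t (Sum.inl x) from (if_neg h₁).trans (if_neg h₂)]
          exact Nat.le_add_left _ _
    have hr : ∀ x, (if lift B f t (Sum.inr x) ≠ 0 then 1 else 0) ≤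
        c 3 x + c 1 ((torusGrid L).step 2 x) + d 1 x := by
      intro x
      by_cases h₁ : x ∈ B
      · rw [show lift B f t (Sum.inr x) = f x 3 from if_pos h₁]
        exact Nat.le_add_right_of_le (Nat.le_add_right _ _)
      · by_cases h₂ : (torusGrid L).lf x ∈ B
        · rw [show lift B f t (Sum.inr x) = f ((torusGrid L).lf x) 1 from
            (if_neg h₁).trans (if_pos h₂)]
          exact Nat.le_add_right_of_le (Nat.le_add_left _ _)
        · rw [show lift B f t (Sum.inr x) = t (Sum.inr x) from (if_neg h₁).trans (if_neg h₂)]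
          exact Nat.le_add_left _ _
    rw [hammingNorm_eq_sum]
    have e₁ := Finset.sum_le_sum fun x (_ : x ∈ Finset.univ) => hl x
    have e₂ := Finset.sum_le_sum fun x (_ : x ∈ Finset.univ) => hr x
    have e₃ := Finset.sum_le_sum fun x (_ : x ∈ Finset.univ) => hd x 0 (by norm_num)
    have e₄ := Finset.sum_le_sum fun x (_ : x ∈ Finset.univ) => hd x 1 (by norm_num)
    have e₅ := Finset.sum_le_sum fun x (_ : x ∈ Finset.univ) => hc x
    have e₆ := Finset.sum_le_sum fun x (_ : x ∈ Finset.univ) => sum_slotShare_le h x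
    simp only [sum_range_eight] at e₆
    simp only [sum_range_four] at e₅
    simp only [Finset.sum_add_distrib, ← Finset.mul_sum] at e₁ e₂ e₃ e₄ e₅ e₆ ⊢
    rw [sum_step (c 2) 3] at e₁
    rw [sum_step (c 1) 2] at e₂
    rw [sum_step (slotShare B s ((0 + 2) % 4)) 0] at e₃
    rw [sum_step (slotShare B s ((1 + 2) % 4)) 1] at e₄
    rw [sum_cor (slotShare B s (4 + 0)) (by norm_num), sum_cor (slotShare B s (4 + 1)) (by norm_num),
      sum_cor (slotShare B s (4 + 2)) (by norm_num), sum_cor (slotShare B s (4 + 3)) (by norm_num)]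
      at e₅
    norm_num at e₃ e₄ e₅
    omega

theorem NoDefect.corrects (hd : 7 ≤ toricDistance L) {e : Qubit L → ZMod 2}
    (he : hammingNorm e ≤ 3) (hs : (toricH L).mulVec e = s) (hBs : blowupSet s = B)
    (hB : Independent B) (h : NoDefect B s) : SBMSCorrects e := by
  have hL : 1 < L := by have := seven_le_of_distance hd; omega
  obtain ⟨e', h₁, h₂⟩ := h.exists_lift hL hB
  have h₃ := sum_share_le hs
  refine corrects_of_estimates hd he hs hBs hB 2 (h.solves_two hL hB) fun j hj hsol => ?_
  interval_cases j
  -- At iteration `0` the estimate is zero; if it solves the syndrome it is the image of the zero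
  -- error.
  · refine ⟨0, ?_, by simp⟩
    funext v
    rcases v with q | ⟨p, k⟩
    · obtain ⟨x, j, hj, hq⟩ := qubit_eq q.1
      rw [msEstimate_old hL 0 hj hq, siteEst_zero]
      rfl
    · rw [msEstimate_new hL 0 (uncor_cor p.1 k.2).symm, siteEst_zero]
      exact add_zero 0
  · refine ⟨e', ?_, by omega⟩
    rw [h₁]
    exact estimate_eq_of_slots hL fun x j hj => (h.one_eq_two hL hB hsol x hj).symm
  · exact ⟨e', h₁, by omega⟩

/-- An error whose syndrome is nowhere bad is corrected. -/
theorem corrects_of_not_bad (hd : 7 ≤ toricDistance L) {e : Qubit L → ZMod 2}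
    (he : hammingNorm e ≤ 3)
    (h : ∀ x, bad (torusGrid L) boolLogic (uns ((toricH L).mulVec e)) x = false) :
    SBMSCorrects e := by
  have hL : 1 < L := by have := seven_le_of_distance hd; omega
  obtain ⟨hB, hi⟩ := blowupSet_spec hL ((toricH L).mulVec e)
  have h' := fun x => Bool.or_eq_false_iff.1 (h x)
  have hb := eq_blown hL hi fun x => (h' x).1
  refine NoDefect.corrects hd he rfl rfl hB (noDefect fun x => ?_)
  rw [hb]
  exact (h' x).2

end Lift


/-! ### Formulas preserve relations between grids and logics -/

/-- A relation between the points of two grids that is preserved by the shifts. -/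
structure Grid.Rel {X Y : Type} (g : Grid X) (g' : Grid Y) (ρ : X → Y → Prop) : Prop where
  rt : ∀ {x y}, ρ x y → ρ (g.rt x) (g'.rt y)
  dn : ∀ {x y}, ρ x y → ρ (g.dn x) (g'.dn y)
  lf : ∀ {x y}, ρ x y → ρ (g.lf x) (g'.lf y)
  up : ∀ {x y}, ρ x y → ρ (g.up x) (g'.up y)

/-- A relation between truth values that is preserved by the connectives. -/
structure Logic.Rel {α β : Type} (o : Logic α) (o' : Logic β) (R : α → β → Prop) : Prop where
  conj : ∀ {a a' b b'}, R a b → R a' b' → R (o.conj a a') (o'.conj b b')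
  disj : ∀ {a a' b b'}, R a b → R a' b' → R (o.disj a a') (o'.disj b b')
  sum : ∀ {a a' b b'}, R a b → R a' b' → R (o.sum a a') (o'.sum b b')
  neg : ∀ {a b}, R a b → R (o.neg a) (o'.neg b)

namespace Logic.Rel

variable {α β : Type} {o : Logic α} {o' : Logic β} {R : α → β → Prop} (hR : o.Rel o' R)
include hR

variable {a b c d : α} {a' b' c' d' : β}

theorem disj4 (h₁ : R a a') (h₂ : R b b') (h₃ : R c c') (h₄ : R d d') :
    R (o.disj4 a b c d) (o'.disj4 a' b' c' d') := hR.disj (hR.disj h₁ h₂) (hR.disj h₃ h₄)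

theorem conj4 (h₁ : R a a') (h₂ : R b b') (h₃ : R c c') (h₄ : R d d') :
    R (o.conj4 a b c d) (o'.conj4 a' b' c' d') := hR.conj (hR.conj h₁ h₂) (hR.conj h₃ h₄)

theorem sum4 (h₁ : R a a') (h₂ : R b b') (h₃ : R c c') (h₄ : R d d') :
    R (o.sum4 a b c d) (o'.sum4 a' b' c' d') := hR.sum (hR.sum h₁ h₂) (hR.sum h₃ h₄)

theorem nor (h₁ : R a a') (h₂ : R b b') : R (o.nor a b) (o'.nor a' b') := hR.neg (hR.disj h₁ h₂)

theorem diff (h₁ : R a a') (h₂ : R b b') : R (o.diff a b) (o'.diff a' b') :=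
  hR.conj h₁ (hR.neg h₂)

theorem three (h₁ : R a a') (h₂ : R b b') (h₃ : R c c') (h₄ : R d d') :
    R (o.three a b c d) (o'.three a' b' c' d') :=
  hR.disj (hR.conj (hR.conj h₁ h₂) (hR.disj h₃ h₄)) (hR.conj (hR.conj h₃ h₄) (hR.disj h₁ h₂))

theorem two (h₁ : R a a') (h₂ : R b b') (h₃ : R c c') (h₄ : R d d') :
    R (o.two a b c d) (o'.two a' b' c' d') :=
  hR.disj (hR.disj (hR.conj h₁ h₂) (hR.conj h₃ h₄)) (hR.conj (hR.disj h₁ h₂) (hR.disj h₃ h₄))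

end Logic.Rel

namespace Grid.Rel

variable {X Y : Type} {g : Grid X} {g' : Grid Y} {ρ : X → Y → Prop} (hρ : g.Rel g' ρ)
include hρ

theorem step {x : X} {y : Y} (h : ρ x y) (k : ℕ) : ρ (g.step k x) (g'.step k y) :=
  match k with
  | 0 => hρ.rt h
  | 1 => hρ.dn h
  | 2 => hρ.lf h
  | _ + 3 => hρ.up h

theorem cor {x : X} {y : Y} (h : ρ x y) (k : ℕ) : ρ (g.cor k x) (g'.cor k y) :=
  match k with
  | 0 => h
  | 1 => hρ.rt h
  | 2 => hρ.dn (hρ.rt h)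
  | _ + 3 => hρ.dn h

theorem uncor {x : X} {y : Y} (h : ρ x y) (k : ℕ) : ρ (g.uncor k x) (g'.uncor k y) :=
  match k with
  | 0 => h
  | 1 => hρ.lf h
  | 2 => hρ.up (hρ.lf h)
  | _ + 3 => hρ.up h

variable {α β : Type} {o : Logic α} {o' : Logic β} {R : α → β → Prop} (hR : o.Rel o' R)
include hR

section Patterns

variable {S : X → α} {S' : Y → β} (hS : ∀ {x y}, ρ x y → R (S x) (S' y))
include hS

theorem patA {x : X} {y : Y} (h : ρ x y) : R (patA g o S x) (patA g' o' S' y) := by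
  have c₁ := hS h
  have c₂ := hS (hρ.rt h)
  have c₃ := hS (hρ.dn (hρ.rt h))
  have c₄ := hS (hρ.dn h)
  exact hR.disj (hR.conj4 c₁ c₂ c₃ c₄) (hR.disj
    (hR.conj (hR.conj4 (hR.neg c₁) c₂ (hR.neg c₃) c₄) (hR.neg (hR.sum4 (hS (hρ.up (hρ.rt h)))
      (hS (hρ.rt (hρ.rt h))) (hS (hρ.lf (hρ.dn h))) (hS (hρ.dn (hρ.dn h))))))
    (hR.conj (hR.conj4 c₁ (hR.neg c₂) c₃ (hR.neg c₄)) (hR.neg (hR.sum4 (hS (hρ.lf h))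
      (hS (hρ.up h)) (hS (hρ.rt (hρ.dn (hρ.rt h)))) (hS (hρ.dn (hρ.dn (hρ.rt h))))))))

theorem patB {x : X} {y : Y} (h : ρ x y) : R (patB g o S x) (patB g' o' S' y) := by
  have c₁ := hS h
  have c₂ := hS (hρ.rt h)
  have c₃ := hS (hρ.dn (hρ.rt h))
  have c₄ := hS (hρ.dn h)
  exact hR.disj (hR.conj4 (hR.neg c₁) c₂ (hR.neg c₃) c₄) (hR.conj4 c₁ (hR.neg c₂) c₃ (hR.neg c₄))

theorem patC {x : X} {y : Y} (h : ρ x y) : R (patC g o S x) (patC g' o' S' y) := by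
  have c₁ := hS h
  have c₂ := hS (hρ.rt h)
  have c₃ := hS (hρ.dn (hρ.rt h))
  have c₄ := hS (hρ.dn h)
  have c₁₁ := hS (hρ.rt (hρ.rt h))
  have c₁₂ := hS (hρ.rt (hρ.dn (hρ.rt h)))
  have c₁₄ := hS (hρ.dn (hρ.dn (hρ.rt h)))
  have c₁₅ := hS (hρ.dn (hρ.dn h))
  exact hR.disj4 (hR.conj (hR.conj c₁ c₁₂) (hR.neg (hR.disj4 c₂ c₁₁ c₄ c₃)))
    (hR.conj (hR.conj c₁₁ c₄) (hR.neg (hR.disj4 c₁ c₂ c₃ c₁₂)))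
    (hR.conj (hR.conj c₁ c₁₄) (hR.neg (hR.disj4 c₂ c₄ c₃ c₁₅)))
    (hR.conj (hR.conj c₂ c₁₅) (hR.neg (hR.disj4 c₁ c₄ c₃ c₁₄)))

theorem adjSome {x : X} {y : Y} (h : ρ x y) : R (adjSome g o S x) (adjSome g' o' S' y) :=
  hR.disj4 (hS (hρ.rt h)) (hS (hρ.dn h)) (hS (hρ.lf h)) (hS (hρ.up h))

theorem kept {x : X} {y : Y} (h : ρ x y) (k : ℕ) : R (kept g o S k x) (kept g' o' S' k y) :=
  match k with
  | 0 => hR.nor (hS h) (hS (hρ.up h))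
  | 1 => hR.nor (hS h) (hS (hρ.lf h))
  | 2 => hR.nor (hS (hρ.lf h)) (hS (hρ.up (hρ.lf h)))
  | _ + 3 => hR.nor (hS (hρ.up h)) (hS (hρ.lf (hρ.up h)))

end Patterns

section Blown

variable {P Q A : X → α} {P' Q' A' : Y → β} (hP : ∀ {x y}, ρ x y → R (P x) (P' y))
  (hQ : ∀ {x y}, ρ x y → R (Q x) (Q' y)) (hA : ∀ {x y}, ρ x y → R (A x) (A' y))
include hP hQ hA

theorem blown {x : X} {y : Y} (h : ρ x y) : R (blown g o P Q A x) (blown g' o' P' Q' A' y) :=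
  hR.disj (hP h) (hR.diff (hR.disj (hQ h) (hR.diff (hA h) (hρ.adjSome hR hQ h)))
    (hρ.adjSome hR hP h))

theorem conflict {x : X} {y : Y} (h : ρ x y) :
    R (conflict g o P Q A x) (conflict g' o' P' Q' A' y) := by
  have hq : ∀ {x y}, ρ x y → R _ _ := fun {x y} (h : ρ x y) =>
    hR.diff (hQ h) (hR.disj (hP h) (hρ.adjSome hR hP h))
  have hr : ∀ {x y}, ρ x y → R _ _ := fun {x y} (h : ρ x y) =>
    hR.diff (hA h) (hR.disj4 (hP h) (hQ h) (hρ.adjSome hR hP h) (hρ.adjSome hR hQ h))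
  exact hR.disj4 (hR.conj (hP h) (hR.disj (hP (hρ.rt h)) (hP (hρ.dn h))))
    (hR.conj (hq h) (hR.disj (hq (hρ.rt h)) (hq (hρ.dn h))))
    (hR.conj (hr h) (hR.disj (hr (hρ.rt h)) (hr (hρ.dn h))))
    (hR.conj (hR.diff (hA h) (hR.disj (hR.disj (hP h) (hQ h)) (hρ.adjSome hR hP h)))
      (hρ.adjSome hR (fun h => hR.conj (hQ h) (hρ.adjSome hR hP h)) h))

theorem invalid {B : X → α} {B' : Y → β} (hB : ∀ {x y}, ρ x y → R (B x) (B' y)) {x : X} {y : Y}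
    (h : ρ x y) : R (invalid g o P Q A B x) (invalid g' o' P' Q' A' B' y) :=
  hR.disj4
    (hR.conj (hB h) (hR.disj (hρ.adjSome hR hB h)
      (hR.neg (hR.disj (hP h) (hR.disj (hQ h) (hA h))))))
    (hR.diff (hP h) (hR.disj (hB h) (hρ.adjSome hR (fun h => hR.conj (hB h) (hP h)) h)))
    (hR.diff (hQ h) (hR.disj (hB h) (hρ.adjSome hR
      (fun h => hR.conj (hB h) (hR.disj (hP h) (hQ h))) h)))
    (hR.diff (hA h) (hR.disj (hB h) (hρ.adjSome hR hB h)))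

end Blown

section Estimates

variable {S B : X → α} {S' B' : Y → β} (hS : ∀ {x y}, ρ x y → R (S x) (S' y))
  (hB : ∀ {x y}, ρ x y → R (B x) (B' y))
include hS hB

theorem unsat {x : X} {y : Y} (h : ρ x y) (k : ℕ) :
    R (unsat g o S B k x) (unsat g' o' S' B' k y) :=
  hR.conj (hρ.kept hR hB h k) (hS (hρ.step h k))

theorem unsatAny {x : X} {y : Y} (h : ρ x y) : R (unsatAny g o S B x) (unsatAny g' o' S' B' y) :=
  hR.disj4 (hρ.unsat hR hS hB h 0) (hρ.unsat hR hS hB h 1) (hρ.unsat hR hS hB h 2)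
    (hρ.unsat hR hS hB h 3)

theorem unsatElse {x : X} {y : Y} (h : ρ x y) (k : ℕ) :
    R (unsatElse g o S B k x) (unsatElse g' o' S' B' k y) :=
  hR.disj (hρ.unsat hR hS hB h _) (hR.disj (hρ.unsat hR hS hB h _) (hρ.unsat hR hS hB h _))

theorem estEdge {x : X} {y : Y} (h : ρ x y) (k : ℕ) :
    R (estEdge g o S B k x) (estEdge g' o' S' B' k y) := by
  have e := fun {x y} (h : ρ x y) k => hρ.unsatElse hR hS hB h k
  have hy := hρ.step h k
  exact hR.conj (hρ.kept hR hB h k) (hR.disj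
    (hR.conj (hR.diff (hS h) (e h k)) (hR.disj (hS hy) (e hy _)))
    (hR.conj (hR.diff (hS hy) (e hy _)) (hR.disj (hS h) (e h k))))

theorem estNew {x : X} {y : Y} (h : ρ x y) (k : ℕ) :
    R (estNew g o S B k x) (estNew g' o' S' B' k y) :=
  hR.conj (hR.conj (hB h) (hR.diff (hS (hρ.cor h k)) (hρ.unsatAny hR hS hB (hρ.cor h k))))
    (hR.disj (hS (hρ.cor h _)) (hR.disj (hS (hρ.cor h _)) (hS (hρ.cor h _))))

theorem defect {E N : ℕ → X → α} {E' N' : ℕ → Y → β}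
    (hE : ∀ {x y}, ρ x y → ∀ k, R (E k x) (E' k y)) (hN : ∀ {x y}, ρ x y → ∀ k, R (N k x) (N' k y))
    {x : X} {y : Y} (h : ρ x y) : R (defect g o S B E N x) (defect g' o' S' B' E' N' y) := by
  have e := hE h
  have m := fun k => hN (hρ.uncor h k) k
  have u := fun k => hρ.unsat hR hS hB h k
  have lone := fun k => hR.diff (e k) (hS (hρ.step h k))
  have part := fun k => hR.diff (m k) (hR.conj4 (hN (hρ.uncor h k) 0) (hN (hρ.uncor h k) 1)
    (hN (hρ.uncor h k) 2) (hN (hρ.uncor h k) 3))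
  exact hR.disj4
    (hR.sum (hS h) (hR.sum (hR.sum4 (e 0) (e 1) (e 2) (e 3)) (hR.sum4 (m 0) (m 1) (m 2) (m 3))))
    (hR.conj (hS h) (hR.disj4
      (hR.conj (hR.disj4 (e 0) (e 1) (e 2) (e 3)) (hR.disj4 (m 0) (m 1) (m 2) (m 3)))
      (hR.two (e 0) (e 1) (e 2) (e 3)) (hR.two (m 0) (m 1) (m 2) (m 3))
      (hR.three (u 0) (u 1) (u 2) (u 3))))
    (hR.conj (hR.conj (hS h) (hR.disj4 (hS (hρ.rt h)) (hS (hρ.dn h)) (hS (hρ.lf h)) (hS (hρ.up h))))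
      (hR.disj (hR.disj4 (lone 0) (lone 1) (lone 2) (lone 3))
        (hR.disj4 (part 0) (part 1) (part 2) (part 3))))
    (hR.sum4 (hN h 0) (hN h 1) (hN h 2) (hN h 3))

end Estimates

/-- The formula is built from shifts and connectives only. The relations used are: a bit of a word
equals a truth value, integer coordinates name a site of the torus, and two evaluations agree if a
flag is set. -/
theorem bad {S : X → α} {S' : Y → β} (hS : ∀ {x y}, ρ x y → R (S x) (S' y)) {x : X} {y : Y}
    (h : ρ x y) : R (bad g o S x) (bad g' o' S' y) := by
  have hP := fun {x y} => hρ.patA hR hS (x := x) (y := y)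
  have hQ := fun {x y} => hρ.patB hR hS (x := x) (y := y)
  have hA := fun {x y} => hρ.patC hR hS (x := x) (y := y)
  have hB := fun {x y} => hρ.blown hR hP hQ hA (x := x) (y := y)
  exact hR.disj (hρ.conflict hR hP hQ hA h) (hρ.defect hR hS hB
    (fun h k => hρ.estEdge hR hS hB h k) (fun h k => hρ.estNew hR hS hB h k) h)

end Grid.Rel

/-! ### Bits -/

theorem strict_eq {β : Type} (n : ℕ) (k : ℕ → β) : strict n k = k n := rfl

theorem strictRow_eq {β : Type} (f : ℕ → ℕ) (n : ℕ) (acc : List ℕ) (k : List ℕ → β) :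
    strictRow f n acc k = k ((List.range n).map f ++ acc) := by
  induction n generalizing acc with
  | zero => rfl
  | succ n ih =>
    rw [strictRow, strict_eq, ih, List.range_succ, List.map_append, List.append_assoc]
    rfl

theorem strictRows_eq {β : Type} (f : ℕ → ℕ → ℕ) (w n : ℕ) (acc : List (List ℕ))
    (k : List (List ℕ) → β) : strictRows f w n acc k =
      k ((List.range n).map (fun i => (List.range w).map (f i)) ++ acc) := by
  induction n generalizing acc with
  | zero => rfl
  | succ n ih =>
    rw [strictRows, strictRow_eq, ih, List.range_succ, List.map_append, List.append_assoc,
      List.append_nil]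
    rfl

theorem memo_eq {β : Type} (r : ℤ) (w : ℕ) (f : ℤ × ℤ → ℕ) (k : (ℤ × ℤ → ℕ) → β) :
    memo r w f k = k f := by
  rw [memo, strictRows_eq]
  congr 1
  funext u
  rw [lookup2]
  split
  · rename_i i j hi hj
    rw [List.append_nil, List.getElem?_map]
    by_cases hw : i < w
    · rw [List.getElem?_range hw, Option.map_some, Option.bind_some, List.getElem?_map]
      by_cases hw' : j < w
      · rw [List.getElem?_range hw', Option.map_some, Option.getD_some]
        congr 1
        refine Prod.ext ?_ ?_
        · change (i : ℤ) - r = u.1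
          rw [Int.ofNat_eq_natCast] at hi
          omega
        · change (j : ℤ) - r = u.2
          rw [Int.ofNat_eq_natCast] at hj
          omega
      · rw [List.getElem?_eq_none (by simpa using hw')]
        rfl
    · rw [List.getElem?_eq_none (by simpa using hw)]
      rfl
  · rfl

theorem badTable_eq (o : Logic ℕ) (S : ℤ × ℤ → ℕ) : badTable o S = bad latticeGrid o S (0, 0) := by
  simp only [badTable, memo_eq, strict_eq]
  rw [bad]
  congr 2
  · funext k x
    rcases k with _ | _ | k <;> rfl
  · funext k x
    rcases k with _ | _ | _ | _ | k <;> rfl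


section Bits

theorem testBit_lor (a b n : ℕ) : (Nat.lor a b).testBit n = (a.testBit n || b.testBit n) :=
  Nat.testBit_or a b n

theorem testBit_land (a b n : ℕ) : (Nat.land a b).testBit n = (a.testBit n && b.testBit n) :=
  Nat.testBit_and a b n

theorem testBit_xor (a b n : ℕ) : (Nat.xor a b).testBit n = xor (a.testBit n) (b.testBit n) :=
  Nat.testBit_xor a b n

theorem testBit_shiftLeft (a k n : ℕ) :
    (Nat.shiftLeft a k).testBit n = (decide (k ≤ n) && a.testBit (n - k)) :=
  Nat.testBit_shiftLeft a

theorem testBit_shiftRight (a k n : ℕ) : (Nat.shiftRight a k).testBit n = a.testBit (k + n) :=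
  Nat.testBit_shiftRight a

theorem testBit_ones (w n : ℕ) : (ones w).testBit n = decide (n < w) :=
  Nat.testBit_two_pow_sub_one w n

theorem rep_zero (w t : ℕ) : rep w 0 t = 0 := by simp [rep]

/-- The quotient in `rep` is a geometric sum of powers of `2 ^ w`. -/
theorem rep_succ {w : ℕ} (hw : 0 < w) (k t : ℕ) : rep w (k + 1) t = 2 ^ w * rep w k t + t := by
  have h2 : 2 ≤ 2 ^ w := by
    calc 2 = 2 ^ 1 := rfl
      _ ≤ 2 ^ w := Nat.pow_le_pow_right (by norm_num) hw
  have h : ∀ k, rep w k t = t * ∑ i ∈ Finset.range k, (2 ^ w) ^ i := by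
    intro k
    rw [Nat.geomSum_eq h2, ← pow_mul, rep]
  rw [h, h, Finset.sum_range_succ', pow_zero, mul_add, mul_one]
  simp only [pow_succ]
  rw [← Finset.sum_mul]
  ring

theorem testBit_rep {w t : ℕ} (hw : 0 < w) (ht : t < 2 ^ w) (k n : ℕ) :
    (rep w k t).testBit n = (decide (n < w * k) && t.testBit (n % w)) := by
  induction k generalizing n with
  | zero => simp [rep_zero]
  | succ k ih =>
    rw [rep_succ hw, Nat.testBit_two_pow_mul_add _ ht]
    split_ifs with h
    · rw [Nat.mod_eq_of_lt h, decide_eq_true (by rw [Nat.mul_succ]; omega), Bool.true_and]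
    · have h' : n = (n - w) + w := by omega
      rw [ih]
      congr 1
      · rw [decide_eq_decide, Nat.mul_succ]; omega
      · conv_rhs => rw [h', Nat.add_mod_right]

theorem testBit_blockOf {w : ℕ} (hw : 0 < w) (x : ℕ) (l : List ℕ) (n : ℕ) :
    (blockOf w x l).testBit n = decide (l[n / w]? = some x) := by
  induction l generalizing n with
  | nil => simp [blockOf]
  | cons a l ih =>
    rw [blockOf, testBit_lor, testBit_shiftLeft, ih]
    by_cases h : n < w
    · rw [Nat.div_eq_of_lt h, decide_eq_false (by omega : ¬w ≤ n)]
      split_ifs with ha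
      · simp [testBit_ones, h, ha]
      · simp [ha]
    · have h' : n / w = (n - w) / w + 1 := by
        rw [← Nat.add_div_right _ hw]; congr 1; omega
      rw [h', decide_eq_true (by omega : w ≤ n)]
      have : (if a = x then ones w else 0).testBit n = false := by
        split_ifs
        · rw [testBit_ones]; simpa using h
        · simp
      rw [this]
      simp

/-- The last two digits of `n` in base `N` are the indices of the second and third edge. Moving a
run of `N` ones by `x * N` selects the middle digit `x`, and moving the multiples of `N` by `x`
selects the last digit `x`; as `x < N`, nothing spills into the next block of `N ^ 2` bits. -/
theorem testBit_tripleTable {N : ℕ} (near : List ℕ) {x n : ℕ} (hx : x < N)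
    (hn : n < N ^ 2 * near.length) :
    (tripleTable N near (ones (N ^ 2 * near.length)) (rep (N ^ 2) near.length (ones N))
      (rep (N ^ 2) near.length (rep N N 1)) x).testBit n =
      (decide (near[n / N ^ 2]? = some x) || (decide (n / N % N = x) || decide (n % N = x))) := by
  have hN : 0 < N := by omega
  have hN2 : 0 < N ^ 2 := by positivity
  have h1 : ones N < 2 ^ N ^ 2 := by
    have : ones N < 2 ^ N := by unfold ones; have := Nat.two_pow_pos N; omega
    exact this.trans_le (Nat.pow_le_pow_right (by norm_num) (Nat.le_self_pow (by norm_num) N))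
  have h1N : 1 < 2 ^ N := Nat.one_lt_two_pow (by omega)
  have h2 : rep N N 1 < 2 ^ N ^ 2 := by
    refine Nat.lt_pow_two_of_testBit _ fun i hi => ?_
    rw [testBit_rep hN h1N, decide_eq_false (by rw [← sq]; omega)]
    rfl
  rw [tripleTable, testBit_lor, testBit_land, testBit_lor, testBit_blockOf hN2, testBit_ones,
    decide_eq_true hn, Bool.true_and, testBit_shiftLeft, testBit_shiftLeft, testBit_rep hN2 h1,
    testBit_rep hN2 h2, testBit_rep hN h1N, testBit_ones]
  congr 2
  · rw [← Bool.decide_and, ← Bool.decide_and, decide_eq_decide]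
    constructor
    · rintro ⟨ha, -, hb⟩
      have e := Nat.div_add_mod (n - x * N) (N ^ 2)
      set m := (n - x * N) / N ^ 2
      set r := (n - x * N) % N ^ 2
      have : n = r + (N * m + x) * N := by
        have : N ^ 2 * m = N * m * N := by ring
        rw [add_mul]; omega
      rw [this, Nat.add_mul_div_right _ _ hN, Nat.div_eq_of_lt hb, zero_add, Nat.mul_add_mod,
        Nat.mod_eq_of_lt hx]
    · intro h
      have e := Nat.div_add_mod n N
      have e' := Nat.div_add_mod (n / N) N
      rw [h] at e'
      set q := n / N / N
      have hc := Nat.mod_lt n hN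
      set c := n % N
      have e3 : n = N ^ 2 * q + x * N + c := by
        rw [← e, ← e']; ring
      have : n - x * N = N ^ 2 * q + c := by omega
      refine ⟨by omega, by omega, ?_⟩
      rw [this, Nat.mul_add_mod, Nat.mod_eq_of_lt]
      · exact hc
      · exact hc.trans_le (Nat.le_self_pow (by norm_num) N)
  · have : N ∣ N ^ 2 := Dvd.intro_left (N ^ 1) rfl
    have hm : (n - x) % N ^ 2 < N * N := by rw [← sq]; exact Nat.mod_lt _ hN2
    have t1 : ∀ i, Nat.testBit 1 i = decide (i = 0) := by
      intro i
      rw [show 1 = 2 ^ 1 - 1 from rfl, Nat.testBit_two_pow_sub_one, decide_eq_decide]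
      omega
    rw [decide_eq_true hm, Bool.true_and, Nat.mod_mod_of_dvd _ this, t1, ← Bool.decide_and,
      ← Bool.decide_and, decide_eq_decide]
    constructor
    · rintro ⟨ha, -, hb⟩
      have e := Nat.div_add_mod (n - x) N
      have : n = x + N * ((n - x) / N) := by omega
      rw [this, Nat.add_mul_mod_self_left, Nat.mod_eq_of_lt hx]
    · intro h
      have e := Nat.div_add_mod n N
      have : n - x = N * (n / N) := by omega
      exact ⟨by rw [← h]; exact Nat.mod_le _ _, by omega, by rw [this]; simp⟩

/-- The logic of bits. -/
theorem tableLogic_rel {full n : ℕ} (h : full.testBit n = true) :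
    (tableLogic full).Rel boolLogic fun a b => a.testBit n = b where
  conj h₁ h₂ := by rw [← h₁, ← h₂]; exact testBit_land _ _ _
  disj h₁ h₂ := by rw [← h₁, ← h₂]; exact testBit_lor _ _ _
  sum h₁ h₂ := by rw [← h₁, ← h₂]; exact testBit_xor _ _ _
  neg {a b} h₁ := by
    rw [← h₁]
    change (Nat.xor full a).testBit n = _
    rw [testBit_xor, h, boolLogic_neg, Bool.true_xor]

end Bits

/-! ### The bits of the table of bad triples. -/

section Triples

/-- The indices of three edges, encoded by a number; the index may be out of range. -/
def tripleEdge (M n x : ℕ) : Bool :=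
  decide ((nearEdges.map fun e => edgeIdx M e.1 e.2)[n / (2 * M ^ 2 + 1) ^ 2]? = some x) ||
    (decide (n / (2 * M ^ 2 + 1) % (2 * M ^ 2 + 1) = x) || decide (n % (2 * M ^ 2 + 1) = x))

def incidentSum (f : ℕ × ℤ × ℤ → Bool) (u : ℤ × ℤ) : Bool :=
  (incident u).foldr (fun e r => xor (f e) r) false

theorem edgeIdx_lt {M : ℕ} (hM : 0 < M) {t : ℕ} (ht : t ≤ 1) (u : ℤ × ℤ) :
    edgeIdx M t u < 2 * M ^ 2 := by
  have h : ∀ z : ℤ, (z % M).toNat < M := fun z => by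
    have h₁ := Int.emod_nonneg z (by omega : (M : ℤ) ≠ 0)
    have h₂ := Int.emod_lt_of_pos z (by omega : (0 : ℤ) < M)
    omega
  have ha := h (u.1 + 5)
  have hb := h (u.2 + 5)
  rw [edgeIdx]
  generalize ((u.1 + 5) % M).toNat = a at *
  generalize ((u.2 + 5) % M).toNat = b at *
  have h₃ : a * M + M ≤ M ^ 2 := by
    rw [sq, ← Nat.succ_mul]; exact Nat.mul_le_mul_right _ ha
  have h₄ : t * M ^ 2 ≤ M ^ 2 := by
    calc _ ≤ 1 * M ^ 2 := Nat.mul_le_mul_right _ ht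
      _ = _ := one_mul _
  omega

theorem incident_le_one {u : ℤ × ℤ} {e : ℕ × ℤ × ℤ} (h : e ∈ incident u) : e.1 ≤ 1 := by
  simp only [incident, List.mem_cons, List.not_mem_nil, or_false] at h
  rcases h with rfl | rfl | rfl | rfl <;> norm_num

/-- Reading off bit `n` turns every connective on words into the Boolean one, so it commutes with
the formula. -/
theorem testBit_badTriples {M : ℕ} (hM : 0 < M) {n : ℕ}
    (hn : n < (2 * M ^ 2 + 1) ^ 2 * nearEdges.length) :
    (badTriples M).testBit n = bad latticeGrid boolLogic
      (incidentSum fun e => tripleEdge M n (edgeIdx M e.1 e.2)) (0, 0) := by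
  have hl : (nearEdges.map fun e => edgeIdx M e.1 e.2).length = nearEdges.length :=
    List.length_map _
  simp only [badTriples, strict_eq, strictRow_eq, badTable_eq, List.append_nil]
  have hf : (ones ((2 * M ^ 2 + 1) ^ 2 *
      (nearEdges.map fun e => edgeIdx M e.1 e.2).length)).testBit n = true := by
    rw [testBit_ones, hl]; simpa using hn
  have hg : latticeGrid.Rel latticeGrid Eq := by
    constructor <;> rintro x _ rfl <;> rfl
  refine hg.bad (tableLogic_rel hf) ?_ rfl
  rintro u _ rfl
  rw [syndromeTable, incidentSum]
  have hi := fun e => incident_le_one (u := u) (e := e)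
  generalize incident u = l at hi
  induction l with
  | nil => simp
  | cons e l ih =>
    rw [List.foldr_cons, List.foldr_cons, testBit_xor, ih fun e he => hi e (List.mem_cons_of_mem _ he)]
    congr 1
    have hlt := edgeIdx_lt hM (hi e List.mem_cons_self) e.2
    rw [List.getD_eq_getElem?_getD, List.getElem?_map, List.getElem?_range hlt, Option.map_some,
      Option.getD_some, testBit_tripleTable _ (by omega) (by rw [hl]; exact hn)]
    rfl

end Triples


/-! ### Configurations with a defect near a given site -/

section Near

/-- There are no conflicts and defects far from the unsatisfied checks. -/
theorem exists_near {X : Type} {g : Grid X} {S : X → Bool} {x : X}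
    (hcu : ∀ k < 4, ∀ x, g.cor k (g.uncor k x) = x) (h : bad g boolLogic S x = true) :
    S x = true ∨ S (g.rt x) = true ∨ S (g.dn x) = true ∨ S (g.dn (g.rt x)) = true ∨
      S (g.lf x) = true ∨ S (g.up x) = true := by
  by_contra hn
  simp only [not_or, Bool.not_eq_true] at hn
  obtain ⟨h0, h1, h2, h3, h4, h5⟩ := hn
  have hP : patA g boolLogic S x = false := by simp [patA, Logic.conj4, boolLogic, h0, h1, h2, h3]
  have hQ : patB g boolLogic S x = false := by simp [patB, Logic.conj4, boolLogic, h0, h1, h2, h3]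
  have hR : patC g boolLogic S x = false := by
    simp [patC, Logic.disj4, boolLogic, h0, h1, h2, h3]
  have hs : ∀ k, S (g.step k x) = false := fun k => by
    match k with
    | 0 => exact h1
    | 1 => exact h2
    | 2 => exact h4
    | _ + 3 => exact h5
  have hE : ∀ B k, estEdge g boolLogic S B k x = false := fun B k => by
    simp [estEdge, Logic.diff, boolLogic, h0, hs]
  have hN : ∀ B, ∀ k < 4, estNew g boolLogic S B k (g.uncor k x) = false := fun B k hk => by
    simp [estNew, Logic.diff, boolLogic, h0, hcu k hk]
  have hc : ∀ k, S (g.cor k x) = false := fun k => by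
    match k with
    | 0 => exact h0
    | 1 => exact h1
    | 2 => exact h3
    | _ + 3 => exact h2
  have hN' : ∀ B k, estNew g boolLogic S B k x = false := fun B k => by
    simp [estNew, Logic.diff, boolLogic, hc]
  have : bad g boolLogic S x = false := by
    rw [bad]
    refine Bool.or_eq_false_iff.2 ⟨?_, ?_⟩
    · simp only [conflict, Logic.diff, Logic.disj4, boolLogic_conj, boolLogic_disj, hP, hQ, hR]
      simp
    · simp only [defect, hE, hN', hN _ 0 (by norm_num), hN _ 1 (by norm_num), hN _ 2 (by norm_num),
        hN _ 3 (by norm_num)]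
      simp [Logic.disj4, Logic.sum4, boolLogic, h0]
  rw [this] at h
  simp at h

/-- Two evaluations of a formula side by side, in order to compare them. -/
def pairLogic : Logic (Bool × Bool) where
  conj a b := (a.1 && b.1, a.2 && b.2)
  disj a b := (a.1 || b.1, a.2 || b.2)
  sum a b := (xor a.1 b.1, xor a.2 b.2)
  neg a := (!a.1, !a.2)

theorem pairLogic_fst : pairLogic.Rel boolLogic fun v a => v.1 = a :=
  ⟨fun h h' => congrArg₂ and h h', fun h h' => congrArg₂ or h h', fun h h' => congrArg₂ xor h h',
    fun h => congrArg Bool.not h⟩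

theorem pairLogic_snd : pairLogic.Rel boolLogic fun v a => v.2 = a :=
  ⟨fun h h' => congrArg₂ and h h', fun h h' => congrArg₂ or h h', fun h h' => congrArg₂ xor h h',
    fun h => congrArg Bool.not h⟩

/-- Pairs of values that agree if a bit of the first component is set. -/
theorem agree_rel : Logic.Rel (⟨Nat.land, Nat.land, Nat.land, id⟩ : Logic ℕ)
    pairLogic
    fun a v => a.testBit 0 = true → v.1 = v.2 where
  conj h₁ h₂ h := by
    rw [testBit_land, Bool.and_eq_true] at h
    simp only [pairLogic, h₁ h.1, h₂ h.2]
  disj h₁ h₂ h := by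
    rw [testBit_land, Bool.and_eq_true] at h
    simp only [pairLogic, h₁ h.1, h₂ h.2]
  sum h₁ h₂ h := by
    rw [testBit_land, Bool.and_eq_true] at h
    simp only [pairLogic, h₁ h.1, h₂ h.2]
  neg h₁ h := by simp only [pairLogic, h₁ h]

theorem latticeGrid_rel : latticeGrid.Rel latticeGrid Eq := by
  constructor <;> rintro x _ rfl <;> rfl

/-- Locality of `bad`, obtained by evaluating it: if every connective is a conjunction and the input
is the indicator of the window, then the value shows that all sites read by the formula lie in the
window. -/
theorem bad_congr {S S' : ℤ × ℤ → Bool}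
    (h : ∀ u : ℤ × ℤ, -4 ≤ u.1 → u.1 ≤ 4 → -4 ≤ u.2 → u.2 ≤ 4 → S u = S' u) :
    bad latticeGrid boolLogic S (0, 0) = bad latticeGrid boolLogic S' (0, 0) := by
  let D : ℤ × ℤ → ℕ := fun u =>
    bif decide (-4 ≤ u.1) && decide (u.1 ≤ 4) && (decide (-4 ≤ u.2) && decide (u.2 ≤ 4)) then 1 else 0
  -- The domain of dependence is computed here; negation is the identity, as it preserves agreement.
  have key : (badTable ⟨Nat.land, Nat.land, Nat.land, id⟩ D).testBit 0 = true := by decide +kernel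
  rw [badTable_eq] at key
  have hD := latticeGrid_rel.bad agree_rel (S := D) (S' := fun u => (S u, S' u)) (by
    rintro u _ rfl hu
    have : (decide (-4 ≤ u.1) && decide (u.1 ≤ 4) && (decide (-4 ≤ u.2) && decide (u.2 ≤ 4))) =
        true := by
      by_contra hn
      rw [Bool.not_eq_true] at hn
      simp only [D, hn] at hu
      simp at hu
    simp only [Bool.and_eq_true, decide_eq_true_eq] at this
    exact h u this.1.1 this.1.2 this.2.1 this.2.2) rfl key
  have h₁ : _ = _ := latticeGrid_rel.bad pairLogic_fst
    (S := fun u => (S u, S' u)) (S' := S) (by rintro u _ rfl; rfl) (x := (0, 0)) rfl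
  have h₂ : _ = _ := latticeGrid_rel.bad pairLogic_snd
    (S := fun u => (S u, S' u)) (S' := S') (by rintro u _ rfl; rfl) (x := (0, 0)) rfl
  rw [← h₁, ← h₂, hD]

theorem exists_of_incidentSum {f : ℕ × ℤ × ℤ → Bool} {u : ℤ × ℤ} (h : incidentSum f u = true) :
    ∃ e ∈ incident u, f e = true := by
  by_contra! hn
  rw [incidentSum] at h
  generalize incident u = l at h hn
  induction l with
  | nil => simp at h
  | cons e l ih =>
    rw [List.foldr_cons, Bool.eq_false_iff.2 (hn e List.mem_cons_self), Bool.false_xor] at h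
    exact ih h fun e he => hn e (List.mem_cons_of_mem _ he)

theorem exists_nearEdge {f : ℕ × ℤ × ℤ → Bool}
    (h : bad latticeGrid boolLogic (incidentSum f) (0, 0) = true) :
    ∃ e ∈ nearEdges, f e = true := by
  have hs : ∃ u ∈ [((0, 0) : ℤ × ℤ), (0, 1), (1, 0), (1, 1), (0, -1), (-1, 0)],
      incidentSum f u = true := by
    rcases exists_near (by
      intro k hk x
      interval_cases k <;> simp [Grid.cor, Grid.uncor, latticeGrid]) h with h | h | h | h | h | h
    · exact ⟨_, by simp, h⟩
    · exact ⟨(0, 1), by simp, h⟩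
    · exact ⟨(1, 0), by simp, h⟩
    · exact ⟨(1, 1), by simp, h⟩
    · exact ⟨(0, -1), by decide, by simpa [latticeGrid] using h⟩
    · exact ⟨(-1, 0), by decide, by simpa [latticeGrid] using h⟩
  obtain ⟨u, hu, h⟩ := hs
  obtain ⟨e, he, h⟩ := exists_of_incidentSum h
  exact ⟨e, List.mem_flatMap.2 ⟨u, hu, he⟩, h⟩

end Near

/-! ### The bits of the table of special triples. -/

section SpecialTriples

theorem strictPlaces_eq {β : Type} (l : List Place) (k : List Place → β) :
    strictPlaces l k = k l := by
  induction l generalizing k with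
  | nil => rfl
  | cons a l ih => simp only [strictPlaces, strict_eq, ih]

theorem strictErrors_eq {β : Type} (l acc : List (List Place)) (k : List (List Place) → β) :
    strictErrors l acc k = k (l.reverse ++ acc) := by
  induction l generalizing acc with
  | nil => rfl
  | cons a l ih => simp only [strictErrors, strictPlaces_eq, ih]; simp

theorem testBit_concat {A : ℕ} (hA : 0 < A) (l : List ℕ) (h : ∀ a ∈ l, a < 2 ^ A) (n : ℕ) :
    (concat A l).testBit n = (l.getD (n / A) 0).testBit (n % A) := by
  induction l generalizing n with
  | nil => simp [concat]
  | cons a l ih =>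
    rw [concat, strict_eq, testBit_lor, testBit_shiftLeft,
      ih fun a ha => h a (List.mem_cons_of_mem _ ha)]
    by_cases hn : n < A
    · rw [Nat.div_eq_of_lt hn, Nat.mod_eq_of_lt hn, decide_eq_false (by omega : ¬A ≤ n)]
      simp
    · have h₁ : n / A = (n - A) / A + 1 := by
        rw [← Nat.add_div_right _ hA]; congr 1; omega
      have h₂ : n % A = (n - A) % A := by
        conv_lhs => rw [show n = n - A + A by omega, Nat.add_mod_right]
      rw [h₁, h₂, decide_eq_true (by omega : A ≤ n), List.getD_cons_succ,
        Nat.testBit_lt_two_pow ((h a List.mem_cons_self).trans_le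
          (Nat.pow_le_pow_right (by norm_num) (by omega)))]
      simp

theorem testBit_shiftLeft_one (k n : ℕ) : (Nat.shiftLeft 1 k).testBit n = decide (k = n) := by
  change (1 <<< k).testBit n = _
  rw [Nat.one_shiftLeft, Nat.testBit_two_pow]

theorem exists_of_testBit_specialPairs {M t i j p : ℕ} {l : List (List Place)} {acc : ℕ}
    (h : (specialPairs M t i j l acc).testBit p = true) : acc.testBit p = true ∨
      ∃ a b c, [a, b, c] ∈ l ∧ a.1 = t ∧
        (M ≤ 9 ∨ fits i j a b = true ∧ fits i j a c = true) ∧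
        (p = movedIdx M i j a b * (2 * M ^ 2 + 1) + movedIdx M i j a c ∨
          p = movedIdx M i j a c * (2 * M ^ 2 + 1) + movedIdx M i j a b) := by
  induction l generalizing acc with
  | nil => exact .inl h
  | cons e l ih =>
    have skip : (specialPairs M t i j l acc).testBit p = true → acc.testBit p = true ∨
      ∃ a b c, [a, b, c] ∈ e :: l ∧ a.1 = t ∧
        (M ≤ 9 ∨ fits i j a b = true ∧ fits i j a c = true) ∧
        (p = movedIdx M i j a b * (2 * M ^ 2 + 1) + movedIdx M i j a c ∨
          p = movedIdx M i j a c * (2 * M ^ 2 + 1) + movedIdx M i j a b) := fun h =>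
      (ih h).imp_right fun ⟨a, b, c, h, h'⟩ => ⟨a, b, c, List.mem_cons_of_mem _ h, h'⟩
    rcases e with _ | ⟨a, _ | ⟨b, _ | ⟨c, _ | ⟨d, e⟩⟩⟩⟩
    · exact skip h
    · exact skip h
    · exact skip h
    · rw [specialPairs] at h
      cases hc : Nat.beq a.1 t && (Nat.ble M 9 || (fits i j a b && fits i j a c))
      · rw [hc, cond_false] at h
        exact skip h
      · rw [hc, cond_true, strict_eq, strict_eq] at h
        simp only [strict_eq] at h
        rcases ih h with h | ⟨a, b, c, h, h'⟩
        · rw [testBit_lor, testBit_lor, Bool.or_eq_true, Bool.or_eq_true, testBit_shiftLeft_one,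
            testBit_shiftLeft_one, decide_eq_true_eq, decide_eq_true_eq] at h
          rcases h with h | h
          · exact .inl h
          · simp only [Bool.and_eq_true, Bool.or_eq_true, Nat.beq_eq, Nat.ble_eq] at hc
            exact .inr ⟨a, b, c, List.mem_cons_self, hc.1, hc.2, h.imp Eq.symm Eq.symm⟩
        · exact .inr ⟨a, b, c, List.mem_cons_of_mem _ h, h'⟩
    · exact skip h

/-- The places of a special error. -/
theorem clusters_spec : ∀ c ∈ clusters, ∀ e ∈ c, e.length = 3 ∧ e.Nodup ∧
    ∀ a ∈ e, a.1 ≤ 1 ∧ 2 ≤ a.2.1 ∧ a.2.1 ≤ 7 ∧ 2 ≤ a.2.2 ∧ a.2.2 ≤ 7 := by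
  decide +kernel

theorem mem_rooted {e : List Place} (h : e ∈ rooted) :
    ∃ c ∈ clusters, ∃ e' ∈ c, e.Nodup ∧ ∀ a, a ∈ e ↔ a ∈ e' := by
  obtain ⟨e', he', h⟩ := List.mem_flatMap.1 h
  obtain ⟨c, hc, he'⟩ := List.mem_flatten.1 he'
  refine ⟨c, hc, e', he', ?_⟩
  have hn := (clusters_spec c hc e' he').2.1
  split at h
  · rename_i x y z
    simp only [List.mem_cons, List.not_mem_nil, or_false] at h
    simp only [List.nodup_cons, List.mem_cons, List.not_mem_nil, or_false, not_or,
      not_false_eq_true, List.nodup_nil, and_true] at hn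
    obtain ⟨⟨h₁, h₂⟩, h₃⟩ := hn
    rcases h with rfl | rfl | rfl
    · exact ⟨by simp [h₁, h₂, h₃], fun a => Iff.rfl⟩
    · exact ⟨by simp [Ne.symm h₁, Ne.symm h₂, h₃], fun a => by simp; tauto⟩
    · exact ⟨by simp [h₁, Ne.symm h₂, Ne.symm h₃], fun a => by simp; tauto⟩
  · simp at h

theorem movedIdx_lt {M : ℕ} (hM : 0 < M) (i j : ℕ) (a : Place) {b : Place} (hb : b.1 ≤ 1) :
    movedIdx M i j a b < 2 * M ^ 2 := by
  rw [movedIdx]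
  have h₁ := Nat.mod_lt (b.2.1 + i + M - a.2.1) hM
  have h₂ := Nat.mod_lt (b.2.2 + j + M - a.2.2) hM
  have h₃ := Nat.mul_le_mul_right M h₁
  have h₄ := Nat.mul_le_mul_right (M ^ 2) hb
  rw [Nat.succ_mul, ← sq] at h₃
  omega

/-- The index is decoded by its digits in base `2 * M ^ 2 + 1`. Only this direction is needed: a set
bit yields a listed error whose first edge is moved to the near edge `n`. -/
theorem exists_of_testBit_specialTriples {M : ℕ} (hM : 0 < M) {k b c : ℕ} {n : ℕ × ℤ × ℤ}
    (hk : nearEdges[k]? = some n) (hb : b < 2 * M ^ 2 + 1) (hc : c < 2 * M ^ 2 + 1)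
    (h : (specialTriples M).testBit ((k * (2 * M ^ 2 + 1) + b) * (2 * M ^ 2 + 1) + c) = true) :
    ∃ x y z, [x, y, z] ∈ rooted ∧ x.1 = n.1 ∧
      (M ≤ 9 ∨ fits (n.2.1 + 5).toNat (n.2.2 + 5).toNat x y = true ∧
        fits (n.2.1 + 5).toNat (n.2.2 + 5).toNat x z = true) ∧
      (b = movedIdx M (n.2.1 + 5).toNat (n.2.2 + 5).toNat x y ∧
        c = movedIdx M (n.2.1 + 5).toNat (n.2.2 + 5).toNat x z ∨
      b = movedIdx M (n.2.1 + 5).toNat (n.2.2 + 5).toNat x z ∧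
        c = movedIdx M (n.2.1 + 5).toNat (n.2.2 + 5).toNat x y) := by
  set N := 2 * M ^ 2 + 1 with hN
  have hN2 : 0 < N ^ 2 := by positivity
  have hle : ∀ x y z, [x, y, z] ∈ rooted → x.1 ≤ 1 ∧ y.1 ≤ 1 ∧ z.1 ≤ 1 := by
    intro x y z h
    obtain ⟨d, hd, e, he, -, hm⟩ := mem_rooted h
    have := (clusters_spec d hd e he).2.2
    exact ⟨(this x ((hm x).1 (by simp))).1, (this y ((hm y).1 (by simp))).1,
      (this z ((hm z).1 (by simp))).1⟩
  have hlt : ∀ {x y : ℕ}, x < N → y < N → x * N + y < N ^ 2 := by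
    intro x y hx hy
    have := Nat.mul_le_mul_right N hx
    rw [Nat.succ_mul, ← sq] at this
    omega
  simp only [specialTriples, strictErrors_eq, strict_eq, List.append_nil] at h
  rw [testBit_concat hN2] at h
  · have e₁ : (k * N + b) * N + c = (b * N + c) + k * N ^ 2 := by ring
    rw [e₁, Nat.add_mul_div_right _ _ hN2, Nat.add_mul_mod_self_right, Nat.mod_eq_of_lt (hlt hb hc),
      Nat.div_eq_of_lt (hlt hb hc), zero_add, List.getD_eq_getElem?_getD, List.getElem?_map, hk,
      Option.map_some, Option.getD_some] at h
    rcases exists_of_testBit_specialPairs h with h | ⟨x, y, z, h, ht, hf, hp⟩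
    · simp at h
    · rw [List.mem_reverse] at h
      refine ⟨x, y, z, h, ht, hf, ?_⟩
      have hy := movedIdx_lt hM (n.2.1 + 5).toNat (n.2.2 + 5).toNat x (hle _ _ _ h).2.1
      have hz := movedIdx_lt hM (n.2.1 + 5).toNat (n.2.2 + 5).toNat x (hle _ _ _ h).2.2
      have inj : ∀ {a a' r r' : ℕ}, r < N → r' < N → a * N + r = a' * N + r' → a = a' ∧ r = r' := by
        intro a a' r r' hr hr' h
        have h₁ := congrArg (· % N) h
        have h₂ := congrArg (· / N) h
        simp only [Nat.mul_add_mod_self_right, Nat.mod_eq_of_lt hr, Nat.mod_eq_of_lt hr'] at h₁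
        rw [Nat.add_comm, Nat.add_comm _ r'] at h₂
        simp only [Nat.add_mul_div_right _ _ (by omega : 0 < N), Nat.div_eq_of_lt hr,
          Nat.div_eq_of_lt hr', zero_add] at h₂
        exact ⟨h₂, h₁⟩
      rcases hp with hp | hp
      · exact .inl (inj hc (by omega) hp)
      · exact .inr (inj hc (by omega) hp)
  · intro a ha
    obtain ⟨m, -, rfl⟩ := List.mem_map.1 ha
    refine Nat.lt_pow_two_of_testBit _ fun p hp => ?_
    by_contra hn
    rw [Bool.not_eq_false] at hn
    rcases exists_of_testBit_specialPairs hn with h | ⟨x, y, z, h, -, -, h'⟩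
    · simp at h
    · rw [List.mem_reverse] at h
      have hy := movedIdx_lt hM (m.2.1 + 5).toNat (m.2.2 + 5).toNat x (hle _ _ _ h).2.1
      have hz := movedIdx_lt hM (m.2.1 + 5).toNat (m.2.2 + 5).toNat x (hle _ _ _ h).2.2
      have h₁ := hlt (Nat.lt_succ_of_lt hy) (Nat.lt_succ_of_lt hz)
      have h₂ := hlt (Nat.lt_succ_of_lt hz) (Nat.lt_succ_of_lt hy)
      simp only [← hN] at h'
      omega

end SpecialTriples


/-! ### Bad errors are translates of listed errors. -/

section Special

variable {L : ℕ}

/-- The edge `(t, i, j)` of a frame with origin `o`. -/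
def placeAt (o : Site L) (a : Place) : Qubit L :=
  if a.1 = 0 then Sum.inl (o.1 + a.2.1, o.2 + a.2.2) else Sum.inr (o.1 + a.2.1, o.2 + a.2.2)

theorem natCast_inj_of_lt {i j : ℕ} (hi : 2 ≤ i) (hi' : i ≤ 7) (hj : 2 ≤ j) (hj' : j ≤ 7)
    (hL : 7 ≤ L) (h : (i : ZMod L) = j) : i = j := by
  have h₀ : ∀ {a b : ℕ}, a ≤ b → b < a + 7 → (a : ZMod L) = b → a = b := by
    intro a b h₁ h₂ h
    by_contra hn
    refine natCast_ne_zero_of_lt (L := L) (k := b - a) (by omega) (by omega) ?_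
    rw [Nat.cast_sub h₁, h, sub_self]
  rcases le_total i j with h' | h'
  · exact h₀ h' (by omega) h
  · exact (h₀ h' (by omega) h.symm).symm

theorem placeAt_inj (hL : 7 ≤ L) {o : Site L} {a b : Place}
    (ha : a.1 ≤ 1 ∧ 2 ≤ a.2.1 ∧ a.2.1 ≤ 7 ∧ 2 ≤ a.2.2 ∧ a.2.2 ≤ 7)
    (hb : b.1 ≤ 1 ∧ 2 ≤ b.2.1 ∧ b.2.1 ≤ 7 ∧ 2 ≤ b.2.2 ∧ b.2.2 ≤ 7)
    (h : placeAt o a = placeAt o b) : a = b := by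
  obtain ⟨t, i, j⟩ := a
  obtain ⟨t', i', j'⟩ := b
  simp only [placeAt] at h ha hb
  have key : (o.1 + (i : ZMod L), o.2 + (j : ZMod L)) = (o.1 + (i' : ZMod L), o.2 + (j' : ZMod L)) →
      i = i' ∧ j = j' := by
    intro h
    rw [Prod.mk.injEq, add_right_inj, add_right_inj] at h
    exact ⟨natCast_inj_of_lt ha.2.1 ha.2.2.1 hb.2.1 hb.2.2.1 hL h.1,
      natCast_inj_of_lt ha.2.2.2.1 ha.2.2.2.2 hb.2.2.2.1 hb.2.2.2.2 hL h.2⟩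
  split_ifs at h with h₁ h₂
  · obtain ⟨rfl, rfl⟩ := key (Sum.inl.inj h)
    rw [h₁, h₂]
  · obtain ⟨rfl, rfl⟩ := key (Sum.inr.inj h)
    rw [show t = t' by omega]

/-- The edge `(t, u)`, in coordinates relative to `c`. -/
def edgeAt (c : Site L) (a : ℕ × ℤ × ℤ) : Qubit L :=
  if a.1 = 0 then Sum.inl (c.1 + a.2.1, c.2 + a.2.2) else Sum.inr (c.1 + a.2.1, c.2 + a.2.2)

/-- The edge of the given index. -/
def idxEdge (M x : ℕ) : ℕ × ℤ × ℤ :=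
  (x / M ^ 2, ((x % M ^ 2 / M : ℕ) : ℤ) - 5, ((x % M : ℕ) : ℤ) - 5)

theorem idxEdge_add {M t i j : ℕ} (hi : i < M) (hj : j < M) :
    idxEdge M (t * M ^ 2 + i * M + j) = (t, (i : ℤ) - 5, (j : ℤ) - 5) := by
  have hM : 0 < M := by omega
  have hij : i * M + j < M ^ 2 := by
    have := Nat.mul_le_mul_right M hi
    rw [Nat.succ_mul, ← sq] at this
    omega
  have h₁ : (t * M ^ 2 + i * M + j) / M ^ 2 = t := by
    rw [add_assoc, Nat.add_comm, Nat.add_mul_div_right _ _ (by positivity), Nat.div_eq_of_lt hij,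
      zero_add]
  have h₂ : (t * M ^ 2 + i * M + j) % M ^ 2 = i * M + j := by
    rw [add_assoc, Nat.add_comm, Nat.add_mul_mod_self_right, Nat.mod_eq_of_lt hij]
  have h₃ : (t * M ^ 2 + i * M + j) % M = j := by
    rw [show t * M ^ 2 + i * M + j = j + (t * M + i) * M by ring, Nat.add_mul_mod_self_right,
      Nat.mod_eq_of_lt hj]
  rw [idxEdge, h₁, h₂, h₃, Nat.add_comm, Nat.add_mul_div_right _ _ hM, Nat.div_eq_of_lt hj, zero_add]

/-- For `M = L` the reduction does not change the residue class, and for `M = 10` no reduction takes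
place. -/
theorem emod_cast {M : ℕ} (hM : M = L ∨ M = 10) {z : ℤ} (h₁ : -5 ≤ z) (h₂ : z ≤ 4) (h7 : 7 ≤ M) :
    ∃ i < M, ((z + 5) % M).toNat = i ∧ (((i : ℤ) - 5 : ℤ) : ZMod L) = z := by
  have h₃ := Int.emod_nonneg (z + 5) (by omega : (M : ℤ) ≠ 0)
  have h₄ := Int.emod_lt_of_pos (z + 5) (by omega : (0 : ℤ) < M)
  refine ⟨_, by omega, rfl, ?_⟩
  rw [Int.toNat_of_nonneg h₃]
  rcases hM with rfl | rfl
  · rw [Int.cast_sub, ZMod.intCast_mod]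
    push_cast
    ring
  · rw [Int.emod_eq_of_lt (by omega) (by push_cast; omega)]
    push_cast
    ring

theorem edgeAt_idxEdge {M : ℕ} (hM : M = L ∨ M = 10) (h7 : 7 ≤ M) (c : Site L) {a : ℕ × ℤ × ℤ}
    (h₁ : -5 ≤ a.2.1) (h₂ : a.2.1 ≤ 4) (h₃ : -5 ≤ a.2.2) (h₄ : a.2.2 ≤ 4) :
    edgeAt c (idxEdge M (edgeIdx M a.1 a.2)) = edgeAt c a := by
  obtain ⟨i, hi, ei, ci⟩ := emod_cast hM h₁ h₂ h7
  obtain ⟨j, hj, ej, cj⟩ := emod_cast hM h₃ h₄ h7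
  rw [edgeIdx, ei, ej, idxEdge_add hi hj, edgeAt, edgeAt]
  simp only [ci, cj]

theorem sub_five_inj {M : ℕ} (hM : M ≤ L) {i j : ℕ} (hi : i < M) (hj : j < M)
    (h : (((i : ℤ) - 5 : ℤ) : ZMod L) = (((j : ℤ) - 5 : ℤ) : ZMod L)) : i = j := by
  push_cast at h
  rw [sub_left_inj, ZMod.natCast_eq_natCast_iff', Nat.mod_eq_of_lt (by omega),
    Nat.mod_eq_of_lt (by omega)] at h
  exact h

/-- The table shows a part of the torus without repetition, so an error of weight three has at most
three indices. -/
theorem edgeAt_idxEdge_inj {M : ℕ} (hM : M ≤ L) (h0 : 0 < M) (c : Site L) {x y : ℕ}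
    (hx : x < 2 * M ^ 2) (hy : y < 2 * M ^ 2)
    (h : edgeAt c (idxEdge M x) = edgeAt c (idxEdge M y)) : x = y := by
  have hM2 : 0 < M ^ 2 := by positivity
  have d : ∀ {x : ℕ}, x < 2 * M ^ 2 → x / M ^ 2 ≤ 1 ∧ x % M ^ 2 / M < M ∧ x % M < M ∧
      x = x / M ^ 2 * M ^ 2 + x % M ^ 2 / M * M + x % M := by
    intro x hx
    refine ⟨Nat.lt_succ_iff.1 (Nat.div_lt_of_lt_mul (by rw [mul_comm]; exact hx)),
      Nat.div_lt_of_lt_mul (by rw [← sq]; exact Nat.mod_lt _ hM2), Nat.mod_lt _ h0, ?_⟩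
    have e₁ := Nat.div_add_mod x (M ^ 2)
    have e₂ := Nat.div_add_mod (x % M ^ 2) M
    have hdvd : M ∣ M ^ 2 := Dvd.intro_left (M ^ 1) rfl
    rw [Nat.mod_mod_of_dvd _ hdvd] at e₂
    rw [mul_comm (x / M ^ 2), mul_comm (x % M ^ 2 / M)]
    omega
  obtain ⟨x₁, x₂, x₃, ex⟩ := d hx
  obtain ⟨y₁, y₂, y₃, ey⟩ := d hy
  have key : (c.1 + ((((x % M ^ 2 / M : ℕ) : ℤ) - 5 : ℤ) : ZMod L),
      c.2 + ((((x % M : ℕ) : ℤ) - 5 : ℤ) : ZMod L)) =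
      (c.1 + ((((y % M ^ 2 / M : ℕ) : ℤ) - 5 : ℤ) : ZMod L),
      c.2 + ((((y % M : ℕ) : ℤ) - 5 : ℤ) : ZMod L)) →
      x % M ^ 2 / M = y % M ^ 2 / M ∧ x % M = y % M := by
    intro h
    rw [Prod.mk.injEq, add_right_inj, add_right_inj] at h
    exact ⟨sub_five_inj hM x₂ y₂ h.1, sub_five_inj hM x₃ y₃ h.2⟩
  rw [edgeAt, edgeAt] at h
  by_cases h₁ : x / M ^ 2 = 0 <;> by_cases h₂ : y / M ^ 2 = 0
  · rw [if_pos (by exact h₁), if_pos (by exact h₂)] at h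
    obtain ⟨k₁, k₂⟩ := key (Sum.inl.inj h)
    rw [ex, ey, k₁, k₂, h₁, h₂]
  · rw [if_pos (by exact h₁), if_neg (by exact h₂)] at h
    simp at h
  · rw [if_neg (by exact h₁), if_pos (by exact h₂)] at h
    simp at h
  · rw [if_neg (by exact h₁), if_neg (by exact h₂)] at h
    obtain ⟨k₁, k₂⟩ := key (Sum.inr.inj h)
    rw [ex, ey, k₁, k₂, le_antisymm (x₁.trans (Nat.one_le_iff_ne_zero.2 h₂)) (y₁.trans (Nat.one_le_iff_ne_zero.2 h₁))]

theorem incidentSum_congr {f f' : ℕ × ℤ × ℤ → Bool} {u : ℤ × ℤ}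
    (h : ∀ a ∈ incident u, f a = f' a) : incidentSum f u = incidentSum f' u := by
  simp only [incidentSum, incident, List.foldr_cons, List.foldr_nil] at h ⊢
  rw [h _ (by simp), h (1, u) (by simp), h (0, u.1, u.2 - 1) (by simp),
    h (1, u.1 - 1, u.2) (by simp)]

theorem uns_mulVec [NeZero L] (e : Qubit L → ZMod 2) (c : Site L) (u : ℤ × ℤ) :
    uns ((toricH L).mulVec e) (c.1 + (u.1 : ZMod L), c.2 + (u.2 : ZMod L)) =
      incidentSum (fun a => decide (e (edgeAt c a) ≠ 0)) u := by
  have h : ∀ a b c d : ZMod 2, decide (a + b + c + d = 1) =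
      xor (decide (a ≠ 0)) (xor (decide (b ≠ 0)) (xor (decide (c ≠ 0)) (xor (decide (d ≠ 0)) false))) := by
    decide
  rw [uns, toricH_mulVec, h]
  simp only [incidentSum, incident, List.foldr_cons, List.foldr_nil, edgeAt, if_true, one_ne_zero,
    if_false, Int.cast_sub, Int.cast_one, add_sub_assoc]

/-- A set with at most three elements, given by a member and two numbers. -/
theorem exists_triple {I : Finset ℕ} {x n : ℕ} (hx : x ∈ I) (hI : I.card ≤ 3)
    (hn : ∀ y ∈ I, y < n) :
    ∃ b c, b < n + 1 ∧ c < n + 1 ∧ ∀ y < n, y ∈ I ↔ x = y ∨ b = y ∨ c = y := by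
  have hc : (I.erase x).card ≤ 2 := by rw [Finset.card_erase_of_mem hx]; omega
  have hm : ∀ y, y ∈ I ↔ x = y ∨ y ∈ I.erase x := fun y => by
    rw [Finset.mem_erase]
    by_cases h : x = y
    · simp [← h, hx]
    · simp [h, Ne.symm h]
  simp only [hm]
  rcases Finset.eq_empty_or_nonempty (I.erase x) with h0 | ⟨b, hb⟩
  -- The number `n` is out of range and stands for a missing edge.
  · refine ⟨n, n, by omega, by omega, fun y hy => ?_⟩
    rw [h0]
    have : n ≠ y := by omega
    simp [this]
  · have hbn := hn b (Finset.mem_of_mem_erase hb)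
    have hc' : ((I.erase x).erase b).card ≤ 1 := by rw [Finset.card_erase_of_mem hb]; omega
    have hm' : ∀ y, y ∈ I.erase x ↔ b = y ∨ y ∈ (I.erase x).erase b := fun y => by
      rw [Finset.mem_erase (a := y) (b := b)]
      by_cases h : b = y
      · simp only [← h, hb, true_or]
      · simp [h, Ne.symm h]
    rcases Finset.eq_empty_or_nonempty ((I.erase x).erase b) with h0 | ⟨c, hcm⟩
    · refine ⟨b, n, by omega, by omega, fun y hy => ?_⟩
      rw [hm', h0]
      have : n ≠ y := by omega
      simp [this]
    · have hcn := hn c (Finset.mem_of_mem_erase (Finset.mem_of_mem_erase hcm))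
      refine ⟨b, c, by omega, by omega, fun y hy => ?_⟩
      rw [hm']
      have : y ∈ (I.erase x).erase b ↔ c = y :=
        ⟨fun h => Finset.card_le_one.1 hc' c hcm y h, fun h => h ▸ hcm⟩
      rw [this]

theorem nearEdges_spec : ∀ a ∈ nearEdges, a.1 ≤ 1 ∧ -5 ≤ a.2.1 ∧ a.2.1 ≤ 4 ∧ -5 ≤ a.2.2 ∧
    a.2.2 ≤ 4 := by
  decide

theorem edgeAt_moved {M : ℕ} (hM : M ≤ 9 ∧ M = L ∨ M = 10) (h7 : 7 ≤ M) {c o : Site L}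
    {n : ℕ × ℤ × ℤ} {a b : Place} (hn₁ : -5 ≤ n.2.1) (hn₂ : -5 ≤ n.2.2)
    (ho : o = (c.1 + n.2.1 - a.2.1, c.2 + n.2.2 - a.2.2)) (ha₁ : a.2.1 ≤ 7) (ha₂ : a.2.2 ≤ 7)
    (hf : M ≤ 9 ∨ fits (n.2.1 + 5).toNat (n.2.2 + 5).toNat a b = true) :
    edgeAt c (idxEdge M (movedIdx M (n.2.1 + 5).toNat (n.2.2 + 5).toNat a b)) = placeAt o b := by
  have hi : (((n.2.1 + 5).toNat : ℕ) : ZMod L) = (n.2.1 : ZMod L) + 5 := by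
    have : (((n.2.1 + 5).toNat : ℕ) : ℤ) = n.2.1 + 5 := Int.toNat_of_nonneg (by omega)
    have := congrArg (Int.cast : ℤ → ZMod L) this
    push_cast at this
    exact this
  have hj : (((n.2.2 + 5).toNat : ℕ) : ZMod L) = (n.2.2 : ZMod L) + 5 := by
    have : (((n.2.2 + 5).toNat : ℕ) : ℤ) = n.2.2 + 5 := Int.toNat_of_nonneg (by omega)
    have := congrArg (Int.cast : ℤ → ZMod L) this
    push_cast at this
    exact this
  generalize (n.2.1 + 5).toNat = i at hi hf ⊢
  generalize (n.2.2 + 5).toNat = j at hj hf ⊢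
  have key : ∀ x y z : ℕ, z ≤ 7 → (M ≤ 9 ∨ z ≤ x + y ∧ x + y + 1 ≤ z + 10) →
      (((x + y + M - z) % M : ℕ) : ZMod L) = x + y - z := by
    intro x y z hz hf
    rcases hM with ⟨-, rfl⟩ | rfl
    · rw [ZMod.natCast_mod, Nat.cast_sub (by omega)]
      simp
    · obtain ⟨h₁, h₂⟩ := hf.resolve_left (by norm_num)
      rw [show x + y + 10 - z = (x + y - z) + 10 by omega, Nat.add_mod_right,
        Nat.mod_eq_of_lt (by omega), Nat.cast_sub h₁, Nat.cast_add]
  have h₁ := key b.2.1 i a.2.1 ha₁ (hf.imp_right fun h => by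
    simp only [fits, Bool.and_eq_true, Nat.ble_eq] at h; omega)
  have h₂ := key b.2.2 j a.2.2 ha₂ (hf.imp_right fun h => by
    simp only [fits, Bool.and_eq_true, Nat.ble_eq] at h; omega)
  rw [movedIdx, idxEdge_add (Nat.mod_lt _ (by omega)) (Nat.mod_lt _ (by omega)), edgeAt, placeAt, ho]
  have e₁ : c.1 + ((((b.2.1 + i + M - a.2.1) % M : ℕ) : ℤ) - 5 : ℤ) =
      c.1 + n.2.1 - a.2.1 + (b.2.1 : ZMod L) := by
    rw [Int.cast_sub, Int.cast_natCast, h₁, hi]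
    push_cast
    ring
  have e₂ : c.2 + ((((b.2.2 + j + M - a.2.2) % M : ℕ) : ℤ) - 5 : ℤ) =
      c.2 + n.2.2 - a.2.2 + (b.2.2 : ZMod L) := by
    rw [Int.cast_sub, Int.cast_natCast, h₂, hj]
    push_cast
    ring
  simp only [e₁, e₂]

/-- A bad configuration comes from one of the special errors. -/
theorem exists_special_of_bad [NeZero L] (hL : 7 ≤ L) (hM : badSpecial (min L 10) = true)
    {e : Qubit L → ZMod 2} (he : hammingNorm e ≤ 3) {c : Site L}
    (hb : bad (torusGrid L) boolLogic (uns ((toricH L).mulVec e)) c = true) :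
    ∃ d ∈ clusters, ∃ l ∈ d, ∃ o : Site L, ∀ q, e q ≠ 0 ↔ ∃ a ∈ l, placeAt o a = q := by
  classical
  set M := min L 10 with hMd
  have hML : M ≤ L := min_le_left _ _
  have h7 : 7 ≤ M := le_min hL (by norm_num)
  have hM' : M ≤ 9 ∧ M = L ∨ M = 10 := by omega
  have hM'' : M = L ∨ M = 10 := hM'.imp_left And.right
  have h0 : 0 < M := by omega
  let f : ℕ × ℤ × ℤ → Bool := fun a => decide (e (edgeAt c a) ≠ 0)
  have hg : latticeGrid.Rel (torusGrid L)
      fun u x => x = (c.1 + (u.1 : ZMod L), c.2 + (u.2 : ZMod L)) := by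
    constructor <;> rintro u _ rfl <;> simp [latticeGrid, torusGrid, add_assoc, add_sub_assoc]
  have hb' : bad latticeGrid boolLogic (incidentSum f) (0, 0) = true := by
    have := hg.bad (o := boolLogic) (o' := boolLogic) (R := Eq) (S := incidentSum f)
      (S' := uns ((toricH L).mulVec e))
      ⟨fun h h' => congrArg₂ and h h', fun h h' => congrArg₂ or h h', fun h h' => congrArg₂ xor h h',
        fun h => congrArg Bool.not h⟩ (by rintro u _ rfl; exact (uns_mulVec e c u).symm)
      (x := (0, 0)) (y := c) (by simp)
    rw [this, hb]
  -- The part of the error that is visible in the table; for large `L` other edges of the error may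
  -- lie outside.
  let I : Finset ℕ := (Finset.range (2 * M ^ 2)).filter fun x => f (idxEdge M x) = true
  have hI : I.card ≤ 3 := by
    refine (Finset.card_le_card_of_injOn (fun x => edgeAt c (idxEdge M x))
      (t := Finset.univ.filter fun q => e q ≠ 0) ?_ ?_).trans he
    · intro x hx
      simpa [I, f] using (Finset.mem_filter.1 hx).2
    · intro x hx y hy h
      exact edgeAt_idxEdge_inj hML h0 c (Finset.mem_range.1 (Finset.mem_filter.1 hx).1)
        (Finset.mem_range.1 (Finset.mem_filter.1 hy).1) h
  have hfI : ∀ a : ℕ × ℤ × ℤ, a.1 ≤ 1 → -5 ≤ a.2.1 → a.2.1 ≤ 4 → -5 ≤ a.2.2 → a.2.2 ≤ 4 →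
      (f a = true ↔ edgeIdx M a.1 a.2 ∈ I) := by
    intro a ha h₁ h₂ h₃ h₄
    rw [Finset.mem_filter, Finset.mem_range]
    simp only [edgeIdx_lt h0 ha, true_and, f, edgeAt_idxEdge hM'' h7 c h₁ h₂ h₃ h₄]
  obtain ⟨n, hn, hfn⟩ := exists_nearEdge hb'
  obtain ⟨k, hk⟩ := List.mem_iff_getElem?.1 hn
  have hkl : k < nearEdges.length := (List.getElem?_eq_some_iff.1 hk).1
  obtain ⟨n₁, n₂, n₃, n₄, n₅⟩ := nearEdges_spec n hn
  have hnI := (hfI n n₁ n₂ n₃ n₄ n₅).1 hfn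
  obtain ⟨b, b', hbn, hbn', hI'⟩ := exists_triple hnI hI
    fun y hy => Finset.mem_range.1 (Finset.mem_filter.1 hy).1
  set N := 2 * M ^ 2 + 1 with hN
  have hN0 : 0 < N := by omega
  set m := (k * N + b) * N + b' with hm
  have hm₁ : m % N = b' := by rw [hm, Nat.mul_add_mod_self_right, Nat.mod_eq_of_lt hbn']
  have hm₂ : m / N = k * N + b := by
    rw [hm, Nat.add_comm, Nat.add_mul_div_right _ _ hN0, Nat.div_eq_of_lt hbn', zero_add]
  have hm₃ : m / N ^ 2 = k := by
    rw [sq, ← Nat.div_div_eq_div_mul, hm₂, Nat.add_comm, Nat.add_mul_div_right _ _ hN0,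
      Nat.div_eq_of_lt hbn, zero_add]
  have hmlt : m < N ^ 2 * nearEdges.length := by
    have := Nat.lt_of_lt_of_le (Nat.lt_succ_self k) hkl
    have h₁ := Nat.lt_mul_div_succ m (show 0 < N ^ 2 by positivity)
    rw [hm₃] at h₁
    exact h₁.trans_le (Nat.mul_le_mul_left _ hkl)
  have htri : ∀ a : ℕ × ℤ × ℤ, a.1 ≤ 1 →
      (tripleEdge M m (edgeIdx M a.1 a.2) = true ↔ edgeIdx M a.1 a.2 ∈ I) := by
    intro a ha
    rw [hI' _ (edgeIdx_lt h0 ha a.2), tripleEdge, ← hN, hm₃, hm₂, hm₁, Nat.mul_add_mod_self_right,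
      Nat.mod_eq_of_lt hbn, List.getElem?_map, hk]
    simp
  have hbit : (badTriples M).testBit m = true := by
    rw [testBit_badTriples h0 hmlt, ← hb']
    -- Only edges with coordinates from `-5` to `4` matter for badness, and there the triple agrees
    -- with the error.
    refine bad_congr fun u h₁ h₂ h₃ h₄ => incidentSum_congr fun a ha => ?_
    have hu : a.1 ≤ 1 ∧ -5 ≤ a.2.1 ∧ a.2.1 ≤ 4 ∧ -5 ≤ a.2.2 ∧ a.2.2 ≤ 4 := by
      simp only [incident, List.mem_cons, List.not_mem_nil, or_false] at ha
      rcases ha with rfl | rfl | rfl | rfl <;> simp only <;> omega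
    obtain ⟨a₁, a₂, a₃, a₄, a₅⟩ := hu
    rw [Bool.eq_iff_iff, htri a a₁, hfI a a₁ a₂ a₃ a₄ a₅]
  have hbit' : (specialTriples M).testBit m = true := by
    simp only [badSpecial, strict_eq, Nat.beq_eq] at hM
    rw [← hM, testBit_land, Bool.and_eq_true] at hbit
    exact hbit.2
  obtain ⟨x, y, z, hr, hxn, hf, hyz⟩ := exists_of_testBit_specialTriples h0 hk hbn hbn' hbit'
  obtain ⟨d, hd, l, hl, hnd, hmem⟩ := mem_rooted hr
  have hs := (clusters_spec d hd l hl).2.2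
  have hx := hs x ((hmem x).1 (by simp))
  have hy := hs y ((hmem y).1 (by simp))
  have hz := hs z ((hmem z).1 (by simp))
  let o : Site L := (c.1 + n.2.1 - x.2.1, c.2 + n.2.2 - x.2.2)
  have ex : e (placeAt o x) ≠ 0 := by
    have : placeAt o x = edgeAt c n := by
      simp only [placeAt, edgeAt, o, hxn, sub_add_cancel]
    rw [this]
    simpa [f] using hfn
  have hel : ∀ w : Place, w.1 ≤ 1 →
      (M ≤ 9 ∨ fits (n.2.1 + 5).toNat (n.2.2 + 5).toNat x w = true) →
      (b = movedIdx M (n.2.1 + 5).toNat (n.2.2 + 5).toNat x w ∨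
        b' = movedIdx M (n.2.1 + 5).toNat (n.2.2 + 5).toNat x w) → e (placeAt o w) ≠ 0 := by
    intro w hw hfit h
    have hlt := movedIdx_lt h0 (n.2.1 + 5).toNat (n.2.2 + 5).toNat x hw
    have := (Finset.mem_filter.1 ((hI' _ hlt).2 (.inr h))).2
    simp only [f, decide_eq_true_eq] at this
    rwa [edgeAt_moved hM' h7 n₂ n₄ (rfl : o = _) hx.2.2.1 hx.2.2.2.2 hfit] at this
  have ey : e (placeAt o y) ≠ 0 :=
    hel y hy.1 (hf.imp_right And.left) (hyz.imp And.left And.right)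
  have ez : e (placeAt o z) ≠ 0 :=
    hel z hz.1 (hf.imp_right And.right) (hyz.symm.imp And.left And.right)
  simp only [List.nodup_cons, List.mem_cons, List.not_mem_nil, or_false, not_or, not_false_eq_true,
    List.nodup_nil, and_true] at hnd
  have hsub : ({placeAt o x, placeAt o y, placeAt o z} : Finset (Qubit L)) ⊆
      Finset.univ.filter fun q => e q ≠ 0 := by
    intro q hq
    simp only [Finset.mem_insert, Finset.mem_singleton] at hq
    rw [Finset.mem_filter]
    rcases hq with rfl | rfl | rfl
    exacts [⟨Finset.mem_univ _, ex⟩, ⟨Finset.mem_univ _, ey⟩, ⟨Finset.mem_univ _, ez⟩]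
  have hcard : ({placeAt o x, placeAt o y, placeAt o z} : Finset (Qubit L)).card = 3 := by
    rw [Finset.card_eq_three]
    exact ⟨_, _, _, fun h => hnd.1.1 (placeAt_inj hL hx hy h),
      fun h => hnd.1.2 (placeAt_inj hL hx hz h), fun h => hnd.2 (placeAt_inj hL hy hz h), rfl⟩
  -- The three edges of the listed error are distinct edges of `e`. Since `e` has weight at most
  -- three, it has no further edge.
  have heq := Finset.eq_of_subset_of_card_le hsub (hcard.symm ▸ he)
  refine ⟨d, hd, l, hl, o, fun q => ?_⟩
  have : e q ≠ 0 ↔ q ∈ Finset.univ.filter fun q => e q ≠ 0 := by simp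
  rw [this, ← heq]
  simp only [← hmem, List.mem_cons, List.not_mem_nil, or_false, Finset.mem_insert,
    Finset.mem_singleton, exists_eq_or_imp, exists_eq_left, eq_comm (a := q)]

end Special


/-! ### Soundness of the bounds for messages -/

/-- The integer with the sign of `x * y` and magnitude `min |x| |y|`. -/
def mulMin (x y : ℤ) : ℤ := x.sign * y.sign * min |x| |y|

theorem sign_eq_zero_or (x : ℤ) : x = 0 ∨ (0 < x ∧ x.sign = 1) ∨ (x < 0 ∧ x.sign = -1) := by
  rcases lt_trichotomy x 0 with h | h | h
  · exact .inr (.inr ⟨h, Int.sign_eq_neg_one_of_neg h⟩)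
  · exact .inl h
  · exact .inr (.inl ⟨h, Int.sign_eq_one_of_pos h⟩)

theorem abs_mulMin (x y : ℤ) : |mulMin x y| = min |x| |y| := by
  rcases sign_eq_zero_or x with rfl | ⟨hx, h⟩ | ⟨hx, h⟩ <;>
  rcases sign_eq_zero_or y with rfl | ⟨hy, h'⟩ | ⟨hy, h'⟩ <;>
  simp [mulMin, *]

theorem sign_mulMin (x y : ℤ) : (mulMin x y).sign = x.sign * y.sign := by
  rcases sign_eq_zero_or x with rfl | ⟨hx, h⟩ | ⟨hx, h⟩
  · simp [mulMin]
  all_goals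
    rcases sign_eq_zero_or y with rfl | ⟨hy, h'⟩ | ⟨hy, h'⟩
    · simp [mulMin]
    all_goals
      have : 0 < min |x| |y| := lt_min (abs_pos.2 (by omega)) (abs_pos.2 (by omega))
      rw [mulMin, Int.sign_mul, Int.sign_mul, Int.sign_sign, Int.sign_sign,
        Int.sign_eq_one_of_pos this, mul_one]

theorem eq_of_sign_abs {x y : ℤ} (h : x.sign = y.sign) (h' : |x| = |y|) : x = y := by
  rw [← Int.sign_mul_abs x, ← Int.sign_mul_abs y, h, h']

theorem sign_foldl_mulMin (l : List ℤ) (a : ℤ) :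
    (l.foldl mulMin a).sign = a.sign * (l.map Int.sign).prod := by
  induction l generalizing a with
  | nil => simp
  | cons x l ih => rw [List.foldl_cons, ih, sign_mulMin, List.map_cons, List.prod_cons, mul_assoc]

theorem le_abs_foldl_mulMin (l : List ℤ) (a z : ℤ) :
    z ≤ |l.foldl mulMin a| ↔ z ≤ |a| ∧ ∀ x ∈ l, z ≤ |x| := by
  induction l generalizing a with
  | nil => simp
  | cons x l ih => rw [List.foldl_cons, ih, abs_mulMin, le_min_iff, List.forall_mem_cons, and_assoc]

section Combine

variable {σ : ℤ} {J : Finset ℕ} {f : ℕ → ℤ}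

theorem combine_eq_of_nonempty (hJ : J.Nonempty) :
    combine σ J f = σ * (∏ i ∈ J, (f i).sign) * J.inf' hJ fun i => |f i| := by
  rw [combine, dif_pos hJ]

theorem sign_combine (hσ : σ = 1 ∨ σ = -1) (hJ : J.Nonempty) :
    (combine σ J f).sign = σ * ∏ i ∈ J, (f i).sign := by
  rw [combine_eq_of_nonempty hJ]
  have hs : ∏ i ∈ J, (f i).sign = (∏ i ∈ J, f i).sign := by
    induction J using Finset.cons_induction with
    | empty => simp
    | cons a J ha ih =>
      rcases J.eq_empty_or_nonempty with rfl | h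
      · simp
      · rw [Finset.prod_cons, Finset.prod_cons, Int.sign_mul, ih h]
  rw [hs]
  obtain ⟨i, hi, h⟩ := Finset.exists_mem_eq_inf' hJ fun i => |f i|
  by_cases h0 : f i = 0
  · rw [Finset.prod_eq_zero hi h0]
    simp
  · have : 0 < J.inf' hJ fun i => |f i| := by rw [h]; exact abs_pos.2 h0
    rw [Int.sign_mul, Int.sign_mul, Int.sign_sign, Int.sign_eq_one_of_pos this, mul_one]
    rcases hσ with rfl | rfl <;> rfl

theorem abs_combine (hσ : σ = 1 ∨ σ = -1) (hJ : J.Nonempty) :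
    |combine σ J f| = J.inf' hJ fun i => |f i| := by
  rw [combine_eq_of_nonempty hJ]
  have hn : 0 ≤ J.inf' hJ fun i => |f i| := by
    rw [Finset.le_inf'_iff]; exact fun i _ => abs_nonneg _
  by_cases h0 : ∃ i ∈ J, f i = 0
  · obtain ⟨i, hi, h⟩ := h0
    have : (J.inf' hJ fun i => |f i|) = 0 :=
      le_antisymm ((Finset.inf'_le _ hi).trans (by simp [h])) hn
    rw [this]
    simp
  · push Not at h0
    have hp : |∏ i ∈ J, (f i).sign| = 1 := by
      rw [Finset.abs_prod]
      refine Finset.prod_eq_one fun i hi => ?_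
      rcases sign_eq_zero_or (f i) with h | ⟨-, h⟩ | ⟨-, h⟩
      · exact absurd h (h0 i hi)
      · rw [h]; rfl
      · rw [h]; rfl
    rw [abs_mul, abs_mul, hp, abs_of_nonneg hn]
    rcases hσ with rfl | rfl <;> simp

/-- Messages without a value count as a large number. -/
theorem combine_eq_foldl {m k : ℕ} {N : ℤ} (hσ : σ = 1 ∨ σ = -1) (u : ℕ → Bool)
    (hJ : J = ((Finset.range m).filter fun i => u i).erase k) (hn : J.Nonempty) (hN : 0 < N)
    (hfN : ∀ i < m, |f i| ≤ N) : combine σ J f =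
      (((List.range m).filter (· ≠ k)).map fun i => if u i then f i else N).foldl mulMin (σ * N) := by
  have hm : ∀ i, i ∈ J ↔ i ≠ k ∧ i < m ∧ u i = true := fun i => by
    rw [hJ, Finset.mem_erase, Finset.mem_filter, Finset.mem_range]
  -- Signs are compared as products, where unused slots contribute `1`. Absolute values are compared
  -- through their lower bounds, where `N` is harmless because some slot is used and its value is at
  -- most `N`.
  refine eq_of_sign_abs ?_ (eq_of_forall_le_iff fun z => ?_)
  · rw [sign_combine hσ hn, sign_foldl_mulMin, Int.sign_mul, Int.sign_eq_one_of_pos hN, mul_one,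
      List.map_map]
    congr 1
    · rcases hσ with rfl | rfl <;> rfl
    · have hnd : ((List.range m).filter (· ≠ k)).Nodup := List.nodup_range.filter _
      rw [← List.prod_toFinset _ hnd]
      refine Finset.prod_subset_one_on_sdiff ?_ ?_ ?_
      · intro i hi
        obtain ⟨h₁, h₂, -⟩ := (hm i).1 hi
        simp [h₁, h₂]
      · intro i hi
        simp only [Finset.mem_sdiff, List.mem_toFinset, List.mem_filter, List.mem_range, hm,
          decide_eq_true_eq] at hi
        have : u i = false := by
          by_contra h
          exact hi.2 ⟨hi.1.2, hi.1.1, by simpa using h⟩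
        simp [this, Int.sign_eq_one_of_pos hN]
      · intro i hi
        simp [((hm i).1 hi).2.2]
  · rw [abs_combine hσ hn, Finset.le_inf'_iff, le_abs_foldl_mulMin]
    have ha : |σ * N| = N := by
      rw [abs_mul, abs_of_pos hN]
      rcases hσ with rfl | rfl <;> simp
    simp only [List.forall_mem_map, List.mem_filter, List.mem_range, decide_eq_true_eq]
    constructor
    · intro h
      obtain ⟨i, hi⟩ := hn
      have hzN : z ≤ N := (h i hi).trans (hfN i ((hm i).1 hi).2.1)
      refine ⟨by rw [ha]; exact hzN, fun i hi => ?_⟩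
      split_ifs with hu
      · exact h i ((hm i).2 ⟨hi.2, hi.1, hu⟩)
      · rwa [abs_of_pos hN]
    · rintro ⟨-, h⟩ i hi
      obtain ⟨h₁, h₂, h₃⟩ := (hm i).1 hi
      have := h i ⟨h₂, h₁⟩
      rwa [if_pos h₃] at this

end Combine

namespace Msg

variable {n : ℕ}

theorem getD_mix {a b t : ℕ} (l l' : List ℕ) (h : ((mix a b l l').getD t 0).testBit n = true) :
    a.testBit n = true ∧ (l.getD t 0).testBit n = true ∨
      b.testBit n = true ∧ (l'.getD t 0).testBit n = true := by
  induction l generalizing l' t with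
  | nil => simp [mix] at h
  | cons x l ih =>
    rcases l' with _ | ⟨y, l'⟩
    · rw [mix] at h
      cases t with
      | zero => rw [List.getD_cons_zero, testBit_land, Bool.and_eq_true] at h; exact .inl h
      | succ t => exact ih [] h
    · rw [mix] at h
      cases t with
      | zero =>
        rw [List.getD_cons_zero, testBit_lor, testBit_land, testBit_land, Bool.or_eq_true,
          Bool.and_eq_true, Bool.and_eq_true] at h
        exact h
      | succ t => exact ih l' h

theorem length_mix (a b : ℕ) (l l' : List ℕ) : (mix a b l l').length = l.length := by
  induction l generalizing l' with
  | nil => simp [mix]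
  | cons x l ih => cases l' <;> simp [mix, ih]

theorem getD_zipWith_lor {l l' : List ℕ} {t : ℕ}
    (h : ((List.zipWith Nat.lor l l').getD t 0).testBit n = true) :
    (l.getD t 0).testBit n = true ∨ (l'.getD t 0).testBit n = true := by
  induction l generalizing l' t with
  | nil => simp at h
  | cons x l ih =>
    rcases l' with _ | ⟨y, l'⟩
    · simp at h
    · cases t with
      | zero =>
        rw [List.zipWith_cons_cons, List.getD_cons_zero, testBit_lor, Bool.or_eq_true] at h
        exact h
      | succ t => exact ih h

theorem getD_zipWith_land {l l' : List ℕ} {t : ℕ}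
    (h : ((List.zipWith Nat.land l l').getD t 0).testBit n = true) :
    (l.getD t 0).testBit n = true ∧ (l'.getD t 0).testBit n = true := by
  induction l generalizing l' t with
  | nil => simp at h
  | cons x l ih =>
    rcases l' with _ | ⟨y, l'⟩
    · simp at h
    · cases t with
      | zero =>
        rw [List.zipWith_cons_cons, List.getD_cons_zero, testBit_land, Bool.and_eq_true] at h
        exact h
      | succ t => exact ih h

theorem getD_drop (l : List ℕ) (k t : ℕ) : (l.drop k).getD t 0 = l.getD (k + t) 0 := by
  rw [List.getD_eq_getElem?_getD, List.getD_eq_getElem?_getD, List.getElem?_drop]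

/-- The bounds, at bit `n`, hold for `x`. -/
structure Holds (a : Msg) (n : ℕ) (x : ℤ) : Prop where
  pos : a.pos.testBit n = true → 0 ≤ x
  neg : a.neg.testBit n = true → x ≤ 0
  ge : ∀ t, (a.ge.getD t 0).testBit n = true → (t : ℤ) + 1 ≤ |x|
  lt : ∀ t, (a.lt.getD t 0).testBit n = true → |x| < (t : ℤ) + 1

theorem Holds.incr {full : ℕ} {a : Msg} {x : ℤ} (h : a.Holds n x) :
    (a.incr full).Holds n (1 + x) := by
  have hg0 := h.ge 0
  have hg1 := h.ge 1
  have hl0 := h.lt 0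
  have hl1 := h.lt 1
  push_cast at hg0 hg1 hl0 hl1
  constructor
  · intro hb
    rw [Msg.incr, testBit_lor, Bool.or_eq_true] at hb
    rcases hb with hb | hb
    · have := h.pos hb; omega
    · have := abs_lt.1 (hl1 hb); omega
  · intro hb
    rw [Msg.incr, testBit_land, Bool.and_eq_true] at hb
    have h₁ := h.neg hb.1
    have h₂ := hg0 hb.2
    rw [abs_of_nonpos h₁] at h₂
    omega
  · intro t hb
    rw [Msg.incr] at hb
    cases t with
    | zero =>
      rw [List.getD_cons_zero, testBit_lor, testBit_lor, testBit_land, Bool.or_eq_true,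
        Bool.or_eq_true, Bool.and_eq_true] at hb
      rcases hb with hb | hb | ⟨hb, hb'⟩
      · have := h.pos hb
        rw [abs_of_nonneg (by omega)]; push_cast; omega
      · have := abs_lt.1 (hl0 hb)
        rw [abs_of_nonneg (by omega)]; push_cast; omega
      · have h₁ := h.neg hb
        have h₂ := hg1 hb'
        rw [abs_of_nonpos h₁] at h₂
        rw [abs_of_nonpos (by omega)]; push_cast; omega
    | succ t =>
      rw [List.getD_cons_succ] at hb
      rcases getD_mix _ _ hb with ⟨hp, hb⟩ | ⟨hp, hb⟩
      · have h₁ := h.pos hp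
        have h₂ := h.ge t hb
        rw [abs_of_nonneg h₁] at h₂
        rw [abs_of_nonneg (by omega)]; push_cast; omega
      · rw [getD_drop] at hb
        have h₁ := h.neg hp
        have h₂ := h.ge _ hb
        rw [abs_of_nonpos h₁] at h₂
        push_cast at h₂ ⊢
        rw [abs_of_nonpos (by omega)]; omega
  · intro t hb
    rw [Msg.incr] at hb
    cases t with
    | zero =>
      rw [List.getD_cons_zero, testBit_land, testBit_land, Bool.and_eq_true, Bool.and_eq_true] at hb
      have h₁ := h.neg hb.1
      have h₂ := hg0 hb.2.1
      have h₃ := hl1 hb.2.2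
      rw [abs_of_nonpos h₁] at h₂ h₃
      rw [abs_lt]; push_cast; omega
    | succ t =>
      rw [List.getD_cons_succ] at hb
      rcases getD_mix _ _ hb with ⟨-, hb⟩ | ⟨hp, hb⟩
      · have h₂ := abs_lt.1 (h.lt t hb)
        rw [abs_lt]; push_cast; omega
      · rw [getD_drop] at hb
        have h₁ := h.neg hp
        have h₂ := abs_lt.1 (h.lt _ hb)
        push_cast at h₂
        rw [abs_lt]; push_cast; omega

theorem Holds.merge {a b : Msg} {x y : ℤ} (h : a.Holds n x) (h' : b.Holds n y) :
    (a.merge b).Holds n (mulMin x y) := by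
  have hz : ((List.zipWith Nat.lor a.lt b.lt).getD 0 0).testBit n = true → mulMin x y = 0 := by
    intro hb
    have : min |x| |y| ≤ 0 := by
      rcases getD_zipWith_lor hb with hb | hb
      · have := h.lt 0 hb
        exact (min_le_left _ _).trans (by push_cast at this; omega)
      · have := h'.lt 0 hb
        exact (min_le_right _ _).trans (by push_cast at this; omega)
    rw [← abs_mulMin] at this
    exact abs_nonpos_iff.1 this
  have hsgn : ∀ {z : ℤ}, (0 ≤ z ↔ 0 ≤ z.sign) ∧ (z ≤ 0 ↔ z.sign ≤ 0) := by
    intro z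
    rcases sign_eq_zero_or z with rfl | ⟨h, h'⟩ | ⟨h, h'⟩
    · simp
    · rw [h']; omega
    · rw [h']; omega
  constructor
  · intro hb
    rw [Msg.merge, testBit_lor, testBit_lor, testBit_land, testBit_land, Bool.or_eq_true,
      Bool.or_eq_true, Bool.and_eq_true, Bool.and_eq_true] at hb
    rcases hb with hb | ⟨h₁, h₂⟩ | ⟨h₁, h₂⟩
    · rw [hz hb]
    · rw [hsgn.1, sign_mulMin]
      exact mul_nonneg (hsgn.1.1 (h.pos h₁)) (hsgn.1.1 (h'.pos h₂))
    · rw [hsgn.1, sign_mulMin]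
      exact mul_nonneg_of_nonpos_of_nonpos (hsgn.2.1 (h.neg h₁)) (hsgn.2.1 (h'.neg h₂))
  · intro hb
    rw [Msg.merge, testBit_lor, testBit_lor, testBit_land, testBit_land, Bool.or_eq_true,
      Bool.or_eq_true, Bool.and_eq_true, Bool.and_eq_true] at hb
    rcases hb with hb | ⟨h₁, h₂⟩ | ⟨h₁, h₂⟩
    · rw [hz hb]
    · rw [hsgn.2, sign_mulMin]
      exact mul_nonpos_of_nonneg_of_nonpos (hsgn.1.1 (h.pos h₁)) (hsgn.2.1 (h'.neg h₂))
    · rw [hsgn.2, sign_mulMin]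
      exact mul_nonpos_of_nonpos_of_nonneg (hsgn.2.1 (h.neg h₁)) (hsgn.1.1 (h'.pos h₂))
  · intro t hb
    obtain ⟨h₁, h₂⟩ := getD_zipWith_land hb
    rw [abs_mulMin]
    exact le_min (h.ge t h₁) (h'.ge t h₂)
  · intro t hb
    rw [abs_mulMin]
    rcases getD_zipWith_lor hb with hb | hb
    · exact (min_le_left _ _).trans_lt (h.lt t hb)
    · exact (min_le_right _ _).trans_lt (h'.lt t hb)

theorem length_incr_lt (full : ℕ) (a : Msg) : (a.incr full).lt.length = a.lt.length + 1 := by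
  simp [incr, length_mix]

theorem length_merge_lt (a b : Msg) : (a.merge b).lt.length = min a.lt.length b.lt.length := by
  simp [merge]

/-- No upper bound is known at bit `n`. -/
structure Far (a : Msg) (n : ℕ) : Prop where
  neg : a.neg.testBit n = false
  lt : ∀ t, (a.lt.getD t 0).testBit n = false

theorem Far.incr {full : ℕ} {a : Msg} (h : a.Far n) : (a.incr full).Far n := by
  constructor
  · rw [Msg.incr, testBit_land, h.neg, Bool.false_and]
  · intro t
    by_contra hb
    rw [Bool.not_eq_false, Msg.incr] at hb
    cases t with
    | zero => rw [List.getD_cons_zero, testBit_land, h.neg] at hb; simp at hb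
    | succ t =>
      rcases getD_mix _ _ hb with ⟨-, hb⟩ | ⟨hb, -⟩
      · rw [h.lt] at hb; simp at hb
      · rw [h.neg] at hb; simp at hb

/-- Lower bounds are recorded only up to the length of the list, so they hold for every number from
there on. -/
theorem Far.holds {a : Msg} (h : a.Far n) {N : ℤ} (hN : (a.ge.length : ℤ) ≤ N) : a.Holds n N := by
  constructor
  · intro _; omega
  · intro hb; rw [h.neg] at hb; simp at hb
  · intro t hb
    have : t < a.ge.length := by
      by_contra hn
      rw [List.getD_eq_default _ _ (by omega)] at hb
      simp at hb
    rw [abs_of_nonneg (by omega)]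
    omega
  · intro t hb; rw [h.lt] at hb; simp at hb

theorem getD_replicate (k a t : ℕ) : (List.replicate k a).getD t 0 = if t < k then a else 0 := by
  rw [List.getD_eq_getElem?_getD, List.getElem?_replicate]
  split_ifs <;> rfl

/-- The value at which merging starts: the sign of the syndrome with a magnitude too large to affect
the minimum. -/
theorem start_holds {full s k : ℕ} (hf : full.testBit n = true) {N : ℤ} (hN : (k : ℤ) ≤ N)
    (hN' : 0 < N) : (start full s k).Holds n ((if s.testBit n then -1 else 1) * N) := by
  constructor
  · intro hb
    rw [start, testBit_xor, hf, Bool.true_xor, Bool.not_eq_true'] at hb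
    rw [hb]; simp; omega
  · intro hb
    rw [start] at hb
    rw [hb]; simp; omega
  · intro t hb
    rw [start, getD_replicate] at hb
    split_ifs at hb with h
    · have : |(if s.testBit n = true then -1 else 1) * N| = N := by
        rw [abs_mul, abs_of_pos hN']
        split_ifs <;> simp
      rw [this]; omega
    · simp at hb
  · intro t hb
    rw [start, getD_replicate] at hb
    split_ifs at hb <;> simp at hb

theorem of_below_go {v : ℕ} {l l' : List ℕ} (h : (below.go v l l').testBit n = true) :
    ∃ t, v.testBit n = true ∧ (l.getD t 0).testBit n = true ∧ (l'.getD t 0).testBit n = true := by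
  induction l generalizing l' with
  | nil => simp [below.go] at h
  | cons x l ih =>
    rcases l' with _ | ⟨y, l'⟩
    · simp [below.go] at h
    · rw [below.go, testBit_lor, testBit_land, testBit_land, Bool.or_eq_true, Bool.and_eq_true,
        Bool.and_eq_true] at h
      rcases h with h | h
      · exact ⟨0, h⟩
      · obtain ⟨t, h⟩ := ih h
        exact ⟨t + 1, h⟩

theorem Holds.below {a b : Msg} {x y : ℤ} (h : a.Holds n x) (h' : b.Holds n y)
    (hb : (a.below b).testBit n = true) : 1 + x + y < 0 := by
  -- Here `|x| ≤ t` and `y ≤ -(t + 2)`; the list for `y` is read one place further on.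
  obtain ⟨t, h₁, h₂, h₃⟩ := of_below_go hb
  rw [getD_drop] at h₃
  have e₁ := h'.neg h₁
  have e₂ := abs_lt.1 (h.lt t h₂)
  have e₃ := h'.ge _ h₃
  rw [abs_of_nonpos e₁] at e₃
  push_cast at e₃
  omega

theorem Holds.sumNeg {a b : Msg} {x y : ℤ} (h : a.Holds n x) (h' : b.Holds n y)
    (hb : (a.sumNeg b).testBit n = true) : 1 + x + y < 0 := by
  rw [Msg.sumNeg, testBit_lor, testBit_lor, Bool.or_eq_true, Bool.or_eq_true] at hb
  rcases hb with hb | hb | hb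
  · simp only [testBit_land, testBit_lor, Bool.and_eq_true, Bool.or_eq_true] at hb
    obtain ⟨⟨h₁, h₂⟩, hb⟩ := hb
    have e₁ := h.neg h₁
    have e₂ := h'.neg h₂
    rcases hb with (hb | hb) | ⟨hb, hb'⟩
    · have := h.ge 1 hb
      rw [abs_of_nonpos e₁] at this
      push_cast at this; omega
    · have := h'.ge 1 hb
      rw [abs_of_nonpos e₂] at this
      push_cast at this; omega
    · have h₃ := h.ge 0 hb
      have h₄ := h'.ge 0 hb'
      rw [abs_of_nonpos e₁] at h₃
      rw [abs_of_nonpos e₂] at h₄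
      push_cast at h₃ h₄; omega
  · exact h.below h' hb
  · have := h'.below h hb
    omega

theorem of_above_go {l l' : List ℕ} (h : (above.go l l').testBit n = true) :
    ∃ t, (l.getD t 0).testBit n = true ∧ ((l'.getD t 0).testBit n = true ∨ t = l'.length) := by
  induction l generalizing l' with
  | nil => simp [above.go] at h
  | cons x l ih =>
    rcases l' with _ | ⟨y, l'⟩
    · exact ⟨0, h, .inr rfl⟩
    · rw [above.go, testBit_lor, testBit_land, Bool.or_eq_true, Bool.and_eq_true] at h
      rcases h with h | h
      · exact ⟨0, h.1, .inl h.2⟩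
      · obtain ⟨t, h, h'⟩ := ih h
        exact ⟨t + 1, h, h'.imp id (congrArg (· + 1))⟩

theorem Holds.above {a b : Msg} {x y : ℤ} (h : a.Holds n x) (h' : b.Holds n y)
    (hl : |y| ≤ b.lt.length) (hb : (a.above b).testBit n = true) : 0 ≤ 1 + x + y := by
  rw [Msg.above, testBit_land, testBit_lor, Bool.and_eq_true, Bool.or_eq_true] at hb
  obtain ⟨hp, hb⟩ := hb
  have e₁ := h.pos hp
  rcases hb with hb | hb
  · have := abs_lt.1 (h'.lt 1 hb)
    push_cast at this; omega
  · obtain ⟨t, h₁, h₂⟩ := of_above_go hb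
    have e₂ := h.ge t h₁
    rw [abs_of_nonneg e₁] at e₂
    rcases h₂ with h₂ | h₂
    · rw [getD_drop] at h₂
      have := abs_lt.1 (h'.lt _ h₂)
      push_cast at this; omega
    -- The case in which the list of upper bounds is exhausted: `x` is at least its length minus
    -- one, and `|y|` is at most its length.
    · rw [List.length_drop] at h₂
      have := abs_le.1 hl
      omega

theorem Holds.sumPos {a b : Msg} {x y : ℤ} (h : a.Holds n x) (h' : b.Holds n y)
    (hx : |x| ≤ a.lt.length) (hy : |y| ≤ b.lt.length) (hb : (a.sumPos b).testBit n = true) :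
    0 ≤ 1 + x + y := by
  rw [Msg.sumPos, testBit_lor, testBit_lor, testBit_land, Bool.or_eq_true, Bool.or_eq_true,
    Bool.and_eq_true] at hb
  rcases hb with hb | hb | hb
  · have := h.pos hb.1
    have := h'.pos hb.2
    omega
  · exact h.above h' hy hb
  · have := h'.above h hx hb
    omega

theorem force_eq {β : Type} (a : Msg) (k : Msg → β) : a.force k = k a := by
  have hl : ∀ (l : List ℕ) {γ : Type} (k : List ℕ → γ), strictList l k = k l := by
    intro l
    induction l with
    | nil => intros; rfl
    | cons a l ih => intro γ k; rw [strictList, strict_eq, ih]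
  simp only [force, strict_eq, hl]

end Msg

theorem strictList_eq {β : Type} (l : List ℕ) (k : List ℕ → β) : strictList l k = k l := by
  induction l generalizing k with
  | nil => rfl
  | cons a l ih => rw [strictList, strict_eq, ih]

theorem strictMsgs_eq {β : Type} (l : List Msg) (k : List Msg → β) : strictMsgs l k = k l := by
  induction l generalizing k with
  | nil => rfl
  | cons a l ih => rw [strictMsgs, Msg.force_eq, ih]

theorem departure_go_eq (l : List Msg) (acc : Msg) (k : ℕ) :
    departure.go l acc k = (l.eraseIdx k).foldl Msg.merge acc := by
  induction l generalizing acc k with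
  | nil => simp [departure.go]
  | cons a l ih =>
    cases k with
    | zero =>
      rw [departure.go, ih, List.eraseIdx_of_length_le le_rfl, List.eraseIdx_cons_zero]
    | succ k => rw [departure.go, Msg.force_eq, ih, List.eraseIdx_cons_succ, List.foldl_cons]

theorem holds_foldl {n : ℕ} {l : List Msg} {v : List ℤ} (h : List.Forall₂ (Msg.Holds · n ·) l v)
    {a : Msg} {x : ℤ} (ha : a.Holds n x) : (l.foldl Msg.merge a).Holds n (v.foldl mulMin x) := by
  induction h generalizing a x with
  | nil => exact ha
  | cons h _ ih => exact ih (ha.merge h)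


/-! ### Soundness of the bounds for messages sent by a check. -/

section Departures

theorem foldl_merge_length {l : List Msg} {a : Msg} {k : ℕ} (ha : a.lt.length = k)
    (h : ∀ b ∈ l, b.lt.length = k) : (l.foldl Msg.merge a).lt.length = k := by
  induction l generalizing a with
  | nil => exact ha
  | cons b l ih =>
    refine ih ?_ fun c hc => h c (List.mem_cons_of_mem _ hc)
    rw [Msg.length_merge_lt, ha, h b List.mem_cons_self, min_self]

theorem eraseIdx_range {m k : ℕ} (hm : m = 8 ∨ m = 4) (hk : k < m) :
    (List.range m).eraseIdx k = (List.range m).filter (· ≠ k) := by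
  rcases hm with rfl | rfl <;> interval_cases k <;> rfl

theorem departure_eq {m k : ℕ} (hm : m = 8 ∨ m = 4) (hk : k < m) (α : ℕ → Msg) (a : Msg) :
    departure ((List.range m).map α) a k =
      (((List.range m).filter (· ≠ k)).map α).foldl Msg.merge a := by
  rw [departure, departure_go_eq, List.eraseIdx_map, eraseIdx_range hm hk]

theorem departure_length {m k c full syn : ℕ} (hm : m = 8 ∨ m = 4) (hk : k < m) {α : ℕ → Msg}
    (h : ∀ i < m, (α i).lt.length + 1 = c) :
    (departure ((List.range m).map fun i => (α i).incr full) (Msg.start full syn c) k).lt.length =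
      c := by
  rw [departure_eq hm hk]
  refine foldl_merge_length (by simp [Msg.start]) fun b hb => ?_
  simp only [List.mem_map, List.mem_filter, List.mem_range] at hb
  obtain ⟨i, ⟨hi, -⟩, rfl⟩ := hb
  rw [Msg.length_incr_lt, h i hi]

/-- All slots are merged, used or not, so that the same operations apply at every place. Unused
slots are given a common large value, which does not change the minimum over the used ones. -/
theorem departure_holds {m k c n full syn : ℕ} (hm : m = 8 ∨ m = 4) (hk : k < m) {α : ℕ → Msg}
    {u : ℕ → Bool} {f : ℕ → ℤ} (hfull : full.testBit n = true)
    (hα : ∀ i < m, u i = true → (α i).Holds n (f i)) (hα' : ∀ i < m, u i = false → (α i).Far n)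
    (hn : (((Finset.range m).filter fun i => u i).erase k).Nonempty) :
    (departure ((List.range m).map fun i => (α i).incr full) (Msg.start full syn c) k).Holds n
      (combine (if syn.testBit n then -1 else 1) (((Finset.range m).filter fun i => u i).erase k)
        fun i => 1 + f i) := by
  -- Larger than every value and every list of bounds involved.
  let N : ℤ := ∑ i ∈ Finset.range m, (|1 + f i| + (((α i).incr full).ge.length : ℤ)) + c + 1
  have hterm : ∀ i < m, |1 + f i| + (((α i).incr full).ge.length : ℤ) ≤
      ∑ i ∈ Finset.range m, (|1 + f i| + (((α i).incr full).ge.length : ℤ)) := fun i hi =>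
    Finset.single_le_sum (f := fun i => |1 + f i| + (((α i).incr full).ge.length : ℤ))
      (fun i _ => by positivity) (Finset.mem_range.2 hi)
  have hsum : 0 ≤ ∑ i ∈ Finset.range m, (|1 + f i| + (((α i).incr full).ge.length : ℤ)) :=
    Finset.sum_nonneg fun i _ => by positivity
  have hN : 0 < N := by simp only [N]; omega
  have hc : (c : ℤ) ≤ N := by simp only [N]; omega
  rw [combine_eq_foldl (by split_ifs <;> simp) u rfl hn hN (fun i hi => by
    have := hterm i hi
    have := Int.natCast_nonneg ((α i).incr full).ge.length
    change |1 + f i| ≤ N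
    simp only [N]
    omega), departure_eq hm hk]
  refine holds_foldl ?_ (Msg.start_holds hfull hc hN)
  rw [List.forall₂_map_left_iff, List.forall₂_map_right_iff, List.forall₂_same]
  intro i hi
  have hi' : i < m := List.mem_range.1 (List.mem_filter.1 hi).1
  change Msg.Holds _ n (if u i = true then 1 + f i else N)
  split_ifs with hu
  swap
  · refine (hα' i hi' (by simpa using hu)).incr.holds ?_
    have := hterm i hi'
    have := abs_nonneg (1 + f i)
    simp only [N]
    omega
  · exact (hα i hi' hu).incr

theorem departures_eq {β : Type} {m full syn c : ℕ} (α : ℕ → Msg) (k : List Msg → β) :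
    departures full syn c ((List.range m).map α) k = k ((List.range m).map
      (departure ((List.range m).map fun i => (α i).incr full) (Msg.start full syn c))) := by
  rw [departures, strictMsgs_eq, strictMsgs_eq]
  simp [Function.comp_def]

end Departures

section Bounds

variable {L : ℕ} {B : Finset (Site L)} {s : Site L → ZMod 2}

theorem abs_combine_le {σ z : ℤ} {J : Finset ℕ} {f : ℕ → ℤ} (hσ : σ = 1 ∨ σ = -1) (hJ : J.Nonempty)
    (h : ∀ i, |f i| ≤ z) : |combine σ J f| ≤ z := by
  rw [abs_combine hσ hJ]
  obtain ⟨i, hi⟩ := hJ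
  exact (Finset.inf'_le _ hi).trans (h i)

/-- Each iteration adds at most `1` to a magnitude and then takes a minimum. The lists of upper
bounds have matching lengths, which is why running past their end in `Msg.above` is harmless. -/
theorem messages_le (hL : 1 < L) (hB : Independent B) (i : ℕ) :
    (∀ x j, |(messages B s i).site x j| ≤ i) ∧ ∀ p k, |(messages B s i).mid p k| ≤ i := by
  induction i with
  | zero => simp [messages]
  | succ i ih =>
    have h : ∀ z : ℤ, |z| ≤ i → |1 + z| ≤ (i + 1 : ℕ) := fun z hz => by
      have := abs_le.1 hz
      rw [abs_le]; push_cast; omega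
    constructor
    · intro x j
      refine abs_combine_le (by split_ifs <;> simp) (slots_erase_nonempty hL hB x j) fun l => h _ ?_
      rw [Messages.siteIn]
      split_ifs
      · exact ih.1 _ _
      · exact ih.2 _ _
    · intro p k
      refine abs_combine_le (by simp) (range_erase_nonempty k) fun l => h _ ?_
      exact ih.1 _ _

theorem abs_siteIn_le (hL : 1 < L) (hB : Independent B) (i : ℕ) (x : Site L) (j : ℕ) :
    |(messages B s i).siteIn x j| ≤ i := by
  rw [Messages.siteIn]
  split_ifs
  · exact (messages_le hL hB i).1 _ _
  · exact (messages_le hL hB i).2 _ _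

theorem combine_nonneg {J : Finset ℕ} {f : ℕ → ℤ} (h : ∀ i ∈ J, 0 ≤ f i) : 0 ≤ combine 1 J f := by
  unfold combine
  refine mul_nonneg (mul_nonneg (by norm_num) (Finset.prod_nonneg fun i hi => ?_)) ?_
  · rcases (h i hi).eq_or_lt with h0 | h0
    · rw [← h0]; rfl
    · rw [Int.sign_eq_one_of_pos h0]; norm_num
  · split_ifs with hJ
    · rw [Finset.le_inf'_iff]; exact fun i _ => abs_nonneg _
    · exact le_rfl

end Bounds

/-! ### One iteration in a frame cut out of the torus. -/

section Setup

variable {Z : Type} {L : ℕ}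

/-- The words of the setup describe, at the bits `pos z` for `z` in the domain `D`, the blown-up
graph at the sites `loc z`. -/
structure Setup.Reads (U : Setup) (B : Finset (Site L)) (s : Site L → ZMod 2) (σ τ : ℕ → Slot)
    (D : Z → Prop) (pos : Z → ℕ) (loc : Z → Site L) : Prop where
  site : U.site = (List.range 8).map σ
  mid : U.mid = (List.range 4).map τ
  full : ∀ z, D z → U.full.testBit (pos z) = true
  syn : ∀ z, D z → U.syn.testBit (pos z) = uns s (loc z)
  off : ∀ z, D z → ∀ j < 8, (σ j).off.testBit (pos z) = !slotUsed B (loc z) j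
  off_out : ∀ z, D z → ∀ j < 8, (σ j).off.testBit (pos z) = true → (σ j).out.testBit (pos z) = true
  old : ∀ z, D z → ∀ j < 4, (σ j).out.testBit (pos z) = false → ∃ z', D z' ∧
    loc z' = (torusGrid L).step j (loc z) ∧
    ∀ w, ((σ j).move w).testBit (pos z) = w.testBit (pos z')
  new : ∀ z, D z → ∀ k < 4, (σ (4 + k)).off.testBit (pos z) = false →
    (σ (4 + k)).out.testBit (pos z) = false ∧ ∃ z', D z' ∧
    loc z' = (torusGrid L).uncor k (loc z) ∧
    ∀ w, ((σ (4 + k)).move w).testBit (pos z) = w.testBit (pos z')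
  mid_off : ∀ z, D z → ∀ k < 4, (τ k).off.testBit (pos z) = !inB B (loc z)
  mid_out : ∀ z, D z → ∀ k < 4, (τ k).out.testBit (pos z) = !inB B (loc z)
  mid_move : ∀ z, D z → ∀ k < 4, inB B (loc z) = true → ∃ z', D z' ∧
    loc z' = (torusGrid L).cor k (loc z) ∧
    ∀ w, ((τ k).move w).testBit (pos z) = w.testBit (pos z')
  -- If the other end of an edge that leaves the frame is again in the frame, the edge counts as
  -- leaving there too. This occurs when opposite sides of the frame are neighbours.
  seam : ∀ z z', D z → D z' → ∀ j < 4, (σ j).out.testBit (pos z) = true →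
    (σ j).off.testBit (pos z) = false → loc z' = (torusGrid L).step j (loc z) →
    (σ ((j + 2) % 4)).out.testBit (pos z') = true
  -- Outside of the frame nothing happens: checks are satisfied and have no new edges.
  ext_sat : ∀ x, (∀ z, D z → loc z ≠ x) → uns s x = false
  ext_old : ∀ x, (∀ z, D z → loc z ≠ x) → ∀ j, 4 ≤ j → j < 8 → slotUsed B x j = false

/-- Bounds for the messages received after `i` iterations. -/
structure Received (B : Finset (Site L)) (s : Site L → ZMod 2) (D : Z → Prop) (pos : Z → ℕ)
    (loc : Z → Site L) (i : ℕ) (α β : ℕ → Msg) : Prop where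
  site : ∀ z, D z → ∀ j < 8, slotUsed B (loc z) j = true →
    (α j).Holds (pos z) ((messages B s i).siteIn (loc z) j)
  site_far : ∀ z, D z → ∀ j < 8, slotUsed B (loc z) j = false → (α j).Far (pos z)
  mid : ∀ z, D z → ∀ k < 4, inB B (loc z) = true →
    (β k).Holds (pos z) ((messages B s i).midIn (loc z) k)
  mid_far : ∀ z, D z → ∀ k < 4, inB B (loc z) = false → (β k).Far (pos z)
  site_length : ∀ j < 8, (α j).lt.length = i + 1
  mid_length : ∀ k < 4, (β k).lt.length = i + 1
  -- The invariant outside of the frame, where no other bound is kept.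
  ext : ∀ x, (∀ z, D z → loc z ≠ x) → ∀ j < 4, slotUsed B x j = true →
    0 ≤ (messages B s i).siteIn x j

variable {U : Setup} {B : Finset (Site L)} {s : Site L → ZMod 2} {σ τ : ℕ → Slot}
    {D : Z → Prop} {pos : Z → ℕ} {loc : Z → Site L} {α β : ℕ → Msg} {i : ℕ}

/-- The messages sent from the slots of a site. -/
def siteDeparture (U : Setup) (i : ℕ) (α : ℕ → Msg) : ℕ → Msg :=
  departure ((List.range 8).map fun j => (α j).incr U.full) (Msg.start U.full U.syn (i + 2))

/-- The messages sent from the slots of the middle of a plaquette. -/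
def midDeparture (U : Setup) (i : ℕ) (β : ℕ → Msg) : ℕ → Msg :=
  departure ((List.range 4).map fun j => (β j).incr U.full) (Msg.start U.full 0 (i + 2))

theorem Received.siteDeparture_length (h : Received B s D pos loc i α β) {j : ℕ} (hj : j < 8) :
    (siteDeparture U i α j).lt.length = i + 2 :=
  departure_length (.inl rfl) hj fun j hj => by rw [h.site_length j hj]

theorem Received.midDeparture_length (h : Received B s D pos loc i α β) {k : ℕ} (hk : k < 4) :
    (midDeparture U i β k).lt.length = i + 2 :=
  departure_length (.inr rfl) hk fun j hj => by rw [h.mid_length j hj]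

theorem Received.siteDeparture_holds (hL : 1 < L) (hB : Independent B)
    (hU : U.Reads B s σ τ D pos loc) (h : Received B s D pos loc i α β) {z : Z} (hz : D z) {j : ℕ}
    (hj : j < 8) :
    (siteDeparture U i α j).Holds (pos z) ((messages B s (i + 1)).site (loc z) j) := by
  have := departure_holds (c := i + 2) (syn := U.syn) (.inl rfl) hj (hU.full z hz) (h.site z hz)
    (h.site_far z hz) (slots_erase_nonempty hL hB (loc z) j)
  rw [hU.syn z hz] at this
  simp only [uns_eq_true] at this
  exact this

theorem Received.midDeparture_holds (hU : U.Reads B s σ τ D pos loc)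
    (h : Received B s D pos loc i α β) {z : Z} (hz : D z) (hB : inB B (loc z) = true) {k : ℕ}
    (hk : k < 4) :
    (midDeparture U i β k).Holds (pos z) ((messages B s (i + 1)).mid (loc z) k) := by
  have := departure_holds (c := i + 2) (syn := 0) (u := fun _ => true) (.inr rfl) hk (hU.full z hz)
    (fun k hk _ => h.mid z hz k hk hB) (fun _ _ h => by simp at h)
    (by simpa using range_erase_nonempty k)
  change (departure _ _ k).Holds _ (combine 1 _ _)
  simpa using this

/-- Checks outside of the frame send nonnegative messages. -/
theorem Received.ext_nonneg (hU : U.Reads B s σ τ D pos loc) (h : Received B s D pos loc i α β)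
    {x : Site L} (hx : ∀ z, D z → loc z ≠ x) (j : ℕ) : 0 ≤ (messages B s (i + 1)).site x j := by
  change 0 ≤ combine (if s x = 1 then -1 else 1) _ _
  have hs := hU.ext_sat x hx
  rw [uns_eq_false] at hs
  rw [if_neg (by rw [hs]; decide)]
  refine combine_nonneg fun l hl => ?_
  obtain ⟨h8, hu⟩ := mem_slots.1 (Finset.mem_of_mem_erase hl)
  by_cases h4 : l < 4
  · have := h.ext x hx l h4 hu
    omega
  · rw [hU.ext_old x hx l (by omega) h8] at hu
    simp at hu

/-- The message received in a slot, see `Msg.arrive`. -/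
def arrival (full : ℕ) (e : Slot) (a : Msg) : Msg := a.arrive full e.move e.off e.out

theorem arrival_holds {full n n' : ℕ} {e : Slot} {a : Msg} {x : ℤ} (hf : full.testBit n = true)
    (hoff : e.off.testBit n = false) (hout : e.out.testBit n = false)
    (hm : ∀ w, (e.move w).testBit n = w.testBit n') (h : a.Holds n' x) :
    (arrival full e a).Holds n x := by
  have hx : (Nat.xor full e.out).testBit n = true := by rw [testBit_xor, hf, hout]; rfl
  have hg : ∀ (l : List ℕ) (f : ℕ → ℕ) (t : ℕ), f 0 = 0 ∨ t < l.length →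
      (l.map f).getD t 0 = f (l.getD t 0) := by
    intro l f t h
    rw [List.getD_eq_getElem?_getD, List.getD_eq_getElem?_getD, List.getElem?_map]
    rcases lt_or_ge t l.length with ht | ht
    · rw [List.getElem?_eq_getElem ht]; rfl
    · rw [List.getElem?_eq_none ht]
      exact (h.resolve_right (by omega)).symm
  have hlen : ∀ (l : List ℕ) (f : ℕ → ℕ) (t : ℕ), ((l.map f).getD t 0).testBit n = true →
      t < l.length := by
    intro l f t h
    by_contra hn
    rw [List.getD_eq_default _ _ (by simpa using hn)] at h
    simp at h
  constructor
  · intro hb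
    simp only [arrival, Msg.arrive, strict_eq, testBit_lor, testBit_land, hout, hx, hm] at hb
    exact h.pos (by simpa using hb)
  · intro hb
    simp only [arrival, Msg.arrive, strict_eq, testBit_land, hx, hm] at hb
    exact h.neg (by simpa using hb)
  · intro t hb
    simp only [arrival, Msg.arrive, strict_eq] at hb
    rw [hg _ _ _ (.inr (hlen _ _ _ hb)), testBit_lor, testBit_land, hoff, hx, hm] at hb
    exact h.ge t (by simpa using hb)
  · intro t hb
    simp only [arrival, Msg.arrive, strict_eq] at hb
    rw [hg _ _ _ (.inr (hlen _ _ _ hb)), testBit_land, hx, hm] at hb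
    exact h.lt t (by simpa using hb)

theorem arrival_far {full n : ℕ} {e : Slot} {a : Msg} (hf : full.testBit n = true)
    (hout : e.out.testBit n = true) : (arrival full e a).Far n := by
  have hx : (Nat.xor full e.out).testBit n = false := by rw [testBit_xor, hf, hout]; rfl
  constructor
  · simp only [arrival, Msg.arrive, strict_eq, testBit_land, hx, Bool.false_and]
  · intro t
    simp only [arrival, Msg.arrive, strict_eq, List.getD_eq_getElem?_getD, List.getElem?_map]
    cases a.lt[t]? with
    | none => simp
    | some w =>
      rw [Option.map_some, Option.getD_some, testBit_land, hx, Bool.false_and]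

theorem arrival_length (full : ℕ) (e : Slot) (a : Msg) :
    (arrival full e a).lt.length = a.lt.length := by
  simp [arrival, Msg.arrive, strict_eq]

/-- All that is known about a message that enters the frame is that it is not negative. -/
theorem arrival_seam {full n : ℕ} {e : Slot} {a : Msg} {x : ℤ} (hf : full.testBit n = true)
    (hoff : e.off.testBit n = false) (hout : e.out.testBit n = true) (h : 0 ≤ x) :
    (arrival full e a).Holds n x := by
  have hx : (Nat.xor full e.out).testBit n = false := by rw [testBit_xor, hf, hout]; rfl
  have hfar := arrival_far (a := a) hf hout
  constructor
  · exact fun _ => h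
  · intro hb; rw [hfar.neg] at hb; simp at hb
  · intro t
    simp only [arrival, Msg.arrive, strict_eq, List.getD_eq_getElem?_getD, List.getElem?_map]
    cases a.ge[t]? with
    | none => simp
    | some w =>
      rw [Option.map_some, Option.getD_some, testBit_lor, testBit_land, hx, hoff, Bool.false_and]
      simp
  · intro t hb; rw [hfar.lt] at hb; simp at hb

/-- The messages that arrive in the slots of a site, given those sent. -/
def siteArrival (U : Setup) (i : ℕ) (σ : ℕ → Slot) (α β : ℕ → Msg) (j : ℕ) : Msg :=
  arrival U.full (σ j)
    (if j < 4 then siteDeparture U i α ((j + 2) % 4) else midDeparture U i β (j - 4))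

/-- The messages that arrive in the slots of the middle of a plaquette. -/
def midArrival (U : Setup) (i : ℕ) (τ : ℕ → Slot) (α : ℕ → Msg) (k : ℕ) : Msg :=
  arrival U.full (τ k) (siteDeparture U i α (4 + k))

/-- If every message that leaves the frame is nonnegative, then the checks outside receive and hence
send only nonnegative messages. So the bound `0 ≤ x` assumed for messages that enter the frame is
correct, and all other bounds follow from the frame itself. -/
theorem Received.succ (hL : 1 < L) (hB : Independent B)
    (hU : U.Reads B s σ τ D pos loc) (h : Received B s D pos loc i α β)
    (hstray : ∀ z, D z → ∀ j < 4, (σ j).out.testBit (pos z) = true →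
      (σ j).off.testBit (pos z) = false → (siteDeparture U i α j).pos.testBit (pos z) = true) :
    Received B s D pos loc (i + 1) (siteArrival U i σ α β) (midArrival U i τ α) := by
  classical
  -- Messages across the boundary are nonnegative in either direction: a sender in the frame is
  -- covered by `hstray`, a sender outside by `ext_nonneg`.
  have hout : ∀ y, ∀ l < 4, (∀ z, D z → loc z = y → (σ l).out.testBit (pos z) = true) →
      slotUsed B y l = true → 0 ≤ (messages B s (i + 1)).site y l := by
    intro y l hl hz hu
    by_cases hy : ∃ z, D z ∧ loc z = y
    · obtain ⟨z, hD, rfl⟩ := hy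
      refine (h.siteDeparture_holds hL hB hU hD (by omega)).pos (hstray z hD l hl (hz z hD rfl) ?_)
      rw [hU.off z hD l (by omega), hu]; rfl
    · exact h.ext_nonneg hU (fun z hD hz => hy ⟨z, hD, hz⟩) l
  have hback : ∀ x, ∀ j < 4, slotUsed B x j = true →
      slotUsed B ((torusGrid L).step j x) ((j + 2) % 4) = true := by
    intro x j hj hu
    rw [slotUsed, if_pos (Nat.mod_lt _ (by norm_num))]
    rw [slotUsed, if_pos hj] at hu
    rw [← hu]
    interval_cases j <;> simp [kept, torusGrid, Grid.step, boolLogic, Logic.nor]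
  constructor
  · intro z hz j hj hu
    have hoff : (σ j).off.testBit (pos z) = false := by rw [hU.off z hz j hj, hu]; rfl
    rw [siteArrival]
    by_cases h4 : j < 4
    · have hin : (messages B s (i + 1)).siteIn (loc z) j =
          (messages B s (i + 1)).site ((torusGrid L).step j (loc z)) ((j + 2) % 4) := if_pos h4
      rw [if_pos h4, hin]
      cases ho : (σ j).out.testBit (pos z)
      · obtain ⟨z', hz', hl, hm⟩ := hU.old z hz j h4 ho
        rw [← hl]
        exact arrival_holds (hU.full z hz) hoff ho hm
          (h.siteDeparture_holds hL hB hU hz' (by omega))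
      -- The sender may itself be in the frame, on the opposite side; then `seam` provides what
      -- `hout` asks for.
      · refine arrival_seam (hU.full z hz) hoff ho (hout _ _ (Nat.mod_lt _ (by norm_num)) ?_
          (hback _ j h4 hu))
        exact fun z' hz' hl => hU.seam z z' hz hz' j h4 ho hoff hl
    · obtain ⟨k, rfl⟩ : ∃ k, j = 4 + k := ⟨j - 4, by omega⟩
      obtain ⟨ho, z', hz', hl, hm⟩ := hU.new z hz k (by omega) hoff
      have hin : (messages B s (i + 1)).siteIn (loc z) (4 + k) =
          (messages B s (i + 1)).mid (loc z') k := by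
        rw [Messages.siteIn, if_neg h4, Nat.add_sub_cancel_left, hl]
      rw [if_neg h4, hin, Nat.add_sub_cancel_left]
      refine arrival_holds (hU.full z hz) hoff ho hm (h.midDeparture_holds hU hz' ?_ (by omega))
      rw [slotUsed, if_neg h4, Nat.add_sub_cancel_left] at hu
      rw [hl, hu]
  · intro z hz j hj hu
    refine arrival_far (hU.full z hz) (hU.off_out z hz j hj ?_)
    rw [hU.off z hz j hj, hu]; rfl
  · intro z hz k hk hu
    obtain ⟨z', hz', hl, hm⟩ := hU.mid_move z hz k hk hu
    rw [Messages.midIn, ← hl]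
    exact arrival_holds (hU.full z hz) (by rw [hU.mid_off z hz k hk, hu]; rfl)
      (by rw [hU.mid_out z hz k hk, hu]; rfl) hm (h.siteDeparture_holds hL hB hU hz' (by omega))
  · intro z hz k hk hu
    exact arrival_far (hU.full z hz) (by rw [hU.mid_out z hz k hk, hu]; rfl)
  · intro j hj
    rw [siteArrival, arrival_length]
    split_ifs
    · exact h.siteDeparture_length (by omega)
    · exact h.midDeparture_length (by omega)
  · intro k hk
    rw [midArrival, arrival_length]
    exact h.siteDeparture_length (by omega)
  · intro x hx j hj hu
    rw [Messages.siteIn, if_pos hj]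
    refine hout _ _ (Nat.mod_lt _ (by norm_num)) (fun z hz hl => ?_) (hback x j hj hu)
    by_contra ho
    obtain ⟨z', hz', hl', -⟩ := hU.old z hz _ (Nat.mod_lt _ (by norm_num)) (by simpa using ho)
    refine hx z' hz' ?_
    rw [hl', hl, step_step x hj]

end Setup


/-! ### Evaluation of the reports. -/

namespace Setup

variable {U : Setup}

/-- The report on the messages sent and received. -/
def reportOf (U : Setup) (out inn : List Msg) : Report :=
  ⟨U.stray U.site out,
    Nat.land (U.known (U.negs out inn U.site) (poss out inn U.site))
      (parity U.syn (U.negs out inn U.site)),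
    U.goals.map fun e => U.miss e (U.negs out inn U.site) (poss out inn U.site)⟩

theorem report_eq {β : Type} (out inn : List Msg) (k : Report → β) :
    U.report out inn k = k (U.reportOf out inn) := by
  simp only [report, strictList_eq, strict_eq, reportOf]

theorem negs_map (l : List ℕ) (a b : ℕ → Msg) (σ : ℕ → Slot) :
    U.negs (l.map a) (l.map b) (l.map σ) =
      l.map fun j => Nat.land (Nat.xor U.full (σ j).off) ((a j).sumNeg (b j)) := by
  induction l with
  | nil => rfl
  | cons j l ih => simp only [List.map_cons, negs, ih]

theorem poss_map (l : List ℕ) (a b : ℕ → Msg) (σ : ℕ → Slot) :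
    poss (l.map a) (l.map b) (l.map σ) = l.map fun j => Nat.lor (σ j).off ((a j).sumPos (b j)) := by
  induction l with
  | nil => rfl
  | cons j l ih => simp only [List.map_cons, poss, ih]

theorem stray_pos {l : List ℕ} {σ : ℕ → Slot} {a : ℕ → Msg} {n : ℕ} (hf : U.full.testBit n = true)
    (h : (U.stray (l.map σ) (l.map a)).testBit n = false) {j : ℕ} (hj : j ∈ l)
    (ho : (σ j).out.testBit n = true) (hoff : (σ j).off.testBit n = false) :
    (a j).pos.testBit n = true := by
  induction l with
  | nil => simp at hj
  | cons k l ih =>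
    simp only [List.map_cons, stray, testBit_lor, testBit_land, testBit_xor, hf,
      Bool.or_eq_false_iff] at h
    rcases List.mem_cons.1 hj with rfl | hj
    · simpa [ho, hoff] using h.1
    · exact ih h.2 hj

theorem known_iff {l : List ℕ} {f g : ℕ → ℕ} {n : ℕ}
    (h : (U.known (l.map f) (l.map g)).testBit n = true) {j : ℕ} (hj : j ∈ l) :
    (f j).testBit n = true ∨ (g j).testBit n = true := by
  induction l with
  | nil => simp at hj
  | cons k l ih =>
    simp only [List.map_cons, known, testBit_lor, testBit_land, Bool.and_eq_true,
      Bool.or_eq_true] at h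
    rcases List.mem_cons.1 hj with rfl | hj
    · exact h.1
    · exact ih h.2 hj

theorem bit2_parity (l : List ℕ) (f : ℕ → ℕ) (s n : ℕ) :
    bit2 ((parity s (l.map f)).testBit n) =
      bit2 (s.testBit n) + (l.map fun j => bit2 ((f j).testBit n)).sum := by
  induction l with
  | nil => simp [parity]
  | cons j l ih =>
    have : parity s ((j :: l).map f) = Nat.xor (f j) (parity s (l.map f)) := rfl
    rw [this, testBit_xor, bit2_xor, ih, List.map_cons, List.sum_cons]
    ring

theorem miss_eq_false {l : List ℕ} {e f g : ℕ → ℕ} {n : ℕ} (hf : U.full.testBit n = true)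
    (h : (U.miss (l.map e) (l.map f) (l.map g)).testBit n = false) {j : ℕ} (hj : j ∈ l) :
    ((e j).testBit n = true ∧ (f j).testBit n = true) ∨
      ((e j).testBit n = false ∧ (g j).testBit n = true) := by
  induction l with
  | nil => simp at hj
  | cons k l ih =>
    simp only [List.map_cons, miss, testBit_lor, testBit_land, testBit_xor, hf,
      Bool.or_eq_false_iff] at h
    rcases List.mem_cons.1 hj with rfl | hj
    · have := h.1
      revert this
      cases (e j).testBit n <;> cases (f j).testBit n <;> cases (g j).testBit n <;> simp
    · exact ih h.2 hj

/-- The reports for given bounds of the messages received. -/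
def reportList (U : Setup) (σ τ : ℕ → Slot) : ℕ → ℕ → (ℕ → Msg) → (ℕ → Msg) → List Report
  | 0, _, _, _ => []
  | n + 1, i, α, β =>
    U.reportOf ((List.range 8).map (siteDeparture U i α))
      ((List.range 8).map (siteArrival U i σ α β)) ::
        reportList U σ τ n (i + 1) (siteArrival U i σ α β) (midArrival U i τ α)

theorem run_eq {γ : Type} {σ τ : ℕ → Slot} (hσ : U.site = (List.range 8).map σ)
    (hτ : U.mid = (List.range 4).map τ) (n i : ℕ) (α β : ℕ → Msg) (k : List Report → γ) :
    U.run n i ((List.range 8).map α) ((List.range 4).map β) k = k (U.reportList σ τ n i α β) := by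
  induction n generalizing i α β k with
  | zero => rfl
  | succ n ih =>
    simp only [run, departures_eq, arrivals, strictMsgs_eq, report_eq]
    rw [hσ, hτ]
    exact ih (i + 1) (siteArrival U i σ α β) (midArrival U i τ α) _

end Setup

/-! ### What reports say about the estimates of min-sum. -/

section Reports

variable {Z : Type} {L : ℕ} {U : Setup} {B : Finset (Site L)} {s : Site L → ZMod 2}
  {σ τ : ℕ → Slot} {D : Z → Prop} {pos : Z → ℕ} {loc : Z → Site L} {α β : ℕ → Msg} {i : ℕ}

open Setup

theorem siteEst_of_neg (hL : 1 < L) (hB : Independent B) (hU : U.Reads B s σ τ D pos loc)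
    (h : Received B s D pos loc i α β)
    (h' : Received B s D pos loc (i + 1) (siteArrival U i σ α β) (midArrival U i τ α))
    {z : Z} (hz : D z) {j : ℕ} (hj : j < 8)
    (hn : (Nat.land (Nat.xor U.full (σ j).off)
      ((siteDeparture U i α j).sumNeg (siteArrival U i σ α β j))).testBit (pos z) = true) :
    slotUsed B (loc z) j = true ∧ siteEst B s (i + 1) (loc z) j = 1 := by
  rw [testBit_land, testBit_xor, hU.full z hz, hU.off z hz j hj, Bool.and_eq_true] at hn
  have hu : slotUsed B (loc z) j = true := by simpa using hn.1
  exact ⟨hu, if_pos (Msg.Holds.sumNeg (h.siteDeparture_holds hL hB hU hz hj) (h'.site z hz j hj hu)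
    hn.2)⟩

theorem siteEst_of_pos (hL : 1 < L) (hB : Independent B) (hU : U.Reads B s σ τ D pos loc)
    (h : Received B s D pos loc i α β)
    (h' : Received B s D pos loc (i + 1) (siteArrival U i σ α β) (midArrival U i τ α))
    {z : Z} (hz : D z) {j : ℕ} (hj : j < 8)
    (hp : (Nat.lor (σ j).off
      ((siteDeparture U i α j).sumPos (siteArrival U i σ α β j))).testBit (pos z) = true)
    (hu : slotUsed B (loc z) j = true) : siteEst B s (i + 1) (loc z) j = 0 := by
  rw [testBit_lor, hU.off z hz j hj, hu, Bool.not_true, Bool.false_or] at hp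
  refine if_neg (not_lt.2 (Msg.Holds.sumPos (h.siteDeparture_holds hL hB hU hz hj)
    (h'.site z hz j hj hu) ?_ ?_ hp))
  · rw [h.siteDeparture_length hj]
    have := (messages_le (s := s) hL hB (i + 1)).1 (loc z) j
    push_cast at this ⊢; omega
  · rw [h'.site_length j hj]
    have := abs_siteIn_le (s := s) hL hB (i + 1) (loc z) j
    push_cast at this ⊢; omega

/-- The report shows that the syndrome is not satisfied. -/
theorem not_solved [NeZero L] (hL : 1 < L) (hB : Independent B) (hU : U.Reads B s σ τ D pos loc)
    (h : Received B s D pos loc i α β)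
    (h' : Received B s D pos loc (i + 1) (siteArrival U i σ α β) (midArrival U i τ α))
    {z : Z} (hz : D z)
    (hr : (U.reportOf ((List.range 8).map (siteDeparture U i α))
      ((List.range 8).map (siteArrival U i σ α β))).unsolved.testBit (pos z) = true) :
    (blowupH B).mulVec (msEstimate (blowupH B) (blowupSyndrome B s) (i + 1)) ≠
      blowupSyndrome B s := by
  intro hs
  have hs := congr_fun hs (Sum.inl (loc z))
  rw [mulVec_msEstimate_site hL] at hs
  simp only [reportOf, hU.site, negs_map, poss_map, testBit_land, Bool.and_eq_true] at hr
  obtain ⟨hk, hp⟩ := hr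
  have hp' := bit2_parity (List.range 8) (fun j => Nat.land (Nat.xor U.full (σ j).off)
      ((siteDeparture U i α j).sumNeg (siteArrival U i σ α β j))) U.syn (pos z)
  rw [hp, hU.syn z hz, bit2_uns] at hp'
  -- All estimates at this check are certain, so the parity of the certainly negative ones is the
  -- sum of the estimates; it disagrees with the syndrome.
  have hsum : ((List.range 8).map fun j => bit2 ((Nat.land (Nat.xor U.full (σ j).off)
      ((siteDeparture U i α j).sumNeg (siteArrival U i σ α β j))).testBit (pos z))).sum =
      ∑ j ∈ slots B (loc z), siteEst B s (i + 1) (loc z) j := by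
    rw [slots, Finset.sum_filter, ← List.sum_toFinset _ List.nodup_range, List.toFinset_range]
    refine Finset.sum_congr rfl fun j hj => ?_
    have hj := Finset.mem_range.1 hj
    rcases known_iff hk (List.mem_range.2 hj) with hb | hb
    · obtain ⟨hu, he⟩ := siteEst_of_neg hL hB hU h h' hz hj hb
      rw [hb, if_pos hu, he]; rfl
    · have h0 := siteEst_of_pos hL hB hU h h' hz hj hb
      cases hn : (Nat.land (Nat.xor U.full (σ j).off)
        ((siteDeparture U i α j).sumNeg (siteArrival U i σ α β j))).testBit (pos z)
      · split_ifs with hu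
        · rw [h0 hu]; rfl
        · rfl
      · obtain ⟨hu, he⟩ := siteEst_of_neg hL hB hU h h' hz hj hn
        rw [h0 hu] at he
        exact absurd he (by decide)
  rw [hsum, hs] at hp'
  change (1 : ZMod 2) = s (loc z) + s (loc z) at hp'
  revert hp'
  generalize s (loc z) = a
  revert a
  decide

/-- The estimate is the expected one `γ`. -/
def Estimated (B : Finset (Site L)) (s : Site L → ZMod 2) (D : Z → Prop) (pos : Z → ℕ)
    (loc : Z → Site L) (γ : ℕ → ℕ) (i : ℕ) : Prop :=
  (∀ z, D z → ∀ j < 8, slotUsed B (loc z) j = true →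
    siteEst B s i (loc z) j = bit2 ((γ j).testBit (pos z))) ∧
  ∀ x, (∀ z, D z → loc z ≠ x) → ∀ j < 8, slotUsed B x j = true → siteEst B s i x j = 0

theorem estimated_of_miss (hL : 1 < L) (hB : Independent B) (hU : U.Reads B s σ τ D pos loc)
    (h : Received B s D pos loc i α β)
    (h' : Received B s D pos loc (i + 1) (siteArrival U i σ α β) (midArrival U i τ α)) {γ : ℕ → ℕ}
    (hr : ∀ z, D z → (U.miss ((List.range 8).map γ)
      (U.negs ((List.range 8).map (siteDeparture U i α))
        ((List.range 8).map (siteArrival U i σ α β)) U.site)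
      (poss ((List.range 8).map (siteDeparture U i α))
        ((List.range 8).map (siteArrival U i σ α β)) U.site)).testBit (pos z) = false) :
    Estimated B s D pos loc γ (i + 1) := by
  constructor
  · intro z hz j hj hu
    have := hr z hz
    rw [hU.site, negs_map, poss_map] at this
    rcases miss_eq_false (hU.full z hz) this (List.mem_range.2 hj) with ⟨hg, hb⟩ | ⟨hg, hb⟩
    · rw [hg, (siteEst_of_neg hL hB hU h h' hz hj hb).2]; rfl
    · rw [hg, siteEst_of_pos hL hB hU h h' hz hj hb hu]; rfl
  -- At checks outside of the frame both messages on an edge are nonnegative, hence the estimate is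
  -- `0`.
  · intro x hx j hj hu
    by_cases h4 : j < 4
    · have h₁ := h.ext_nonneg hU hx j
      have h₂ := h'.ext x hx j h4 hu
      exact if_neg (by omega)
    · rw [hU.ext_old x hx j (by omega) hj] at hu
      simp at hu

/-- Accepted reports show that an expected estimate is found before any other one satisfies the
syndrome. -/
theorem exists_estimated [NeZero L] (hL : 1 < L) (hB : Independent B) (hU : U.Reads B s σ τ D pos loc)
    {A l : ℕ} (hzero : ∀ w, blockAt A l w = 0 → ∀ z, D z → w.testBit (pos z) = false)
    (hone : ∀ w, blockAt A l w ≠ 0 → ∃ z, D z ∧ w.testBit (pos z) = true) {Γ : List (ℕ → ℕ)}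
    (hΓ : U.goals = Γ.map fun γ => (List.range 8).map γ) {n : ℕ}
    (h : Received B s D pos loc i α β) (ha : accept A l (U.reportList σ τ n i α β) = true) :
    ∃ k, i < k ∧ (∃ γ ∈ Γ, Estimated B s D pos loc γ k) ∧ ∀ k', i < k' → k' < k →
      (blowupH B).mulVec (msEstimate (blowupH B) (blowupSyndrome B s) k') ≠
        blowupSyndrome B s := by
  induction n generalizing i α β with
  | zero => simp [reportList, accept] at ha
  | succ n ih =>
    rw [reportList, accept, Bool.and_eq_true, Bool.or_eq_true, Bool.and_eq_true, Nat.beq_eq,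
      Nat.ble_eq] at ha
    obtain ⟨hs, ha⟩ := ha
    have h' : Received B s D pos loc (i + 1) (siteArrival U i σ α β) (midArrival U i τ α) := by
      refine h.succ hL hB hU fun z hz j hj ho hoff => ?_
      have := hzero _ hs z hz
      rw [reportOf, hU.site] at this
      exact stray_pos (hU.full z hz) this (List.mem_range.2 (by omega)) ho hoff
    rcases ha with ha | ⟨hu, ha⟩
    · obtain ⟨w, hw, hw0⟩ := List.any_eq_true.1 ha
      simp only [reportOf, hΓ, List.map_map, List.mem_map] at hw
      obtain ⟨γ, hγ, rfl⟩ := hw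
      refine ⟨i + 1, by omega, ⟨γ, hγ, ?_⟩, fun k' h₁ h₂ => by omega⟩
      exact estimated_of_miss hL hB hU h h' (hzero _ (Nat.eq_of_beq_eq_true hw0))
    · obtain ⟨k, hk, hγ, hk'⟩ := ih h' ha
      refine ⟨k, by omega, hγ, fun k' h₁ h₂ => ?_⟩
      rcases eq_or_lt_of_le (Nat.succ_le_of_lt h₁) with rfl | h₁
      · obtain ⟨z, hz, hb⟩ := hone _ (Nat.one_le_iff_ne_zero.1 hu)
        exact not_solved hL hB hU h h' hz hb
      · exact hk' k' h₁ h₂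

/-- Before the first iteration all messages of checks are `0`. -/
theorem received_zero (hU : U.Reads B s σ τ D pos loc) :
    Received B s D pos loc 0
      (fun j => ⟨U.full, Nat.xor U.full (σ j).off, [(σ j).off], [Nat.xor U.full (σ j).off]⟩)
      (fun k => ⟨U.full, Nat.xor U.full (τ k).off, [(τ k).off], [Nat.xor U.full (τ k).off]⟩) := by
  have hlist : ∀ (a n t : ℕ), a.testBit n = false → (([a] : List ℕ).getD t 0).testBit n = false := by
    intro a n t ha
    cases t with
    | zero => exact ha
    | succ t => simp
  have hlist' : ∀ (a n t : ℕ), (([a] : List ℕ).getD t 0).testBit n = true → t = 0 := by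
    intro a n t ha
    cases t with
    | zero => rfl
    | succ t => simp at ha
  constructor
  · intro z hz j hj hu
    have hoff : (σ j).off.testBit (pos z) = false := by rw [hU.off z hz j hj, hu]; rfl
    have h0 : (messages B s 0).siteIn (loc z) j = 0 := by simp [messages, Messages.siteIn]
    rw [h0]
    refine ⟨fun _ => le_rfl, fun _ => le_rfl, fun t ht => ?_, fun t ht => ?_⟩
    · rw [hlist _ _ _ hoff] at ht; simp at ht
    · simp
  · intro z hz j hj hu
    have hx : (Nat.xor U.full (σ j).off).testBit (pos z) = false := by
      rw [testBit_xor, hU.full z hz, hU.off z hz j hj, hu]; rfl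
    exact ⟨hx, fun t => hlist _ _ _ hx⟩
  · intro z hz k hk hu
    have hoff : (τ k).off.testBit (pos z) = false := by rw [hU.mid_off z hz k hk, hu]; rfl
    have h0 : (messages B s 0).midIn (loc z) k = 0 := by simp [messages, Messages.midIn]
    rw [h0]
    refine ⟨fun _ => le_rfl, fun _ => le_rfl, fun t ht => ?_, fun t ht => ?_⟩
    · rw [hlist _ _ _ hoff] at ht; simp at ht
    · simp
  · intro z hz k hk hu
    have hx : (Nat.xor U.full (τ k).off).testBit (pos z) = false := by
      rw [testBit_xor, hU.full z hz, hU.mid_off z hz k hk, hu]; rfl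
    exact ⟨hx, fun t => hlist _ _ _ hx⟩
  · intro j _; rfl
  · intro k _; rfl
  · intro x _ j hj _
    simp [messages, Messages.siteIn]

end Reports


/-! ### Bits of words as cells of tables, and shifts of words. -/

section Cells

/-- The words for `K` tables on the `m × m` torus. -/
def Words.ofSize (m K : ℕ) : Words where
  m := m
  full := ones (m * m * K)
  firstCol := rep (m * m) K (rep m m 1)
  lastCol := rep (m * m) K (rep m m (Nat.shiftLeft 1 (m - 1)))
  firstRow := rep (m * m) K (ones m)
  lastRow := rep (m * m) K (Nat.shiftLeft (ones m) (m * (m - 1)))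

theorem withWords_eq {β : Type} (m K : ℕ) (k : Words → β) : withWords m K k = k (.ofSize m K) := by
  simp only [withWords, strict_eq, Words.ofSize]

/-- The bit that belongs to `(r, c)` in table `l`. -/
def bitIdx (m l r c : ℕ) : ℕ := l * (m * m) + (r * m + c)

variable {m K l r c : ℕ}

theorem bitIdx_lt (hr : r < m) (hc : c < m) : r * m + c < m * m := by
  have := Nat.mul_le_mul_right m (Nat.succ_le_of_lt hr)
  rw [Nat.succ_mul] at this
  omega

theorem bitIdx_mod (hr : r < m) (hc : c < m) : bitIdx m l r c % (m * m) = r * m + c := by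
  rw [bitIdx, Nat.mul_add_mod_of_lt (bitIdx_lt hr hc)]

theorem bitIdx_div (hr : r < m) (hc : c < m) : bitIdx m l r c / (m * m) = l := by
  rw [bitIdx, Nat.mul_comm l, Nat.mul_add_div (by have := bitIdx_lt hr hc; omega),
    Nat.div_eq_of_lt (bitIdx_lt hr hc), Nat.add_zero]

theorem bitIdx_lt_mul (hl : l < K) (hr : r < m) (hc : c < m) : bitIdx m l r c < m * m * K := by
  have := Nat.mul_le_mul_left (m * m) (Nat.succ_le_of_lt hl)
  have h := bitIdx_lt hr hc
  rw [Nat.mul_succ] at this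
  rw [bitIdx, Nat.mul_comm l]
  omega

theorem testBit_rep_bitIdx (hl : l < K) (hr : r < m) (hc : c < m) {t : ℕ} (ht : t < 2 ^ (m * m)) :
    (rep (m * m) K t).testBit (bitIdx m l r c) = t.testBit (r * m + c) := by
  have := bitIdx_lt hr hc
  rw [testBit_rep (by omega) ht, bitIdx_mod hr hc, decide_eq_true (bitIdx_lt_mul hl hr hc),
    Bool.true_and]

theorem testBit_full (hl : l < K) (hr : r < m) (hc : c < m) :
    (Words.ofSize m K).full.testBit (bitIdx m l r c) = true := by
  rw [Words.ofSize, testBit_ones, decide_eq_true (bitIdx_lt_mul hl hr hc)]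

theorem rep_lt {w t : ℕ} (hw : 0 < w) (ht : t < 2 ^ w) (k : ℕ) : rep w k t < 2 ^ (w * k) :=
  Nat.lt_pow_two_of_testBit _ fun i hi => by
    rw [testBit_rep hw ht, decide_eq_false (by omega), Bool.false_and]

theorem ones_lt {w w' : ℕ} (h : w ≤ w') : ones w < 2 ^ w' := by
  have := Nat.pow_le_pow_right (n := 2) (by norm_num) h
  have := Nat.one_le_two_pow (n := w)
  rw [ones]
  omega

theorem testBit_rep_row (hr : r < m) (hc : c < m) {t : ℕ} (ht : t < 2 ^ m) :
    (rep m m t).testBit (r * m + c) = t.testBit c := by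
  rw [testBit_rep (by omega) ht, decide_eq_true (bitIdx_lt hr hc), Bool.true_and,
    Nat.mul_add_mod_of_lt hc]

theorem testBit_firstCol (hl : l < K) (hr : r < m) (hc : c < m) :
    (Words.ofSize m K).firstCol.testBit (bitIdx m l r c) = decide (c = 0) := by
  have h1 : 1 < 2 ^ m := Nat.one_lt_two_pow (by omega)
  have h := testBit_shiftLeft_one 0 c
  rw [Words.ofSize, testBit_rep_bitIdx hl hr hc (rep_lt (by omega) h1 _), testBit_rep_row hr hc h1]
  exact h.trans (by simp [eq_comm])

theorem testBit_lastCol (hl : l < K) (hr : r < m) (hc : c < m) :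
    (Words.ofSize m K).lastCol.testBit (bitIdx m l r c) = decide (c + 1 = m) := by
  have h1 : Nat.shiftLeft 1 (m - 1) < 2 ^ m := Nat.lt_pow_two_of_testBit _ fun i hi => by
    rw [testBit_shiftLeft_one, decide_eq_false (by omega)]
  rw [Words.ofSize, testBit_rep_bitIdx hl hr hc (rep_lt (by omega) h1 _), testBit_rep_row hr hc h1,
    testBit_shiftLeft_one]
  exact decide_eq_decide.2 (by omega)

theorem testBit_firstRow (hl : l < K) (hr : r < m) (hc : c < m) :
    (Words.ofSize m K).firstRow.testBit (bitIdx m l r c) = decide (r = 0) := by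
  rw [Words.ofSize, testBit_rep_bitIdx hl hr hc (ones_lt (Nat.le_mul_self m)), testBit_ones]
  refine decide_eq_decide.2 ⟨fun h => ?_, fun h => by rw [h]; omega⟩
  by_contra h0
  have := Nat.mul_le_mul_right m (Nat.one_le_iff_ne_zero.2 h0)
  omega

theorem testBit_lastRow (hl : l < K) (hr : r < m) (hc : c < m) :
    (Words.ofSize m K).lastRow.testBit (bitIdx m l r c) = decide (r + 1 = m) := by
  have hm : m * (m - 1) + m = m * m := by
    rw [← Nat.mul_succ, Nat.succ_eq_add_one, Nat.sub_add_cancel (by omega)]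
  have h1 : Nat.shiftLeft (ones m) (m * (m - 1)) < 2 ^ (m * m) :=
    Nat.lt_pow_two_of_testBit _ fun i hi => by
      rw [testBit_shiftLeft, testBit_ones, decide_eq_false (p := i - _ < m) (by omega),
        Bool.and_false]
  rw [Words.ofSize, testBit_rep_bitIdx hl hr hc h1, testBit_shiftLeft, testBit_ones,
    ← Bool.decide_and]
  have hb := bitIdx_lt hr hc
  refine decide_eq_decide.2 ⟨fun h => ?_, fun h => ?_⟩
  · by_contra h0
    have := Nat.mul_le_mul_right m (show r + 1 ≤ m - 1 by omega)
    rw [Nat.succ_mul, Nat.mul_comm (m - 1)] at this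
    omega
  · have : r * m = m * (m - 1) := by rw [← h, Nat.add_sub_cancel, Nat.mul_comm]
    omega

theorem testBit_select {T : Words} {mask a b n : ℕ} (h : T.full.testBit n = true) :
    (T.select mask a b).testBit n = if mask.testBit n then b.testBit n else a.testBit n := by
  rw [Words.select, Words.not, testBit_lor, testBit_land, testBit_land, testBit_xor, h]
  cases mask.testBit n <;> simp

theorem testBit_not {T : Words} {a n : ℕ} (h : T.full.testBit n = true) :
    (T.not a).testBit n = !a.testBit n := by
  rw [Words.not, testBit_xor, h, Bool.true_xor]

theorem testBit_shiftLeft_of_eq {w k n n' : ℕ} (h : n' + k = n) :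
    (Nat.shiftLeft w k).testBit n = w.testBit n' := by
  rw [testBit_shiftLeft, decide_eq_true (by omega), Bool.true_and, ← h, Nat.add_sub_cancel]

theorem testBit_shiftRight_of_eq {w k n n' : ℕ} (h : k + n = n') :
    (Nat.shiftRight w k).testBit n = w.testBit n' := by
  rw [testBit_shiftRight, h]

theorem testBit_rt (hl : l < K) (hr : r < m) (hc : c < m) (w : ℕ) :
    ((Words.ofSize m K).rt w).testBit (bitIdx m l r c) =
      w.testBit (bitIdx m l r (if c + 1 = m then 0 else c + 1)) := by
  rw [Words.rt, testBit_select (testBit_full hl hr hc), testBit_lastCol hl hr hc,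
    show (Words.ofSize m K).m = m from rfl]
  simp only [decide_eq_true_eq]
  split_ifs with h
  · exact testBit_shiftLeft_of_eq (by simp only [bitIdx]; omega)
  · exact testBit_shiftRight_of_eq (by simp only [bitIdx]; omega)

theorem testBit_lf (hl : l < K) (hr : r < m) (hc : c < m) (w : ℕ) :
    ((Words.ofSize m K).lf w).testBit (bitIdx m l r c) =
      w.testBit (bitIdx m l r (if c = 0 then m - 1 else c - 1)) := by
  rw [Words.lf, testBit_select (testBit_full hl hr hc), testBit_firstCol hl hr hc,
    show (Words.ofSize m K).m = m from rfl]
  simp only [decide_eq_true_eq]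
  split_ifs with h
  · exact testBit_shiftRight_of_eq (by simp only [bitIdx]; omega)
  · exact testBit_shiftLeft_of_eq (by simp only [bitIdx]; omega)

theorem testBit_dn (hl : l < K) (hr : r < m) (hc : c < m) (w : ℕ) :
    ((Words.ofSize m K).dn w).testBit (bitIdx m l r c) =
      w.testBit (bitIdx m l (if r + 1 = m then 0 else r + 1) c) := by
  rw [Words.dn, testBit_select (testBit_full hl hr hc), testBit_lastRow hl hr hc,
    show (Words.ofSize m K).m = m from rfl]
  simp only [decide_eq_true_eq]
  split_ifs with h
  · have : r * m = m * (m - 1) := by rw [← h, Nat.add_sub_cancel, Nat.mul_comm]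
    exact testBit_shiftLeft_of_eq (by simp only [bitIdx]; omega)
  · exact testBit_shiftRight_of_eq (by simp only [bitIdx, Nat.succ_mul]; omega)

theorem testBit_up (hl : l < K) (hr : r < m) (hc : c < m) (w : ℕ) :
    ((Words.ofSize m K).up w).testBit (bitIdx m l r c) =
      w.testBit (bitIdx m l (if r = 0 then m - 1 else r - 1) c) := by
  rw [Words.up, testBit_select (testBit_full hl hr hc), testBit_firstRow hl hr hc,
    show (Words.ofSize m K).m = m from rfl]
  simp only [decide_eq_true_eq]
  split_ifs with h
  · subst h
    exact testBit_shiftRight_of_eq (by simp only [bitIdx, Nat.mul_comm m]; omega)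
  · have : r * m = (r - 1) * m + m := by
      rw [← Nat.succ_mul, Nat.succ_eq_add_one, Nat.sub_add_cancel (by omega)]
    exact testBit_shiftLeft_of_eq (by simp only [bitIdx]; omega)

/-- The bit that belongs to `z` in table `l`. -/
def cell (m l : ℕ) (z : ℤ × ℤ) : ℕ := bitIdx m l (z.1 % m).toNat (z.2 % m).toNat

theorem toNat_emod_lt (hm : 0 < m) (z : ℤ) : (z % m).toNat < m := by
  have h₁ := Int.emod_nonneg z (by omega : (m : ℤ) ≠ 0)
  have h₂ := Int.emod_lt_of_pos z (by omega : (0 : ℤ) < m)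
  omega

theorem toNat_emod_add_one (hm : 0 < m) (z : ℤ) :
    ((z + 1) % m).toNat = if (z % m).toNat + 1 = m then 0 else (z % m).toNat + 1 := by
  have h₁ := Int.emod_nonneg z (by omega : (m : ℤ) ≠ 0)
  have h₂ := Int.emod_lt_of_pos z (by omega : (0 : ℤ) < m)
  rw [← Int.emod_add_emod]
  split_ifs with h
  · rw [show z % m + 1 = m by omega, Int.emod_self]; rfl
  · rw [Int.emod_eq_of_lt (by omega) (by omega)]
    omega

theorem toNat_emod_sub_one (hm : 0 < m) (z : ℤ) :
    ((z - 1) % m).toNat = if (z % m).toNat = 0 then m - 1 else (z % m).toNat - 1 := by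
  have h₁ := Int.emod_nonneg z (by omega : (m : ℤ) ≠ 0)
  have h₂ := Int.emod_lt_of_pos z (by omega : (0 : ℤ) < m)
  rw [← Int.emod_sub_emod]
  split_ifs with h
  · rw [show z % m - 1 = -1 by omega, ← Int.add_emod_right, Int.emod_eq_of_lt (by omega) (by omega)]
    omega
  · rw [Int.emod_eq_of_lt (by omega) (by omega)]
    omega

/-- Shifted words, read at a fixed bit, follow the steps in the plane modulo `m`, within one table.
So formulas evaluated on words hold in every table at once. -/
theorem wordGrid_rel (hm : 0 < m) (hl : l < K) (n : ℕ) : (Words.ofSize m K).grid.Rel latticeGrid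
    fun x z => ∀ w, (x w).testBit n = w.testBit (cell m l z) := by
  have h := toNat_emod_lt hm
  constructor
  · intro x z hx w
    refine (hx _).trans ?_
    rw [cell, testBit_rt hl (h _) (h _), ← toNat_emod_add_one hm]
    rfl
  · intro x z hx w
    refine (hx _).trans ?_
    rw [cell, testBit_dn hl (h _) (h _), ← toNat_emod_add_one hm]
    rfl
  · intro x z hx w
    refine (hx _).trans ?_
    rw [cell, testBit_lf hl (h _) (h _), ← toNat_emod_sub_one hm]
    rfl
  · intro x z hx w
    refine (hx _).trans ?_
    rw [cell, testBit_up hl (h _) (h _), ← toNat_emod_sub_one hm]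
    rfl

theorem testBit_full_cell (hm : 0 < m) (hl : l < K) (z : ℤ × ℤ) :
    (Words.ofSize m K).full.testBit (cell m l z) = true :=
  testBit_full hl (toNat_emod_lt hm _) (toNat_emod_lt hm _)

end Cells


/-! ### The frame as a part of the torus. -/

section Frame

theorem Logic.rel_eq {α : Type} (o : Logic α) : o.Rel o Eq :=
  ⟨fun h h' => congrArg₂ o.conj h h', fun h h' => congrArg₂ o.disj h h',
    fun h h' => congrArg₂ o.sum h h', fun h => congrArg o.neg h⟩

variable {L : ℕ}

/-- The site with coordinates `z` relative to `o`. -/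
def loc (o : Site L) (z : ℤ × ℤ) : Site L := (o.1 + (z.1 : ZMod L), o.2 + (z.2 : ZMod L))

theorem locGrid_rel (o : Site L) : latticeGrid.Rel (torusGrid L) fun z x => x = loc o z := by
  constructor <;> rintro z _ rfl <;> simp [latticeGrid, torusGrid, loc, add_assoc, add_sub_assoc]

theorem loc_eq_iff {o : Site L} {z z' : ℤ × ℤ} :
    loc o z = loc o z' ↔ (L : ℤ) ∣ z.1 - z'.1 ∧ (L : ℤ) ∣ z.2 - z'.2 := by
  rw [loc, loc, Prod.mk.injEq, add_right_inj, add_right_inj, eq_comm,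
    ZMod.intCast_eq_intCast_iff_dvd_sub, eq_comm, ZMod.intCast_eq_intCast_iff_dvd_sub]

theorem eq_of_dvd_sub {a b : ℤ} (h : (L : ℤ) ∣ a - b) (h₁ : a < b + L) (h₂ : b < a + L) : a = b := by
  have := Int.eq_zero_of_abs_lt_dvd h (abs_lt.2 ⟨by omega, by omega⟩)
  omega

theorem exists_loc_eq [NeZero L] (o x : Site L) : ∃ z, loc o z = x :=
  ⟨(((x.1 - o.1).val : ℤ), ((x.2 - o.2).val : ℤ)), by simp [loc]⟩

/-- The domain described by the words: all sites, or a square cut out of the torus. -/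
def InFrame (cut : Bool) (r : ℤ) (z : ℤ × ℤ) : Prop :=
  cut = true → -r ≤ z.1 ∧ z.1 ≤ 9 + r ∧ -r ≤ z.2 ∧ z.2 ≤ 9 + r

namespace Words

/-- The edges in direction `j` that leave the square. -/
def frameEdge (T : Words) (cut : Bool) (j : ℕ) : ℕ :=
  bif cut then [T.lastCol, T.lastRow, T.firstCol, T.firstRow].getD j 0 else 0

/-- The slots of sites, for the word `B` of blown-up plaquettes. -/
def siteSlot (T : Words) (cut : Bool) (B j : ℕ) : Slot :=
  if j < 4 then
    ⟨T.not (kept T.grid T.logic (fun x => x B) j id),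
      Nat.lor (T.not (kept T.grid T.logic (fun x => x B) j id)) (T.frameEdge cut j),
      T.grid.step j id⟩
  else ⟨T.not (T.grid.uncor (j - 4) id B), T.not (T.grid.uncor (j - 4) id B),
    T.grid.uncor (j - 4) id⟩

/-- The slots of the middles of plaquettes. -/
def midSlot (T : Words) (B k : ℕ) : Slot := ⟨T.not B, T.not B, T.grid.cor k id⟩

end Words

theorem kept_congr {α : Type} {o : Logic α} {f g : ℤ × ℤ → α} {z : ℤ × ℤ}
    (h : ∀ z', z.1 - 1 ≤ z'.1 → z'.1 ≤ z.1 → z.2 - 1 ≤ z'.2 → z'.2 ≤ z.2 → f z' = g z') (j : ℕ) :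
    kept latticeGrid o f j z = kept latticeGrid o g j z := by
  have h₀ := h z (by omega) (by omega) (by omega) (by omega)
  have h₁ := h (latticeGrid.lf z) (by simp [latticeGrid]) (by simp [latticeGrid])
    (by simp [latticeGrid]) (by simp [latticeGrid])
  have h₂ := h (latticeGrid.up z) (by simp [latticeGrid]) (by simp [latticeGrid])
    (by simp [latticeGrid]) (by simp [latticeGrid])
  have h₃ := h (latticeGrid.up (latticeGrid.lf z)) (by simp [latticeGrid]) (by simp [latticeGrid])
    (by simp [latticeGrid]) (by simp [latticeGrid])
  match j with
  | 0 => simp only [kept, h₀, h₂]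
  | 1 => simp only [kept, h₀, h₁]
  | 2 => simp only [kept, h₁, h₃]
  | j + 3 =>
    have : latticeGrid.lf (latticeGrid.up z) = latticeGrid.up (latticeGrid.lf z) := rfl
    simp only [kept, this, h₂, h₃]

theorem uncor_bounds {z : ℤ × ℤ} {k : ℕ} (hk : k < 4) :
    z.1 - 1 ≤ (latticeGrid.uncor k z).1 ∧ (latticeGrid.uncor k z).1 ≤ z.1 ∧
      z.2 - 1 ≤ (latticeGrid.uncor k z).2 ∧ (latticeGrid.uncor k z).2 ≤ z.2 := by
  interval_cases k <;> simp [Grid.uncor, latticeGrid]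

theorem cor_bounds {z : ℤ × ℤ} {k : ℕ} (hk : k < 4) :
    z.1 ≤ (latticeGrid.cor k z).1 ∧ (latticeGrid.cor k z).1 ≤ z.1 + 1 ∧
      z.2 ≤ (latticeGrid.cor k z).2 ∧ (latticeGrid.cor k z).2 ≤ z.2 + 1 := by
  interval_cases k <;> simp [Grid.cor, latticeGrid]

variable {m K l : ℕ} {cut : Bool} {o : Site L} {B : Finset (Site L)} {s : Site L → ZMod 2}
  {S W : ℕ} {U : Setup}

theorem cell_toNat {z : ℤ × ℤ} (h₁ : 0 ≤ z.1) (h₁' : z.1 < m) (h₂ : 0 ≤ z.2) (h₂' : z.2 < m) :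
    cell m l z = bitIdx m l z.1.toNat z.2.toNat := by
  rw [cell, Int.emod_eq_of_lt h₁ h₁', Int.emod_eq_of_lt h₂ h₂']

/-- In a frame that is cut out of the torus, the edges that leave the frame. -/
theorem testBit_frameEdge (hl : l < K) {z : ℤ × ℤ} (h₁ : 0 ≤ z.1) (h₁' : z.1 ≤ 9) (h₂ : 0 ≤ z.2)
    (h₂' : z.2 ≤ 9) {j : ℕ} (hj : j < 4) :
    ((Words.ofSize 10 K).frameEdge true j).testBit (cell 10 l z) = true ↔
      (j = 0 ∧ z.2 = 9) ∨ (j = 1 ∧ z.1 = 9) ∨ (j = 2 ∧ z.2 = 0) ∨ (j = 3 ∧ z.1 = 0) := by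
  rw [cell_toNat h₁ (by push_cast; omega) h₂ (by push_cast; omega)]
  have hr : z.1.toNat < 10 := by omega
  have hc : z.2.toNat < 10 := by omega
  interval_cases j
  · exact (Bool.eq_iff_iff.1 (testBit_lastCol hl hr hc)).trans (by simp; omega)
  · exact (Bool.eq_iff_iff.1 (testBit_lastRow hl hr hc)).trans (by simp; omega)
  · exact (Bool.eq_iff_iff.1 (testBit_firstCol hl hr hc)).trans (by simp; omega)
  · exact (Bool.eq_iff_iff.1 (testBit_firstRow hl hr hc)).trans (by simp; omega)

/-- In the cut case the unsatisfied checks and the blown-up plaquettes have coordinates from `1` to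
`8`. Therefore no new edge crosses the boundary of the square, and nothing outside differs from the
empty lattice. -/
theorem reads_frame [NeZero L] (hm : 0 < m) (hl : l < K)
    (hcut : cut = true → m = 10 ∧ 10 ≤ L)
    (hS : ∀ z, InFrame cut 0 z → S.testBit (cell m l z) = uns s (loc o z))
    (hW : ∀ z, InFrame cut 1 z → W.testBit (cell m l z) = inB B (loc o z))
    (hs : cut = true → ∀ z, uns s (loc o z) = true →
      ∃ z', 1 ≤ z'.1 ∧ z'.1 ≤ 8 ∧ 1 ≤ z'.2 ∧ z'.2 ≤ 8 ∧ loc o z = loc o z')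
    (hB : cut = true → ∀ z, inB B (loc o z) = true →
      ∃ z', 1 ≤ z'.1 ∧ z'.1 ≤ 8 ∧ 1 ≤ z'.2 ∧ z'.2 ≤ 8 ∧ loc o z = loc o z')
    (hfull : U.full = (Words.ofSize m K).full) (hsyn : U.syn = S)
    (hsite : U.site = (List.range 8).map ((Words.ofSize m K).siteSlot cut W))
    (hmid : U.mid = (List.range 4).map ((Words.ofSize m K).midSlot W)) :
    U.Reads B s ((Words.ofSize m K).siteSlot cut W) ((Words.ofSize m K).midSlot W) (InFrame cut 0)
      (cell m l) (loc o) := by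
  have hf := testBit_full_cell hm hl
  have hg : ∀ z, ((Words.ofSize m K).grid).Rel latticeGrid
    fun x z' => ∀ w, (x w).testBit (cell m l z) = w.testBit (cell m l z') :=
    fun z => wordGrid_rel hm hl _
  have hkept : ∀ z, InFrame cut 0 z → ∀ j, (kept (Words.ofSize m K).grid (Words.ofSize m K).logic
      (fun x => x W) j id).testBit (cell m l z) =
      kept (torusGrid L) boolLogic (inB B) j (loc o z) := by
    intro z hz j
    have h₁ : _ = _ := (hg z).kept (tableLogic_rel (hf z)) (S := fun x => x W)
      (S' := fun z => W.testBit (cell m l z)) (fun h => h W) (x := id) (y := z) (fun _ => rfl) j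
    have h₂ : _ = _ := (locGrid_rel o).kept boolLogic.rel_eq (S := fun z => inB B (loc o z))
      (S' := inB B) (by rintro _ _ rfl; rfl) (x := z) rfl j
    rw [← h₂]
    refine h₁.trans (kept_congr (fun z' a b c d => hW z' fun hc => ?_) j)
    have := hz hc
    omega
  have huncor : ∀ z, InFrame cut 0 z → ∀ k < 4, ((Words.ofSize m K).grid.uncor k id W).testBit
      (cell m l z) = inB B ((torusGrid L).uncor k (loc o z)) := by
    intro z hz k hk
    refine ((hg z).uncor (x := id) (y := z) (fun _ => rfl) k W).trans ?_
    rw [(locGrid_rel o).uncor (x := z) rfl k]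
    refine hW _ fun hc => ?_
    have := hz hc
    have := uncor_bounds (z := z) hk
    omega
  have hB' : cut = true → ∀ z, InFrame cut 1 z → inB B (loc o z) = true →
      1 ≤ z.1 ∧ z.1 ≤ 8 ∧ 1 ≤ z.2 ∧ z.2 ≤ 8 := by
    intro hc z hz hb
    obtain ⟨z', h₁, h₂, h₃, h₄, h⟩ := hB hc z hb
    rw [loc_eq_iff] at h
    have h10 := (hcut hc).2
    have := hz hc
    have e₁ := eq_of_dvd_sub h.1 (by omega) (by omega)
    have e₂ := eq_of_dvd_sub h.2 (by omega) (by omega)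
    omega
  have hedge : ∀ z, InFrame cut 0 z → ∀ j < 4, ((Words.ofSize m K).frameEdge cut j).testBit
      (cell m l z) = true ↔ cut = true ∧
      ((j = 0 ∧ z.2 = 9) ∨ (j = 1 ∧ z.1 = 9) ∨ (j = 2 ∧ z.2 = 0) ∨ (j = 3 ∧ z.1 = 0)) := by
    intro z hz j hj
    cases cut
    · simp [Words.frameEdge]
    · obtain ⟨rfl, -⟩ := hcut rfl
      have := hz rfl
      rw [testBit_frameEdge hl (by omega) (by omega) (by omega) (by omega) hj]
      simp
  have hold : ∀ z, InFrame cut 0 z → ∀ j < 4,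
      ((Words.ofSize m K).siteSlot cut W j).off.testBit (cell m l z) = !slotUsed B (loc o z) j := by
    intro z hz j hj
    rw [Words.siteSlot, if_pos hj, slotUsed, if_pos hj, testBit_not (hf z), hkept z hz]
  have hnew : ∀ z, InFrame cut 0 z → ∀ k < 4,
      ((Words.ofSize m K).siteSlot cut W (4 + k)).off.testBit (cell m l z) =
        !inB B ((torusGrid L).uncor k (loc o z)) := by
    intro z hz k hk
    rw [Words.siteSlot, if_neg (by omega), Nat.add_sub_cancel_left, testBit_not (hf z),
      huncor z hz k hk]
  have hout : ∀ z, InFrame cut 0 z → ∀ j < 4,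
      ((Words.ofSize m K).siteSlot cut W j).out.testBit (cell m l z) =
        (((Words.ofSize m K).siteSlot cut W j).off.testBit (cell m l z) ||
          ((Words.ofSize m K).frameEdge cut j).testBit (cell m l z)) := by
    intro z hz j hj
    rw [Words.siteSlot, if_pos hj, testBit_lor]
  have hW0 : ∀ z, InFrame cut 0 z → W.testBit (cell m l z) = inB B (loc o z) := fun z hz =>
    hW z fun hc => by have := hz hc; omega
  constructor
  · exact hsite
  · exact hmid
  · intro z _; rw [hfull, hf]
  · intro z hz; rw [hsyn, hS z hz]
  · intro z hz j hj
    by_cases h4 : j < 4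
    · exact hold z hz j h4
    · obtain ⟨k, rfl⟩ : ∃ k, j = 4 + k := ⟨j - 4, by omega⟩
      rw [hnew z hz k (by omega), slotUsed, if_neg h4, Nat.add_sub_cancel_left]
  · intro z hz j hj h
    by_cases h4 : j < 4
    · rw [hout z hz j h4, h, Bool.true_or]
    · simp only [Words.siteSlot, if_neg h4] at h ⊢
      exact h
  · intro z hz j hj h
    rw [hout z hz j hj, Bool.or_eq_false_iff] at h
    refine ⟨latticeGrid.step j z, fun hc => ?_, ((locGrid_rel o).step (x := z) rfl j).symm,
      fun w => ?_⟩
    · have hn := mt (hedge z hz j hj).2 (by simp [h.2])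
      have := hz hc
      interval_cases j <;> simp [hc] at hn <;> simp [Grid.step, latticeGrid] <;> omega
    · rw [Words.siteSlot, if_pos hj]
      exact (hg z).step (x := id) (y := z) (fun _ => rfl) j w
  · intro z hz k hk h
    have hb := hnew z hz k hk
    rw [h] at hb
    have hb : inB B ((torusGrid L).uncor k (loc o z)) = true := by simpa using hb
    rw [(locGrid_rel o).uncor (x := z) rfl k] at hb
    refine ⟨?_, latticeGrid.uncor k z, fun hc => ?_, ((locGrid_rel o).uncor (x := z) rfl k).symm,
      fun w => ?_⟩
    · simp only [Words.siteSlot, if_neg (show ¬ 4 + k < 4 by omega)] at h ⊢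
      exact h
    · have := hB' hc _ (fun hc => by
        have := hz hc
        have := uncor_bounds (z := z) hk
        omega) hb
      omega
    · rw [Words.siteSlot, if_neg (by omega), Nat.add_sub_cancel_left]
      exact (hg z).uncor (x := id) (y := z) (fun _ => rfl) k w
  · intro z hz k _
    rw [Words.midSlot, testBit_not (hf z), hW0 z hz]
  · intro z hz k _
    rw [Words.midSlot, testBit_not (hf z), hW0 z hz]
  · intro z hz k hk hb
    refine ⟨latticeGrid.cor k z, fun hc => ?_, ((locGrid_rel o).cor (x := z) rfl k).symm,
      fun w => (hg z).cor (x := id) (y := z) (fun _ => rfl) k w⟩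
    have := hB' hc z (fun hc => by have := hz hc; omega) hb
    have := cor_bounds (z := z) hk
    omega
  -- For `L > 10` the two ends cannot both lie in the square. For `L = 10` opposite sides of the
  -- square are adjacent, and divisibility puts `z'` on the opposite side.
  · intro z z' hz hz' j hj ho hoff hl'
    rw [hout z hz j hj, hoff, Bool.false_or, hedge z hz j hj] at ho
    rw [hout z' hz' _ (Nat.mod_lt _ (by norm_num)), Bool.or_eq_true]
    refine .inr ((hedge z' hz' _ (Nat.mod_lt _ (by norm_num))).2 ⟨ho.1, ?_⟩)
    rw [(locGrid_rel o).step (x := z) rfl j, loc_eq_iff] at hl'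
    have h10 := (hcut ho.1).2
    have h₁ := hz ho.1
    have h₂ := hz' ho.1
    obtain ⟨hc, ⟨rfl, h⟩ | ⟨rfl, h⟩ | ⟨rfl, h⟩ | ⟨rfl, h⟩⟩ := ho
    · have := Int.le_of_dvd (by omega)
        ((dvd_sub_comm.1 hl'.2 : (L : ℤ) ∣ (z.2 + 1) - z'.2))
      simp; omega
    · have := Int.le_of_dvd (by omega)
        ((dvd_sub_comm.1 hl'.1 : (L : ℤ) ∣ (z.1 + 1) - z'.1))
      simp; omega
    · have hd : (L : ℤ) ∣ z'.2 - (z.2 - 1) := hl'.2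
      have := Int.le_of_dvd (by omega) hd
      simp; omega
    · have hd : (L : ℤ) ∣ z'.1 - (z.1 - 1) := hl'.1
      have := Int.le_of_dvd (by omega) hd
      simp; omega
  · intro x hx
    by_contra hn
    obtain ⟨z, rfl⟩ := exists_loc_eq o x
    cases cut
    · exact hx z (by intro h; simp at h) rfl
    · obtain ⟨z', h₁, h₂, h₃, h₄, h⟩ := hs rfl z (by simpa using hn)
      exact hx z' (fun _ => by omega) h.symm
  · intro x hx j h4 h8
    obtain ⟨z, rfl⟩ := exists_loc_eq o x
    cases cut
    · exact absurd rfl (hx z (by intro h; simp at h))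
    · by_contra hn
      rw [slotUsed, if_neg (by omega), (locGrid_rel o).uncor (x := z) rfl, Bool.not_eq_false] at hn
      obtain ⟨z', h₁, h₂, h₃, h₄, h⟩ := hB rfl _ hn
      have hc : (torusGrid L).cor (j - 4) ((torusGrid L).uncor (j - 4) (loc o z)) = loc o z :=
        cor_uncor _ (by omega)
      rw [(locGrid_rel o).uncor (x := z) rfl, h, (locGrid_rel o).cor (x := z') rfl] at hc
      refine hx _ (fun _ => ?_) hc
      have := cor_bounds (z := z') (k := j - 4) (by omega)
      omega

end Frame


/-! ### The change of variables in terms of slots. -/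

section SlotValue

variable {L : ℕ} {B : Finset (Site L)} {s : Site L → ZMod 2}

/-- The change of variables, for the edges in the slots of `x`. -/
def slotValue (e : Qubit L → ZMod 2) (x : Site L) : ℕ → ZMod 2
  | 0 => e (Sum.inl x)
  | 1 => e (Sum.inr x)
  | 2 => e (Sum.inl ((torusGrid L).lf x))
  | 3 => e (Sum.inr ((torusGrid L).up x))
  | 4 => e (Sum.inl x) + e (Sum.inr x)
  | 5 => e (Sum.inr x) + e (Sum.inl ((torusGrid L).lf x))
  | 6 => e (Sum.inl ((torusGrid L).lf x)) + e (Sum.inr ((torusGrid L).up x))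
  | _ => e (Sum.inr ((torusGrid L).up x)) + e (Sum.inl x)

theorem slotValue_old (e : Qubit L → ZMod 2) (x : Site L) {j : ℕ} (hj : j < 4) :
    slotValue e x j = e (qubitAt x j) := by
  interval_cases j <;> rfl

theorem slotValue_new (e : Qubit L → ZMod 2) (p : {p : Site L // p ∈ B}) (k : Fin 4) :
    slotValue e ((torusGrid L).cor k p.1) (4 + k) = changeVars B e (Sum.inr (p, k)) := by
  rw [changeVars]
  fin_cases k <;> simp [slotValue, Grid.cor, torusGrid, side, add_comm]

theorem estimate_eq_changeVars [NeZero L] (hL : 1 < L) {i : ℕ} {e : Qubit L → ZMod 2}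
    (h : ∀ x, ∀ j ∈ slots B x, siteEst B s i x j = slotValue e x j) :
    msEstimate (blowupH B) (blowupSyndrome B s) i = changeVars B e := by
  funext v
  rcases v with q | ⟨p, k⟩
  · obtain ⟨x, j, hj, hq⟩ := qubit_eq q.1
    rw [msEstimate_old hL i hj hq, h x j (mem_slots_of_old hj hq), slotValue_old e x hj, ← hq]
    rfl
  · rw [msEstimate_new hL i (uncor_cor p.1 k.2).symm, h _ _ (mem_slots_of_new p k), slotValue_new]

end SlotValue

/-! ### Translates of listed errors and their syndromes. -/

section Translates

variable {L : ℕ}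

/-- Whether an edge is in the translate by `o` of the edges in `l`. -/
def errBit (o : Site L) (l : List Place) (q : Qubit L) : Bool := decide (∃ a ∈ l, placeAt o a = q)

/-- The translate by `o` of the error with the edges in `l`. -/
def errOf (o : Site L) (l : List Place) (q : Qubit L) : ZMod 2 := bit2 (errBit o l q)

theorem hammingNorm_errOf [NeZero L] (o : Site L) (l : List Place) :
    hammingNorm (errOf o l) ≤ l.length := by
  classical
  refine (Finset.card_le_card (t := (l.map (placeAt o)).toFinset) fun q hq => ?_).trans
    ((List.toFinset_card_le _).trans (List.length_map _).le)
  have hq : errOf o l q ≠ 0 := (Finset.mem_filter.1 hq).2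
  rw [List.mem_toFinset, List.mem_map]
  by_contra hn
  exact hq (by rw [errOf, errBit, decide_eq_false hn]; rfl)

theorem placeAt_eq_loc (o : Site L) (a : Place) : placeAt o a =
    if a.1 = 0 then Sum.inl (loc o (a.2.1, a.2.2)) else Sum.inr (loc o (a.2.1, a.2.2)) := by
  simp [placeAt, loc]

/-- All places are at a distance from the boundary of the frame. -/
def Inner (l : List Place) : Prop := ∀ a ∈ l, 2 ≤ a.2.1 ∧ a.2.1 ≤ 7 ∧ 2 ≤ a.2.2 ∧ a.2.2 ≤ 7

theorem exists_of_errBit_inl {o : Site L} {l : List Place} (hl : Inner l) {x : Site L}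
    (h : errBit o l (Sum.inl x) = true) :
    ∃ z : ℤ × ℤ, 2 ≤ z.1 ∧ z.1 ≤ 7 ∧ 2 ≤ z.2 ∧ z.2 ≤ 7 ∧ x = loc o z := by
  obtain ⟨a, ha, h⟩ := of_decide_eq_true h
  obtain ⟨h₁, h₂, h₃, h₄⟩ := hl a ha
  rw [placeAt_eq_loc] at h
  split_ifs at h
  exact ⟨(a.2.1, a.2.2), by simp; omega, by simp; omega, by simp; omega, by simp; omega,
    (Sum.inl.inj h).symm⟩

theorem exists_of_errBit_inr {o : Site L} {l : List Place} (hl : Inner l) {x : Site L}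
    (h : errBit o l (Sum.inr x) = true) :
    ∃ z : ℤ × ℤ, 2 ≤ z.1 ∧ z.1 ≤ 7 ∧ 2 ≤ z.2 ∧ z.2 ≤ 7 ∧ x = loc o z := by
  obtain ⟨a, ha, h⟩ := of_decide_eq_true h
  obtain ⟨h₁, h₂, h₃, h₄⟩ := hl a ha
  rw [placeAt_eq_loc] at h
  split_ifs at h
  exact ⟨(a.2.1, a.2.2), by simp; omega, by simp; omega, by simp; omega, by simp; omega,
    (Sum.inr.inj h).symm⟩

/-- Errors near a site, in the slots of the site. -/
def slotBit (f : Qubit L → Bool) (x : Site L) : ℕ → Bool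
  | 0 => f (Sum.inl x)
  | 1 => f (Sum.inr x)
  | 2 => f (Sum.inl ((torusGrid L).lf x))
  | 3 => f (Sum.inr ((torusGrid L).up x))
  | 4 => xor (f (Sum.inl x)) (f (Sum.inr x))
  | 5 => xor (f (Sum.inr x)) (f (Sum.inl ((torusGrid L).lf x)))
  | 6 => xor (f (Sum.inl ((torusGrid L).lf x))) (f (Sum.inr ((torusGrid L).up x)))
  | _ => xor (f (Sum.inr ((torusGrid L).up x))) (f (Sum.inl x))

theorem slotValue_errOf (o : Site L) (l : List Place) (x : Site L) (j : ℕ) :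
    slotValue (errOf o l) x j = bit2 (slotBit (errBit o l) x j) := by
  unfold slotValue slotBit
  split <;> simp only [errOf, bit2_xor]

theorem slotBit_of_errBit_eq_false {f : Qubit L → Bool} {x : Site L} (h₀ : f (Sum.inl x) = false)
    (h₁ : f (Sum.inr x) = false) (h₂ : f (Sum.inl ((torusGrid L).lf x)) = false)
    (h₃ : f (Sum.inr ((torusGrid L).up x)) = false) (j : ℕ) : slotBit f x j = false := by
  unfold slotBit
  split <;> simp [h₀, h₁, h₂, h₃]

theorem near_of_errBit {o : Site L} {l : List Place} (hl : Inner l) {x : Site L}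
    (h : errBit o l (Sum.inl x) = true ∨ errBit o l (Sum.inr x) = true ∨
      errBit o l (Sum.inl ((torusGrid L).lf x)) = true ∨
      errBit o l (Sum.inr ((torusGrid L).up x)) = true) :
    ∃ z : ℤ × ℤ, 2 ≤ z.1 ∧ z.1 ≤ 8 ∧ 2 ≤ z.2 ∧ z.2 ≤ 8 ∧ x = loc o z := by
  rcases h with h | h | h | h
  · obtain ⟨z, h₁, h₂, h₃, h₄, h⟩ := exists_of_errBit_inl hl h
    exact ⟨z, by omega, by omega, by omega, by omega, h⟩
  · obtain ⟨z, h₁, h₂, h₃, h₄, h⟩ := exists_of_errBit_inr hl h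
    exact ⟨z, by omega, by omega, by omega, by omega, h⟩
  · obtain ⟨z, h₁, h₂, h₃, h₄, h⟩ := exists_of_errBit_inl hl h
    refine ⟨(z.1, z.2 + 1), by omega, by omega, by simp; omega, by simp; omega, ?_⟩
    have : x = (torusGrid L).rt ((torusGrid L).lf x) := by simp [torusGrid]
    rw [this, h]
    exact (locGrid_rel o).rt rfl
  · obtain ⟨z, h₁, h₂, h₃, h₄, h⟩ := exists_of_errBit_inr hl h
    refine ⟨(z.1 + 1, z.2), by simp; omega, by simp; omega, by simp; omega, by simp; omega, ?_⟩
    have : x = (torusGrid L).dn ((torusGrid L).up x) := by simp [torusGrid]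
    rw [this, h]
    exact (locGrid_rel o).dn rfl

theorem uns_errOf [NeZero L] (o : Site L) (l : List Place) (x : Site L) :
    uns ((toricH L).mulVec (errOf o l)) x = xor
      (xor (errBit o l (Sum.inl x)) (errBit o l (Sum.inl ((torusGrid L).lf x))))
      (xor (errBit o l (Sum.inr x)) (errBit o l (Sum.inr ((torusGrid L).up x)))) := by
  have h : ∀ a b c d : Bool, decide (bit2 a + bit2 b + bit2 c + bit2 d = 1) =
      xor (xor a c) (xor b d) := by decide
  rw [uns, toricH_mulVec]
  exact h _ _ _ _

theorem near_of_uns [NeZero L] {o : Site L} {l : List Place} (hl : Inner l) {x : Site L}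
    (h : uns ((toricH L).mulVec (errOf o l)) x = true) :
    ∃ z : ℤ × ℤ, 2 ≤ z.1 ∧ z.1 ≤ 8 ∧ 2 ≤ z.2 ∧ z.2 ≤ 8 ∧ x = loc o z := by
  refine near_of_errBit hl ?_
  by_contra! hn
  rw [uns_errOf, Bool.eq_false_iff.2 hn.1, Bool.eq_false_iff.2 hn.2.1,
    Bool.eq_false_iff.2 hn.2.2.1, Bool.eq_false_iff.2 hn.2.2.2] at h
  simp at h

end Translates

/-! ### Bits of errors. -/

section Blocks

variable {m : ℕ}

theorem mul_add_eq_iff {r c r' c' : ℕ} (hc : c < m) (hc' : c' < m) :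
    r * m + c = r' * m + c' ↔ r = r' ∧ c = c' := by
  refine ⟨fun h => ?_, by rintro ⟨rfl, rfl⟩; rfl⟩
  have h₁ := congrArg (· % m) h
  have h₂ := congrArg (· / m) h
  simp only [Nat.mul_comm _ m, Nat.mul_add_mod, Nat.mod_eq_of_lt hc, Nat.mod_eq_of_lt hc',
    Nat.mul_add_div (show 0 < m by omega), Nat.div_eq_of_lt hc, Nat.div_eq_of_lt hc',
    Nat.add_zero] at h₁ h₂
  exact ⟨h₂, h₁⟩

theorem blocks_cons (a : Place) (l : List Place) : blocks m (a :: l) =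
    if a.1 = 0 then
      (Nat.lor (Nat.shiftLeft 1 (a.2.1 % m * m + a.2.2 % m)) (blocks m l).1, (blocks m l).2)
    else ((blocks m l).1, Nat.lor (Nat.shiftLeft 1 (a.2.1 % m * m + a.2.2 % m)) (blocks m l).2) := by
  obtain ⟨t, i, j⟩ := a
  cases t <;> rfl

theorem testBit_blocks_fst (l : List Place) (n : ℕ) : (blocks m l).1.testBit n = true ↔
    ∃ a ∈ l, a.1 = 0 ∧ a.2.1 % m * m + a.2.2 % m = n := by
  induction l with
  | nil => simp [blocks]
  | cons a l ih =>
    rw [blocks_cons]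
    split_ifs with h
    · simp only [testBit_lor, Bool.or_eq_true, testBit_shiftLeft_one, decide_eq_true_eq, ih,
        List.exists_mem_cons_iff, h, true_and]
    · simp only [ih, List.exists_mem_cons_iff, h, false_and, false_or]

theorem testBit_blocks_snd (l : List Place) (n : ℕ) : (blocks m l).2.testBit n = true ↔
    ∃ a ∈ l, a.1 ≠ 0 ∧ a.2.1 % m * m + a.2.2 % m = n := by
  induction l with
  | nil => simp [blocks]
  | cons a l ih =>
    rw [blocks_cons]
    split_ifs with h
    · simp only [ih, List.exists_mem_cons_iff, h, ne_eq, not_true_eq_false, false_and, false_or]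
    · simp only [testBit_lor, Bool.or_eq_true, testBit_shiftLeft_one, decide_eq_true_eq, ih,
        List.exists_mem_cons_iff, ne_eq, h, not_false_eq_true, true_and]

theorem blocks_lt (hm : 0 < m) (l : List Place) :
    (blocks m l).1 < 2 ^ (m * m) ∧ (blocks m l).2 < 2 ^ (m * m) := by
  constructor <;> refine Nat.lt_pow_two_of_testBit _ fun i hi => ?_ <;> by_contra h <;>
    rw [Bool.not_eq_false] at h
  · obtain ⟨a, -, -, h⟩ := (testBit_blocks_fst _ _).1 h
    have := bitIdx_lt (Nat.mod_lt a.2.1 hm) (Nat.mod_lt a.2.2 hm)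
    omega
  · obtain ⟨a, -, -, h⟩ := (testBit_blocks_snd _ _).1 h
    have := bitIdx_lt (Nat.mod_lt a.2.1 hm) (Nat.mod_lt a.2.2 hm)
    omega

theorem mod_eq_toNat_iff (hm : 0 < m) {a : ℕ} {z : ℤ} :
    a % m = (z % m).toNat ↔ (m : ℤ) ∣ a - z := by
  have h₁ := Int.emod_nonneg z (by omega : (m : ℤ) ≠ 0)
  rw [← Int.modEq_iff_dvd, Int.ModEq, ← Int.natCast_mod]
  omega

variable {L l K : ℕ} {cut : Bool} {o : Site L} {e : List Place} {z : ℤ × ℤ}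

/-- In the cut case `|a - b| ≤ 9`, so divisibility by `10` and by `L` both mean `a = b`. This is why
places stay between `2` and `7` and the margin of the frame is `2`. -/
theorem dvd_iff_of_frame (h : (cut = false ∧ m = L) ∨ (cut = true ∧ m = 10 ∧ 10 ≤ L)) {a b : ℤ}
    (ha : 2 ≤ a) (ha' : a ≤ 7) (hb : cut = true → -2 ≤ b ∧ b ≤ 11) :
    (m : ℤ) ∣ a - b ↔ (L : ℤ) ∣ a - b := by
  rcases h with ⟨-, rfl⟩ | ⟨hc, rfl, hL⟩
  · rfl
  · have := hb hc
    constructor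
    · intro h
      rw [eq_of_dvd_sub h (by push_cast; omega) (by push_cast; omega), sub_self]
      exact dvd_zero _
    · intro h
      rw [eq_of_dvd_sub h (by omega) (by omega), sub_self]
      exact dvd_zero _

theorem bit_blocks_iff (hm : 0 < m) (h : (cut = false ∧ m = L) ∨ (cut = true ∧ m = 10 ∧ 10 ≤ L))
    (he : Inner e) (hz : InFrame cut 2 z) {a : Place} (ha : a ∈ e) :
    a.2.1 % m * m + a.2.2 % m = cell m 0 z ↔ loc o (a.2.1, a.2.2) = loc o z := by
  obtain ⟨h₁, h₂, h₃, h₄⟩ := he a ha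
  rw [cell, bitIdx, Nat.zero_mul, Nat.zero_add, mul_add_eq_iff (Nat.mod_lt _ hm)
    (toNat_emod_lt hm _), mod_eq_toNat_iff hm, mod_eq_toNat_iff hm, loc_eq_iff,
    dvd_iff_of_frame h (by omega) (by omega) fun hc => by have := hz hc; omega,
    dvd_iff_of_frame h (by omega) (by omega) fun hc => by have := hz hc; omega]

theorem testBit_blocks (hm : 0 < m) (h : (cut = false ∧ m = L) ∨ (cut = true ∧ m = 10 ∧ 10 ≤ L))
    (he : Inner e) (hz : InFrame cut 2 z) :
    (blocks m e).1.testBit (cell m 0 z) = errBit o e (Sum.inl (loc o z)) ∧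
      (blocks m e).2.testBit (cell m 0 z) = errBit o e (Sum.inr (loc o z)) := by
  constructor <;> rw [Bool.eq_iff_iff]
  · rw [testBit_blocks_fst, errBit, decide_eq_true_eq]
    refine exists_congr fun a => and_congr_right fun ha => ?_
    rw [bit_blocks_iff (o := o) hm h he hz ha, placeAt_eq_loc]
    split_ifs with h0 <;> simp [h0]
  · rw [testBit_blocks_snd, errBit, decide_eq_true_eq]
    refine exists_congr fun a => and_congr_right fun ha => ?_
    rw [bit_blocks_iff (o := o) hm h he hz ha, placeAt_eq_loc]
    split_ifs with h0 <;> simp [h0]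

theorem testBit_concat_cell (hm : 0 < m) {w : List ℕ} (hw : ∀ a ∈ w, a < 2 ^ (m * m))
    (z : ℤ × ℤ) : (concat (m * m) w).testBit (cell m l z) = (w.getD l 0).testBit (cell m 0 z) := by
  have h := toNat_emod_lt hm
  rw [testBit_concat (Nat.mul_pos hm hm) w hw, cell, bitIdx_div (h _) (h _), bitIdx_mod (h _) (h _),
    cell, bitIdx, Nat.zero_mul, Nat.zero_add]

end Blocks

/-! ### The patterns read only a window of side four. -/

section Patterns

variable {α : Type} {p : Logic α} {f g : ℤ × ℤ → α} {z : ℤ × ℤ}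

theorem patA_congr (h : ∀ z' : ℤ × ℤ, z.1 - 1 ≤ z'.1 → z'.1 ≤ z.1 + 2 → z.2 - 1 ≤ z'.2 →
    z'.2 ≤ z.2 + 2 → f z' = g z') : patA latticeGrid p f z = patA latticeGrid p g z := by
  simp (disch := first | omega | (dsimp only; omega)) only [patA, latticeGrid, h]

theorem patB_congr (h : ∀ z' : ℤ × ℤ, z.1 - 1 ≤ z'.1 → z'.1 ≤ z.1 + 2 → z.2 - 1 ≤ z'.2 →
    z'.2 ≤ z.2 + 2 → f z' = g z') : patB latticeGrid p f z = patB latticeGrid p g z := by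
  simp (disch := first | omega | (dsimp only; omega)) only [patB, latticeGrid, h]

theorem patC_congr (h : ∀ z' : ℤ × ℤ, z.1 - 1 ≤ z'.1 → z'.1 ≤ z.1 + 2 → z.2 - 1 ≤ z'.2 →
    z'.2 ≤ z.2 + 2 → f z' = g z') : patC latticeGrid p f z = patC latticeGrid p g z := by
  simp (disch := first | omega | (dsimp only; omega)) only [patC, latticeGrid, h]

variable {L : ℕ}

/-- Plaquettes without unsatisfied corners do not match the patterns. -/
theorem pattern_eq_false {S : Site L → Bool} {x : Site L} (h₁ : S x = false)
    (h₂ : S ((torusGrid L).rt x) = false) (h₃ : S ((torusGrid L).dn ((torusGrid L).rt x)) = false)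
    (h₄ : S ((torusGrid L).dn x) = false) : patA (torusGrid L) boolLogic S x = false ∧
      patB (torusGrid L) boolLogic S x = false ∧ patC (torusGrid L) boolLogic S x = false := by
  refine ⟨?_, ?_, ?_⟩ <;>
    simp [patA, patB, patC, h₁, h₂, h₃, h₄, boolLogic, Logic.conj4, Logic.disj4]

end Patterns

/-! ### Errors, syndromes and patterns shown by words. -/

section Lattice

variable {L m l K : ℕ} {cut : Bool} {o : Site L} {e : List Place} {z : ℤ × ℤ} {h v S : ℕ}

/-- Table `l` of `S` is the syndrome `s`. -/
def ShowsSyndrome (m l : ℕ) (cut : Bool) (o : Site L) (s : Site L → ZMod 2) (S : ℕ) : Prop :=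
  ∀ z : ℤ × ℤ, (cut = true → -1 ≤ z.1 ∧ z.1 ≤ 11 ∧ -1 ≤ z.2 ∧ z.2 ≤ 11) →
    S.testBit (cell m l z) = uns s (loc o z)

/-- Table `l` of `h` and `v` is the translate by `o` of the edges in `e`. -/
def ShowsError (m l : ℕ) (cut : Bool) (o : Site L) (e : List Place) (h v : ℕ) : Prop :=
  ∀ z, InFrame cut 2 z → h.testBit (cell m l z) = errBit o e (Sum.inl (loc o z)) ∧
    v.testBit (cell m l z) = errBit o e (Sum.inr (loc o z))

theorem testBit_lf_cell (hm : 0 < m) (hl : l < K) (w : ℕ) (z : ℤ × ℤ) :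
    ((Words.ofSize m K).lf w).testBit (cell m l z) = w.testBit (cell m l (latticeGrid.lf z)) :=
  (wordGrid_rel hm hl (cell m l z)).lf (x := id) (y := z) (fun _ => rfl) w

theorem testBit_up_cell (hm : 0 < m) (hl : l < K) (w : ℕ) (z : ℤ × ℤ) :
    ((Words.ofSize m K).up w).testBit (cell m l z) = w.testBit (cell m l (latticeGrid.up z)) :=
  (wordGrid_rel hm hl (cell m l z)).up (x := id) (y := z) (fun _ => rfl) w

theorem ShowsError.lf_up (hm : 0 < m) (hl : l < K) (hhv : ShowsError m l cut o e h v)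
    (hz : cut = true → -1 ≤ z.1 ∧ z.1 ≤ 11 ∧ -1 ≤ z.2 ∧ z.2 ≤ 11) :
    ((Words.ofSize m K).lf h).testBit (cell m l z) =
        errBit o e (Sum.inl ((torusGrid L).lf (loc o z))) ∧
      ((Words.ofSize m K).up v).testBit (cell m l z) =
        errBit o e (Sum.inr ((torusGrid L).up (loc o z))) := by
  constructor
  · rw [testBit_lf_cell hm hl, (locGrid_rel o).lf (x := z) rfl]
    exact (hhv _ fun hc => by have := hz hc; simp [latticeGrid]; omega).1
  · rw [testBit_up_cell hm hl, (locGrid_rel o).up (x := z) rfl]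
    exact (hhv _ fun hc => by have := hz hc; simp [latticeGrid]; omega).2

/-- The syndrome looks one step left and up, so a faithful error from `-2` to `11` gives a faithful
syndrome from `-1` to `11`. The patterns look from `-1` to `+2`, which leaves `0` to `9`, the frame.
-/
theorem ShowsError.synd [NeZero L] (hm : 0 < m) (hl : l < K) (hhv : ShowsError m l cut o e h v) :
    ShowsSyndrome m l cut o ((toricH L).mulVec (errOf o e)) ((Words.ofSize m K).synd h v) := by
  intro z hz
  have h₁ := hhv z fun hc => by have := hz hc; omega
  have h₂ := hhv.lf_up hm hl hz
  rw [Words.synd, testBit_xor, testBit_xor, testBit_xor, h₁.1, h₁.2, h₂.1, h₂.2, uns_errOf]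

theorem ShowsError.goal (hm : 0 < m) (hl : l < K) (hhv : ShowsError m l cut o e h v)
    (hz : InFrame cut 0 z) {j : ℕ} (hj : j < 8) :
    (([h, v, (Words.ofSize m K).lf h, (Words.ofSize m K).up v] ++
      [Nat.xor h v, Nat.xor v ((Words.ofSize m K).lf h),
        Nat.xor ((Words.ofSize m K).lf h) ((Words.ofSize m K).up v),
        Nat.xor ((Words.ofSize m K).up v) h]).getD j 0).testBit (cell m l z) =
      slotBit (errBit o e) (loc o z) j := by
  have h₁ := hhv z fun hc => by have := hz hc; omega
  have h₂ := hhv.lf_up hm hl (z := z) fun hc => by have := hz hc; omega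
  interval_cases j <;>
    simp only [List.cons_append, List.nil_append, List.getD_cons_zero, List.getD_cons_succ,
      testBit_xor, h₁.1, h₁.2, h₂.1, h₂.2, slotBit]

variable {s : Site L → ZMod 2}

theorem ShowsSyndrome.patterns (hm : 0 < m) (hl : l < K) (hS : ShowsSyndrome m l cut o s S)
    (hz : InFrame cut 0 z) :
    (patA (Words.ofSize m K).grid (Words.ofSize m K).logic (fun x => x S) id).testBit
        (cell m l z) = patA (torusGrid L) boolLogic (uns s) (loc o z) ∧
    (patB (Words.ofSize m K).grid (Words.ofSize m K).logic (fun x => x S) id).testBit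
        (cell m l z) = patB (torusGrid L) boolLogic (uns s) (loc o z) ∧
    (patC (Words.ofSize m K).grid (Words.ofSize m K).logic (fun x => x S) id).testBit
        (cell m l z) = patC (torusGrid L) boolLogic (uns s) (loc o z) := by
  have hg := wordGrid_rel hm hl (cell m l z)
  have ho := tableLogic_rel (testBit_full_cell hm hl z)
  have hc : ∀ z' : ℤ × ℤ, z.1 - 1 ≤ z'.1 → z'.1 ≤ z.1 + 2 → z.2 - 1 ≤ z'.2 → z'.2 ≤ z.2 + 2 →
      S.testBit (cell m l z') = uns s (loc o z') := fun z' a b c d => hS z' fun hc => by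
    have := hz hc; omega
  refine ⟨?_, ?_, ?_⟩
  · refine (hg.patA ho (S := fun x => x S) (S' := fun z => S.testBit (cell m l z))
      (fun h => h S) (x := id) (y := z) (fun _ => rfl)).trans ((patA_congr hc).trans ?_)
    exact (locGrid_rel o).patA boolLogic.rel_eq (S := fun z => uns s (loc o z))
      (by rintro _ _ rfl; rfl) rfl
  · refine (hg.patB ho (S := fun x => x S) (S' := fun z => S.testBit (cell m l z))
      (fun h => h S) (x := id) (y := z) (fun _ => rfl)).trans ((patB_congr hc).trans ?_)
    exact (locGrid_rel o).patB boolLogic.rel_eq (S := fun z => uns s (loc o z))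
      (by rintro _ _ rfl; rfl) rfl
  · refine (hg.patC ho (S := fun x => x S) (S' := fun z => S.testBit (cell m l z))
      (fun h => h S) (x := id) (y := z) (fun _ => rfl)).trans ((patC_congr hc).trans ?_)
    exact (locGrid_rel o).patC boolLogic.rel_eq (S := fun z => uns s (loc o z))
      (by rintro _ _ rfl; rfl) rfl

end Lattice


/-! ### The conditions on blown-up plaquettes, read from words. -/

section Invalid

variable {L m l K : ℕ} {cut : Bool} {o : Site L} {z : ℤ × ℤ} {P Q R W : ℕ}
  {p q r b : Site L → Bool}

/-- Patterns at neighbouring plaquettes enter only together with membership in `B`. Hence their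
values just outside of the frame, where words need not be faithful, do not matter. -/
theorem invalid_congr {P P' Q Q' R R' B B' : ℤ × ℤ → Bool} (hP : P z = P' z) (hQ : Q z = Q' z)
    (hR : R z = R' z) (hB : B z = B' z) (h : ∀ y : ℤ × ℤ, z.1 - 1 ≤ y.1 → y.1 ≤ z.1 + 1 →
      z.2 - 1 ≤ y.2 → y.2 ≤ z.2 + 1 → B y = B' y ∧ (B' y = true → P y = P' y ∧ Q y = Q' y)) :
    invalid latticeGrid boolLogic P Q R B z = invalid latticeGrid boolLogic P' Q' R' B' z := by
  have h' : ∀ y : ℤ × ℤ, z.1 - 1 ≤ y.1 → y.1 ≤ z.1 + 1 → z.2 - 1 ≤ y.2 → y.2 ≤ z.2 + 1 →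
      B y = B' y ∧ (B' y && P y) = (B' y && P' y) ∧
        (B' y && (P y || Q y)) = (B' y && (P' y || Q' y)) := by
    intro y h₁ h₂ h₃ h₄
    obtain ⟨hb, h⟩ := h y h₁ h₂ h₃ h₄
    refine ⟨hb, ?_⟩
    cases hb' : B' y
    · simp
    · rw [(h hb').1, (h hb').2]
      exact ⟨rfl, rfl⟩
  have h₁ := h' (latticeGrid.rt z) (by simp [latticeGrid]) (by simp [latticeGrid])
    (by simp [latticeGrid]; omega) (by simp [latticeGrid])
  have h₂ := h' (latticeGrid.dn z) (by simp [latticeGrid]; omega) (by simp [latticeGrid])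
    (by simp [latticeGrid]) (by simp [latticeGrid])
  have h₃ := h' (latticeGrid.lf z) (by simp [latticeGrid]) (by simp [latticeGrid])
    (by simp [latticeGrid]) (by simp [latticeGrid]; omega)
  have h₄ := h' (latticeGrid.up z) (by simp [latticeGrid]) (by simp [latticeGrid]; omega)
    (by simp [latticeGrid]) (by simp [latticeGrid])
  simp only [invalid, adjSome, Logic.disj4, Logic.diff, boolLogic_conj, boolLogic_disj,
    boolLogic_neg, hP, hQ, hR, hB, h₁, h₂, h₃, h₄]

theorem testBit_invalid (hm : 0 < m) (hl : l < K)
    (hP : ∀ z, InFrame cut 0 z → P.testBit (cell m l z) = p (loc o z))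
    (hQ : ∀ z, InFrame cut 0 z → Q.testBit (cell m l z) = q (loc o z))
    (hR : ∀ z, InFrame cut 0 z → R.testBit (cell m l z) = r (loc o z))
    (hW : ∀ z, InFrame cut 1 z → W.testBit (cell m l z) = b (loc o z))
    (hb : ∀ z, InFrame cut 1 z → b (loc o z) = true → InFrame cut 0 z) (hz : InFrame cut 0 z) :
    (invalid (Words.ofSize m K).grid (Words.ofSize m K).logic (fun x => x P) (fun x => x Q)
      (fun x => x R) (fun x => x W) id).testBit (cell m l z) =
      invalid (torusGrid L) boolLogic p q r b (loc o z) := by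
  have hg := wordGrid_rel hm hl (cell m l z)
  have ho := tableLogic_rel (testBit_full_cell hm hl z)
  refine (hg.invalid ho (P := fun x => x P) (P' := fun z => P.testBit (cell m l z)) (fun h => h P)
    (Q := fun x => x Q) (Q' := fun z => Q.testBit (cell m l z)) (fun h => h Q)
    (A := fun x => x R) (A' := fun z => R.testBit (cell m l z)) (fun h => h R)
    (B := fun x => x W) (B' := fun z => W.testBit (cell m l z)) (fun h => h W)
    (x := id) (y := z) (fun _ => rfl)).trans
    ((invalid_congr (P' := fun z => p (loc o z)) (Q' := fun z => q (loc o z))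
      (R' := fun z => r (loc o z)) (B' := fun z => b (loc o z)) (hP z hz) (hQ z hz) (hR z hz)
      (hW z fun hc => by have := hz hc; omega) fun y h₁ h₂ h₃ h₄ => ?_).trans ?_)
  · have hy : InFrame cut 1 y := fun hc => by have := hz hc; omega
    exact ⟨hW y hy, fun hb' => ⟨hP y (hb y hy hb'), hQ y (hb y hy hb')⟩⟩
  · exact (locGrid_rel o).invalid boolLogic.rel_eq (by rintro _ _ rfl; rfl)
      (by rintro _ _ rfl; rfl) (by rintro _ _ rfl; rfl) (by rintro _ _ rfl; rfl) rfl

end Invalid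

/-! ### Enumeration of the subsets of a set of bits. -/

section Submasks

/-- The highest bit of `a` is split off, and the rest of `b` is a submask of the rest of `a`. -/
theorem mem_submasks {n a b : ℕ} (ha : a < 2 ^ n)
    (h : ∀ i, b.testBit i = true → a.testBit i = true) : b ∈ submasks n a := by
  have h0 : ∀ {b : ℕ}, (∀ i, b.testBit i = true → (0 : ℕ).testBit i = true) → b = 0 := by
    intro b h
    refine Nat.eq_of_testBit_eq fun i => ?_
    cases hb : b.testBit i
    · simp
    · rw [h i hb]
  induction n generalizing a b with
  | zero =>
    obtain rfl : a = 0 := by simpa using ha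
    simp [submasks, h0 h]
  | succ n ih =>
    cases a with
    | zero => simp [submasks, h0 h]
    | succ a =>
      rw [submasks, strict_eq]
      set k := Nat.log2 (a + 1)
      have hk : (a + 1).testBit k = true := Nat.testBit_log2 (by omega)
      have hlt : a + 1 < 2 ^ (k + 1) := Nat.lt_log2_self
      have hkn : k ≤ n := Nat.lt_succ_iff.1 ((Nat.log2_lt (by omega)).2 ha)
      have hbit : ∀ i, (Nat.xor (a + 1) (Nat.shiftLeft 1 k)).testBit i =
          ((a + 1).testBit i && decide (k ≠ i)) := by
        intro i
        rw [testBit_xor, testBit_shiftLeft_one]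
        by_cases hi : k = i
        · subst hi; simp [hk]
        · simp [hi]
      have hsmall : Nat.xor (a + 1) (Nat.shiftLeft 1 k) < 2 ^ n := by
        refine Nat.lt_pow_two_of_testBit _ fun i hi => ?_
        rw [hbit]
        by_cases hik : k = i
        · simp [hik]
        · rw [Nat.testBit_lt_two_pow (hlt.trans_le (Nat.pow_le_pow_right (by norm_num)
            (by omega : k + 1 ≤ i))), Bool.false_and]
      refine List.mem_flatMap.2 ?_
      by_cases hb : b.testBit k = true
      · have hbit' : ∀ i, (Nat.xor b (Nat.shiftLeft 1 k)).testBit i =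
            (b.testBit i && decide (k ≠ i)) := by
          intro i
          rw [testBit_xor, testBit_shiftLeft_one]
          by_cases hi : k = i
          · subst hi; simp [hb]
          · simp [hi]
        refine ⟨Nat.xor b (Nat.shiftLeft 1 k), ih hsmall fun i hi => ?_, ?_⟩
        · rw [hbit', Bool.and_eq_true] at hi
          rw [hbit, Bool.and_eq_true]
          exact ⟨h i hi.1, hi.2⟩
        · refine List.mem_cons_of_mem _ (List.mem_singleton.2 (Nat.eq_of_testBit_eq fun i => ?_))
          rw [testBit_lor, hbit', testBit_shiftLeft_one]
          by_cases hi : k = i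
          · subst hi; simp [hb]
          · simp [hi]
      · refine ⟨b, ih hsmall fun i hi => ?_, List.mem_cons_self⟩
        rw [hbit, Bool.and_eq_true]
        refine ⟨h i hi, ?_⟩
        simp only [decide_eq_true_eq]
        rintro rfl
        exact hb hi

theorem of_mem_submasks {n a b : ℕ} (h : b ∈ submasks n a) {i : ℕ} (hi : b.testBit i = true) :
    a.testBit i = true := by
  induction n generalizing a b with
  | zero =>
    rw [submasks, List.mem_singleton] at h
    simp [h] at hi
  | succ n ih =>
    cases a with
    | zero =>
      rw [submasks, List.mem_singleton] at h
      simp [h] at hi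
    | succ a =>
      rw [submasks, strict_eq] at h
      obtain ⟨c, hc, h⟩ := List.mem_flatMap.1 h
      have hk : (a + 1).testBit (Nat.log2 (a + 1)) = true := Nat.testBit_log2 (by omega)
      have hc' : c.testBit i = true → (a + 1).testBit i = true := fun h => by
        have := ih hc h
        rw [testBit_xor, testBit_shiftLeft_one] at this
        by_cases hi : Nat.log2 (a + 1) = i
        · rwa [← hi]
        · simpa [hi] using this
      rcases List.mem_cons.1 h with rfl | h
      · exact hc' hi
      · rw [List.mem_singleton.1 h, testBit_lor, Bool.or_eq_true, testBit_shiftLeft_one,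
          decide_eq_true_eq] at hi
        rcases hi with rfl | hi
        · exact hk
        · exact hc' hi

end Submasks

/-! ### The lanes and the words built from them. -/

section Lanes

theorem Words.patterns_eq {β : Type} (T : Words) (S : ℕ) (k : ℕ → ℕ → ℕ → β) : T.patterns S k =
    k (patA T.grid T.logic (fun x => x S) id) (patB T.grid T.logic (fun x => x S) id)
      (patC T.grid T.logic (fun x => x S) id) := by
  simp only [Words.patterns, strict_eq]

theorem mem_lanesOf {m : ℕ} {e : List Place} {d : List (List Place)} {b : ℕ}
    (hb : let T := Words.ofSize m 1
      let S := T.synd (blocks m e).1 (blocks m e).2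
      b ∈ submasks (m * m) (Nat.lor (patA T.grid T.logic (fun x => x S) id)
        (Nat.lor (patB T.grid T.logic (fun x => x S) id)
          (patC T.grid T.logic (fun x => x S) id)))) :
    (⟨(e :: d).map (blocks m), b⟩ : Lane) ∈ lanesOf m (e :: d) := by
  rw [lanesOf, List.map_cons]
  simp only [strict_eq, withWords_eq, Words.patterns_eq]
  exact List.mem_map.2 ⟨b, hb, rfl⟩

/-- Words below `N`, as statements without content. -/
theorem logic_rel_lt {T : Words} {n : ℕ} (h : T.full < 2 ^ n) :
    T.logic.Rel (⟨fun _ _ => (), fun _ _ => (), fun _ _ => (), fun _ => ()⟩ : Logic Unit)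
      fun a _ => a < 2 ^ n :=
  ⟨fun h _ => lt_of_le_of_lt Nat.and_le_left h, fun h h' => Nat.or_lt_two_pow h h',
    fun h h' => Nat.xor_lt_two_pow h h', fun h' => Nat.xor_lt_two_pow h h'⟩

/-- Preservation of relations with a one-point grid: shifted words keep within their number of bits,
and so do the formulas evaluated on them. -/
theorem grid_rel_lt {m K : ℕ} (hm : 0 < m) : (Words.ofSize m K).grid.Rel
    (⟨id, id, id, id⟩ : Grid Unit) fun x _ => ∀ w < 2 ^ (m * m * K), x w < 2 ^ (m * m * K) := by
  have hsel : ∀ mask < 2 ^ (m * m * K), ∀ a b,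
      (Words.ofSize m K).select mask a b < 2 ^ (m * m * K) := fun mask hmask a b =>
    Nat.or_lt_two_pow (lt_of_le_of_lt Nat.and_le_left
      (Nat.xor_lt_two_pow (ones_lt le_rfl) hmask)) (lt_of_le_of_lt Nat.and_le_left hmask)
  have hmm := Nat.mul_pos hm hm
  have h1 : 1 < 2 ^ m := Nat.one_lt_two_pow (by omega)
  have h2 : Nat.shiftLeft 1 (m - 1) < 2 ^ m := Nat.lt_pow_two_of_testBit _ fun i hi => by
    rw [testBit_shiftLeft_one, decide_eq_false (by omega)]
  have h3 : Nat.shiftLeft (ones m) (m * (m - 1)) < 2 ^ (m * m) :=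
    Nat.lt_pow_two_of_testBit _ fun i hi => by
      have hm : m * (m - 1) + m = m * m := by
        rw [← Nat.mul_succ, Nat.succ_eq_add_one, Nat.sub_add_cancel (by omega)]
      rw [testBit_shiftLeft, testBit_ones, decide_eq_false (p := i - _ < m) (by omega),
        Bool.and_false]
  constructor
  · exact fun h w _ => h _ (hsel _ (rep_lt hmm (rep_lt hm h2 _) _) _ _)
  · exact fun h w _ => h _ (hsel _ (rep_lt hmm h3 _) _ _)
  · exact fun h w _ => h _ (hsel _ (rep_lt hmm (rep_lt hm h1 _) _) _ _)
  · exact fun h w _ => h _ (hsel _ (rep_lt hmm (ones_lt (Nat.le_mul_self m)) _) _ _)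

theorem synd_lt {m h v : ℕ} (hm : 0 < m) (hh : h < 2 ^ (m * m)) (hv : v < 2 ^ (m * m)) :
    (Words.ofSize m 1).synd h v < 2 ^ (m * m) := by
  have hg := grid_rel_lt (m := m) (K := 1) hm
  rw [Nat.mul_one] at hg
  have h₁ : (Words.ofSize m 1).lf h < 2 ^ (m * m) :=
    hg.lf (x := id) (y := ()) (fun _ h => h) h hh
  have h₂ : (Words.ofSize m 1).up v < 2 ^ (m * m) :=
    hg.up (x := id) (y := ()) (fun _ h => h) v hv
  exact Nat.xor_lt_two_pow (Nat.xor_lt_two_pow hh h₁) (Nat.xor_lt_two_pow hv h₂)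

theorem patterns_lt {m S : ℕ} (hm : 0 < m) (hS : S < 2 ^ (m * m)) :
    let T := Words.ofSize m 1
    Nat.lor (patA T.grid T.logic (fun x => x S) id) (Nat.lor (patB T.grid T.logic (fun x => x S) id)
      (patC T.grid T.logic (fun x => x S) id)) < 2 ^ (m * m) := by
  intro T
  have hg := grid_rel_lt (m := m) (K := 1) hm
  rw [Nat.mul_one] at hg
  have ho : T.logic.Rel _ _ := logic_rel_lt (n := m * m) (T := T) (ones_lt (by rw [Nat.mul_one]))
  exact Nat.or_lt_two_pow (hg.patA ho (S := fun x => x S) (S' := fun _ => ()) (fun h => h S hS)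
      (x := id) (y := ()) fun _ h => h)
    (Nat.or_lt_two_pow (hg.patB ho (S := fun x => x S) (S' := fun _ => ()) (fun h => h S hS)
      (x := id) (y := ()) fun _ h => h) (hg.patC ho (S := fun x => x S) (S' := fun _ => ())
      (fun h => h S hS) (x := id) (y := ()) fun _ h => h))

/-- All words of the lane have `n` bits. -/
def Lane.Fits (n : ℕ) (a : Lane) : Prop :=
  a.blown < 2 ^ n ∧ ∀ x ∈ a.errs, x.1 < 2 ^ n ∧ x.2 < 2 ^ n

theorem fits_of_mem_lanesOf {m : ℕ} (hm : 0 < m) {d : List (List Place)} {a : Lane}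
    (h : a ∈ lanesOf m d) : a.Fits (m * m) := by
  cases d with
  | nil => simp [lanesOf] at h
  | cons e d =>
    rw [lanesOf, List.map_cons] at h
    simp only [strict_eq, withWords_eq, Words.patterns_eq] at h
    obtain ⟨b, hb, rfl⟩ := List.mem_map.1 h
    have hlt := blocks_lt hm e
    refine ⟨Nat.lt_pow_two_of_testBit _ fun i hi => ?_, fun x hx => ?_⟩
    · by_contra hn
      have := of_mem_submasks hb (by simpa using hn)
      rw [Nat.testBit_lt_two_pow ((patterns_lt hm (synd_lt hm hlt.1 hlt.2)).trans_le
        (Nat.pow_le_pow_right (by norm_num) hi))] at this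
      simp at this
    · rw [← List.map_cons (f := blocks m)] at hx
      obtain ⟨e', -, rfl⟩ := List.mem_map.1 hx
      exact blocks_lt hm e'

theorem strictLanes_go_eq {β : Type} (l acc : List (ℕ × ℕ)) (k : List (ℕ × ℕ) → β) :
    strictLanes.go l acc k = k (l.reverse ++ acc) := by
  induction l generalizing acc with
  | nil => rfl
  | cons a l ih =>
    rw [strictLanes.go, strict_eq, strict_eq, ih, List.reverse_cons, List.append_assoc]
    rfl

theorem strictLanes_eq {β : Type} (l : List Lane) (k : List Lane → β) :
    strictLanes l k = k (l.map fun a => ⟨a.errs.reverse, a.blown⟩) := by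
  induction l generalizing k with
  | nil => rfl
  | cons a l ih =>
    rw [strictLanes, ih, strictLanes_go_eq, strict_eq, List.append_nil]
    rfl

/-- The error of rank `r` in a lane, or the first one. -/
def Lane.err (a : Lane) (r : ℕ) : ℕ × ℕ := a.errs.getD r (a.errs.getD 0 (0, 0))

theorem Lane.Fits.err {n : ℕ} {a : Lane} (h : a.Fits n) (r : ℕ) :
    (a.err r).1 < 2 ^ n ∧ (a.err r).2 < 2 ^ n := by
  have hd : ∀ (r : ℕ) (x : ℕ × ℕ), x.1 < 2 ^ n ∧ x.2 < 2 ^ n →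
      (a.errs.getD r x).1 < 2 ^ n ∧ (a.errs.getD r x).2 < 2 ^ n := by
    intro r x hx
    rcases lt_or_ge r a.errs.length with hr | hr
    · rw [List.getD_eq_getElem _ _ hr]; exact h.2 _ (List.getElem_mem hr)
    · rwa [List.getD_eq_default _ _ hr]
  exact hd _ _ (hd _ _ ⟨Nat.two_pow_pos n, Nat.two_pow_pos n⟩)

/-- The horizontal edges of the errors of rank `r` in all lanes. -/
def horizontal (m : ℕ) (lanes : List Lane) (r : ℕ) : ℕ :=
  concat (m * m) (lanes.map fun a => (a.err r).1)

/-- The vertical edges of the errors of rank `r` in all lanes. -/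
def vertical (m : ℕ) (lanes : List Lane) (r : ℕ) : ℕ :=
  concat (m * m) (lanes.map fun a => (a.err r).2)

/-- The syndromes of the errors of rank `r` in all lanes. -/
def syndromeWord (m : ℕ) (lanes : List Lane) (r : ℕ) : ℕ :=
  (Words.ofSize m lanes.length).synd (horizontal m lanes r) (vertical m lanes r)

/-- The blown-up plaquettes in all lanes. -/
def blownWord (m : ℕ) (lanes : List Lane) : ℕ := concat (m * m) (lanes.map fun a => a.blown)

/-- The expected estimates in the slots of sites. -/
def expected (m : ℕ) (cut : Bool) (lanes : List Lane) (r j : ℕ) : ℕ :=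
  let T := Words.ofSize m lanes.length
  let h := horizontal m lanes r
  let v := vertical m lanes r
  Nat.land (([h, v, T.lf h, T.up v] ++ [Nat.xor h v, Nat.xor v (T.lf h),
    Nat.xor (T.lf h) (T.up v), Nat.xor (T.up v) h]).getD j 0)
    (T.not (T.siteSlot cut (blownWord m lanes) j).off)

/-- The setup for the lanes. -/
def laneSetup (m : ℕ) (cut : Bool) (lanes : List Lane) : Setup :=
  let T := Words.ofSize m lanes.length
  ⟨T.full, syndromeWord m lanes 0,
    [expected m cut lanes 0, expected m cut lanes 1, expected m cut lanes 2].map fun γ =>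
      (List.range 8).map γ,
    (List.range 8).map (T.siteSlot cut (blownWord m lanes)),
    (List.range 4).map (T.midSlot (blownWord m lanes))⟩

/-- The reports on the first `n` iterations in the lanes. -/
def laneReports (m : ℕ) (cut : Bool) (n : ℕ) (lanes : List Lane) : List Report :=
  let T := Words.ofSize m lanes.length
  let W := blownWord m lanes
  (laneSetup m cut lanes).reportList (T.siteSlot cut W) (T.midSlot W) n 0
    (fun j => ⟨T.full, T.not (T.siteSlot cut W j).off, [(T.siteSlot cut W j).off],
      [T.not (T.siteSlot cut W j).off]⟩)
    (fun k => ⟨T.full, T.not (T.midSlot W k).off, [(T.midSlot W k).off],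
      [T.not (T.midSlot W k).off]⟩)

/-- Where the plaquettes of the lanes are not those that are blown up. -/
def invalidWord (m : ℕ) (lanes : List Lane) : ℕ :=
  let T := Words.ofSize m lanes.length
  let S := syndromeWord m lanes 0
  invalid T.grid T.logic (fun x => x (patA T.grid T.logic (fun x => x S) id))
    (fun x => x (patB T.grid T.logic (fun x => x S) id))
    (fun x => x (patC T.grid T.logic (fun x => x S) id)) (fun x => x (blownWord m lanes)) id

/-- Removes the order of evaluation from `reports`, which leaves an expression that can be reasoned
about. -/
theorem reports_eq {β : Type} (m : ℕ) (cut : Bool) (n : ℕ) (lanes : List Lane)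
    (k : Bool → ℕ → List Report → β) : reports m cut n lanes k =
      k ([syndromeWord m lanes 0, syndromeWord m lanes 1, syndromeWord m lanes 2].all
        fun w => Nat.beq w (syndromeWord m lanes 0)) (invalidWord m lanes)
        (laneReports m cut n lanes) := by
  rw [laneReports, ← Setup.run_eq (U := laneSetup m cut lanes) rfl rfl n 0 _ _ fun rs =>
    k ([syndromeWord m lanes 0, syndromeWord m lanes 1, syndromeWord m lanes 2].all
        fun w => Nat.beq w (syndromeWord m lanes 0)) (invalidWord m lanes) rs]
  rw [reports, withWords_eq]
  simp only [strict_eq, strictList_eq, Words.patterns_eq]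
  cases cut <;> rfl

theorem acceptAll_spec {A V : ℕ} {rs : List Report} {n : ℕ} (h : acceptAll A V rs n = true) {l : ℕ}
    (hl : l < n) : blockAt A l V ≠ 0 ∨ accept A l rs = true := by
  induction n with
  | zero => omega
  | succ n ih =>
    rw [acceptAll, Bool.and_eq_true, Bool.or_eq_true, Nat.ble_eq] at h
    rcases Nat.lt_succ_iff_lt_or_eq.1 hl with hl | rfl
    · exact ih h.2 hl
    · exact h.1.imp_left Nat.one_le_iff_ne_zero.1

theorem testBit_blockAt (A l w : ℕ) {i : ℕ} (hi : i < A) :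
    (blockAt A l w).testBit i = w.testBit (l * A + i) := by
  rw [blockAt, Nat.testBit_mod_two_pow, testBit_shiftRight, decide_eq_true hi, Bool.true_and,
    Nat.mul_comm]

theorem testBit_cell_of_blockAt {m l w : ℕ} (hm : 0 < m) (h : blockAt (m * m) l w = 0)
    (z : ℤ × ℤ) : w.testBit (cell m l z) = false := by
  have hz := toNat_emod_lt hm
  rw [cell, bitIdx, ← testBit_blockAt (m * m) l w (bitIdx_lt (hz _) (hz _)), h, Nat.zero_testBit]

theorem exists_cell_of_blockAt {m l w : ℕ} (h : blockAt (m * m) l w ≠ 0) :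
    ∃ z : ℤ × ℤ, 0 ≤ z.1 ∧ z.1 < m ∧ 0 ≤ z.2 ∧ z.2 < m ∧ w.testBit (cell m l z) = true := by
  obtain ⟨i, hi⟩ := Nat.exists_testBit_of_ne_zero h
  have him : i < m * m := by
    by_contra hn
    rw [blockAt, Nat.testBit_mod_two_pow, decide_eq_false hn, Bool.false_and] at hi
    simp at hi
  have hm : 0 < m := by
    by_contra hn
    simp [Nat.eq_zero_of_not_pos hn] at him
  rw [testBit_blockAt _ _ _ him] at hi
  have h₁ : i / m < m := Nat.div_lt_of_lt_mul him
  have h₂ := Nat.mod_lt i hm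
  have h₁' : ((i / m : ℕ) : ℤ) < m := by exact_mod_cast h₁
  have h₂' : ((i % m : ℕ) : ℤ) < m := by exact_mod_cast h₂
  refine ⟨((i / m : ℕ), (i % m : ℕ)), Int.natCast_nonneg _, h₁', Int.natCast_nonneg _, h₂', ?_⟩
  rw [cell_toNat (Int.natCast_nonneg _) h₁' (Int.natCast_nonneg _) h₂']
  simp only [Int.toNat_natCast, bitIdx]
  rwa [Nat.div_add_mod']

end Lanes


/-! ### Accepted lanes yield corrected errors. -/

section Engine

theorem clusters_length : ∀ d ∈ clusters, d.length ≤ 3 := by decide +kernel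

theorem inner_of_mem {d : List (List Place)} (hd : d ∈ clusters) {e : List Place} (he : e ∈ d) :
    Inner e := fun a ha => ((clusters_spec d hd e he).2.2 a ha).2

variable {L m l : ℕ} {cut : Bool} {o : Site L}

/-- The errors of a cluster, in the order used in the lanes. -/
def ranked (d : List (List Place)) (r : ℕ) : List Place := d.reverse.getD r (d.reverse.getD 0 [])

theorem getD_mem {α : Type} {d : List α} {r : ℕ} {a : α} (ha : a ∈ d) : d.getD r a ∈ d := by
  rcases lt_or_ge r d.length with h | h
  · rw [List.getD_eq_getElem _ _ h]; exact List.getElem_mem h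
  · rwa [List.getD_eq_default _ _ h]

theorem ranked_mem {d : List (List Place)} {e : List Place} (he : e ∈ d) (r : ℕ) :
    ranked d r ∈ d := by
  have h0 : 0 < d.reverse.length := by
    rw [List.length_reverse]; exact List.length_pos_of_mem he
  rw [← List.mem_reverse, ranked]
  refine getD_mem ?_
  rw [List.getD_eq_getElem _ _ h0]
  exact List.getElem_mem h0

theorem exists_ranked {d : List (List Place)} (hd : d.length ≤ 3) {e : List Place} (he : e ∈ d) :
    ∃ r < 3, ranked d r = e := by
  obtain ⟨r, hr, h⟩ := List.getElem_of_mem (List.mem_reverse.2 he)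
  have hr' := hr
  rw [List.length_reverse] at hr'
  exact ⟨r, by omega, by rw [ranked, List.getD_eq_getElem _ _ hr, h]⟩

theorem blocks_ranked (d : List (List Place)) (r : ℕ) (b : ℕ) :
    (⟨(d.map (blocks m)).reverse, b⟩ : Lane).err r = blocks m (ranked d r) := by
  have h : ∀ (l : List (List Place)) (r : ℕ) (a : List Place),
      (l.map (blocks m)).getD r (blocks m a) = blocks m (l.getD r a) := by
    intro l r a
    rw [List.getD_eq_getElem?_getD, List.getElem?_map, List.getD_eq_getElem?_getD]
    cases l[r]? <;> rfl
  rw [Lane.err, ranked, ← h, ← h, List.map_reverse]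
  rfl

/-- A blown-up plaquette matches a pattern and so has an unsatisfied corner. Those have coordinates
from `2` to `8`, and the top left corner is at most one row and one column before. -/
theorem near_of_inB [NeZero L] (hL : 1 < L) {e : List Place} (he : Inner e) {x : Site L}
    (h : inB (blowupSet ((toricH L).mulVec (errOf o e))) x = true) :
    ∃ z : ℤ × ℤ, 1 ≤ z.1 ∧ z.1 ≤ 8 ∧ 1 ≤ z.2 ∧ z.2 ≤ 8 ∧ x = loc o z := by
  set s := (toricH L).mulVec (errOf o e)
  have hi := ((invalid_eq_false_iff hL _ _ _ _ x).1 ((blowupSet_spec hL s).2 x)).1 h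
  have hg := locGrid_rel o
  by_cases h₁ : uns s x = true
  · obtain ⟨z, a, b, c, d, h⟩ := near_of_uns he h₁
    exact ⟨z, by omega, by omega, by omega, by omega, h⟩
  by_cases h₂ : uns s ((torusGrid L).rt x) = true
  · obtain ⟨z, a, b, c, d, h⟩ := near_of_uns he h₂
    refine ⟨latticeGrid.lf z, by simp [latticeGrid]; omega, by simp [latticeGrid]; omega,
      by simp [latticeGrid]; omega, by simp [latticeGrid]; omega, ?_⟩
    rw [← hg.lf h]; simp [torusGrid]
  by_cases h₃ : uns s ((torusGrid L).dn ((torusGrid L).rt x)) = true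
  · obtain ⟨z, a, b, c, d, h⟩ := near_of_uns he h₃
    refine ⟨latticeGrid.lf (latticeGrid.up z), by simp [latticeGrid]; omega,
      by simp [latticeGrid]; omega, by simp [latticeGrid]; omega,
      by simp [latticeGrid]; omega, ?_⟩
    rw [← hg.lf (hg.up h)]; simp [torusGrid]
  by_cases h₄ : uns s ((torusGrid L).dn x) = true
  · obtain ⟨z, a, b, c, d, h⟩ := near_of_uns he h₄
    refine ⟨latticeGrid.up z, by simp [latticeGrid]; omega, by simp [latticeGrid]; omega,
      by simp [latticeGrid]; omega, by simp [latticeGrid]; omega, ?_⟩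
    rw [← hg.up h]; simp [torusGrid]
  obtain ⟨hA, hB, hC⟩ := pattern_eq_false (Bool.eq_false_iff.2 h₁) (Bool.eq_false_iff.2 h₂)
    (Bool.eq_false_iff.2 h₃) (Bool.eq_false_iff.2 h₄)
  rw [hA, hB, hC] at hi
  simp at hi

theorem eq_of_loc_eq {z z' : ℤ × ℤ} (h : loc o z = loc o z') (h₁ : |z.1 - z'.1| < L)
    (h₂ : |z.2 - z'.2| < L) : z = z' := by
  rw [loc_eq_iff] at h
  rw [abs_lt] at h₁ h₂
  exact Prod.ext (eq_of_dvd_sub h.1 (by omega) (by omega)) (eq_of_dvd_sub h.2 (by omega) (by omega))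

/-- In a frame that is cut out of the torus, blown-up plaquettes are inside. -/
theorem inside_of_inB [NeZero L] (hL : 1 < L) (hcut : cut = true → m = 10 ∧ 10 ≤ L)
    {e : List Place} (he : Inner e) (hc : cut = true) {z : ℤ × ℤ} (hz : InFrame cut 1 z)
    (h : inB (blowupSet ((toricH L).mulVec (errOf o e))) (loc o z) = true) :
    1 ≤ z.1 ∧ z.1 ≤ 8 ∧ 1 ≤ z.2 ∧ z.2 ≤ 8 := by
  obtain ⟨z', h₁, h₂, h₃, h₄, h⟩ := near_of_inB hL he h
  have := hz hc
  have := (hcut hc).2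
  obtain rfl := eq_of_loc_eq h (abs_lt.2 ⟨by omega, by omega⟩) (abs_lt.2 ⟨by omega, by omega⟩)
  exact ⟨h₁, h₂, h₃, h₄⟩

/-- Encodes the actual set of blown-up plaquettes by a number, in order to find its lane. -/
theorem exists_testBit_eq (m : ℕ) (f : ℤ × ℤ → Bool) : ∃ b < 2 ^ (m * m), ∀ z : ℤ × ℤ, 0 < m →
    b.testBit (cell m 0 z) = f (z.1 % m, z.2 % m) := by
  refine ⟨Nat.ofBits fun i : Fin (m * m) => f ((i.1 / m : ℕ), (i.1 % m : ℕ)), Nat.ofBits_lt_two_pow _,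
    fun z hm => ?_⟩
  have h := toNat_emod_lt hm
  have hc : cell m 0 z = (z.1 % m).toNat * m + (z.2 % m).toNat := by
    rw [cell, bitIdx, Nat.zero_mul, Nat.zero_add]
  rw [hc, Nat.testBit_ofBits_lt _ _ (bitIdx_lt (h _) (h _))]
  have h₁ := Int.emod_nonneg z.1 (by omega : (m : ℤ) ≠ 0)
  have h₂ := Int.emod_nonneg z.2 (by omega : (m : ℤ) ≠ 0)
  have h₃ : ((z.1 % m).toNat * m + (z.2 % m).toNat) / m = (z.1 % m).toNat := by
    rw [Nat.mul_comm, Nat.mul_add_div hm, Nat.div_eq_of_lt (h _), Nat.add_zero]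
  have h₄ : ((z.1 % m).toNat * m + (z.2 % m).toNat) % m = (z.2 % m).toNat :=
    Nat.mul_add_mod_of_lt (h _)
  dsimp only
  rw [h₃, h₄, Int.toNat_of_nonneg h₁, Int.toNat_of_nonneg h₂]

theorem msEstimate_zero {C V : Type} [Fintype C] [Fintype V] [DecidableEq C] [DecidableEq V]
    (H : Matrix C V (ZMod 2)) (s : C → ZMod 2) : msEstimate H s 0 = 0 := by
  funext v
  simp [msEstimate, app]

theorem blowupH_mulVec_changeVars_eq [NeZero L] (hL : 1 < L) {B : Finset (Site L)}
    (hB : Independent B) (e : Qubit L → ZMod 2) :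
    (blowupH B).mulVec (changeVars B e) = blowupSyndrome B ((toricH L).mulVec e) := by
  funext c
  rcases c with c | p
  · exact blowupH_mulVec_changeVars hL hB e c
  · rw [blowupH_mulVec_mid]
    change ∑ k, (e (side p.1 (k - 1)) + e (side p.1 k)) = 0
    have := Equiv.sum_comp (Equiv.subRight (1 : Fin 4)) fun k => e (side p.1 k)
    simp only [Equiv.subRight_apply] at this
    rw [Finset.sum_add_distrib, this]
    exact CharTwo.add_self_eq_zero _

/-- In the cut case a point just outside of the square wraps around to the other side of it; no
plaquette is blown up at either place. -/
theorem inB_emod [NeZero L] (hL : 1 < L)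
    (hmL : (cut = false ∧ m = L) ∨ (cut = true ∧ m = 10 ∧ 10 ≤ L)) {e : List Place} (he : Inner e)
    {z : ℤ × ℤ} (hz : InFrame cut 1 z) :
    inB (blowupSet ((toricH L).mulVec (errOf o e))) (loc o (z.1 % m, z.2 % m)) =
      inB (blowupSet ((toricH L).mulVec (errOf o e))) (loc o z) := by
  have hcut : cut = true → m = 10 ∧ 10 ≤ L := by
    rintro rfl
    simpa using hmL
  rcases hmL with ⟨-, rfl⟩ | ⟨hc, rfl, hL'⟩
  · congr 1
    rw [loc_eq_iff]
    exact ⟨dvd_sub_comm.1 (Int.dvd_self_sub_emod), dvd_sub_comm.1 (Int.dvd_self_sub_emod)⟩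
  · have hz' := hz hc
    by_cases hr : 0 ≤ z.1 ∧ z.1 ≤ 9 ∧ 0 ≤ z.2 ∧ z.2 ≤ 9
    · rw [Int.emod_eq_of_lt (by omega) (by push_cast; omega),
        Int.emod_eq_of_lt (by omega) (by push_cast; omega)]
    · have h₁ : inB (blowupSet ((toricH L).mulVec (errOf o e))) (loc o z) = false := by
        by_contra hn
        have := inside_of_inB hL hcut he hc hz (by simpa using hn)
        omega
      have h₂ : inB (blowupSet ((toricH L).mulVec (errOf o e)))
          (loc o (z.1 % (10 : ℕ), z.2 % (10 : ℕ))) = false := by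
        by_contra hn
        have := inside_of_inB hL hcut he hc (z := (z.1 % (10 : ℕ), z.2 % (10 : ℕ)))
          (fun _ => by push_cast; omega) (by simpa using hn)
        push_cast at this
        omega
      rw [h₁, h₂]

/-- The lane describes the actual blown-up graph, so it is not invalid and its reports are accepted.
Whichever error of the cluster the estimate reaches is good enough: all of them have weight three
and the same syndrome. -/
theorem corrects_of_lane [NeZero L] (hdist : 7 ≤ toricDistance L) (hm : 0 < m)
    (hmL : (cut = false ∧ m = L) ∨ (cut = true ∧ m = 10 ∧ 10 ≤ L)) {n : ℕ} {lanes : List Lane}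
    (hfit : ∀ a ∈ lanes, a.Fits (m * m))
    (hsame : ∀ r < 3, syndromeWord m lanes r = syndromeWord m lanes 0)
    (hacc : acceptAll (m * m) (invalidWord m lanes) (laneReports m cut n lanes) lanes.length = true)
    {k b : ℕ} (hk : k < lanes.length) {d : List (List Place)}
    (hlane : lanes[k] = ⟨(d.map (blocks m)).reverse, b⟩) (hin : ∀ e ∈ d, Inner e)
    (hthree : ∀ e ∈ d, e.length = 3) (hd : d.length ≤ 3) {e₀ : List Place} (h₀ : e₀ ∈ d)
    (hbit : ∀ z : ℤ × ℤ, b.testBit (cell m 0 z) =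
      inB (blowupSet ((toricH L).mulVec (errOf o e₀))) (loc o (z.1 % m, z.2 % m)))
    {e : List Place} (he : e ∈ d) : SBMSCorrects (errOf o e) := by
  have hL : 1 < L := by have := seven_le_of_distance hdist; omega
  have hcut : cut = true → m = 10 ∧ 10 ≤ L := by
    rintro rfl
    simpa using hmL
  set s := (toricH L).mulVec (errOf o e₀) with hs
  obtain ⟨hB, hvalid⟩ := blowupSet_spec hL s
  have hword : ∀ f : Lane → ℕ, (∀ a ∈ lanes, f a < 2 ^ (m * m)) → ∀ z,
      (concat (m * m) (lanes.map f)).testBit (cell m k z) = (f lanes[k]).testBit (cell m 0 z) := by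
    intro f hf z
    rw [testBit_concat_cell hm (List.forall_mem_map.2 hf), List.getD_eq_getElem _ _
      (by rwa [List.length_map]), List.getElem_map]
  have hshow : ∀ r, ShowsError m k cut o (ranked d r) (horizontal m lanes r)
      (vertical m lanes r) := by
    intro r z hz
    rw [horizontal, vertical, hword _ fun a ha => ((hfit a ha).err r).1,
      hword _ fun a ha => ((hfit a ha).err r).2, hlane, blocks_ranked]
    exact testBit_blocks hm hmL (hin _ (ranked_mem he r)) hz
  have hsyn : ∀ r, ShowsSyndrome m k cut o ((toricH L).mulVec (errOf o (ranked d r)))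
      (syndromeWord m lanes r) := fun r => (hshow r).synd hm hk
  -- Equality of words gives equality of syndromes in the frame, and outside of it all checks are
  -- satisfied.
  have hrank : ∀ r < 3, (toricH L).mulVec (errOf o (ranked d r)) =
      (toricH L).mulVec (errOf o (ranked d 0)) := by
    intro r hr
    have h : ∀ z : ℤ × ℤ, 2 ≤ z.1 → z.1 ≤ 8 → 2 ≤ z.2 → z.2 ≤ 8 →
        uns ((toricH L).mulVec (errOf o (ranked d r))) (loc o z) =
        uns ((toricH L).mulVec (errOf o (ranked d 0))) (loc o z) := by
      intro z _ _ _ _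
      rw [← hsyn r z fun _ => by omega, ← hsyn 0 z fun _ => by omega, hsame r hr]
    funext x
    refine (bit2_uns _ x).symm.trans (Eq.trans (congrArg bit2 ?_) (bit2_uns _ x))
    rw [Bool.eq_iff_iff]
    constructor
    · intro hx
      obtain ⟨z, h₁, h₂, h₃, h₄, rfl⟩ := near_of_uns (hin _ (ranked_mem he r)) hx
      rwa [← h z h₁ h₂ h₃ h₄]
    · intro hx
      obtain ⟨z, h₁, h₂, h₃, h₄, rfl⟩ := near_of_uns (hin _ (ranked_mem he 0)) hx
      rwa [h z h₁ h₂ h₃ h₄]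
  have hall : ∀ e ∈ d, (toricH L).mulVec (errOf o e) = s := by
    intro e he
    obtain ⟨r, hr, h⟩ := exists_ranked hd he
    obtain ⟨r', hr', h'⟩ := exists_ranked hd h₀
    rw [hs, ← h, ← h', hrank r hr, hrank r' hr']
  have hS : ShowsSyndrome m k cut o s (syndromeWord m lanes 0) := by
    rw [← hall _ (ranked_mem he 0)]
    exact hsyn 0
  have hW : ∀ z, InFrame cut 1 z →
      (blownWord m lanes).testBit (cell m k z) = inB (blowupSet s) (loc o z) := by
    intro z hz
    rw [blownWord, hword _ fun a ha => (hfit a ha).1, hlane, hbit]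
    exact inB_emod hL hmL (hin e₀ h₀) hz
  have hreads : (laneSetup m cut lanes).Reads (blowupSet s) s _ _ (InFrame cut 0) (cell m k)
      (loc o) :=
    reads_frame hm hk hcut (fun z hz => hS z fun hc => by have := hz hc; omega) hW
      (fun _ z hz => by
        obtain ⟨z', h₁, h₂, h₃, h₄, h⟩ := near_of_uns (hin e₀ h₀) hz
        exact ⟨z', by omega, by omega, by omega, by omega, h⟩)
      (fun _ z hz => near_of_inB hL (hin e₀ h₀) hz) rfl rfl rfl rfl
  have hframe : ∀ z : ℤ × ℤ, 0 ≤ z.1 → z.1 < m → 0 ≤ z.2 → z.2 < m → InFrame cut 0 z :=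
    fun z _ _ _ _ hc => by have := (hcut hc).1; omega
  have haccept : accept (m * m) k (laneReports m cut n lanes) = true := by
    refine (acceptAll_spec hacc hk).resolve_left fun hV => ?_
    obtain ⟨z, h₁, h₂, h₃, h₄, hz⟩ := exists_cell_of_blockAt hV
    have hp := fun z (hz : InFrame cut 0 z) => hS.patterns hm hk hz
    rw [invalidWord, testBit_invalid hm hk (fun z hz => (hp z hz).1) (fun z hz => (hp z hz).2.1)
      (fun z hz => (hp z hz).2.2) hW (fun z hz hb hc => by
        have := inside_of_inB hL hcut (hin e₀ h₀) hc hz hb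
        omega) (hframe z h₁ h₂ h₃ h₄), hvalid] at hz
    simp at hz
  obtain ⟨i, hi, ⟨γ, hγ, hest⟩, hno⟩ := exists_estimated hL hB hreads
    (fun w h z _ => testBit_cell_of_blockAt hm h z) (fun w h => by
      obtain ⟨z, h₁, h₂, h₃, h₄, hz⟩ := exists_cell_of_blockAt h
      exact ⟨z, hframe z h₁ h₂ h₃ h₄, hz⟩)
    (Γ := [expected m cut lanes 0, expected m cut lanes 1, expected m cut lanes 2]) rfl
    (received_zero hreads) haccept
  obtain ⟨r, rfl⟩ : ∃ r, γ = expected m cut lanes r := by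
    simp only [List.mem_cons, List.not_mem_nil, or_false] at hγ
    rcases hγ with rfl | rfl | rfl
    exacts [⟨0, rfl⟩, ⟨1, rfl⟩, ⟨2, rfl⟩]
  have hfinal : msEstimate (blowupH (blowupSet s)) (blowupSyndrome (blowupSet s) s) i =
      changeVars (blowupSet s) (errOf o (ranked d r)) := by
    refine estimate_eq_changeVars hL fun x j hj => ?_
    obtain ⟨hj8, hu⟩ := mem_slots.1 hj
    rw [slotValue_errOf]
    by_cases hx : ∃ z, InFrame cut 0 z ∧ loc o z = x
    · obtain ⟨z, hz, rfl⟩ := hx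
      have hoff := hreads.off z hz j hj8
      rw [hest.1 z hz j hj8 hu, expected, testBit_land, (hshow r).goal hm hk hz hj8,
        testBit_not (testBit_full_cell hm hk z), hoff, hu]
      simp
    · rw [hest.2 x (fun z hz h => hx ⟨z, hz, h⟩) j hj8 hu]
      have hn : ∀ h, False := fun h => by
        obtain ⟨z, h₁, h₂, h₃, h₄, rfl⟩ := near_of_errBit (o := o) (x := x)
          (hin _ (ranked_mem he r)) h
        exact hx ⟨z, fun _ => by omega, rfl⟩
      simp only [imp_false, not_or, Bool.not_eq_true] at hn
      rw [slotBit_of_errBit_eq_false hn.1 hn.2.1 hn.2.2.1 hn.2.2.2]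
      rfl
  have hnorm : ∀ e ∈ d, hammingNorm (errOf o e) ≤ 3 := fun e he =>
    (hammingNorm_errOf o e).trans (hthree e he).le
  refine corrects_of_estimates hdist (hnorm e he) (hall e he) rfl hB i ?_ fun j hj hsol => ?_
  · rw [hfinal, blowupH_mulVec_changeVars_eq hL hB, hall _ (ranked_mem he r)]
  · rcases Nat.eq_zero_or_pos j with rfl | h0
    · refine ⟨0, ?_, by simp⟩
      rw [msEstimate_zero]
      funext v
      rcases v with q | ⟨p, k⟩ <;> simp [changeVars]
    · rcases hj.eq_or_lt with rfl | hlt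
      · exact ⟨_, hfinal.symm, hnorm _ (ranked_mem he r)⟩
      · exact absurd hsol (hno j h0 hlt)

/-- The translate by `o` affects the decoder only through the greedy set. This set consists of
matches of the patterns, so it is among the submasks for which lanes were made. -/
theorem corrects_of_checkLanes [NeZero L] (hdist : 7 ≤ toricDistance L) (hm : 0 < m)
    (hmL : (cut = false ∧ m = L) ∨ (cut = true ∧ m = 10 ∧ 10 ≤ L)) {n : ℕ}
    {cl : List (List (List Place))} (hcheck : checkLanes m cut n (cl.flatMap (lanesOf m)) = true)
    (hcl : ∀ d ∈ cl, d.length ≤ 3 ∧ ∀ e ∈ d, e.length = 3 ∧ Inner e)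
    {d : List (List Place)} (hd : d ∈ cl) {e : List Place} (he : e ∈ d) (o : Site L) :
    SBMSCorrects (errOf o e) := by
  have hL : 1 < L := by have := seven_le_of_distance hdist; omega
  have hcut : cut = true → m = 10 ∧ 10 ≤ L := by
    rintro rfl
    simpa using hmL
  obtain ⟨hd3, hd'⟩ := hcl d hd
  obtain ⟨e₀, d', hdd⟩ := List.exists_cons_of_ne_nil (List.ne_nil_of_mem he)
  have h₀ : e₀ ∈ d := by rw [hdd]; exact List.mem_cons_self
  have hin : ∀ e ∈ d, Inner e := fun e he => (hd' e he).2
  obtain ⟨hB, hvalid⟩ := blowupSet_spec hL ((toricH L).mulVec (errOf o e₀))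
  obtain ⟨b, hb, hbit⟩ := exists_testBit_eq m fun z =>
    inB (blowupSet ((toricH L).mulVec (errOf o e₀))) (loc o z)
  have hlane : (⟨d.map (blocks m), b⟩ : Lane) ∈ cl.flatMap (lanesOf m) := by
    refine List.mem_flatMap.2 ⟨d, hd, hdd ▸ mem_lanesOf ?_⟩
    intro T S
    have hlt := blocks_lt hm e₀
    refine mem_submasks (patterns_lt hm (synd_lt hm hlt.1 hlt.2)) fun i hi => ?_
    have him : i < m * m := by
      by_contra hn
      rw [Nat.testBit_lt_two_pow (hb.trans_le (Nat.pow_le_pow_right (by norm_num)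
        (not_lt.1 hn)))] at hi
      simp at hi
    have h0 : blockAt (m * m) 0 (Nat.shiftLeft 1 i) ≠ 0 := fun h => by
      have := testBit_blockAt (m * m) 0 (Nat.shiftLeft 1 i) him
      rw [h, testBit_shiftLeft_one, decide_eq_true (by omega)] at this
      simp at this
    obtain ⟨z, h₁, h₂, h₃, h₄, hz⟩ := exists_cell_of_blockAt h0
    obtain rfl : i = cell m 0 z := by
      rw [testBit_shiftLeft_one] at hz
      exact of_decide_eq_true hz
    have hz : InFrame cut 0 z := fun hc => by have := (hcut hc).1; omega
    rw [hbit z hm, inB_emod hL hmL (hin e₀ h₀) fun hc => by have := hz hc; omega] at hi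
    have hp := ShowsSyndrome.patterns hm Nat.one_pos (ShowsError.synd hm (K := 1) Nat.one_pos
      fun z hz => testBit_blocks (o := o) hm hmL (hin e₀ h₀) hz) hz
    rw [testBit_lor, testBit_lor, Bool.or_eq_true, Bool.or_eq_true]
    have hv := (((invalid_eq_false_iff hL _ _ _ _ _).1 (hvalid (loc o z))).1 hi).2
    rwa [← hp.1, ← hp.2.1, ← hp.2.2] at hv
  rw [checkLanes, strictLanes_eq] at hcheck
  obtain ⟨k, hk, hkl⟩ := List.getElem_of_mem hlane
  have hfit : ∀ a ∈ cl.flatMap (lanesOf m), a.Fits (m * m) := fun a ha => by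
    obtain ⟨d, -, ha⟩ := List.mem_flatMap.1 ha
    exact fits_of_mem_lanesOf hm ha
  generalize cl.flatMap (lanesOf m) = lanes at hcheck hk hkl hfit
  rw [reports_eq, Bool.and_eq_true] at hcheck
  refine corrects_of_lane hdist hm hmL (List.forall_mem_map.2 fun a ha => ?_) (fun r hr => ?_)
    hcheck.2 (k := k) (by rwa [List.length_map]) (d := d) (b := b) ?_ hin
    (fun e he => (hd' e he).1) hd3 h₀ (fun z => hbit z hm) he
  · exact ⟨(hfit a ha).1, fun x hx => (hfit a ha).2 x (List.mem_reverse.1 hx)⟩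
  · have := List.all_eq_true.1 hcheck.1
    interval_cases r
    · rfl
    · exact Nat.eq_of_beq_eq_true (this _ (by simp))
    · exact Nat.eq_of_beq_eq_true (this _ (by simp))
  · rw [List.getElem_map, hkl]

end Engine


/-! ### The finite verifications and the conclusion. -/

section Main

theorem badSpecial_seven : badSpecial 7 = true := by decide +kernel
theorem badSpecial_eight : badSpecial 8 = true := by decide +kernel
theorem badSpecial_nine : badSpecial 9 = true := by decide +kernel
theorem badSpecial_ten : badSpecial 10 = true := by decide +kernel

theorem checkLanes_seven : checkLanes 7 false 10 (clusters.flatMap (lanesOf 7)) = true := by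
  decide +kernel

theorem checkLanes_eight : checkLanes 8 false 10 (clusters.flatMap (lanesOf 8)) = true := by
  decide +kernel

theorem checkLanes_nine : checkLanes 9 false 10 (clusters.flatMap (lanesOf 9)) = true := by
  decide +kernel

theorem checkLanes_ten : checkLanes 10 true 10 (clusters.flatMap (lanesOf 10)) = true := by
  decide +kernel

theorem badSpecial_min {L : ℕ} (hL : 7 ≤ L) : badSpecial (min L 10) = true := by
  obtain h | h | h | h : min L 10 = 7 ∨ min L 10 = 8 ∨ min L 10 = 9 ∨ min L 10 = 10 := by omega
  · rw [h]; exact badSpecial_seven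
  · rw [h]; exact badSpecial_eight
  · rw [h]; exact badSpecial_nine
  · rw [h]; exact badSpecial_ten

theorem corrects_of_mem_clusters {L : ℕ} [NeZero L] (hd : 7 ≤ toricDistance L)
    {d : List (List Place)} (hdc : d ∈ clusters) {l : List Place} (hl : l ∈ d) (o : Site L) :
    SBMSCorrects (errOf o l) := by
  have hL := seven_le_of_distance hd
  have hcl : ∀ d ∈ clusters, d.length ≤ 3 ∧ ∀ e ∈ d, e.length = 3 ∧ Inner e := fun d hd =>
    ⟨clusters_length d hd, fun e he => ⟨(clusters_spec d hd e he).1, inner_of_mem hd he⟩⟩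
  obtain rfl | rfl | rfl | h : L = 7 ∨ L = 8 ∨ L = 9 ∨ 10 ≤ L := by omega
  · exact corrects_of_checkLanes hd (by norm_num) (.inl ⟨rfl, rfl⟩) checkLanes_seven hcl hdc hl o
  · exact corrects_of_checkLanes hd (by norm_num) (.inl ⟨rfl, rfl⟩) checkLanes_eight hcl hdc hl o
  · exact corrects_of_checkLanes hd (by norm_num) (.inl ⟨rfl, rfl⟩) checkLanes_nine hcl hdc hl o
  · exact corrects_of_checkLanes hd (by norm_num) (.inr ⟨rfl, rfl, h⟩) checkLanes_ten hcl hdc hl o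

end Main

end ToricSBMS

theorem theorem3 (L : ℕ) [NeZero L] (hd : 7 ≤ ToricSBMS.toricDistance L)
    (e : ToricSBMS.Qubit L → ZMod 2) (he : hammingNorm e ≤ 3) :
    ToricSBMS.SBMSCorrects e := by
  have hL := ToricSBMS.seven_le_of_distance hd
  by_cases h : ∀ x, ToricSBMS.bad (ToricSBMS.torusGrid L) ToricSBMS.boolLogic
      (ToricSBMS.uns ((ToricSBMS.toricH L).mulVec e)) x = false
  · exact ToricSBMS.corrects_of_not_bad hd he h
  · push Not at h
    obtain ⟨x, hx⟩ := h
    obtain ⟨d, hdc, l, hl, o, hq⟩ := ToricSBMS.exists_special_of_bad hL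
      (ToricSBMS.badSpecial_min hL) he (by simpa using hx)
    obtain rfl : e = ToricSBMS.errOf o l := by
      -- Modulo 2 an error is determined by the edges on which it is nonzero.
      funext q
      rw [ToricSBMS.errOf, ToricSBMS.errBit, ToricSBMS.bit2]
      have h2 : ∀ a : ZMod 2, a ≠ 0 → a = 1 := by decide
      by_cases hq' : e q = 0
      · rw [if_neg (by simpa using fun h => (hq q).2 h hq'), hq']
      · rw [if_pos (by simpa using (hq q).1 hq'), h2 _ hq']
    exact ToricSBMS.corrects_of_mem_clusters hd hdc hl o
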